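/- Let $D\in\{1,2,3,7,11\}$, let $K=\mathbb{Q}(\sqrt{-D})\subset\mathbb{C}$ be the corresponding Euclidean imaginary quadratic field, $\mathcal O_K=\mathbb Z+\mathbb Z\omega$ its ring of integers, $\Gamma=\mathrm{SL}_2(\mathcal O_K)$, and let $k\ge 0$ be an integer. Let $\mathcal H_3=\{(z,t):z\in\mathbb C,\ t>0\}$ with the usual action of $\mathrm{GL}_2(\mathbb C)$ (identify $(z,t)$ with the quaternion $z+tj$). For $\gamma=\begin{pmatrix}a&b\\c&d\end{pmatrix}$ put $$J(\gamma;(z,t))=\begin{pmatrix}cz+d&\bar c t\\-ct&\overline{cz+d}\end{pmatrix},\qquad (F|_\gamma)(x)\binom XY=|\det\gamma|^{-k}\,F(\gamma x)\Big(J\big(\gamma/\sqrt{\det\gamma};x\big)^{-1}\binom XY\Big)$$ for functions $F$ on $\mathcal H_3$ with values in the homogeneous polynomials of degree $2k+2$ in $X,Y$. A cuspidal Bianchi modular form of weight $(k,k)$ and level $\Gamma$ is a smooth such function with (i) $F|_\gamma=F$ for all $\gamma\in\Gamma$; (ii) $\Psi F=\Psi'F=0$, where $\Psi,\Psi'$ are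 the two Casimir operators of $\mathfrak{sl}_2(\mathbb C)\otimes_{\mathbb R}\mathbb C=\mathfrak{sl}_2(\mathbb C)\oplus\mathfrak{sl}_2(\mathbb C)$, acting on the function $g\mapsto (F|_g)(0,1)$ on $\mathrm{SL}_2(\mathbb C)$ and shifted by their value on $V_{k,k}=\mathrm{Sym}^k\otimes\overline{\mathrm{Sym}^k}$ (that is, $H^2+2EE'+2E'E-(k^2+2k)$ in each factor, where $H=\mathrm{diag}(1,-1)$ and $E,E'$ are the upper and lower nilpotent generators); (iii) at most polynomial growth at every cusp; (iv) $\int_{\mathbb C/\mathcal O_K}(F|_\gamma)(z,t)\,dz=0$ for all $\gamma\in\Gamma$, $t>0$. Write $F=\sum_{m}F_mX^{2k+2-m}Y^m$. For $\kappa\in K$ and $0\le p,q\le k$ put $$c_{i,j}(\kappa,F)=2\binom{2k+2}{k+i-j+1}^{-1}(-1)^{k+j+1}\int_0^\infty t^{i+j}F_{k+i-j+1}(\kappa,t)\,dt,$$ $$r_{p,q}(\kappa,F)=\sum_{i=0}^p\sum_{j=0}^q c_{i,j}(\kappa,F)\,(-\kappa)^{p-i}(-\bar\kappa)^{q-j}\binom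 pi\binom qj ,$$ $$r'_{p,q}(\kappa,F)=\sum_{i=0}^p\sum_{j=0}^q c_{i,j}(\kappa,F)\,(-\kappa)^{p-i}(-\bar\kappa)^{q-j}\binom{k-i}{p-i}\binom{k-j}{q-j},$$ so that $r_{p,q}(0,F)=r'_{p,q}(0,F)=c_{p,q}(0,F)$. For $0\ne n\in\mathcal O_K$ let $$T_nF=|n|^{2k}\sum_{ad=n}\ \sum_{b\bmod d}F|_{\left(\begin{smallmatrix}a&b\\0&d\end{smallmatrix}\right)},$$ where the factorizations $n=ad$ are taken up to $(a,d)\mapsto(u^{-1}a,ud)$, $u\in\mathcal O_K^\times$. All sums over divisors and factorizations below are likewise taken up to units. **Theorem.** For every cuspidal Bianchi modular form $F$ of weight $(k,k)$ and level $\Gamma$, every nonzero $n\in\mathcal O_K$ and all $0\le p,q\le k$: 1. The integrals defining $c_{i,j}(\kappa,F)$ $(\kappa\in K)$ and $c_{i,j}(0,T_nF)$, $0\le i,j\le k$, converge absolutely. 2. For every choice of representatives, $$r_{p,q}(0,T_nF)=\sum_{d\mid n}\Big[\sum_{i=0}^p\sum_{j=0}^q\sum_{\substack{b\bmod d\\(b,d)=1}}\binom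 pi\binom qj\,b^{p-i}d^{i}\,\bar b^{q-j}\bar d^{j}\,r_{i,j}(b/d,F)\Big]\Big[\sum_{e_1e_2=n/d}e_1^p\,\bar e_1^{q}\,e_2^{k-p}\,\bar e_2^{k-q}\Big],$$ and the same formula holds with $r'$ in place of $r$ and $\binom{k-i}{p-i}\binom{k-j}{q-j}$ in place of $\binom pi\binom qj$. 3. Let $\kappa\in K$ and let $\kappa_0=\kappa$, $\beta_l\in\mathcal O_K$ a nearest element to $\kappa_l$ (with any fixed rule to break ties), $\kappa_{l+1}=1/(\kappa_l-\beta_l)$ be its Hurwitz continued fraction. It stops: $\kappa_m=\beta_m$ for some (first) $m$. With the convergents $\mu_{-2}=0,\ \mu_{-1}=1,\ \mu_l=\beta_l\mu_{l-1}+\mu_{l-2}$ and $\nu_{-2}=1,\ \nu_{-1}=0,\ \nu_l=\beta_l\nu_{l-1}+\nu_{l-2}$ one has $$r_{p,q}(\kappa,F)=\sum_{l=0}^m\sum_{i,j=0}^k(-1)^{p+q-i-j}\,(e^{p,q}_{i,j})_l\; r_{i,j}(0,F),$$ $$(e^{p,q}_{i,j})_l=(-1)^{l(i+j)}\sum_{u,v}\binom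 pu\binom{k-p}{i-u}\mu_{l-1}^{u}\mu_l^{p-u}\nu_{l-1}^{i-u}\nu_l^{k-p-i+u}\ \binom qv\binom{k-q}{j-v}\overline{\mu_{l-1}}^{\,v}\,\overline{\mu_l}^{\,q-v}\,\overline{\nu_{l-1}}^{\,j-v}\,\overline{\nu_l}^{\,k-q-j+v}.$$ 4. In particular, for each $\kappa\in K$ the periods $r_{p,q}(\kappa,F)$, and for each nonzero $n\in\mathcal O_K$ the periods $r_{p,q}(0,T_nF)$, are $\mathcal O_K$-linear combinations of the periods $r_{i,j}(0,F)$, $0\le i,j\le k$, with coefficients that do not depend on $F$. -/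

import Mathlib

open scoped ComplexConjugate ContDiff

namespace Bianchi

noncomputable section

/-! ### The field `K = ℚ(√-D)`, its ring of integers and some finite systems of representatives -/

/-- The imaginary quadratic field `ℚ(√-D)`, as a subfield of `ℂ`. -/
abbrev K (D : ℕ) : IntermediateField ℚ ℂ :=
  IntermediateField.adjoin ℚ {Complex.I * (Real.sqrt D : ℂ)}

/-- The ring of integers of `K = ℚ(√-D)`. -/
abbrev OK (D : ℕ) : Type := NumberField.RingOfIntegers (K D)

/-- The inclusion of `𝓞_K` in `ℂ`. -/
def toC {D : ℕ} (a : OK D) : ℂ := ((a : K D) : ℂ)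

/-- The element `ω` with `𝓞_K = ℤ + ℤ ω`: it is `(-1 + √-3)/2` for `D = 3`, `(1 + √-D)/2` for
the other `D ≡ 3 mod 4` and `√-D` otherwise. -/
def omega (D : ℕ) : ℂ :=
  if D = 3 then (-1 + Complex.I * (Real.sqrt D : ℂ)) / 2
  else if D % 4 = 3 then (1 + Complex.I * (Real.sqrt D : ℂ)) / 2
  else Complex.I * (Real.sqrt D : ℂ)

/-- `B` is a complete system of residues modulo `d`. -/
def IsResidueSystem {D : ℕ} (d : OK D) (B : Finset (OK D)) : Prop :=
  ∀ x : OK D, ∃! b, b ∈ B ∧ d ∣ x - b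

/-- `S` is a system of representatives `(d, e)` of the factorizations `n = d e`, where the
factorizations `(d, e)` and `(u d, u⁻¹ e)` with a unit `u` are identified. -/
def IsFactorizationSystem {D : ℕ} (n : OK D) (S : Finset (OK D × OK D)) : Prop :=
  (∀ x ∈ S, x.1 * x.2 = n) ∧ ∀ d : OK D, d ∣ n → ∃! x, x ∈ S ∧ Associated d x.1

open Classical in
/-- The elements of `B` that are coprime to `d`. -/
def coprimePart {D : ℕ} (d : OK D) (B : Finset (OK D)) : Finset (OK D) :=
  B.filter (fun b => IsCoprime b d)

lemma isIntegral_gen (D : ℕ) : IsIntegral ℤ (Complex.I * (Real.sqrt D : ℂ)) := by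
  refine ⟨Polynomial.X ^ 2 + Polynomial.C (D : ℤ), ?_, ?_⟩
  · exact Polynomial.monic_X_pow_add_C _ (by norm_num)
  · have h : ((Real.sqrt D : ℝ) : ℂ) ^ 2 = D := by
      rw [← Complex.ofReal_pow, Real.sq_sqrt (Nat.cast_nonneg D)]; simp
    simp [mul_pow, h]

instance finiteDimensional_K (D : ℕ) : FiniteDimensional ℚ (K D) :=
  IntermediateField.adjoin.finiteDimensional (isIntegral_gen D).tower_top

instance numberField_K (D : ℕ) : NumberField (K D) where

lemma exists_residueSystem {D : ℕ} (d : OK D) (hd : d ≠ 0) :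
    ∃ B : Finset (OK D), IsResidueSystem d B := by
  classical
  have hI : Ideal.span {d} ≠ (⊥ : Ideal (OK D)) := by simpa using hd
  have hfin : Finite (OK D ⧸ Ideal.span {d}) := Ideal.finiteQuotientOfFreeOfNeBot _ hI
  have := Fintype.ofFinite (OK D ⧸ Ideal.span {d})
  refine ⟨Finset.univ.image (fun c : OK D ⧸ Ideal.span {d} => c.out), fun x => ?_⟩
  refine ⟨(Ideal.Quotient.mk (Ideal.span {d}) x).out, ⟨by simp, ?_⟩, ?_⟩
  · rw [← Ideal.mem_span_singleton, ← Ideal.Quotient.eq]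
    simp
  · rintro b ⟨hb, hdb⟩
    rw [← Ideal.mem_span_singleton, ← Ideal.Quotient.eq] at hdb
    obtain ⟨c, -, rfl⟩ := Finset.mem_image.1 hb
    rw [hdb]
    simp

lemma exists_factorizationSystem {D : ℕ} (n : OK D) (hn : n ≠ 0) :
    ∃ S : Finset (OK D × OK D), IsFactorizationSystem n S := by
  classical
  have hI : Ideal.span {n} ≠ (0 : Ideal (OK D)) := by simpa using hn
  have hfin : {J : Ideal (OK D) | J ∣ Ideal.span {n}}.Finite := by
    have h := UniqueFactorizationMonoid.fintypeSubtypeDvd (Ideal.span {n}) hI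
    exact @Finite.of_fintype {J : Ideal (OK D) // J ∣ Ideal.span {n}} h
  have hfin' : (Set.range fun d : {d : OK D // d ∣ n} => Ideal.span {d.1}).Finite := by
    refine hfin.subset ?_
    rintro _ ⟨d, rfl⟩
    exact Ideal.dvd_iff_le.2 (Ideal.span_singleton_le_span_singleton.2 d.2)
  have hex : ∀ J ∈ hfin'.toFinset, ∃ x : OK D × OK D, x.1 * x.2 = n ∧ Ideal.span {x.1} = J := by
    intro J hJ
    obtain ⟨⟨d, e, rfl⟩, rfl⟩ := hfin'.mem_toFinset.1 hJ
    exact ⟨(d, e), rfl, rfl⟩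
  choose! g hg1 hg2 using hex
  refine ⟨hfin'.toFinset.image g, ?_, fun d hd => ?_⟩
  · intro x hx
    obtain ⟨J, hJ, rfl⟩ := Finset.mem_image.1 hx
    exact hg1 J hJ
  · have hmem : Ideal.span {d} ∈ hfin'.toFinset := hfin'.mem_toFinset.2 ⟨⟨d, hd⟩, rfl⟩
    refine ⟨g (Ideal.span {d}), ⟨Finset.mem_image_of_mem _ hmem, ?_⟩, ?_⟩
    · exact Ideal.span_singleton_eq_span_singleton.1 (hg2 _ hmem).symm
    · rintro x ⟨hx, hdx⟩
      obtain ⟨J, hJ, rfl⟩ := Finset.mem_image.1 hx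
      rw [Ideal.span_singleton_eq_span_singleton.2 hdx, hg2 J hJ]

open Classical in
/-- A chosen complete system of residues modulo `d ≠ 0`. -/
def residues {D : ℕ} (d : OK D) : Finset (OK D) :=
  if hd : d ≠ 0 then (exists_residueSystem d hd).choose else ∅

open Classical in
/-- A chosen system of representatives of the factorizations of `n ≠ 0` up to units. -/
def factorizations {D : ℕ} (n : OK D) : Finset (OK D × OK D) :=
  if hn : n ≠ 0 then (exists_factorizationSystem n hn).choose else ∅

/-! ### Hyperbolic space and the slash operator -/

/-- Hyperbolic 3-space, inside `ℂ × ℝ`. -/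
def H3 : Set (ℂ × ℝ) := {x | 0 < x.2}

/-- The action of `GL₂(ℂ)` on hyperbolic 3-space. -/
def act (g : Matrix (Fin 2) (Fin 2) ℂ) (x : ℂ × ℝ) : ℂ × ℝ :=
  ((((g 0 0 * x.1 + g 0 1) * conj (g 1 0 * x.1 + g 1 1) + g 0 0 * conj (g 1 0) * (x.2 : ℂ) ^ 2)
      / ((‖g 1 0 * x.1 + g 1 1‖ ^ 2 + ‖g 1 0‖ ^ 2 * x.2 ^ 2 : ℝ) : ℂ)),
    ‖g.det‖ * x.2 / (‖g 1 0 * x.1 + g 1 1‖ ^ 2 + ‖g 1 0‖ ^ 2 * x.2 ^ 2))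

/-- The multiplier system. -/
def multiplier (g : Matrix (Fin 2) (Fin 2) ℂ) (x : ℂ × ℝ) : Matrix (Fin 2) (Fin 2) ℂ :=
  !![g 1 0 * x.1 + g 1 1, conj (g 1 0) * x.2;
     -(g 1 0 * x.2), conj (g 1 0 * x.1 + g 1 1)]

/-- The polynomial `P(M (X, Y)ᵗ)`, with `X = X₀` and `Y = X₁`. -/
def subst (M : Matrix (Fin 2) (Fin 2) ℂ) (P : MvPolynomial (Fin 2) ℂ) : MvPolynomial (Fin 2) ℂ :=
  MvPolynomial.bind₁ (fun i => ∑ j, MvPolynomial.C (M i j) * MvPolynomial.X j) P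

/-- The slash operator of weight `(k, k)`:
`(F|_g)(x)(X, Y) = |det g|^{-k} F(g x)(J(g / √(det g); x)⁻¹ (X, Y)ᵗ)`. The sign of the square root
does not matter since `F` has values in the polynomials of even degree `2k+2`. -/
def slash (k : ℕ) (g : Matrix (Fin 2) (Fin 2) ℂ) (F : ℂ × ℝ → MvPolynomial (Fin 2) ℂ)
    (x : ℂ × ℝ) : MvPolynomial (Fin 2) ℂ :=
  MvPolynomial.C (((‖g.det‖ ^ k)⁻¹ : ℝ) : ℂ) *
    subst (multiplier ((g.det ^ (1 / 2 : ℂ))⁻¹ • g) x)⁻¹ (F (act g x))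

/-- The coefficient of `X^{2k+2-n} Y^n`. -/
def coef (k n : ℕ) (P : MvPolynomial (Fin 2) ℂ) : ℂ :=
  P.coeff (Finsupp.single 0 (2 * k + 2 - n) + Finsupp.single 1 n)

/-! ### Casimir operators -/

/-- The action of the real Lie algebra element `A` of `SL₂(ℂ)` on functions on the group. -/
def lieDeriv (A : Matrix (Fin 2) (Fin 2) ℂ) (f : Matrix (Fin 2) (Fin 2) ℂ → ℂ) :
    Matrix (Fin 2) (Fin 2) ℂ → ℂ :=
  fun g => deriv (fun s : ℝ => f (g * NormedSpace.exp ((s : ℂ) • A))) 0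

/-- `sl₂(ℂ)`, seen as a real Lie algebra, has the complexification `sl₂(ℂ) ⊕ sl₂(ℂ)`. This is the
action of `(A, 0)`, namely of `(A ⊗ 1 - i A ⊗ i) / 2`. -/
def lieDeriv₁ (A : Matrix (Fin 2) (Fin 2) ℂ) (f : Matrix (Fin 2) (Fin 2) ℂ → ℂ) :
    Matrix (Fin 2) (Fin 2) ℂ → ℂ :=
  fun g => (lieDeriv A f g - Complex.I * lieDeriv (Complex.I • A) f g) / 2

/-- The action of `(0, A)`, for real `A`, namely of `(A ⊗ 1 + i A ⊗ i) / 2`. -/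
def lieDeriv₂ (A : Matrix (Fin 2) (Fin 2) ℂ) (f : Matrix (Fin 2) (Fin 2) ℂ → ℂ) :
    Matrix (Fin 2) (Fin 2) ℂ → ℂ :=
  fun g => (lieDeriv A f g + Complex.I * lieDeriv (Complex.I • A) f g) / 2

/-- The Casimir element `H² + 2 E E' + 2 E' E` of `sl₂`, for the action `ρ` of `sl₂` on functions,
where `H = diag(1, -1)` and `E`, `E'` are the upper and lower nilpotent generators. -/
def casimir
    (ρ : Matrix (Fin 2) (Fin 2) ℂ → (Matrix (Fin 2) (Fin 2) ℂ → ℂ) → Matrix (Fin 2) (Fin 2) ℂ → ℂ)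
    (f : Matrix (Fin 2) (Fin 2) ℂ → ℂ) : Matrix (Fin 2) (Fin 2) ℂ → ℂ :=
  ρ !![1, 0; 0, -1] (ρ !![1, 0; 0, -1] f) + 2 • ρ !![0, 1; 0, 0] (ρ !![0, 0; 1, 0] f)
    + 2 • ρ !![0, 0; 1, 0] (ρ !![0, 1; 0, 0] f)

/-- The `n`-th coefficient of the function `g ↦ (F|_g)(0, 1)` on the group `SL₂(ℂ)` that
corresponds to `F`. -/
def lift (k n : ℕ) (F : ℂ × ℝ → MvPolynomial (Fin 2) ℂ) : Matrix (Fin 2) (Fin 2) ℂ → ℂ :=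
  fun g => coef k n (slash k g F (0, 1))

/-! ### Bianchi cusp forms -/

/-- Cuspidal Bianchi modular forms of weight `(k, k)` and level `SL₂(𝓞_K)`, where `K = ℚ(√-D)`.
Only the values of `F` on hyperbolic space matter. The Casimir operators are normalized so as to
annihilate the forms: each of the two Casimir elements acts by the scalar `k² + 2k` by which it
acts on `V_{k,k}`. -/
structure IsCuspForm (D k : ℕ) (F : ℂ × ℝ → MvPolynomial (Fin 2) ℂ) : Prop where
  homogeneous : ∀ x ∈ H3, (F x).IsHomogeneous (2 * k + 2)
  smooth : ∀ n ≤ 2 * k + 2, ContDiffOn ℝ ∞ (fun x => coef k n (F x)) H3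
  invariant : ∀ γ : Matrix.SpecialLinearGroup (Fin 2) (OK D), ∀ x ∈ H3,
    slash k (γ.1.map toC) F x = F x
  casimir_one : ∀ n ≤ 2 * k + 2, ∀ g : Matrix (Fin 2) (Fin 2) ℂ, g.det = 1 →
    casimir lieDeriv₁ (lift k n F) g - (k ^ 2 + 2 * k) * lift k n F g = 0
  casimir_two : ∀ n ≤ 2 * k + 2, ∀ g : Matrix (Fin 2) (Fin 2) ℂ, g.det = 1 →
    casimir lieDeriv₂ (lift k n F) g - (k ^ 2 + 2 * k) * lift k n F g = 0
  growth : ∀ γ : Matrix.SpecialLinearGroup (Fin 2) (K D), ∃ (C : ℝ) (N : ℕ),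
    ∀ n ≤ 2 * k + 2, ∀ (z : ℂ) (t : ℝ), 1 ≤ t →
      ‖coef k n (slash k (γ.1.map (fun a => (a : ℂ))) F (z, t))‖ ≤ C * t ^ N
  cuspidal : ∀ γ : Matrix.SpecialLinearGroup (Fin 2) (OK D), ∀ n ≤ 2 * k + 2, ∀ t : ℝ, 0 < t →
    ∫ x in (0 : ℝ)..1, ∫ y in (0 : ℝ)..1,
      coef k n (slash k (γ.1.map toC) F (x + y * omega D, t)) = 0

/-- The Hecke operator `T_n`: `T_n F = |n|^{2k} ∑ F|_{(a b; 0 d)}`, over the factorizations `a d = n`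
up to units and the residues `b` modulo `d`. -/
def hecke {D : ℕ} (k : ℕ) (n : OK D) (F : ℂ × ℝ → MvPolynomial (Fin 2) ℂ) (x : ℂ × ℝ) :
    MvPolynomial (Fin 2) ℂ :=
  MvPolynomial.C ((‖toC n‖ ^ (2 * k) : ℝ) : ℂ) *
    ∑ y ∈ factorizations n, ∑ b ∈ residues y.1,
      slash k !![toC y.2, toC b; 0, toC y.1] F x

/-! ### Periods -/

/-- The function `t ↦ t^{i+j} F_{k+i-j+1}(κ, t)`. -/
def periodIntegrand (k i j : ℕ) (κ : ℂ) (F : ℂ × ℝ → MvPolynomial (Fin 2) ℂ) (t : ℝ) : ℂ :=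
  (t : ℂ) ^ (i + j) * coef k (k + 1 + i - j) (F (κ, t))

/-- `c_{i,j}(κ, F)
= 2 binom(2k+2, k+i-j+1)⁻¹ (-1)^{k+j+1} ∫_0^∞ t^{i+j} F_{k+i-j+1}(κ, t) dt`. -/
def cPeriod (k i j : ℕ) (κ : ℂ) (F : ℂ × ℝ → MvPolynomial (Fin 2) ℂ) : ℂ :=
  2 * ((2 * k + 2).choose (k + 1 + i - j) : ℂ)⁻¹ * (-1) ^ (k + j + 1) *
    ∫ t in Set.Ioi (0 : ℝ), periodIntegrand k i j κ F t

/-- The period `r_{p,q}(κ, F)`: the coefficient of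
`binom(k,p) binom(k,q) Y^p X^{k-p} Ȳ^q X̄^{k-q}` in
`∑_{i,j} binom(k,i) binom(k,j) c_{i,j}(κ, F) (X - κ Y)^{k-i} Y^i (X̄ - κ̄ Ȳ)^{k-j} Ȳ^j`. -/
def period (k p q : ℕ) (κ : ℂ) (F : ℂ × ℝ → MvPolynomial (Fin 2) ℂ) : ℂ :=
  ∑ i ∈ Finset.range (p + 1), ∑ j ∈ Finset.range (q + 1),
    cPeriod k i j κ F * (-1) ^ ((p - i) + (q - j)) * (p.choose i : ℂ) * (q.choose j : ℂ) *
      κ ^ (p - i) * (conj κ) ^ (q - j)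

/-- The variant of `r_{p,q}(κ, F)` with the other binomial weights: the coefficient of
`Y^p X^{k-p} Ȳ^q X̄^{k-q}` in `∑_{i,j} c_{i,j}(κ, F) (X - κ Y)^{k-i} Y^i (X̄ - κ̄ Ȳ)^{k-j} Ȳ^j`.
The two agree for `κ = 0`. -/
def period' (k p q : ℕ) (κ : ℂ) (F : ℂ × ℝ → MvPolynomial (Fin 2) ℂ) : ℂ :=
  ∑ i ∈ Finset.range (p + 1), ∑ j ∈ Finset.range (q + 1),
    cPeriod k i j κ F * (-1) ^ ((p - i) + (q - j)) *
      ((k - i).choose (p - i) : ℂ) * ((k - j).choose (q - j) : ℂ) *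
      κ ^ (p - i) * (conj κ) ^ (q - j)

/-! ### Hurwitz continued fractions -/

/-- `ρ` sends every complex number to a nearest element of `𝓞_K`, with any rule to break ties. -/
def IsNearest {D : ℕ} (ρ : ℂ → OK D) : Prop :=
  ∀ (z : ℂ) (a : OK D), ‖z - toC (ρ z)‖ ≤ ‖z - toC a‖

/-- The complete quotients: `κ₀ = κ` and `κ_{n+1} = 1 / (κ_n - β_n)` with `β_n = ρ(κ_n)`. -/
def quotients {D : ℕ} (ρ : ℂ → OK D) (κ : ℂ) : ℕ → ℂ
  | 0 => κ
  | n + 1 => (quotients ρ κ n - toC (ρ (quotients ρ κ n)))⁻¹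

/-- The partial quotient `β_n`. -/
def digit {D : ℕ} (ρ : ℂ → OK D) (κ : ℂ) (n : ℕ) : OK D := ρ (quotients ρ κ n)

/-- The numerators of the convergents, with the index shifted by one: `num ρ κ n = μ_{n-1}`. -/
def num {D : ℕ} (ρ : ℂ → OK D) (κ : ℂ) : ℕ → OK D
  | 0 => 1
  | 1 => digit ρ κ 0
  | n + 2 => digit ρ κ (n + 1) * num ρ κ (n + 1) + num ρ κ n

/-- The denominators of the convergents, with the index shifted by one: `den ρ κ n = ν_{n-1}`. -/
def den {D : ℕ} (ρ : ℂ → OK D) (κ : ℂ) : ℕ → OK D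
  | 0 => 0
  | 1 => 1
  | n + 2 => digit ρ κ (n + 1) * den ρ κ (n + 1) + den ρ κ n

/-- `κ_m = β_m`, and the expansion did not stop before. -/
def StopsAt {D : ℕ} (ρ : ℂ → OK D) (κ : ℂ) (m : ℕ) : Prop :=
  quotients ρ κ m = toC (digit ρ κ m) ∧ ∀ n < m, quotients ρ κ n ≠ toC (digit ρ κ n)

/-- `∑_u binom(p,u) binom(k-p,i-u) a^u b^{p-u} c^{i-u} d^{k-p-i+u}`. -/
def halfCoeff (k p i : ℕ) (a b c d : ℂ) : ℂ :=
  ∑ u ∈ Finset.range (min p i + 1), (p.choose u : ℂ) * ((k - p).choose (i - u) : ℂ) *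
    a ^ u * b ^ (p - u) * c ^ (i - u) * d ^ (k - p - (i - u))

/-- The coefficient `e_{i,j}^{p,q}` of the matrix `(a b; c d)`. -/
def eCoeff (k p q i j : ℕ) (a b c d : ℂ) : ℂ :=
  halfCoeff k p i a b c d * halfCoeff k q j (conj a) (conj b) (conj c) (conj d)

lemma norm_embedding_eq {D : ℕ} (φ : K D →+* ℂ) (a : K D) : ‖φ a‖ = ‖(a : ℂ)‖ := by
  set θ : ℂ := Complex.I * (Real.sqrt D : ℂ) with hθ
  have hsq : θ ^ 2 = -(D : ℂ) := by
    have h : ((Real.sqrt D : ℝ) : ℂ) ^ 2 = D := by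
      rw [← Complex.ofReal_pow, Real.sq_sqrt (Nat.cast_nonneg D)]; simp
    simp [hθ, mul_pow, h]
  let θ' : K D := ⟨θ, IntermediateField.mem_adjoin_simple_self ℚ θ⟩
  have h1 : (φ θ') ^ 2 = θ ^ 2 := by
    rw [← map_pow]
    have : θ' ^ 2 = -(D : K D) := by
      apply Subtype.ext
      simpa using hsq
    rw [this, hsq]
    simp
  have hcj : conj θ = -θ := by simp [hθ]
  have ext_hom : ∀ f : K D →+* ℂ, φ θ' = f θ' → φ = f := by
    intro f hf
    let alg : (K D →+* ℂ) → (K D →ₐ[ℚ] ℂ) := fun h => { h with commutes' := fun r => by simp }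
    have : alg φ = alg f := by
      refine IntermediateField.algHom_ext_of_eq_adjoin ℚ (S := K D) rfl ?_
      rintro x hx
      simp only [Set.mem_singleton_iff] at hx
      subst hx
      exact hf
    ext x
    exact DFunLike.congr_fun this x
  rcases sq_eq_sq_iff_eq_or_eq_neg.1 h1 with h | h
  · rw [ext_hom (K D).val.toRingHom h]
    rfl
  · rw [ext_hom ((starRingEnd ℂ).comp (K D).val.toRingHom) (h.trans hcj.symm)]
    exact RCLike.norm_conj (a : ℂ)

/-- Every complex number has a nearest element in `𝓞_K`. -/
lemma exists_isNearest (D : ℕ) : ∃ ρ : ℂ → OK D, IsNearest ρ := by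
  have key : ∀ z : ℂ, ∃ r : OK D, ∀ a : OK D, ‖z - toC r‖ ≤ ‖z - toC a‖ := by
    intro z
    have hfin : {a : OK D | ‖z - toC a‖ ≤ ‖z - toC (0 : OK D)‖}.Finite := by
      have h := NumberField.Embeddings.finite_of_norm_le (K D) ℂ (2 * ‖z‖)
      refine Set.Finite.subset (h.preimage
        (NumberField.RingOfIntegers.coe_injective (K := K D)).injOn) ?_
      intro a ha
      refine ⟨a.isIntegral_coe, fun φ => ?_⟩
      rw [norm_embedding_eq]
      have ha' : ‖z - toC a‖ ≤ ‖z‖ := by simpa [toC] using ha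
      have h2 : ‖toC a‖ ≤ ‖z‖ + ‖z - toC a‖ := by
        have := norm_sub_le z (z - toC a)
        simpa using this
      exact h2.trans (by linarith)
    obtain ⟨r, hr, hmin⟩ := Set.exists_min_image _ (fun a => ‖z - toC a‖) hfin ⟨0, by simp⟩
    refine ⟨r, fun a => ?_⟩
    by_cases ha : ‖z - toC a‖ ≤ ‖z - toC (0 : OK D)‖
    · exact hmin a ha
    · exact le_trans hr (not_le.1 ha).le
  choose ρ hρ using key
  exact ⟨ρ, hρ⟩

end

end Bianchi

namespace Bianchi

noncomputable section

section

/-! ### Binary forms and substitutions -/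

/-! The periods of `F` are integrals of a closed differential form, and the continued fraction
formula is Stokes' theorem for it. The form `periodForm` is the invariant pairing `apolar` of `F(x)`
with the product of a quadratic form in `X, Y`, whose coefficients are `dz`, `dz̄`, `dt`, and the
`k`-th powers of two linear forms with free parameters `v` and `u`. Integrated over the vertical
geodesic from `κ` to `∞` it gives, up to the factor `2(-1)^{k+1}`, the bihomogeneous polynomial in
`v` and `u` whose coefficients are the `r_{p,q}(κ, F)` (`linePeriod_eq_sum_period`).

Closedness is a system of first order equations for the coefficients of `F`. The two Casimir
operators yield only one first order relation, which couples the indices `n - 1, n, n + 1`, and one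
second order equation (`casimir_coordinates`). On a Fourier mode of nonzero frequency these imply
the whole system by induction on `n`, starting at `n = 0`, where one neighbour is absent
(`mode_lowering`, `mode_raising`). The mode of frequency zero vanishes by cuspidality. As Fourier
coefficients determine a function, the system holds for `F` (`expCoef_lowering`, `expCoef_raising`),
and Poincaré's lemma gives primitives. On each mode the system also decouples into a Bessel type
equation `v'' = p v` with `p ≥ 4|l|² e^{2τ}`. A solution of at most exponential growth in `τ = log
t` then decays superexponentially, uniformly enough to sum over the modes (`rapid_decay`). Moving a
cusp to `∞` makes all the period integrals converge.

The primitives are normalized to vanish at `∞`. Translations by `𝓞_K` permute the normalized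
primitives when `v` and `u` are transformed accordingly. The inversion does so only up to a
constant, and this constant is minus the integral of the form from `0` to `∞`
(`exists_primitive_inv3`). The matrix of the `l`-th convergents is, up to sign, the previous one
times an inversion and a translation. So going down the continued fraction of `κ` collects one
integral over `(0, ∞)` for each convergent (`linePeriod_eq_sum_convergents`). Since `v` and `u` are
independent, comparing coefficients gives the formula for `r_{p,q}(κ, F)`. The Euclidean algorithm
makes the expansion stop, and the last convergent exhibits `κ` as a cusp equivalent to `∞`.

For the Hecke operators, an upper triangular matrix acts on `c_{p,q}` by a change of variable in `t`
(`periodIntegrand_slash`), so that `c_{p,q}(0, T_n F)` is a weighted sum of the `c_{p,q}(b/d, F)`.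
Grouping the `b` by their greatest common divisor with `d` gives the sum over coprime residues
(`sum_hecke_representatives`). The passage between `c_{p,q}` and `r_{p,q}`, or `r'_{p,q}`, inverts a
triangular matrix of binomial type (`IsInverseTriangular`). All the coefficients that occur are
integral, which gives the last assertion. -/

lemma subst_add (M : Matrix (Fin 2) (Fin 2) ℂ) (P Q : MvPolynomial (Fin 2) ℂ) :
    subst M (P + Q) = subst M P + subst M Q := by simp [subst]

lemma subst_mul (M : Matrix (Fin 2) (Fin 2) ℂ) (P Q : MvPolynomial (Fin 2) ℂ) :
    subst M (P * Q) = subst M P * subst M Q := by simp [subst]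

lemma subst_C (M : Matrix (Fin 2) (Fin 2) ℂ) (c : ℂ) :
    subst M (MvPolynomial.C c) = MvPolynomial.C c := by simp [subst]

lemma subst_X (M : Matrix (Fin 2) (Fin 2) ℂ) (i : Fin 2) :
    subst M (MvPolynomial.X i) =
      MvPolynomial.C (M i 0) * MvPolynomial.X 0 + MvPolynomial.C (M i 1) * MvPolynomial.X 1 := by
  simp [subst, Fin.sum_univ_two]

lemma subst_one (P : MvPolynomial (Fin 2) ℂ) : subst 1 P = P := by
  have : (fun i => ∑ j, MvPolynomial.C ((1 : Matrix (Fin 2) (Fin 2) ℂ) i j) * MvPolynomial.X j)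
      = (MvPolynomial.X : Fin 2 → MvPolynomial (Fin 2) ℂ) := by
    funext i; fin_cases i <;> simp [Matrix.one_apply]
  rw [subst, this, MvPolynomial.bind₁_X_left]; rfl

lemma subst_subst (A B : Matrix (Fin 2) (Fin 2) ℂ) (P : MvPolynomial (Fin 2) ℂ) :
    subst A (subst B P) = subst (B * A) P := by
  induction P using MvPolynomial.induction_on with
  | C a => simp [subst_C]
  | add p q hp hq => simp [subst_add, hp, hq]
  | mul_X p i hp =>
    simp only [subst_mul, hp, subst_X, subst_add, subst_C, Matrix.mul_apply, Fin.sum_univ_two,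
      map_add, map_mul]
    ring

lemma eval_subst (M : Matrix (Fin 2) (Fin 2) ℂ) (P : MvPolynomial (Fin 2) ℂ) (v : Fin 2 → ℂ) :
    MvPolynomial.eval v (subst M P) = MvPolynomial.eval (M.mulVec v) P := by
  induction P using MvPolynomial.induction_on with
  | C a => simp [subst_C]
  | add p q hp hq => simp [subst_add, hp, hq]
  | mul_X p i hp =>
    fin_cases i <;> simp [subst_mul, hp, subst_X]

lemma fin2_finsupp_eq (s : Fin 2 →₀ ℕ) : s = Finsupp.single 0 (s 0) + Finsupp.single 1 (s 1) := by
  ext i; fin_cases i <;> simp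

lemma monomial_fin2 (s : Fin 2 →₀ ℕ) (c : ℂ) : MvPolynomial.monomial s c =
    MvPolynomial.C c * (MvPolynomial.X 0 ^ s 0 * MvPolynomial.X 1 ^ s 1) := by
  rw [MvPolynomial.monomial_eq, Finsupp.prod_fintype _ _ (by simp), Fin.prod_univ_two]

lemma subst_pow (M : Matrix (Fin 2) (Fin 2) ℂ) (P : MvPolynomial (Fin 2) ℂ) (n : ℕ) :
    subst M (P ^ n) = subst M P ^ n := by simp [subst]

lemma coeff_subst_diag (a b : ℂ) (P : MvPolynomial (Fin 2) ℂ) (s : Fin 2 →₀ ℕ) :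
    (subst !![a, 0; 0, b] P).coeff s = a ^ s 0 * b ^ s 1 * P.coeff s := by
  induction P using MvPolynomial.induction_on' with
  | add p q hp hq => rw [subst_add, MvPolynomial.coeff_add, hp, hq, MvPolynomial.coeff_add]; ring
  | monomial u c =>
    have : subst !![a, 0; 0, b] (MvPolynomial.monomial u c) =
        MvPolynomial.monomial u (a ^ u 0 * b ^ u 1 * c) := by
      rw [monomial_fin2, monomial_fin2]
      simp only [subst_mul, subst_C, subst_pow, subst_X, map_mul, map_pow]
      simp
      ring
    rw [this, MvPolynomial.coeff_monomial, MvPolynomial.coeff_monomial]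
    split_ifs with h
    · rw [h]
    · simp

lemma coef_subst_diag (k n : ℕ) (a b : ℂ) (P : MvPolynomial (Fin 2) ℂ) :
    coef k n (subst !![a, 0; 0, b] P) = a ^ (2 * k + 2 - n) * b ^ n * coef k n P := by
  rw [coef, coeff_subst_diag]; simp [coef]

lemma coef_eval {k : ℕ} {P : MvPolynomial (Fin 2) ℂ} (hP : P.IsHomogeneous (2 * k + 2))
    (v : Fin 2 → ℂ) : MvPolynomial.eval v P =
      ∑ n ∈ Finset.range (2 * k + 3), coef k n P * (v 0 ^ (2 * k + 2 - n) * v 1 ^ n) := by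
  classical
  rw [MvPolynomial.eval_eq']
  simp only [Fin.prod_univ_two]
  have hdeg : ∀ s ∈ P.support, s 0 + s 1 = 2 * k + 2 := fun s hs => by
    have := hP (MvPolynomial.mem_support_iff.1 hs)
    rw [fin2_finsupp_eq s] at this
    simpa [Finsupp.weight_apply, Finsupp.sum_add_index', Finsupp.sum_fintype,
      Fin.sum_univ_two] using this
  have e : ∀ s ∈ P.support,
      Finsupp.single 0 (2 * k + 2 - s 1) + Finsupp.single 1 (s 1) = s := fun s hs => by
    rw [show 2 * k + 2 - s 1 = s 0 by have := hdeg s hs; omega, ← fin2_finsupp_eq]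
  refine Finset.sum_of_injOn (fun s => s 1) ?_ ?_ ?_ ?_
  · intro s hs t ht h
    rw [← e s hs, ← e t ht]; simp only at h; rw [h]
  · intro s hs
    have := hdeg s hs
    simp only [Finset.coe_range, Set.mem_Iio]; omega
  · intro n hn hn'
    have : coef k n P = 0 := by
      by_contra h
      refine hn' ⟨_, MvPolynomial.mem_support_iff.2 h, by simp⟩
    simp [this]
  · intro s hs
    simp only [coef, e s hs]
    rw [show 2 * k + 2 - s 1 = s 0 by have := hdeg s hs; omega]

/-- The form with given coefficients. -/
lemma eq_sum_coef {k : ℕ} {P : MvPolynomial (Fin 2) ℂ} (hP : P.IsHomogeneous (2 * k + 2)) :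
    P = ∑ n ∈ Finset.range (2 * k + 3), MvPolynomial.C (coef k n P) *
      (MvPolynomial.X 0 ^ (2 * k + 2 - n) * MvPolynomial.X 1 ^ n) := by
  apply MvPolynomial.funext
  intro v
  rw [coef_eval hP]
  simp

/-- A polynomial function determines its coefficients. -/
lemma eq_of_sum_pow_eq {N : ℕ} {c d : ℕ → ℂ}
    (h : ∀ y : ℂ, ∑ n ∈ Finset.range N, c n * y ^ n = ∑ n ∈ Finset.range N, d n * y ^ n)
    {n : ℕ} (hn : n < N) : c n = d n := by
  have : ∑ n ∈ Finset.range N, Polynomial.C (c n) * Polynomial.X ^ n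
      = ∑ n ∈ Finset.range N, Polynomial.C (d n) * Polynomial.X ^ n := by
    apply Polynomial.funext
    intro y
    simpa [Polynomial.eval_finsetSum] using h y
  have := congrArg (fun p => Polynomial.coeff p n) this
  simpa [Polynomial.finsetSum_coeff, Polynomial.coeff_C_mul, Polynomial.coeff_X_pow, hn]
    using this

lemma isHomogeneous_subst {N : ℕ} {P : MvPolynomial (Fin 2) ℂ} (hP : P.IsHomogeneous N)
    (M : Matrix (Fin 2) (Fin 2) ℂ) : (subst M P).IsHomogeneous N := by
  rw [← one_mul N]
  refine hP.aeval _ (n := 1) fun i => ?_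
  refine MvPolynomial.IsHomogeneous.sum _ _ _ fun j _ => ?_
  simpa using (MvPolynomial.isHomogeneous_C (Fin 2) (M i j)).mul
      (MvPolynomial.isHomogeneous_X ℂ j)

/-! ### The apolar pairing -/

lemma coef_C_mul (k n : ℕ) (c : ℂ) (P : MvPolynomial (Fin 2) ℂ) :
    coef k n (MvPolynomial.C c * P) = c * coef k n P := by
  simp [coef]

lemma coef_add (k n : ℕ) (P Q : MvPolynomial (Fin 2) ℂ) :
    coef k n (P + Q) = coef k n P + coef k n Q := by
  simp [coef]

lemma coef_sum {ι : Type*} (k n : ℕ) (s : Finset ι) (P : ι → MvPolynomial (Fin 2) ℂ) :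
    coef k n (∑ i ∈ s, P i) = ∑ i ∈ s, coef k n (P i) := by
  simp [coef, MvPolynomial.coeff_sum]

lemma coef_X_pow_mul_X_pow {k m n : ℕ} :
    coef k m (MvPolynomial.X 0 ^ (2 * k + 2 - n) * MvPolynomial.X 1 ^ n) =
      if n = m then 1 else 0 := by
  have : (MvPolynomial.X 0 ^ (2 * k + 2 - n) * MvPolynomial.X 1 ^ n : MvPolynomial (Fin 2) ℂ) =
      MvPolynomial.monomial (Finsupp.single 0 (2 * k + 2 - n) + Finsupp.single 1 n) 1 := by
    rw [monomial_fin2]; simp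
  rw [this, coef, MvPolynomial.coeff_monomial]
  refine if_congr ⟨fun h => ?_, fun h => by rw [h]⟩ rfl rfl
  simpa using DFunLike.congr_fun h 1

/-- The invariant pairing of binary forms of degree `2k+2`. -/
def apolar (k : ℕ) (P : MvPolynomial (Fin 2) ℂ) : MvPolynomial (Fin 2) ℂ →ₗ[ℂ] ℂ where
  toFun q := ∑ n ∈ Finset.range (2 * k + 3), coef k n q *
    (coef k n P / ((2 * k + 2).choose n : ℂ))
  map_add' q r := by simp [coef_add, add_mul, Finset.sum_add_distrib]
  map_smul' c q := by
    simp [MvPolynomial.smul_eq_C_mul, coef_C_mul, Finset.mul_sum, mul_assoc]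

lemma apolar_X_pow_mul_X_pow {k n : ℕ} (hn : n ≤ 2 * k + 2) (P : MvPolynomial (Fin 2) ℂ) :
    apolar k P (MvPolynomial.X 0 ^ (2 * k + 2 - n) * MvPolynomial.X 1 ^ n) =
      coef k n P / ((2 * k + 2).choose n : ℂ) := by
  change ∑ m ∈ Finset.range (2 * k + 3), _ = _
  simp only [coef_X_pow_mul_X_pow]
  simp
  omega

lemma add_pow_eq_sum (N : ℕ) (a b : ℂ) (A B : MvPolynomial (Fin 2) ℂ) :
    (MvPolynomial.C a * A + MvPolynomial.C b * B) ^ N =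
      ∑ n ∈ Finset.range (N + 1), ((N.choose n : ℂ) * a ^ (N - n) * b ^ n) •
        (A ^ (N - n) * B ^ n) := by
  rw [add_comm, add_pow]
  refine Finset.sum_congr rfl fun n _ => ?_
  rw [MvPolynomial.smul_eq_C_mul]
  simp only [map_mul, map_pow, map_natCast, mul_pow]
  ring

lemma choose_cast_ne_zero {N n : ℕ} (hn : n ≤ N) : (N.choose n : ℂ) ≠ 0 :=
  Nat.cast_ne_zero.2 (Nat.choose_pos hn).ne'

/-- The binomial coefficients in the pairing are chosen so that pairing with the power of a linear
form is evaluation at its coefficients. Such powers span the forms, so this property characterizes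
the pairing and is the source of its invariance. -/
lemma apolar_pow {k : ℕ} {P : MvPolynomial (Fin 2) ℂ} (hP : P.IsHomogeneous (2 * k + 2))
    (a b : ℂ) : apolar k P ((MvPolynomial.C a * MvPolynomial.X 0 +
      MvPolynomial.C b * MvPolynomial.X 1) ^ (2 * k + 2)) = MvPolynomial.eval ![a, b] P := by
  rw [add_pow_eq_sum, map_sum, coef_eval hP]
  refine Finset.sum_congr rfl fun n hn => ?_
  have hn' : n ≤ 2 * k + 2 := by simp at hn; omega
  rw [map_smul, apolar_X_pow_mul_X_pow hn', smul_eq_mul]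
  have := choose_cast_ne_zero hn'
  simp
  field_simp

/-- The pairing is invariant. -/
lemma apolar_subst {k : ℕ} {P q : MvPolynomial (Fin 2) ℂ} (hP : P.IsHomogeneous (2 * k + 2))
    (hq : q.IsHomogeneous (2 * k + 2)) (M : Matrix (Fin 2) (Fin 2) ℂ) :
    apolar k (subst M P) q = apolar k P (subst M.transpose q) := by
  -- The monomials are reached through the generating function `(X + y Y)^{2k+2}`: by `apolar_pow`
  -- both sides are the value of `P` at `M (1, y)ᵗ`, and the coefficients of the powers of `y` are
  -- compared.
  have key : ∀ n < 2 * k + 3,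
      ((2 * k + 2).choose n : ℂ) * apolar k (subst M P)
        (MvPolynomial.X 0 ^ (2 * k + 2 - n) * MvPolynomial.X 1 ^ n) =
      ((2 * k + 2).choose n : ℂ) * apolar k P (subst M.transpose
        (MvPolynomial.X 0 ^ (2 * k + 2 - n) * MvPolynomial.X 1 ^ n)) := by
    intro n hn
    refine eq_of_sum_pow_eq (c := fun n => ((2 * k + 2).choose n : ℂ) * apolar k (subst M P)
        (MvPolynomial.X 0 ^ (2 * k + 2 - n) * MvPolynomial.X 1 ^ n))
      (d := fun n => ((2 * k + 2).choose n : ℂ) * apolar k P (subst M.transpose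
        (MvPolynomial.X 0 ^ (2 * k + 2 - n) * MvPolynomial.X 1 ^ n))) (fun y => ?_) hn
    have h1 := apolar_pow (isHomogeneous_subst hP M) 1 y
    rw [eval_subst, show M.mulVec ![1, y] = ![M 0 0 + M 0 1 * y, M 1 0 + M 1 1 * y] by
      ext i; fin_cases i <;> simp, ← apolar_pow hP] at h1
    have h2 : (MvPolynomial.C (M 0 0 + M 0 1 * y) * MvPolynomial.X 0 +
        MvPolynomial.C (M 1 0 + M 1 1 * y) * MvPolynomial.X 1) =
        MvPolynomial.C 1 * (subst M.transpose (MvPolynomial.X 0)) +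
        MvPolynomial.C y * (subst M.transpose (MvPolynomial.X 1)) := by
      simp only [subst_X, Matrix.transpose_apply, map_add, map_mul, map_one]
      ring
    rw [h2, add_pow_eq_sum, add_pow_eq_sum, map_sum, map_sum] at h1
    simp only [map_smul, smul_eq_mul, one_pow, mul_one] at h1
    simp only [subst_mul, subst_pow]
    calc _ = _ := Finset.sum_congr rfl fun n _ => by ring
      _ = _ := h1
      _ = _ := Finset.sum_congr rfl fun n _ => by ring
  have hsub : subst M.transpose q = ∑ n ∈ Finset.range (2 * k + 3), (coef k n q) •
      subst M.transpose (MvPolynomial.X 0 ^ (2 * k + 2 - n) * MvPolynomial.X 1 ^ n) := by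
    conv_lhs => rw [eq_sum_coef hq]
    simp [subst, MvPolynomial.smul_eq_C_mul]
  rw [hsub]
  conv_lhs => rw [eq_sum_coef hq]
  simp only [map_sum, map_smul, ← MvPolynomial.smul_eq_C_mul]
  refine Finset.sum_congr rfl fun n hn => ?_
  have hn' := Finset.mem_range.1 hn
  rw [mul_left_cancel₀ (choose_cast_ne_zero (by omega)) (key n hn')]

/-- Substituting an antidiagonal matrix. -/
lemma coef_subst_antidiag {k n : ℕ} (hn : n ≤ 2 * k + 2) (b c : ℂ)
    {P : MvPolynomial (Fin 2) ℂ} (hP : P.IsHomogeneous (2 * k + 2)) :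
    coef k n (subst !![0, b; c, 0] P) =
      b ^ n * c ^ (2 * k + 2 - n) * coef k (2 * k + 2 - n) P := by
  have hm : (MvPolynomial.X 0 ^ (2 * k + 2 - n) * MvPolynomial.X 1 ^ n :
      MvPolynomial (Fin 2) ℂ).IsHomogeneous (2 * k + 2) := by
    have := ((MvPolynomial.isHomogeneous_X ℂ (0 : Fin 2)).pow (2 * k + 2 - n)).mul
      ((MvPolynomial.isHomogeneous_X ℂ (1 : Fin 2)).pow n)
    rwa [show 1 * (2 * k + 2 - n) + 1 * n = 2 * k + 2 by omega] at this
  have h := apolar_subst hP hm !![0, b; c, 0]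
  rw [apolar_X_pow_mul_X_pow hn, subst_mul, subst_pow, subst_pow, subst_X, subst_X] at h
  have e : ∀ A : MvPolynomial (Fin 2) ℂ, A = (MvPolynomial.X 0 ^ (2 * k + 2 - (2 * k + 2 - n)) *
      MvPolynomial.X 1 ^ (2 * k + 2 - n)) → apolar k P ((b ^ n * c ^ (2 * k + 2 - n)) • A) =
      b ^ n * c ^ (2 * k + 2 - n) * (coef k (2 * k + 2 - n) P / ((2 * k + 2).choose n : ℂ)) := by
    rintro A rfl
    rw [map_smul, apolar_X_pow_mul_X_pow (by omega), Nat.choose_symm hn, smul_eq_mul]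
  have e2 : 2 * k + 2 - (2 * k + 2 - n) = n := by omega
  have h3 := h.trans ((congrArg _ (?_)).trans (e _ rfl))
  · have := choose_cast_ne_zero hn
    field_simp at h3
    exact h3
  · rw [e2, MvPolynomial.smul_eq_C_mul]
    simp [mul_pow]
    ring

end

section

/-! ### The slash operator for matrices of determinant one -/

lemma slash_of_det_one {k : ℕ} {g : Matrix (Fin 2) (Fin 2) ℂ} (hg : g.det = 1)
    (F : ℂ × ℝ → MvPolynomial (Fin 2) ℂ) (x : ℂ × ℝ) :
    slash k g F x = subst (multiplier g x)⁻¹ (F (act g x)) := by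
  simp [slash, hg]

lemma det_multiplier (g : Matrix (Fin 2) (Fin 2) ℂ) (x : ℂ × ℝ) :
    (multiplier g x).det = ((‖g 1 0 * x.1 + g 1 1‖ ^ 2 + ‖g 1 0‖ ^ 2 * x.2 ^ 2 : ℝ) : ℂ) := by
  rw [multiplier, Matrix.det_fin_two_of, Complex.mul_conj']
  push_cast
  rw [← Complex.mul_conj' (g 1 0)]
  ring

lemma height_pos {g : Matrix (Fin 2) (Fin 2) ℂ} (hg : g.det ≠ 0) {x : ℂ × ℝ} (hx : x ∈ H3) :
    0 < ‖g 1 0 * x.1 + g 1 1‖ ^ 2 + ‖g 1 0‖ ^ 2 * x.2 ^ 2 := by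
  have hx' : 0 < x.2 := hx
  by_cases h : g 1 0 = 0
  · have h1 : g 1 1 ≠ 0 := by
      rintro h1
      rw [Matrix.det_fin_two, h, h1] at hg
      simp at hg
    have : 0 < ‖g 1 1‖ := norm_pos_iff.2 h1
    simp only [h, zero_mul, zero_add, norm_zero]
    positivity
  · have : 0 < ‖g 1 0‖ := norm_pos_iff.2 h
    positivity

lemma isUnit_det_multiplier {g : Matrix (Fin 2) (Fin 2) ℂ} (hg : g.det ≠ 0) {x : ℂ × ℝ}
    (hx : x ∈ H3) : IsUnit (multiplier g x).det := by
  rw [det_multiplier, isUnit_iff_ne_zero]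
  exact_mod_cast (height_pos hg hx).ne'

lemma act_mem {g : Matrix (Fin 2) (Fin 2) ℂ} (hg : g.det ≠ 0) {x : ℂ × ℝ}
    (hx : x ∈ H3) : act g x ∈ H3 := by
  have h := height_pos hg hx
  have hx' : 0 < x.2 := hx
  have : 0 < ‖g.det‖ := norm_pos_iff.2 hg
  simp only [H3, act, Set.mem_ofPred_eq]
  positivity

/-- The invariance of a cusp form under a matrix with integral entries. -/
lemma IsCuspForm.apply_act {D k : ℕ} {F : ℂ × ℝ → MvPolynomial (Fin 2) ℂ}
    (hF : IsCuspForm D k F) {a b c d : OK D} (h : a * d - b * c = 1) {x : ℂ × ℝ} (hx : x ∈ H3) :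
    F (act !![toC a, toC b; toC c, toC d] x) =
      subst (multiplier !![toC a, toC b; toC c, toC d] x) (F x) := by
  have hdet : (!![toC a, toC b; toC c, toC d] : Matrix (Fin 2) (Fin 2) ℂ).det = 1 := by
    have := congrArg (fun a : OK D => toC a) h
    simpa [toC] using this
  have := hF.invariant ⟨!![a, b; c, d], by simp [Matrix.det_fin_two, h]⟩ x hx
  have e : (!![a, b; c, d] : Matrix (Fin 2) (Fin 2) (OK D)).map toC =
      !![toC a, toC b; toC c, toC d] := by
    ext i j; fin_cases i <;> fin_cases j <;> rfl
  simp only [e] at this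
  rw [slash_of_det_one hdet] at this
  conv_rhs => rw [← this]
  rw [subst_subst, Matrix.nonsing_inv_mul, subst_one]
  exact isUnit_det_multiplier (by rw [hdet]; exact one_ne_zero) hx

lemma act_translation (b : ℂ) (x : ℂ × ℝ) : act !![1, b; 0, 1] x = (x.1 + b, x.2) := by
  simp [act]

lemma multiplier_translation (b : ℂ) (x : ℂ × ℝ) : multiplier !![1, b; 0, 1] x = 1 := by
  ext i j; fin_cases i <;> fin_cases j <;> simp [multiplier]

lemma IsCuspForm.apply_add {D k : ℕ} {F : ℂ × ℝ → MvPolynomial (Fin 2) ℂ}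
    (hF : IsCuspForm D k F) (b : OK D) (z : ℂ) {t : ℝ} (ht : 0 < t) :
    F (z + toC b, t) = F (z, t) := by
  have := hF.apply_act (a := 1) (b := b) (c := 0) (d := 1) (by ring) (x := (z, t)) ht
  have e : (!![toC (1 : OK D), toC b; toC (0 : OK D), toC (1 : OK D)] : Matrix (Fin 2) (Fin 2) ℂ)
      = !![1, toC b; 0, 1] := by simp [toC]
  rwa [e, act_translation, multiplier_translation, subst_one] at this

/-- The inversion `x ↦ -1/x` of hyperbolic space. -/
def inv3 (x : ℂ × ℝ) : ℂ × ℝ :=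
  (-conj x.1 / ((‖x.1‖ ^ 2 + x.2 ^ 2 : ℝ) : ℂ), x.2 / (‖x.1‖ ^ 2 + x.2 ^ 2))

lemma IsCuspForm.apply_inv3 {D k : ℕ} {F : ℂ × ℝ → MvPolynomial (Fin 2) ℂ}
    (hF : IsCuspForm D k F) {x : ℂ × ℝ} (hx : x ∈ H3) :
    F (inv3 x) = subst !![x.1, (x.2 : ℂ); -(x.2 : ℂ), conj x.1] (F x) := by
  have := hF.apply_act (a := 0) (b := -1) (c := 1) (d := 0) (by ring) hx
  have e : (!![toC (0 : OK D), toC (-1 : OK D); toC (1 : OK D), toC (0 : OK D)] :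
      Matrix (Fin 2) (Fin 2) ℂ) = !![0, -1; 1, 0] := by simp [toC]
  rw [e] at this
  simpa [act, inv3, multiplier] using this

/-- Near the cusp `-d/c` a cusp form is expressed through its values near infinity. -/
lemma IsCuspForm.apply_near_cusp {D k : ℕ} {F : ℂ × ℝ → MvPolynomial (Fin 2) ℂ}
    (hF : IsCuspForm D k F) {a b c d : OK D} (h : a * d - b * c = 1) (hc : c ≠ 0) {κ : ℂ}
    (hκ : toC c * κ + toC d = 0) {t : ℝ} (ht : 0 < t) {n : ℕ} (hn : n ≤ 2 * k + 2) :
    coef k n (F (κ, t)) = (-(toC c * t))⁻¹ ^ (n) * (conj (toC c) * t)⁻¹ ^ (2 * k + 2 - n) *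
      coef k (2 * k + 2 - n) (F (toC a / toC c, (‖toC c‖ ^ 2 * t)⁻¹)) := by
  have hx : ((κ, t) : ℂ × ℝ) ∈ H3 := ht
  have hc' : toC c ≠ 0 := by simpa [toC] using hc
  have hdet : toC a * toC d - toC b * toC c = 1 := by
    have := congrArg (fun a : OK D => toC a) h
    simpa [toC] using this
  have h1 := hF.apply_act h hx
  -- At `κ = -d/c` the height is inverted, so the behaviour as `t → 0` is read off from the values
  -- of `F` near infinity.
  have hact : act !![toC a, toC b; toC c, toC d] (κ, t) =
      (toC a / toC c, (‖toC c‖ ^ 2 * t)⁻¹) := by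
    have hn : ‖toC c‖ ≠ 0 := norm_ne_zero_iff.2 hc'
    have hcc : conj (toC c) ≠ 0 := by simpa using hc'
    have ht' : (t : ℂ) ≠ 0 := by exact_mod_cast ht.ne'
    ext1
    · simp only [act, Matrix.of_apply, Matrix.cons_val', Matrix.cons_val_zero, Matrix.cons_val_one,
        Matrix.cons_val_fin_one, hκ]
      simp only [map_zero, mul_zero, zero_add, norm_zero]
      push_cast
      rw [← Complex.mul_conj' (toC c)]
      field_simp
      simp
      ring
    · simp only [act, Matrix.of_apply, Matrix.cons_val', Matrix.cons_val_zero, Matrix.cons_val_one,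
        Matrix.cons_val_fin_one, hκ, Matrix.det_fin_two_of, hdet]
      simp
      field_simp
  -- The diagonal entries are `cκ + d = 0` and its conjugate; the antidiagonal shape exchanges the
  -- coefficients of index `n` and `2k + 2 - n`.
  have hJ : multiplier !![toC a, toC b; toC c, toC d] (κ, t) =
      !![0, conj (toC c) * t; -(toC c * t), 0] := by
    simp [multiplier, hκ]
  rw [hact, hJ] at h1
  rw [h1, coef_subst_antidiag (by omega) _ _ (hF.homogeneous _ hx)]
  have ht' : (t : ℂ) ≠ 0 := by exact_mod_cast ht.ne'
  have hcc : conj (toC c) ≠ 0 := by simpa using hc'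
  rw [show 2 * k + 2 - (2 * k + 2 - n) = n by omega, ← mul_assoc,
    show ∀ a b c d : ℂ, a ^ n * b ^ (2 * k + 2 - n) * (c ^ (2 * k + 2 - n) * d ^ n) =
      (a * d) ^ n * (b * c) ^ (2 * k + 2 - n) by intros; simp only [mul_pow]; ring,
    inv_mul_cancel₀ (by simp [hc', ht']), inv_mul_cancel₀ (by simp [hc', ht'])]
  simp

lemma slash_one (k : ℕ) (F : ℂ × ℝ → MvPolynomial (Fin 2) ℂ) (x : ℂ × ℝ) :
    slash k 1 F x = F x := by
  rw [slash_of_det_one (by simp)]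
  have h1 : (1 : Matrix (Fin 2) (Fin 2) ℂ) = !![1, 0; 0, 1] := Matrix.one_fin_two
  rw [h1, act_translation, multiplier_translation]
  simp [subst_one]

/-- Polynomial growth at infinity. -/
lemma IsCuspForm.growth_infty {D k : ℕ} {F : ℂ × ℝ → MvPolynomial (Fin 2) ℂ}
    (hF : IsCuspForm D k F) : ∃ (C : ℝ) (N : ℕ), ∀ n ≤ 2 * k + 2, ∀ (z : ℂ) (t : ℝ), 1 ≤ t →
      ‖coef k n (F (z, t))‖ ≤ C * t ^ N := by
  obtain ⟨C, N, h⟩ := hF.growth 1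
  refine ⟨C, N, fun n hn z t ht => ?_⟩
  have e : (((1 : Matrix.SpecialLinearGroup (Fin 2) (K D)).1.map (fun a => (a : ℂ)))) =
      (1 : Matrix (Fin 2) (Fin 2) ℂ) := by
    ext i j; fin_cases i <;> fin_cases j <;> simp
  have := h n hn z t ht
  rwa [e, slash_one] at this

/-- The mean value over a period parallelogram vanishes. -/
lemma IsCuspForm.cuspidal_infty {D k : ℕ} {F : ℂ × ℝ → MvPolynomial (Fin 2) ℂ}
    (hF : IsCuspForm D k F) {n : ℕ} (hn : n ≤ 2 * k + 2) {t : ℝ} (ht : 0 < t) :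
    ∫ x in (0 : ℝ)..1, ∫ y in (0 : ℝ)..1, coef k n (F (x + y * omega D, t)) = 0 := by
  have e : ((1 : Matrix.SpecialLinearGroup (Fin 2) (OK D)).1.map toC) =
      (1 : Matrix (Fin 2) (Fin 2) ℂ) := by
    ext i j; fin_cases i <;> fin_cases j <;> simp [toC]
  have := hF.cuspidal 1 n hn t ht
  simpa only [e, slash_one] using this

end

section

/-! ### Lie derivatives on `SL₂(ℂ)` -/

/-- Functions of matrices are differentiated as functions of the array of entries. -/
abbrev Entries : Type := Fin 2 → Fin 2 → ℂ

/-- A neighbourhood of `SL₂(ℂ)` in the space of matrices. -/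
def nearSL : Set Entries := {g | (Matrix.of g).det ∈ Complex.slitPlane}

/-- Smoothness of functions near `SL₂(ℂ)`. -/
def SmoothNearSL (f : Matrix (Fin 2) (Fin 2) ℂ → ℂ) : Prop :=
  ContDiffOn ℝ ∞ (fun e : Entries => f (Matrix.of e)) nearSL

/-- The derivative of a function of matrices. -/
def matDeriv (f : Matrix (Fin 2) (Fin 2) ℂ → ℂ) (g : Entries) : Entries →L[ℝ] ℂ :=
  fderiv ℝ (fun e : Entries => f (Matrix.of e)) g

/-- Right multiplication by a matrix. -/
def rightMul (A : Matrix (Fin 2) (Fin 2) ℂ) : Entries →L[ℝ] Entries :=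
  LinearMap.toContinuousLinearMap
    { toFun := fun g i j => g i 0 * A 0 j + g i 1 * A 1 j
      map_add' := fun g h => by ext i j; simp only [Pi.add_apply]; ring
      map_smul' := fun c g => by ext i j; simp; ring }

lemma rightMul_apply (A : Matrix (Fin 2) (Fin 2) ℂ) (g : Entries) (i j : Fin 2) :
    rightMul A g i j = g i 0 * A 0 j + g i 1 * A 1 j := rfl

lemma of_rightMul (A : Matrix (Fin 2) (Fin 2) ℂ) (g : Entries) :
    Matrix.of (rightMul A g) = Matrix.of g * A := by
  ext i j; simp [rightMul_apply, Matrix.mul_apply, Fin.sum_univ_two]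

lemma rightMul_rightMul (A B : Matrix (Fin 2) (Fin 2) ℂ) (g : Entries) :
    rightMul B (rightMul A g) = rightMul (A * B) g := by
  apply Matrix.of.injective
  rw [of_rightMul, of_rightMul, of_rightMul, mul_assoc]

lemma rightMul_add (A B : Matrix (Fin 2) (Fin 2) ℂ) (g : Entries) :
    rightMul (A + B) g = rightMul A g + rightMul B g := by
  ext i j; simp only [rightMul_apply, Matrix.add_apply, Pi.add_apply]; ring

lemma rightMul_neg (A : Matrix (Fin 2) (Fin 2) ℂ) (g : Entries) :
    rightMul (-A) g = -rightMul A g := by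
  ext i j; simp only [rightMul_apply, Matrix.neg_apply, Pi.neg_apply]; ring

lemma isOpen_nearSL : IsOpen nearSL := by
  refine Complex.isOpen_slitPlane.preimage (f := fun g : Entries => (Matrix.of g).det) ?_
  simp only [Matrix.det_fin_two, Matrix.of_apply]
  fun_prop

lemma mem_nearSL {g : Entries} (hg : (Matrix.of g).det = 1) : g ∈ nearSL := by
  simp [nearSL, hg]

section
open scoped Matrix.Norms.Operator

/-- Stated entrywise, so that the norm on matrices that is used to differentiate the exponential
stays inside this proof. -/
lemma hasDerivAt_mul_exp_apply (g A : Matrix (Fin 2) (Fin 2) ℂ) (i j : Fin 2) :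
    HasDerivAt (fun s : ℝ => (g * NormedSpace.exp ((s : ℂ) • A)) i j) ((g * A) i j) 0 := by
  have h := (hasDerivAt_exp_smul_const (𝕂 := ℝ) A (0 : ℝ)).const_mul g
  let L : Matrix (Fin 2) (Fin 2) ℂ →ₗ[ℝ] ℂ := Matrix.entryLinearMap ℝ ℂ i j
  have h2 := (LinearMap.toContinuousLinearMap L).hasFDerivAt.comp_hasDerivAt (0 : ℝ) h
  have e : L (g * (NormedSpace.exp ((0 : ℝ) • A) * A)) = (g * A) i j := by simp [L]
  exact e ▸ h2

end

variable {f : Matrix (Fin 2) (Fin 2) ℂ → ℂ} {g : Entries}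

lemma differentiableAt_of_nearSL (hf : SmoothNearSL f) (hg : g ∈ nearSL) :
    DifferentiableAt ℝ (fun e : Entries => f (Matrix.of e)) g :=
  ((hf g hg).contDiffAt (isOpen_nearSL.mem_nhds hg)).differentiableAt (by simp)

/-- The exponential curve may be replaced by any curve with the same tangent vector at `g`. This
allows curves inside the Borel subgroup or inside `SU(2)`, along which the function is explicit. -/
lemma lieDeriv_eq_of_curve (hf : SmoothNearSL f) (hg : g ∈ nearSL) {A : Matrix (Fin 2) (Fin 2) ℂ}
    {c : ℝ → Entries} (hc : HasDerivAt c (rightMul A g) 0) (h0 : c 0 = g) {d : ℂ}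
    (hd : HasDerivAt (fun s => f (Matrix.of (c s))) d 0) : matDeriv f g (rightMul A g) = d := by
  have h1 : HasFDerivAt (fun e : Entries => f (Matrix.of e)) (matDeriv f g) (c 0) := by
    rw [h0]; exact (differentiableAt_of_nearSL hf hg).hasFDerivAt
  exact (h1.comp_hasDerivAt (0 : ℝ) hc).unique hd

lemma lieDeriv_eq (hf : SmoothNearSL f) (hg : g ∈ nearSL) (A : Matrix (Fin 2) (Fin 2) ℂ) :
    lieDeriv A f (Matrix.of g) = matDeriv f g (rightMul A g) := by
  let c : ℝ → Entries := fun s => Matrix.of.symm (Matrix.of g * NormedSpace.exp ((s : ℂ) • A))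
  have hc : HasDerivAt c (rightMul A g) 0 := by
    refine hasDerivAt_pi.2 fun i => hasDerivAt_pi.2 fun j => ?_
    have := hasDerivAt_mul_exp_apply (Matrix.of g) A i j
    rwa [← of_rightMul] at this
  have h0 : c 0 = g := by simp [c]
  have h1 : HasFDerivAt (fun e : Entries => f (Matrix.of e)) (matDeriv f g) (c 0) := by
    rw [h0]; exact (differentiableAt_of_nearSL hf hg).hasFDerivAt
  exact (h1.comp_hasDerivAt (0 : ℝ) hc).deriv

lemma SmoothNearSL.lieDeriv (hf : SmoothNearSL f) (A : Matrix (Fin 2) (Fin 2) ℂ) :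
    SmoothNearSL (lieDeriv A f) := by
  have h1 : ContDiffOn ℝ ∞ (matDeriv f) nearSL := hf.fderiv_of_isOpen isOpen_nearSL (by simp)
  exact (h1.clm_apply (rightMul A).contDiff.contDiffOn).congr fun g hg => lieDeriv_eq hf hg A

/-- The left invariant field of `B` is `g ↦ g B`, which is linear in `g`; differentiating it along
`g A` produces the first order term in `g A B`. -/
lemma lieDeriv_lieDeriv (hf : SmoothNearSL f) (hg : g ∈ nearSL)
    (A B : Matrix (Fin 2) (Fin 2) ℂ) : lieDeriv A (lieDeriv B f) (Matrix.of g) =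
      fderiv ℝ (matDeriv f) g (rightMul A g) (rightMul B g) +
        matDeriv f g (rightMul (A * B) g) := by
  rw [lieDeriv_eq (hf.lieDeriv B) hg]
  have he : (fun e : Entries => lieDeriv B f (Matrix.of e)) =ᶠ[nhds g]
      fun h => matDeriv f h (rightMul B h) := by
    filter_upwards [isOpen_nearSL.mem_nhds hg] with h hh
    exact lieDeriv_eq hf hh B
  have h1 : ContDiffOn ℝ ∞ (matDeriv f) nearSL := hf.fderiv_of_isOpen isOpen_nearSL (by simp)
  have h2 : HasFDerivAt (matDeriv f) (fderiv ℝ (matDeriv f) g) g :=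
    (((h1 g hg).contDiffAt (isOpen_nearSL.mem_nhds hg)).differentiableAt (by simp)).hasFDerivAt
  rw [matDeriv, he.fderiv_eq, (h2.clm_apply (rightMul B).hasFDerivAt).fderiv]
  simp [add_comm, rightMul_rightMul]

/-- The second derivative is symmetric, so only the first order terms of `lieDeriv_lieDeriv` survive
in the difference. -/
lemma lieDeriv_commutator (hf : SmoothNearSL f) (hg : g ∈ nearSL)
    (A B : Matrix (Fin 2) (Fin 2) ℂ) : lieDeriv A (lieDeriv B f) (Matrix.of g) =
      lieDeriv B (lieDeriv A f) (Matrix.of g) + lieDeriv (A * B - B * A) f (Matrix.of g) := by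
  rw [lieDeriv_lieDeriv hf hg, lieDeriv_lieDeriv hf hg, lieDeriv_eq hf hg]
  have hs : IsSymmSndFDerivAt ℝ (fun e : Entries => f (Matrix.of e)) g :=
    ((hf g hg).contDiffAt (isOpen_nearSL.mem_nhds hg)).isSymmSndFDerivAt (by
      simp only [minSmoothness_of_isRCLikeNormedField]; exact WithTop.coe_le_coe.2 le_top)
  have := hs.eq (rightMul A g) (rightMul B g)
  change fderiv ℝ (matDeriv f) g _ _ = fderiv ℝ (matDeriv f) g _ _ at this
  rw [this, sub_eq_add_neg, rightMul_add, rightMul_neg, map_add, map_neg]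
  ring

lemma lieDeriv_matrix_add (hf : SmoothNearSL f) (hg : g ∈ nearSL)
    (A B : Matrix (Fin 2) (Fin 2) ℂ) : lieDeriv (A + B) f (Matrix.of g) =
      lieDeriv A f (Matrix.of g) + lieDeriv B f (Matrix.of g) := by
  rw [lieDeriv_eq hf hg, lieDeriv_eq hf hg, lieDeriv_eq hf hg, rightMul_add, map_add]

lemma lieDeriv_matrix_neg (hf : SmoothNearSL f) (hg : g ∈ nearSL)
    (A : Matrix (Fin 2) (Fin 2) ℂ) :
    lieDeriv (-A) f (Matrix.of g) = -lieDeriv A f (Matrix.of g) := by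
  rw [lieDeriv_eq hf hg, lieDeriv_eq hf hg, rightMul_neg, map_neg]

lemma SmoothNearSL.combination {f₁ f₂ : Matrix (Fin 2) (Fin 2) ℂ → ℂ}
    (h₁ : SmoothNearSL f₁) (h₂ : SmoothNearSL f₂) (a b : ℂ) :
    SmoothNearSL (fun g => a * f₁ g + b * f₂ g) :=
  (contDiffOn_const.mul h₁).add (contDiffOn_const.mul h₂)

lemma lieDeriv_combination {f₁ f₂ : Matrix (Fin 2) (Fin 2) ℂ → ℂ}
    (h₁ : SmoothNearSL f₁) (h₂ : SmoothNearSL f₂) (hg : g ∈ nearSL)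
    (A : Matrix (Fin 2) (Fin 2) ℂ) (a b : ℂ) :
    lieDeriv A (fun g => a * f₁ g + b * f₂ g) (Matrix.of g) =
      a * lieDeriv A f₁ (Matrix.of g) + b * lieDeriv A f₂ (Matrix.of g) := by
  have d₁ := differentiableAt_of_nearSL h₁ hg
  have d₂ := differentiableAt_of_nearSL h₂ hg
  rw [lieDeriv_eq h₁ hg, lieDeriv_eq h₂ hg, lieDeriv_eq (h₁.combination h₂ a b) hg]
  have : HasFDerivAt (fun e : Entries => a * f₁ (Matrix.of e) + b * f₂ (Matrix.of e))
      (a • matDeriv f₁ g + b • matDeriv f₂ g) g :=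
    (d₁.hasFDerivAt.const_mul a).add (d₂.hasFDerivAt.const_mul b)
  rw [matDeriv, this.fderiv]
  simp

lemma lieDeriv₁_lieDeriv₁ (hf : SmoothNearSL f) (hg : g ∈ nearSL)
    (A B : Matrix (Fin 2) (Fin 2) ℂ) : lieDeriv₁ A (lieDeriv₁ B f) (Matrix.of g) =
      (lieDeriv A (lieDeriv B f) (Matrix.of g) - lieDeriv (Complex.I • A) (lieDeriv (Complex.I • B) f) (Matrix.of g)) / 4
      - Complex.I * (lieDeriv A (lieDeriv (Complex.I • B) f) (Matrix.of g) +
        lieDeriv (Complex.I • A) (lieDeriv B f) (Matrix.of g)) / 4 := by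
  have e : lieDeriv₁ B f = fun g => 1 / 2 * lieDeriv B f g +
      (-Complex.I / 2) * lieDeriv (Complex.I • B) f g := by
    funext g; rw [lieDeriv₁]; ring
  rw [e, lieDeriv₁, lieDeriv_combination (hf.lieDeriv _) (hf.lieDeriv _) hg,
    lieDeriv_combination (hf.lieDeriv _) (hf.lieDeriv _) hg]
  linear_combination (1 / 4 * lieDeriv (Complex.I • A) (lieDeriv (Complex.I • B) f) (Matrix.of g)) *
    Complex.I_sq

lemma lieDeriv₂_lieDeriv₂ (hf : SmoothNearSL f) (hg : g ∈ nearSL)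
    (A B : Matrix (Fin 2) (Fin 2) ℂ) : lieDeriv₂ A (lieDeriv₂ B f) (Matrix.of g) =
      (lieDeriv A (lieDeriv B f) (Matrix.of g) - lieDeriv (Complex.I • A) (lieDeriv (Complex.I • B) f) (Matrix.of g)) / 4
      + Complex.I * (lieDeriv A (lieDeriv (Complex.I • B) f) (Matrix.of g) +
        lieDeriv (Complex.I • A) (lieDeriv B f) (Matrix.of g)) / 4 := by
  have e : lieDeriv₂ B f = fun g => 1 / 2 * lieDeriv B f g +
      (Complex.I / 2) * lieDeriv (Complex.I • B) f g := by
    funext g; rw [lieDeriv₂]; ring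
  rw [e, lieDeriv₂, lieDeriv_combination (hf.lieDeriv _) (hf.lieDeriv _) hg,
    lieDeriv_combination (hf.lieDeriv _) (hf.lieDeriv _) hg]
  linear_combination (1 / 4 * lieDeriv (Complex.I • A) (lieDeriv (Complex.I • B) f) (Matrix.of g)) *
    Complex.I_sq

/-- The equations given by the two Casimir operators, through real vector fields. -/
lemma casimir_equations (hf : SmoothNearSL f) (hg : g ∈ nearSL) {c : ℂ}
    (h₁ : casimir lieDeriv₁ f (Matrix.of g) - c * f (Matrix.of g) = 0) (h₂ : casimir lieDeriv₂ f (Matrix.of g) - c * f (Matrix.of g) = 0) :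
    (lieDeriv !![1, 0; 0, -1] (lieDeriv !![1, 0; 0, -1] f) (Matrix.of g)
      - lieDeriv (Complex.I • !![1, 0; 0, -1]) (lieDeriv (Complex.I • !![1, 0; 0, -1]) f) (Matrix.of g)
      + 4 * (lieDeriv !![0, 1; 0, 0] (lieDeriv !![0, 0; 1, 0] f) (Matrix.of g)
        - lieDeriv (Complex.I • !![0, 1; 0, 0]) (lieDeriv (Complex.I • !![0, 0; 1, 0]) f) (Matrix.of g))
      - 4 * lieDeriv !![1, 0; 0, -1] f (Matrix.of g) = 4 * c * f (Matrix.of g)) ∧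
    (lieDeriv !![1, 0; 0, -1] (lieDeriv (Complex.I • !![1, 0; 0, -1]) f) (Matrix.of g)
      + 2 * (lieDeriv !![0, 1; 0, 0] (lieDeriv (Complex.I • !![0, 0; 1, 0]) f) (Matrix.of g)
        + lieDeriv (Complex.I • !![0, 1; 0, 0]) (lieDeriv !![0, 0; 1, 0] f) (Matrix.of g))
      - 2 * lieDeriv (Complex.I • !![1, 0; 0, -1]) f (Matrix.of g) = 0) := by
  -- The commutators move `E` to the left of `E'` in the Casimir elements, and `c5` says that `H`
  -- and `iH` commute. The sum of the two Casimir equations gives the first assertion, and `i` times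
  -- their difference the second.
  have c1 := lieDeriv_commutator hf hg !![0, 1; 0, 0] !![0, 0; 1, 0]
  have c2 := lieDeriv_commutator hf hg (Complex.I • !![0, 1; 0, 0]) (Complex.I • !![0, 0; 1, 0])
  have c3 := lieDeriv_commutator hf hg (Complex.I • !![0, 1; 0, 0]) !![0, 0; 1, 0]
  have c4 := lieDeriv_commutator hf hg !![0, 1; 0, 0] (Complex.I • !![0, 0; 1, 0])
  have c5 := lieDeriv_commutator hf hg !![1, 0; 0, -1] (Complex.I • !![1, 0; 0, -1])
  have e1 : (!![0, 1; 0, 0] * !![0, 0; 1, 0] - !![0, 0; 1, 0] * !![0, 1; 0, 0] :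
      Matrix (Fin 2) (Fin 2) ℂ) = !![1, 0; 0, -1] := by
    ext i j; fin_cases i <;> fin_cases j <;> simp
  have e1n : (!![0, 0; 1, 0] * !![0, 1; 0, 0] - !![0, 1; 0, 0] * !![0, 0; 1, 0] :
      Matrix (Fin 2) (Fin 2) ℂ) = -!![1, 0; 0, -1] := by
    rw [← e1, neg_sub]
  have e5 : (!![1, 0; 0, -1] * !![1, 0; 0, -1] - !![1, 0; 0, -1] * !![1, 0; 0, -1] :
      Matrix (Fin 2) (Fin 2) ℂ) = 0 := sub_self _
  simp only [smul_mul_assoc, mul_smul_comm, smul_smul, Complex.I_mul_I, ← smul_sub, e1, e5,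
    smul_zero, neg_smul, one_smul, neg_sub_neg, e1n] at c1 c2 c3 c4 c5
  rw [lieDeriv_matrix_neg hf hg] at c2
  have z : lieDeriv 0 f (Matrix.of g) = 0 := by
    rw [lieDeriv_eq hf hg, show rightMul 0 g = 0 by ext i j; simp [rightMul_apply], map_zero]
  rw [z, add_zero] at c5
  simp only [casimir, Pi.add_apply, Pi.smul_apply, lieDeriv₁_lieDeriv₁ hf hg,
    lieDeriv₂_lieDeriv₂ hf hg] at h₁ h₂
  simp only [nsmul_eq_mul, Nat.cast_ofNat] at h₁ h₂
  constructor
  · linear_combination 2 * h₁ + 2 * h₂ + 2 * c1 - 2 * c2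
  · linear_combination Complex.I * h₁ - Complex.I * h₂ + c3 + c4 + 1 / 2 * c5 + 1 / 2 *
      (lieDeriv !![1, 0; 0, -1] (lieDeriv (Complex.I • !![1, 0; 0, -1]) f) (Matrix.of g)
      + lieDeriv (Complex.I • !![1, 0; 0, -1]) (lieDeriv !![1, 0; 0, -1] f) (Matrix.of g)
      + 2 * lieDeriv !![0, 1; 0, 0] (lieDeriv (Complex.I • !![0, 0; 1, 0]) f) (Matrix.of g)
      + 2 * lieDeriv (Complex.I • !![0, 1; 0, 0]) (lieDeriv !![0, 0; 1, 0] f) (Matrix.of g)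
      + 2 * lieDeriv !![0, 0; 1, 0] (lieDeriv (Complex.I • !![0, 1; 0, 0]) f) (Matrix.of g)
      + 2 * lieDeriv (Complex.I • !![0, 0; 1, 0]) (lieDeriv !![0, 1; 0, 0] f) (Matrix.of g)) *
      Complex.I_sq

end

section

/-! ### Families of polynomials -/

/-- Smoothness of the coefficients of a family of polynomials. -/
def SmoothCoeffs (P : Entries → MvPolynomial (Fin 2) ℂ) : Prop :=
  ∀ s, ContDiffOn ℝ ∞ (fun e => (P e).coeff s) nearSL

lemma SmoothCoeffs.mul {P Q : Entries → MvPolynomial (Fin 2) ℂ} (hP : SmoothCoeffs P)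
    (hQ : SmoothCoeffs Q) : SmoothCoeffs (fun e => P e * Q e) := by
  classical
  intro s
  simp only [MvPolynomial.coeff_mul]
  exact ContDiffOn.sum fun x _ => (hP x.1).mul (hQ x.2)

lemma SmoothCoeffs.pow {P : Entries → MvPolynomial (Fin 2) ℂ} (hP : SmoothCoeffs P) (n : ℕ) :
    SmoothCoeffs (fun e => P e ^ n) := by
  induction n with
  | zero => intro s; simp only [pow_zero]; exact contDiffOn_const
  | succ n ih => simp only [pow_succ]; exact ih.mul hP

lemma smoothCoeffs_linear {a b : Entries → ℂ} (ha : ContDiffOn ℝ ∞ a nearSL)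
    (hb : ContDiffOn ℝ ∞ b nearSL) : SmoothCoeffs (fun e =>
      MvPolynomial.C (a e) * MvPolynomial.X 0 + MvPolynomial.C (b e) * MvPolynomial.X 1) := by
  intro s
  simp only [MvPolynomial.coeff_add, MvPolynomial.coeff_C_mul]
  exact (ha.mul contDiffOn_const).add (hb.mul contDiffOn_const)

/-- Differentiability at `0` of the coefficients of a one-parameter family of polynomials. -/
def HasCoeffDeriv (P : ℝ → MvPolynomial (Fin 2) ℂ) (P' : MvPolynomial (Fin 2) ℂ) : Prop :=
  ∀ s, HasDerivAt (fun x => (P x).coeff s) (P'.coeff s) 0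

lemma HasCoeffDeriv.mul {P Q : ℝ → MvPolynomial (Fin 2) ℂ} {P' Q' : MvPolynomial (Fin 2) ℂ}
    (hP : HasCoeffDeriv P P') (hQ : HasCoeffDeriv Q Q') :
    HasCoeffDeriv (fun x => P x * Q x) (P' * Q 0 + P 0 * Q') := by
  classical
  intro s
  simp only [MvPolynomial.coeff_mul, MvPolynomial.coeff_add, ← Finset.sum_add_distrib]
  exact HasDerivAt.fun_sum fun x _ => (hP x.1).mul (hQ x.2)

lemma HasCoeffDeriv.pow {P : ℝ → MvPolynomial (Fin 2) ℂ} {P' : MvPolynomial (Fin 2) ℂ}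
    (hP : HasCoeffDeriv P P') (n : ℕ) :
    HasCoeffDeriv (fun x => P x ^ n) (n * P 0 ^ (n - 1) * P') := by
  induction n with
  | zero => intro s; simpa using hasDerivAt_const (0 : ℝ) _
  | succ n ih =>
    have := ih.mul hP
    simp only [← pow_succ] at this
    convert this using 1
    rcases n with _ | n
    · simp
    · simp only [Nat.add_sub_cancel, pow_succ]; push_cast; ring

lemma hasCoeffDeriv_linear {a b : ℝ → ℂ} {a' b' : ℂ} (ha : HasDerivAt a a' 0)
    (hb : HasDerivAt b b' 0) : HasCoeffDeriv (fun x =>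
      MvPolynomial.C (a x) * MvPolynomial.X 0 + MvPolynomial.C (b x) * MvPolynomial.X 1)
      (MvPolynomial.C a' * MvPolynomial.X 0 + MvPolynomial.C b' * MvPolynomial.X 1) := by
  intro s
  simp only [MvPolynomial.coeff_add, MvPolynomial.coeff_C_mul]
  exact (ha.mul_const _).add (hb.mul_const _)

/-- The coefficients of a form of degree `2k+2`, divided by the binomial coefficients. -/
def ncoef (k n : ℕ) (P : MvPolynomial (Fin 2) ℂ) : ℂ := coef k n P / ((2 * k + 2).choose n : ℂ)

lemma coef_eq_ncoef {k n : ℕ} (hn : n ≤ 2 * k + 2) (P : MvPolynomial (Fin 2) ℂ) :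
    coef k n P = ((2 * k + 2).choose n : ℂ) * ncoef k n P := by
  have := choose_cast_ne_zero hn
  rw [ncoef]; field_simp

lemma apolar_X_pow_mul_X_pow' {k a b : ℕ} (h : a + b = 2 * k + 2) (P : MvPolynomial (Fin 2) ℂ) :
    apolar k P (MvPolynomial.X 0 ^ a * MvPolynomial.X 1 ^ b) = ncoef k b P := by
  obtain rfl : a = 2 * k + 2 - b := by omega
  exact apolar_X_pow_mul_X_pow (by omega) P

/-- The normalized coefficient of index `n` is the pairing with `X^{2k+2-n} Y^n`, and the adjoint of
a substitution is the substitution of the transpose. The right side is polynomial in the entries of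
`M`, so it can be differentiated. -/
lemma ncoef_subst {k n : ℕ} (hn : n ≤ 2 * k + 2) {P : MvPolynomial (Fin 2) ℂ}
    (hP : P.IsHomogeneous (2 * k + 2)) (M : Matrix (Fin 2) (Fin 2) ℂ) :
    ncoef k n (subst M P) = apolar k P
      ((MvPolynomial.C (M 0 0) * MvPolynomial.X 0 + MvPolynomial.C (M 1 0) * MvPolynomial.X 1)
        ^ (2 * k + 2 - n) *
      (MvPolynomial.C (M 0 1) * MvPolynomial.X 0 + MvPolynomial.C (M 1 1) * MvPolynomial.X 1)
        ^ n) := by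
  have hm : (MvPolynomial.X 0 ^ (2 * k + 2 - n) * MvPolynomial.X 1 ^ n :
      MvPolynomial (Fin 2) ℂ).IsHomogeneous (2 * k + 2) := by
    have := ((MvPolynomial.isHomogeneous_X ℂ (0 : Fin 2)).pow (2 * k + 2 - n)).mul
      ((MvPolynomial.isHomogeneous_X ℂ (1 : Fin 2)).pow n)
    rwa [show 1 * (2 * k + 2 - n) + 1 * n = 2 * k + 2 by omega] at this
  have := apolar_subst hP hm M
  rwa [apolar_X_pow_mul_X_pow' (by omega), subst_mul, subst_pow, subst_pow, subst_X, subst_X]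
    at this

lemma apolar_eq_sum (k : ℕ) (P q : MvPolynomial (Fin 2) ℂ) :
    apolar k P q = ∑ m ∈ Finset.range (2 * k + 3), coef k m q * ncoef k m P := rfl

/-- The infinitesimal action of matrices on the coefficients of a form. -/
lemma hasDerivAt_ncoef_subst {k n : ℕ} (hn : n ≤ 2 * k + 2) {P : MvPolynomial (Fin 2) ℂ}
    (hP : P.IsHomogeneous (2 * k + 2)) {p q r s : ℝ → ℂ} {p' q' r' s' : ℂ}
    (hp : HasDerivAt p p' 0) (hq : HasDerivAt q q' 0) (hr : HasDerivAt r r' 0)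
    (hs : HasDerivAt s s' 0) (p0 : p 0 = 1) (q0 : q 0 = 0) (r0 : r 0 = 0) (s0 : s 0 = 1) :
    HasDerivAt (fun x => ncoef k n (subst !![p x, q x; r x, s x] P))
      ((2 * k + 2 - n : ℂ) * (p' * ncoef k n P + r' * ncoef k (n + 1) P) +
        n * (q' * ncoef k (n - 1) P + s' * ncoef k n P)) 0 := by
  have h := ((hasCoeffDeriv_linear hp hr).pow (2 * k + 2 - n)).mul
    ((hasCoeffDeriv_linear hq hs).pow n)
  simp only [p0, q0, r0, s0, map_one, map_zero, one_mul, zero_mul, add_zero, zero_add] at h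
  have e1 : apolar k P (((2 * k + 2 - n : ℕ) : MvPolynomial (Fin 2) ℂ) *
      MvPolynomial.X 0 ^ (2 * k + 2 - n - 1) * (MvPolynomial.C p' * MvPolynomial.X 0 +
        MvPolynomial.C r' * MvPolynomial.X 1) * MvPolynomial.X 1 ^ n) =
      (2 * k + 2 - n : ℂ) * (p' * ncoef k n P + r' * ncoef k (n + 1) P) := by
    -- The neighbour of index `n + 1` at `n = 2k + 2`, and in `e2` that of index `n - 1` at `n = 0`,
    -- are multiplied by zero; these extreme cases are treated separately because of the truncated
    -- subtraction.
    obtain ⟨a, ha⟩ : ∃ a, 2 * k + 2 - n = a := ⟨_, rfl⟩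
    have ha' : (a : ℂ) = 2 * k + 2 - n := by rw [← ha, Nat.cast_sub hn]; push_cast; ring
    rw [ha, ← ha']
    rcases a with _ | a
    · simp
    · have : ((a + 1 : ℕ) : MvPolynomial (Fin 2) ℂ) * MvPolynomial.X 0 ^ (a + 1 - 1) *
          (MvPolynomial.C p' * MvPolynomial.X 0 + MvPolynomial.C r' * MvPolynomial.X 1) *
          MvPolynomial.X 1 ^ n =
          (((a + 1 : ℕ) : ℂ) * p') • (MvPolynomial.X 0 ^ (a + 1) * MvPolynomial.X 1 ^ n) +
          (((a + 1 : ℕ) : ℂ) * r') • (MvPolynomial.X 0 ^ a * MvPolynomial.X 1 ^ (n + 1)) := by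
        simp only [MvPolynomial.smul_eq_C_mul, map_mul, map_natCast, Nat.add_sub_cancel]
        ring
      rw [this, map_add, map_smul, map_smul, apolar_X_pow_mul_X_pow' (by omega),
        apolar_X_pow_mul_X_pow' (by omega), smul_eq_mul, smul_eq_mul]
      ring
  have e2 : apolar k P (MvPolynomial.X 0 ^ (2 * k + 2 - n) * ((n : MvPolynomial (Fin 2) ℂ) *
      MvPolynomial.X 1 ^ (n - 1) * (MvPolynomial.C q' * MvPolynomial.X 0 +
        MvPolynomial.C s' * MvPolynomial.X 1))) =
      n * (q' * ncoef k (n - 1) P + s' * ncoef k n P) := by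
    rcases n with _ | n
    · simp
    · have : MvPolynomial.X 0 ^ (2 * k + 2 - (n + 1)) * (((n + 1 : ℕ) : MvPolynomial (Fin 2) ℂ) *
          MvPolynomial.X 1 ^ (n + 1 - 1) * (MvPolynomial.C q' * MvPolynomial.X 0 +
            MvPolynomial.C s' * MvPolynomial.X 1)) =
          (((n + 1 : ℕ) : ℂ) * q') •
            (MvPolynomial.X 0 ^ (2 * k + 2 - (n + 1) + 1) * MvPolynomial.X 1 ^ n) +
          (((n + 1 : ℕ) : ℂ) * s') •
            (MvPolynomial.X 0 ^ (2 * k + 2 - (n + 1)) * MvPolynomial.X 1 ^ (n + 1)) := by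
        simp only [MvPolynomial.smul_eq_C_mul, map_mul, map_natCast, Nat.add_sub_cancel]
        ring
      rw [this, map_add, map_smul, map_smul, apolar_X_pow_mul_X_pow' (by omega),
        apolar_X_pow_mul_X_pow' (by omega), smul_eq_mul, smul_eq_mul, Nat.add_sub_cancel]
      ring
  rw [← e1, ← e2, ← map_add]
  simp only [ncoef_subst hn hP, apolar_eq_sum, Matrix.of_apply, Matrix.cons_val',
    Matrix.cons_val_zero, Matrix.cons_val_one, Matrix.cons_val_fin_one]
  exact HasDerivAt.fun_sum fun m _ => (h _).mul_const _

/-! ### The function on the group attached to a form -/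

lemma contDiffOn_entry (i j : Fin 2) : ContDiffOn ℝ ∞ (fun e : Entries => e i j) nearSL := by
  fun_prop

lemma contDiffOn_conj {f : Entries → ℂ} (hf : ContDiffOn ℝ ∞ f nearSL) :
    ContDiffOn ℝ ∞ (fun e => conj (f e)) nearSL :=
  Complex.conjCLE.contDiff.comp_contDiffOn hf

lemma contDiffOn_det : ContDiffOn ℝ ∞ (fun e : Entries => (Matrix.of e).det) nearSL := by
  simp only [Matrix.det_fin_two, Matrix.of_apply]
  fun_prop

lemma det_ne_zero_of_nearSL {e : Entries} (he : e ∈ nearSL) : (Matrix.of e).det ≠ 0 :=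
  Complex.slitPlane_ne_zero he

/-- The slash operator divides by the principal square root of the determinant, which is smooth on
the slit plane. This is why `nearSL` asks for a determinant in the slit plane rather than merely a
nonzero one. -/
lemma contDiffOn_det_cpow (c : ℂ) :
    ContDiffOn ℝ ∞ (fun e : Entries => (Matrix.of e).det ^ c) nearSL := by
  have h1 : ContDiffOn ℝ ∞ (fun z : ℂ => Complex.exp (Complex.log z * c)) Complex.slitPlane := by
    intro z hz
    have : ContDiffAt ℂ ∞ (fun z : ℂ => Complex.exp (Complex.log z * c)) z :=
      ((Complex.contDiffAt_log hz).mul contDiffAt_const).cexp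
    exact (this.restrict_scalars ℝ).contDiffWithinAt
  refine (h1.comp contDiffOn_det fun e he => he).congr fun e he => ?_
  rw [Complex.cpow_def_of_ne_zero (det_ne_zero_of_nearSL he)]
  rfl

/-- Smoothness is needed on a full neighbourhood of `SL₂(ℂ)`, because the Lie derivatives are
computed from the derivative in all the matrix entries. By `ncoef_subst` the function is a
polynomial in the entries of the inverse multiplier and in the coefficients of `F` at `g (0, 1)`. -/
lemma smoothNearSL_lift {D k : ℕ} {F : ℂ × ℝ → MvPolynomial (Fin 2) ℂ} (hF : IsCuspForm D k F)
    {n : ℕ} (hn : n ≤ 2 * k + 2) : SmoothNearSL (lift k n F) := by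
  have hx : ((0, 1) : ℂ × ℝ) ∈ H3 := zero_lt_one (α := ℝ)
  have hc := contDiffOn_entry 1 0
  have hd := contDiffOn_entry 1 1
  have hw : ContDiffOn ℝ ∞ (fun e : Entries => ((Matrix.of e).det ^ (1 / 2 : ℂ))⁻¹) nearSL :=
    (contDiffOn_det_cpow _).inv fun e he => by
      rw [Complex.cpow_ne_zero_iff_of_exponent_ne_zero (by norm_num)]
      exact det_ne_zero_of_nearSL he
  have hheight : ContDiffOn ℝ ∞ (fun e : Entries =>
      ‖(Matrix.of e) 1 0 * ((0, 1) : ℂ × ℝ).1 + (Matrix.of e) 1 1‖ ^ 2 +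
        ‖(Matrix.of e) 1 0‖ ^ 2 * ((0, 1) : ℂ × ℝ).2 ^ 2) nearSL := by
    simp only [Matrix.of_apply]
    exact (((hc.mul contDiffOn_const).add hd).norm_sq ℝ).add ((hc.norm_sq ℝ).mul contDiffOn_const)
  have hpos : ∀ e ∈ nearSL, 0 < ‖(Matrix.of e) 1 0 * ((0, 1) : ℂ × ℝ).1 + (Matrix.of e) 1 1‖ ^ 2 +
        ‖(Matrix.of e) 1 0‖ ^ 2 * ((0, 1) : ℂ × ℝ).2 ^ 2 := fun e he =>
    height_pos (det_ne_zero_of_nearSL he) hx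
  have hact : ContDiffOn ℝ ∞ (fun e : Entries => act (Matrix.of e) (0, 1)) nearSL := by
    unfold act
    simp only [div_eq_mul_inv]
    refine ContDiffOn.prodMk (ContDiffOn.mul ?_ (ContDiffOn.inv
      (Complex.ofRealCLM.contDiff.comp_contDiffOn hheight) fun e he => ?_))
      (ContDiffOn.mul ?_ (hheight.inv fun e he => (hpos e he).ne'))
    · have ha := contDiffOn_entry 0 0
      have hb := contDiffOn_entry 0 1
      exact (((ha.mul contDiffOn_const).add hb).mul
        (contDiffOn_conj ((hc.mul contDiffOn_const).add hd))).add
        ((ha.mul (contDiffOn_conj hc)).mul contDiffOn_const)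
    · exact Complex.ofReal_ne_zero.2 (hpos e he).ne'
    · exact (contDiffOn_det.norm ℝ fun e he => det_ne_zero_of_nearSL he).mul contDiffOn_const
  have hF' : ∀ m ≤ 2 * k + 2, ContDiffOn ℝ ∞
      (fun e : Entries => coef k m (F (act (Matrix.of e) (0, 1)))) nearSL := fun m hm =>
    (hF.smooth m hm).comp hact fun e he => act_mem (det_ne_zero_of_nearSL he) hx
  have hentry : ∀ i j, ContDiffOn ℝ ∞ (fun e : Entries =>
      (multiplier (((Matrix.of e).det ^ (1 / 2 : ℂ))⁻¹ • Matrix.of e) (0, 1))⁻¹ i j) nearSL := by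
    have hC : ContDiffOn ℝ ∞ (fun e : Entries => ((Matrix.of e).det ^ (1 / 2 : ℂ))⁻¹ * e 1 0)
      nearSL := hw.mul hc
    have hD : ContDiffOn ℝ ∞ (fun e : Entries => ((Matrix.of e).det ^ (1 / 2 : ℂ))⁻¹ * e 1 1)
      nearSL := hw.mul hd
    have hdet : ContDiffOn ℝ ∞ (fun e : Entries => Ring.inverse
        (multiplier (((Matrix.of e).det ^ (1 / 2 : ℂ))⁻¹ • Matrix.of e) (0, 1)).det) nearSL := by
      simp only [Ring.inverse_eq_inv']
      refine ContDiffOn.inv ?_ fun e he => ?_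
      · simp only [multiplier, Matrix.smul_apply, Matrix.of_apply, smul_eq_mul, mul_zero, zero_add,
          Matrix.det_fin_two_of]
        exact (hD.mul (contDiffOn_conj hD)).sub
          (((contDiffOn_conj hC).mul contDiffOn_const).mul (hC.mul contDiffOn_const).neg)
      · refine (isUnit_det_multiplier ?_ hx).ne_zero
        rw [Matrix.det_smul]
        refine mul_ne_zero (pow_ne_zero _ (inv_ne_zero ?_)) (det_ne_zero_of_nearSL he)
        rw [Complex.cpow_ne_zero_iff_of_exponent_ne_zero (by norm_num)]
        exact det_ne_zero_of_nearSL he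
    intro i j
    simp only [Matrix.inv_def, Matrix.smul_apply, smul_eq_mul]
    refine hdet.mul ?_
    simp only [multiplier, Matrix.smul_apply, Matrix.of_apply, smul_eq_mul, mul_zero, zero_add,
      Matrix.adjugate_fin_two_of]
    fin_cases i <;> fin_cases j
    · exact contDiffOn_conj hD
    · exact ((contDiffOn_conj hC).mul contDiffOn_const).neg
    · exact (hC.mul contDiffOn_const).neg.neg
    · exact hD
  have hpoly := ((smoothCoeffs_linear (hentry 0 0) (hentry 1 0)).pow (2 * k + 2 - n)).mul
    ((smoothCoeffs_linear (hentry 0 1) (hentry 1 1)).pow n)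
  have hdetk : ContDiffOn ℝ ∞
      (fun e : Entries => (((‖(Matrix.of e).det‖ ^ k)⁻¹ : ℝ) : ℂ)) nearSL :=
    Complex.ofRealCLM.contDiff.comp_contDiffOn
      (((contDiffOn_det.norm ℝ fun e he => det_ne_zero_of_nearSL he).pow k).inv fun e he =>
        pow_ne_zero _ (norm_ne_zero_iff.2 (det_ne_zero_of_nearSL he)))
  have main : ContDiffOn ℝ ∞ (fun e : Entries =>
      (((‖(Matrix.of e).det‖ ^ k)⁻¹ : ℝ) : ℂ) * (((2 * k + 2).choose n : ℂ) *
        ∑ m ∈ Finset.range (2 * k + 3), coef k m (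
        ((MvPolynomial.C ((multiplier (((Matrix.of e).det ^ (1 / 2 : ℂ))⁻¹ • Matrix.of e)
          (0, 1))⁻¹ 0 0) * MvPolynomial.X 0 +
          MvPolynomial.C ((multiplier (((Matrix.of e).det ^ (1 / 2 : ℂ))⁻¹ • Matrix.of e)
          (0, 1))⁻¹ 1 0) * MvPolynomial.X 1) ^ (2 * k + 2 - n) *
        (MvPolynomial.C ((multiplier (((Matrix.of e).det ^ (1 / 2 : ℂ))⁻¹ • Matrix.of e)
          (0, 1))⁻¹ 0 1) * MvPolynomial.X 0 +
          MvPolynomial.C ((multiplier (((Matrix.of e).det ^ (1 / 2 : ℂ))⁻¹ • Matrix.of e)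
          (0, 1))⁻¹ 1 1) * MvPolynomial.X 1) ^ n)) *
        (coef k m (F (act (Matrix.of e) (0, 1))) / ((2 * k + 2).choose m : ℂ)))) nearSL := by
    refine hdetk.mul (contDiffOn_const.mul (ContDiffOn.sum fun m hm => (hpoly _).mul ?_))
    exact (hF' m (by simp at hm; omega)).div_const _
  refine main.congr fun e he => ?_
  have hy : act (Matrix.of e) (0, 1) ∈ H3 := act_mem (det_ne_zero_of_nearSL he) hx
  rw [lift, slash, coef_C_mul, coef_eq_ncoef hn, ncoef_subst hn (hF.homogeneous _ hy)]
  rfl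

end

section

/-! ### The Casimir equations in horospherical coordinates -/

/-- The upper triangular matrix that sends `(0, 1)` to `(z, e^τ)`. -/
def borel (x : ℂ × ℝ) : Entries :=
  ![![(Real.exp (x.2 / 2) : ℂ), x.1 * (Real.exp (-x.2 / 2) : ℂ)], ![0, (Real.exp (-x.2 / 2) : ℂ)]]

lemma exp_half_mul (τ : ℝ) : (Real.exp (τ / 2) : ℂ) * (Real.exp (-τ / 2) : ℂ) = 1 := by
  rw [← Complex.ofReal_mul, ← Real.exp_add]; ring_nf; simp

lemma det_borel (x : ℂ × ℝ) : (Matrix.of (borel x)).det = 1 := by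
  rw [Matrix.det_fin_two]
  simp only [borel, Matrix.of_apply, Matrix.cons_val', Matrix.cons_val_zero, Matrix.cons_val_one,
    Matrix.cons_val_fin_one]
  rw [exp_half_mul]; ring

/-- The entries of the product of `borel x` and a matrix of `SU(2)`. -/
def iwasawa (x : ℂ × ℝ) (p q : ℂ) : Entries := rightMul !![p, q; -conj q, conj p] (borel x)

lemma of_iwasawa (x : ℂ × ℝ) (p q : ℂ) :
    Matrix.of (iwasawa x p q) = !![(Real.exp (x.2 / 2) : ℂ) * p - x.1 * Real.exp (-x.2 / 2) * conj q,
      (Real.exp (x.2 / 2) : ℂ) * q + x.1 * Real.exp (-x.2 / 2) * conj p;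
      -(Real.exp (-x.2 / 2) * conj q), Real.exp (-x.2 / 2) * conj p] := by
  ext i j
  fin_cases i <;> fin_cases j <;>
    (simp [iwasawa, rightMul_apply, borel, -Complex.ofReal_exp]; try ring)

lemma iwasawa_one (x : ℂ × ℝ) : iwasawa x 1 0 = borel x := by
  ext i j
  fin_cases i <;> fin_cases j <;> simp [iwasawa, rightMul_apply]

variable {D k : ℕ} {F : ℂ × ℝ → MvPolynomial (Fin 2) ℂ}

/-- For `g` equal to `borel x` times an element of `SU(2)`, the inverse multiplier at `(0, 1)` is
the element of `SU(2)` times the scalar `e^{τ/2}`. By homogeneity the scalar contributes its power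
`2k + 2`, that is `e^{(k+1)τ}`. -/
lemma lift_iwasawa {k n : ℕ} (hn : n ≤ 2 * k + 2) (F : ℂ × ℝ → MvPolynomial (Fin 2) ℂ)
    (x : ℂ × ℝ) {p q : ℂ} (h : p * conj p + q * conj q = 1) :
    lift k n F (Matrix.of (iwasawa x p q)) = (Real.exp ((k + 1) * x.2) : ℂ) *
      coef k n (subst !![p, q; -conj q, conj p] (F (x.1, Real.exp x.2))) := by
  have hr : (Real.exp (x.2 / 2) : ℂ) * (Real.exp (-x.2 / 2) : ℂ) = 1 := exp_half_mul x.2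
  have hrr : Real.exp (x.2 / 2) * Real.exp (-x.2 / 2) = 1 := by exact_mod_cast hr
  have hN : (Real.exp ((k + 1) * x.2) : ℂ) = (Real.exp (x.2 / 2) : ℂ) ^ (2 * k + 2 - n) *
      (Real.exp (x.2 / 2) : ℂ) ^ n := by
    rw [← pow_add, Nat.sub_add_cancel hn, ← Complex.ofReal_pow, ← Real.exp_nat_mul]
    congr 2
    push_cast
    ring
  have ht : Real.exp x.2 = Real.exp (x.2 / 2) ^ 2 := by
    rw [← Real.exp_nat_mul]; ring_nf
  have hc1 : conj ((Real.exp (-x.2 / 2) : ℝ) : ℂ) = (Real.exp (-x.2 / 2) : ℝ) :=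
    Complex.conj_ofReal _
  rw [hN, ht, of_iwasawa]
  set r := Real.exp (x.2 / 2)
  set r' := Real.exp (-x.2 / 2)
  set g : Matrix (Fin 2) (Fin 2) ℂ := !![(r : ℂ) * p - x.1 * r' * conj q,
    (r : ℂ) * q + x.1 * r' * conj p; -(r' * conj q), r' * conj p] with hg
  have hdet : g.det = 1 := by
    rw [hg, Matrix.det_fin_two_of]
    linear_combination (p * conj p + q * conj q) * hr + h
  have hden : ‖-(r' * conj q) * 0 + r' * conj p‖ ^ 2 + ‖-(r' * conj q)‖ ^ 2 * (1 : ℝ) ^ 2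
      = r' ^ 2 := by
    have : (((‖-(r' * conj q) * 0 + r' * conj p‖ ^ 2 + ‖-(r' * conj q)‖ ^ 2 * (1 : ℝ) ^ 2 : ℝ))
        : ℂ) = (r' : ℂ) ^ 2 := by
      push_cast
      rw [← Complex.mul_conj', ← Complex.mul_conj']
      simp only [mul_zero, zero_add, map_mul, map_neg, Complex.conj_conj, hc1]
      linear_combination (r' : ℂ) ^ 2 * h
    exact_mod_cast this
  have hr0 : (r' : ℂ) ≠ 0 := right_ne_zero_of_mul_eq_one hr
  have hact : act g (0, 1) = (x.1, r ^ 2) := by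
    ext1
    · simp only [act, hg, Matrix.of_apply, Matrix.cons_val', Matrix.cons_val_zero,
        Matrix.cons_val_one, Matrix.cons_val_fin_one]
      rw [hden]
      simp only [mul_zero, zero_add, map_mul, map_neg, Complex.conj_conj, hc1]
      push_cast
      rw [div_eq_iff (pow_ne_zero 2 hr0)]
      linear_combination x.1 * (r' : ℂ) ^ 2 * h
    · simp only [act, hdet]
      simp only [hg, Matrix.of_apply, Matrix.cons_val',
        Matrix.cons_val_one, Matrix.cons_val_fin_one, Matrix.cons_val_zero]
      rw [hden, norm_one, one_mul, div_eq_iff (by positivity)]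
      linear_combination (-1 - r * r') * hrr
  have hJ : (multiplier g (0, 1))⁻¹ = !![p, q; -conj q, conj p] * !![(r : ℂ), 0; 0, (r : ℂ)] := by
    refine Matrix.inv_eq_right_inv ?_
    ext i j
    fin_cases i <;> fin_cases j <;>
      simp [multiplier, hg, Matrix.mul_apply, Fin.sum_univ_two]
    · linear_combination (p * conj p + q * conj q) * hr + h
    · ring
    · ring
    · linear_combination (p * conj p + q * conj q) * hr + h
  rw [lift, slash_of_det_one hdet, hact, hJ, ← subst_subst, coef_subst_diag]

/-- The coefficients of a form in the coordinates `(z, τ)`, with `t = e^τ`. -/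
def expCoef (k n : ℕ) (F : ℂ × ℝ → MvPolynomial (Fin 2) ℂ) (x : ℂ × ℝ) : ℂ :=
  (Real.exp ((k + 1) * x.2) : ℂ) * ncoef k n (F (x.1, Real.exp x.2))

/-- Derivative in a direction. -/
def dirDeriv (v : ℂ × ℝ) (f : ℂ × ℝ → ℂ) (x : ℂ × ℝ) : ℂ := fderiv ℝ f x v

variable {f : Matrix (Fin 2) (Fin 2) ℂ → ℂ}

lemma contDiff_borel : ContDiff ℝ ∞ borel := by
  have h1 : ContDiff ℝ ∞ (fun x : ℂ × ℝ => (Real.exp (x.2 / 2) : ℂ)) :=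
    Complex.ofRealCLM.contDiff.comp (Real.contDiff_exp.comp (contDiff_snd.div_const 2))
  have h2 : ContDiff ℝ ∞ (fun x : ℂ × ℝ => (Real.exp (-x.2 / 2) : ℂ)) :=
    Complex.ofRealCLM.contDiff.comp (Real.contDiff_exp.comp (contDiff_snd.neg.div_const 2))
  refine contDiff_pi.2 fun i => contDiff_pi.2 fun j => ?_
  fin_cases i <;> fin_cases j
  · exact h1
  · exact contDiff_fst.mul h2
  · exact contDiff_const
  · exact h2

lemma contDiff_comp_borel (hf : SmoothNearSL f) :
    ContDiff ℝ ∞ (fun x => f (Matrix.of (borel x))) := by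
  rw [← contDiffOn_univ]
  exact ContDiffOn.comp (g := fun e : Entries => f (Matrix.of e)) hf contDiff_borel.contDiffOn
    fun x _ => mem_nearSL (det_borel x)

/-- A function of a one-parameter line. -/
lemma hasDerivAt_line {h : ℂ × ℝ → ℂ} (hh : ContDiff ℝ ∞ h) (x v : ℂ × ℝ) :
    HasDerivAt (fun s : ℝ => h (x + s • v)) (dirDeriv v h x) 0 := by
  have h1 : HasFDerivAt h (fderiv ℝ h x) (x + (0 : ℝ) • v) := by
    simpa using (hh.differentiable (by simp) x).hasFDerivAt
  have h2 : HasDerivAt (fun s : ℝ => x + s • v) v 0 := by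
    simpa using ((hasDerivAt_id (0 : ℝ)).smul_const v).const_add x
  exact h1.comp_hasDerivAt (0 : ℝ) h2

lemma lieDeriv_borel (hf : SmoothNearSL f) (x v : ℂ × ℝ) (A : Matrix (Fin 2) (Fin 2) ℂ)
    (hA : HasDerivAt (fun s : ℝ => borel (x + s • v)) (rightMul A (borel x)) 0) :
    lieDeriv A f (Matrix.of (borel x)) = dirDeriv v (fun x => f (Matrix.of (borel x))) x := by
  have hg := mem_nearSL (det_borel x)
  rw [lieDeriv_eq hf hg]
  exact lieDeriv_eq_of_curve hf hg hA (by simp) (hasDerivAt_line (contDiff_comp_borel hf) x v)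

/-- The exponential of `sH` multiplies the diagonal entry `e^{τ/2}` by `e^s`, so `τ` moves with
speed two and `z` stays fixed. -/
lemma lieDeriv_H_borel (hf : SmoothNearSL f) (x : ℂ × ℝ) :
    lieDeriv !![1, 0; 0, -1] f (Matrix.of (borel x)) =
      2 * dirDeriv (0, 1) (fun x => f (Matrix.of (borel x))) x := by
  rw [lieDeriv_borel hf x (0, 2)]
  · have : ((0, 2) : ℂ × ℝ) = (2 : ℝ) • (0, 1) := by ext <;> simp
    rw [this, dirDeriv, map_smul]; simp [dirDeriv]
  · have h1 : HasDerivAt (fun s : ℝ => ((Real.exp ((x.2 + s * 2) / 2) : ℝ) : ℂ))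
        (Real.exp (x.2 / 2) : ℝ) 0 := by
      have : HasDerivAt (fun s : ℝ => Real.exp ((x.2 + s * 2) / 2)) (Real.exp (x.2 / 2)) 0 := by
        have := ((((hasDerivAt_id (0 : ℝ)).mul_const 2).const_add x.2).div_const 2).exp
        simpa using this
      exact this.ofReal_comp
    have h2 : HasDerivAt (fun s : ℝ => ((Real.exp (-(x.2 + s * 2) / 2) : ℝ) : ℂ))
        (-(Real.exp (-x.2 / 2) : ℝ) : ℂ) 0 := by
      have : HasDerivAt (fun s : ℝ => Real.exp (-(x.2 + s * 2) / 2)) (-Real.exp (-x.2 / 2)) 0 := by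
        have := ((((hasDerivAt_id (0 : ℝ)).mul_const 2).const_add x.2).neg.div_const 2).exp
        simpa using this
      simpa using this.ofReal_comp
    refine hasDerivAt_pi.2 fun i => hasDerivAt_pi.2 fun j => ?_
    fin_cases i <;> fin_cases j
    · simpa [borel, rightMul_apply, -Complex.ofReal_exp] using h1
    · simpa [borel, rightMul_apply, -Complex.ofReal_exp] using h2.const_mul x.1
    · simpa [borel, rightMul_apply, -Complex.ofReal_exp] using hasDerivAt_const (0 : ℝ) (0 : ℂ)
    · simpa [borel, rightMul_apply, -Complex.ofReal_exp] using h2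

/-- Conjugating the unipotent matrix past the diagonal part moves `z` by `e^τ s u`. -/
lemma lieDeriv_E_borel (hf : SmoothNearSL f) (x : ℂ × ℝ) (u : ℂ) :
    lieDeriv (u • !![0, 1; 0, 0]) f (Matrix.of (borel x)) =
      Real.exp x.2 * dirDeriv (u, 0) (fun x => f (Matrix.of (borel x))) x := by
  rw [lieDeriv_borel hf x (Real.exp x.2 * u, 0)]
  · have : ((Real.exp x.2 * u, 0) : ℂ × ℝ) = Real.exp x.2 • (u, 0) := by ext <;> simp
    rw [this, dirDeriv, map_smul]; simp [dirDeriv]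
  · have e : (Real.exp x.2 : ℂ) * (Real.exp (-x.2 / 2) : ℂ) = Real.exp (x.2 / 2) := by
      rw [← Complex.ofReal_mul, ← Real.exp_add]; ring_nf
    have h1 : HasDerivAt (fun s : ℝ => (x.1 + s * (Real.exp x.2 * u)) *
        (Real.exp (-x.2 / 2) : ℂ)) (Real.exp (x.2 / 2) * u) 0 := by
      have := (((hasDerivAt_id (0 : ℝ)).ofReal_comp.mul_const
        (Real.exp x.2 * u : ℂ)).const_add x.1).mul_const (Real.exp (-x.2 / 2) : ℂ)
      refine this.congr_deriv ?_
      rw [← e]; simp; ring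
    refine hasDerivAt_pi.2 fun i => hasDerivAt_pi.2 fun j => ?_
    fin_cases i <;> fin_cases j
    · simpa [borel, rightMul_apply, -Complex.ofReal_exp] using hasDerivAt_const (0 : ℝ) _
    · simpa [borel, rightMul_apply, -Complex.ofReal_exp] using h1
    · simpa [borel, rightMul_apply, -Complex.ofReal_exp] using hasDerivAt_const (0 : ℝ) (0 : ℂ)
    · simpa [borel, rightMul_apply, -Complex.ofReal_exp] using hasDerivAt_const (0 : ℝ) _

/-- The derivative along a curve in `SU(2)`. -/
lemma lieDeriv_compact (hF : IsCuspForm D k F) {n : ℕ} (hn : n ≤ 2 * k + 2) (x : ℂ × ℝ)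
    {p q : ℝ → ℂ} {p' q' : ℂ} (hp : HasDerivAt p p' 0) (hq : HasDerivAt q q' 0) (p0 : p 0 = 1)
    (q0 : q 0 = 0) (hpq : ∀ s, p s * conj (p s) + q s * conj (q s) = 1) :
    lieDeriv !![p', q'; -conj q', conj p'] (lift k n F) (Matrix.of (borel x)) =
      ((2 * k + 2).choose n : ℂ) * ((2 * k + 2 - n : ℂ) *
        (p' * expCoef k n F x - conj q' * expCoef k (n + 1) F x) +
        n * (q' * expCoef k (n - 1) F x + conj p' * expCoef k n F x)) := by
  have hg := mem_nearSL (det_borel x)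
  have hf := smoothNearSL_lift hF hn
  have hp2 : HasDerivAt (fun s => conj (p s)) (conj p') 0 :=
    Complex.conjCLE.toContinuousLinearMap.hasFDerivAt.comp_hasDerivAt (0 : ℝ) hp
  have hq2 : HasDerivAt (fun s => -conj (q s)) (-conj q') 0 :=
    (Complex.conjCLE.toContinuousLinearMap.hasFDerivAt.comp_hasDerivAt (0 : ℝ) hq).neg
  have hx : (x.1, Real.exp x.2) ∈ H3 := Real.exp_pos x.2
  rw [lieDeriv_eq hf hg]
  refine lieDeriv_eq_of_curve hf hg (c := fun s => iwasawa x (p s) (q s)) ?_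
    (by simp only [p0, q0, iwasawa_one]) ?_
  · refine hasDerivAt_pi.2 fun i => hasDerivAt_pi.2 fun j => ?_
    simp only [iwasawa, rightMul_apply]
    refine HasDerivAt.add (HasDerivAt.const_mul _ ?_) (HasDerivAt.const_mul _ ?_)
    · fin_cases j
      · exact hp
      · exact hq
    · fin_cases j
      · exact hq2
      · exact hp2
  · have e : (fun s => lift k n F (Matrix.of (iwasawa x (p s) (q s)))) = fun s =>
        (Real.exp ((k + 1) * x.2) : ℂ) * (((2 * k + 2).choose n : ℂ) *
          ncoef k n (subst !![p s, q s; -conj (q s), conj (p s)] (F (x.1, Real.exp x.2)))) := by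
      funext s
      rw [lift_iwasawa hn F x (hpq s), coef_eq_ncoef hn]
    simp only [e]
    have := ((hasDerivAt_ncoef_subst hn (hF.homogeneous _ hx) hp hq hq2 hp2 p0 q0 (by simp [q0])
      (by simp [p0])).const_mul ((2 * k + 2).choose n : ℂ)).const_mul
      (Real.exp ((k + 1) * x.2) : ℂ)
    refine this.congr_deriv ?_
    simp only [expCoef]
    ring

lemma lift_borel {n : ℕ} (hn : n ≤ 2 * k + 2) (x : ℂ × ℝ) :
    lift k n F (Matrix.of (borel x)) = ((2 * k + 2).choose n : ℂ) * expCoef k n F x := by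
  have h1 : (!![1, 0; -conj 0, conj 1] : Matrix (Fin 2) (Fin 2) ℂ) = 1 := by
    ext i j; fin_cases i <;> fin_cases j <;> simp
  rw [← iwasawa_one, lift_iwasawa hn F x (by simp), h1, subst_one, coef_eq_ncoef hn, expCoef]
  ring

/-- There is no restriction on `n`: beyond `2k + 2` the function is zero, as `ncoef` divides by a
vanishing binomial coefficient. So the index `n + 1` in the Casimir equations needs no special case.
-/
lemma contDiff_expCoef (hF : IsCuspForm D k F) (n : ℕ) : ContDiff ℝ ∞ (expCoef k n F) := by
  by_cases hn : n ≤ 2 * k + 2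
  · have h := (contDiff_comp_borel (smoothNearSL_lift hF hn)).div_const ((2 * k + 2).choose n : ℂ)
    have e : expCoef k n F = fun x => lift k n F (Matrix.of (borel x)) /
        ((2 * k + 2).choose n : ℂ) := by
      funext x
      have := choose_cast_ne_zero hn
      rw [lift_borel hn]; field_simp
    rwa [e]
  · have e : expCoef k n F = fun _ => 0 := by
      funext x
      rw [expCoef, ncoef, Nat.choose_eq_zero_of_lt (by omega)]
      simp
    rw [e]
    exact contDiff_const

lemma contDiff_dirDeriv {h : ℂ × ℝ → ℂ} (hh : ContDiff ℝ ∞ h) (v : ℂ × ℝ) :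
    ContDiff ℝ ∞ (dirDeriv v h) :=
  (hh.fderiv_right (by simp)).clm_apply contDiff_const

lemma dirDeriv_eq_of_hasDerivAt {h : ℂ × ℝ → ℂ} (hh : ContDiff ℝ ∞ h) {x v : ℂ × ℝ} {d : ℂ}
    (hd : HasDerivAt (fun s : ℝ => h (x + s • v)) d 0) : dirDeriv v h x = d :=
  (hasDerivAt_line hh x v).unique hd

lemma dirDeriv_const_mul {h : ℂ × ℝ → ℂ} (hh : ContDiff ℝ ∞ h) (v : ℂ × ℝ) (c : ℂ) (x : ℂ × ℝ) :
    dirDeriv v (fun x => c * h x) x = c * dirDeriv v h x :=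
  dirDeriv_eq_of_hasDerivAt (contDiff_const.mul hh) ((hasDerivAt_line hh x v).const_mul c)

lemma dirDeriv_add {h₁ h₂ : ℂ × ℝ → ℂ} (hh₁ : ContDiff ℝ ∞ h₁) (hh₂ : ContDiff ℝ ∞ h₂)
    (v x : ℂ × ℝ) : dirDeriv v (fun x => h₁ x + h₂ x) x = dirDeriv v h₁ x + dirDeriv v h₂ x :=
  dirDeriv_eq_of_hasDerivAt (hh₁.add hh₂) ((hasDerivAt_line hh₁ x v).add (hasDerivAt_line hh₂ x v))

lemma contDiff_exp_snd : ContDiff ℝ ∞ (fun x : ℂ × ℝ => (Real.exp x.2 : ℂ)) :=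
  Complex.ofRealCLM.contDiff.comp (Real.contDiff_exp.comp contDiff_snd)

lemma dirDeriv_exp_mul {h : ℂ × ℝ → ℂ} (hh : ContDiff ℝ ∞ h) (u : ℂ) (x : ℂ × ℝ) :
    dirDeriv (u, 0) (fun x => (Real.exp x.2 : ℂ) * h x) x =
      (Real.exp x.2 : ℂ) * dirDeriv (u, 0) h x := by
  refine dirDeriv_eq_of_hasDerivAt (contDiff_exp_snd.mul hh) ?_
  simpa using (hasDerivAt_line hh x (u, 0)).const_mul (Real.exp x.2 : ℂ)

lemma rotation_unit (s : ℝ) : Complex.exp (s * Complex.I) * conj (Complex.exp (s * Complex.I)) +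
    0 * conj 0 = 1 := by
  rw [Complex.mul_conj', Complex.norm_exp_ofReal_mul_I]; simp

lemma hasDerivAt_rotation : HasDerivAt (fun s : ℝ => Complex.exp (s * Complex.I)) Complex.I 0 ∧
    HasDerivAt (fun s : ℝ => conj (Complex.exp (s * Complex.I))) (-Complex.I) 0 := by
  have h1 : HasDerivAt (fun s : ℝ => Complex.exp (s * Complex.I)) Complex.I 0 := by
    have := ((hasDerivAt_id (0 : ℝ)).ofReal_comp.mul_const Complex.I).cexp
    simpa using this
  refine ⟨h1, ?_⟩
  have := Complex.conjCLE.toContinuousLinearMap.hasFDerivAt.comp_hasDerivAt (0 : ℝ) h1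
  exact this.congr_deriv (by simp)

lemma hasDerivAt_torus (x : ℂ × ℝ) (p : ℂ) :
    HasDerivAt (fun s : ℝ => iwasawa x (p * Complex.exp (s * Complex.I)) 0)
      (rightMul (Complex.I • !![1, 0; 0, -1]) (iwasawa x p 0)) 0 := by
  obtain ⟨h1, h2⟩ := hasDerivAt_rotation
  refine hasDerivAt_pi.2 fun i => hasDerivAt_pi.2 fun j => ?_
  simp only [iwasawa, rightMul_apply]
  fin_cases i <;> fin_cases j
  all_goals simp only [Matrix.of_apply, Matrix.cons_val', Matrix.cons_val_zero,
    Matrix.cons_val_one, Matrix.cons_val_fin_one, Matrix.smul_apply, smul_eq_mul, Fin.zero_eta,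
    Fin.mk_one, map_zero, neg_zero, mul_zero, add_zero, zero_add, map_mul, mul_one, mul_neg]
  · exact ((h1.const_mul p).const_mul _).congr_deriv (by ring)
  · exact ((h2.const_mul _).const_mul _).congr_deriv (by ring)
  · exact ((h1.const_mul p).const_mul _).congr_deriv (by ring)
  · exact ((h2.const_mul _).const_mul _).congr_deriv (by ring)

lemma mul_rotation_unit {p : ℂ} (hp : p * conj p = 1) (s : ℝ) :
    (p * Complex.exp (s * Complex.I)) * conj (p * Complex.exp (s * Complex.I)) +
      0 * conj 0 = 1 := by
  rw [map_mul]
  linear_combination rotation_unit s + Complex.exp (s * Complex.I) *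
    conj (Complex.exp (s * Complex.I)) * hp

/-- The matrix `diag(p, p̄)` multiplies the coefficient of `X^{2k+2-n} Y^n` by `p^{2k+2-n} p̄^n`, a
character of weight `2k + 2 - 2n` of the circle. -/
lemma hasDerivAt_lift_torus {n : ℕ} (hn : n ≤ 2 * k + 2) (x : ℂ × ℝ) {p : ℂ}
    (hp : p * conj p = 1) : HasDerivAt
      (fun s : ℝ => lift k n F (Matrix.of (iwasawa x (p * Complex.exp (s * Complex.I)) 0)))
      (Complex.I * (2 * k + 2 - 2 * n) * lift k n F (Matrix.of (iwasawa x p 0))) 0 := by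
  obtain ⟨h1, h2⟩ := hasDerivAt_rotation
  have hd : ∀ q : ℂ, (!![q, 0; -conj 0, conj q] : Matrix (Fin 2) (Fin 2) ℂ) =
      !![q, 0; 0, conj q] := fun q => by simp
  have e : ∀ q : ℂ, q * conj q + 0 * conj 0 = 1 → lift k n F (Matrix.of (iwasawa x q 0)) =
      (Real.exp ((k + 1) * x.2) : ℂ) * (q ^ (2 * k + 2 - n) * conj q ^ n *
        coef k n (F (x.1, Real.exp x.2))) := fun q hq => by
    rw [lift_iwasawa hn F x hq, hd, coef_subst_diag]
  simp only [e _ (mul_rotation_unit hp _)]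
  rw [e p (by simpa using hp)]
  have := (((((h1.const_mul p).pow (2 * k + 2 - n)).mul ((h2.const_mul (conj p)).pow n)).mul_const
    (coef k n (F (x.1, Real.exp x.2)))).const_mul (Real.exp ((k + 1) * x.2) : ℂ))
  simp only [map_mul]
  refine this.congr_deriv ?_
  have e1 : ∀ (m : ℕ) (a c : ℂ), (m : ℂ) * a ^ (m - 1) * (a * c) = m * a ^ m * c := by
    intro m a c
    rcases m with _ | m
    · simp
    · simp [pow_succ]; ring
  simp only [Pi.pow_apply, Complex.ofReal_zero, zero_mul, Complex.exp_zero, mul_one, map_one]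
  rw [e1, e1, Nat.cast_sub hn]
  push_cast
  ring

lemma iwasawa_torus_mem {p : ℂ} (hp : p * conj p = 1) (x : ℂ × ℝ) : iwasawa x p 0 ∈ nearSL := by
  refine mem_nearSL ?_
  rw [of_iwasawa, Matrix.det_fin_two_of]
  simp only [map_zero]
  linear_combination p * conj p * exp_half_mul x.2 + hp

/-- The action of the Lie algebra of the diagonal torus of `SU(2)`. -/
lemma lieDeriv_torus (hF : IsCuspForm D k F) {n : ℕ} (hn : n ≤ 2 * k + 2) (x : ℂ × ℝ) {p : ℂ}
    (hp : p * conj p = 1) :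
    lieDeriv (Complex.I • !![1, 0; 0, -1]) (lift k n F) (Matrix.of (iwasawa x p 0)) =
      Complex.I * (2 * k + 2 - 2 * n) * lift k n F (Matrix.of (iwasawa x p 0)) := by
  have hf := smoothNearSL_lift hF hn
  have hg := iwasawa_torus_mem hp x
  rw [lieDeriv_eq hf hg]
  exact lieDeriv_eq_of_curve hf hg (hasDerivAt_torus x p) (by simp) (hasDerivAt_lift_torus hn x hp)

/-- The first derivative is differentiated again along the torus orbit of `borel x`. This is why
`lieDeriv_torus` holds at all points `iwasawa x p 0` with `|p| = 1` and not only at `p = 1`. -/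
lemma lieDeriv_lieDeriv_torus (hF : IsCuspForm D k F) {n : ℕ} (hn : n ≤ 2 * k + 2) (x : ℂ × ℝ) :
    lieDeriv (Complex.I • !![1, 0; 0, -1]) (lieDeriv (Complex.I • !![1, 0; 0, -1]) (lift k n F))
      (Matrix.of (borel x)) = -(2 * k + 2 - 2 * n) ^ 2 * lift k n F (Matrix.of (borel x)) := by
  have hf := (smoothNearSL_lift hF hn).lieDeriv (Complex.I • !![1, 0; 0, -1])
  have hg := iwasawa_torus_mem (p := 1) (by simp) x
  rw [← iwasawa_one, lieDeriv_eq hf hg]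
  refine lieDeriv_eq_of_curve hf hg (hasDerivAt_torus x 1) (by simp) ?_
  have e : ∀ s : ℝ, lieDeriv (Complex.I • !![1, 0; 0, -1]) (lift k n F)
      (Matrix.of (iwasawa x (1 * Complex.exp (s * Complex.I)) 0)) =
      Complex.I * (2 * k + 2 - 2 * n) *
        lift k n F (Matrix.of (iwasawa x (1 * Complex.exp (s * Complex.I)) 0)) := fun s =>
    lieDeriv_torus hF hn x (by simpa using mul_rotation_unit (p := 1) (by simp) s)
  simp only [e]
  refine ((hasDerivAt_lift_torus hn x (p := 1) (by simp)).const_mul _).congr_deriv ?_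
  linear_combination (2 * k + 2 - 2 * n : ℂ) ^ 2 * lift k n F (Matrix.of (iwasawa x 1 0)) *
    Complex.I_sq

lemma dirDeriv_comm {h : ℂ × ℝ → ℂ} (hh : ContDiff ℝ ∞ h) (u v x : ℂ × ℝ) :
    dirDeriv u (dirDeriv v h) x = dirDeriv v (dirDeriv u h) x := by
  have hd : DifferentiableAt ℝ (fderiv ℝ h) x :=
    (hh.fderiv_right (m := ∞) (by simp)).differentiable (by simp) x
  have e : ∀ u v, dirDeriv u (dirDeriv v h) x = fderiv ℝ (fderiv ℝ h) x u v := fun u v => by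
    have : HasFDerivAt (fun y => fderiv ℝ h y v) _ x :=
      hd.hasFDerivAt.clm_apply (hasFDerivAt_const v x)
    change fderiv ℝ (fun y => fderiv ℝ h y v) x u = _
    rw [this.fderiv]
    simp
  rw [e, e]
  exact hh.contDiffAt.isSymmSndFDerivAt (by
    simp only [minSmoothness_of_isRCLikeNormedField]; exact WithTop.coe_le_coe.2 le_top) u v

/-- The Casimir equations in the coordinates `(z, τ)`, with `t = e^τ`. -/
lemma IsCuspForm.casimir_coordinates (hF : IsCuspForm D k F) {n : ℕ} (hn : n ≤ 2 * k + 2) (x : ℂ × ℝ) :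
    (2 * k + 2 - 2 * n : ℂ) * (dirDeriv (0, 1) (expCoef k n F) x - expCoef k n F x) +
      Real.exp x.2 * ((2 * k + 2 - n : ℂ) * (dirDeriv (1, 0) (expCoef k (n + 1) F) x -
        Complex.I * dirDeriv (Complex.I, 0) (expCoef k (n + 1) F) x) +
      n * (dirDeriv (1, 0) (expCoef k (n - 1) F) x +
        Complex.I * dirDeriv (Complex.I, 0) (expCoef k (n - 1) F) x)) = 0 ∧
    dirDeriv (0, 1) (dirDeriv (0, 1) (expCoef k n F)) x - 2 * dirDeriv (0, 1) (expCoef k n F) x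
      + (k + 1 - n) ^ 2 * expCoef k n F x + Real.exp x.2 ^ 2 *
        (dirDeriv (1, 0) (dirDeriv (1, 0) (expCoef k n F)) x +
          dirDeriv (Complex.I, 0) (dirDeriv (Complex.I, 0) (expCoef k n F)) x) +
      Real.exp x.2 * ((2 * k + 2 - n : ℂ) * (dirDeriv (1, 0) (expCoef k (n + 1) F) x -
        Complex.I * dirDeriv (Complex.I, 0) (expCoef k (n + 1) F) x) -
      n * (dirDeriv (1, 0) (expCoef k (n - 1) F) x +
        Complex.I * dirDeriv (Complex.I, 0) (expCoef k (n - 1) F) x)) =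
      (k ^ 2 + 2 * k) * expCoef k n F x := by
  have hf := smoothNearSL_lift hF hn
  have hg := mem_nearSL (det_borel x)
  obtain ⟨hS, hT⟩ := casimir_equations hf hg (hF.casimir_one n hn _ (det_borel x))
    (hF.casimir_two n hn _ (det_borel x))
  set b : ℂ := ((2 * k + 2).choose n : ℂ) with hb
  have hb0 : b ≠ 0 := choose_cast_ne_zero hn
  set Q := expCoef k n F
  set A := expCoef k (n + 1) F
  set B := expCoef k (n - 1) F
  have sQ : ContDiff ℝ ∞ Q := contDiff_expCoef hF n
  have sA : ContDiff ℝ ∞ A := contDiff_expCoef hF (n + 1)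
  have sB : ContDiff ℝ ∞ B := contDiff_expCoef hF (n - 1)
  have hfb : (fun x => lift k n F (Matrix.of (borel x))) = fun x => b * Q x :=
    funext fun x => lift_borel hn x
  have fH : ∀ y, lieDeriv !![1, 0; 0, -1] (lift k n F) (Matrix.of (borel y)) =
      (2 * b) * dirDeriv (0, 1) Q y := fun y => by
    rw [lieDeriv_H_borel hf, hfb, dirDeriv_const_mul sQ, mul_assoc]
  have fE : ∀ (u : ℂ) y, lieDeriv (u • !![0, 1; 0, 0]) (lift k n F) (Matrix.of (borel y)) =
      Real.exp y.2 * (b * dirDeriv (u, 0) Q y) := fun u y => by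
    rw [lieDeriv_E_borel hf, hfb, dirDeriv_const_mul sQ]
  have fT : ∀ y, lieDeriv (Complex.I • !![1, 0; 0, -1]) (lift k n F) (Matrix.of (borel y)) =
      (Complex.I * (2 * k + 2 - 2 * n) * b) * Q y := fun y => by
    rw [← iwasawa_one, lieDeriv_torus hF hn y (by simp), iwasawa_one, lift_borel hn]
    simp only [b, Q]
    ring
  have fTT : lieDeriv (Complex.I • !![1, 0; 0, -1]) (lieDeriv (Complex.I • !![1, 0; 0, -1])
      (lift k n F)) (Matrix.of (borel x)) = -(2 * k + 2 - 2 * n) ^ 2 * (b * Q x) := by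
    rw [lieDeriv_lieDeriv_torus hF hn, lift_borel hn]
  have fW : ∀ y, lieDeriv !![0, 0; 1, 0] (lift k n F) (Matrix.of (borel y)) =
      Real.exp y.2 * (b * dirDeriv (1, 0) Q y) + ((2 * k + 2 - n) * b * A y + (-n * b) * B y) := by
    intro y
    have h1 : HasDerivAt (fun s : ℝ => (Real.cos s : ℂ)) 0 0 := by
      have := (Real.hasDerivAt_cos 0).ofReal_comp
      simpa using this
    have h2 : HasDerivAt (fun s : ℝ => -(Real.sin s : ℂ)) (-1) 0 := by
      exact (Real.hasDerivAt_sin 0).ofReal_comp.neg.congr_deriv (by simp)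
    have h3 := lieDeriv_compact hF hn y h1 h2 (by simp) (by simp) (fun s => by
      simp only [map_neg, Complex.conj_ofReal]
      have := Real.sin_sq_add_cos_sq s
      have : ((Real.sin s ^ 2 + Real.cos s ^ 2 : ℝ) : ℂ) = 1 := by rw [this]; simp
      push_cast at this ⊢
      linear_combination this)
    -- Decomposition `E' = E + (E' - E)`: the first summand moves `z`, while the second lies in the
    -- Lie algebra of `SU(2)`, is tangent to the rotations, and only mixes the coefficients.
    have e : (!![0, 0; 1, 0] : Matrix (Fin 2) (Fin 2) ℂ) = (1 : ℂ) • !![0, 1; 0, 0] +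
        !![0, -1; -conj (-1), conj 0] := by
      ext i j; fin_cases i <;> fin_cases j <;> simp
    rw [e, lieDeriv_matrix_add hf (mem_nearSL (det_borel y)), fE, h3]
    simp only [map_zero, map_neg, map_one]
    ring
  have fV : ∀ y, lieDeriv (Complex.I • !![0, 0; 1, 0]) (lift k n F) (Matrix.of (borel y)) =
      -1 * (Real.exp y.2 * (b * dirDeriv (Complex.I, 0) Q y)) +
        ((2 * k + 2 - n) * b * Complex.I * A y + (n * b * Complex.I) * B y) := by
    intro y
    have h1 : HasDerivAt (fun s : ℝ => (Real.cos s : ℂ)) 0 0 := by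
      have := (Real.hasDerivAt_cos 0).ofReal_comp
      simpa using this
    have h2 : HasDerivAt (fun s : ℝ => Complex.I * (Real.sin s : ℂ)) Complex.I 0 := by
      have := (Real.hasDerivAt_sin 0).ofReal_comp.const_mul Complex.I
      simpa using this
    have h3 := lieDeriv_compact hF hn y h1 h2 (by simp) (by simp) (fun s => by
      simp only [map_mul, Complex.conj_ofReal, Complex.conj_I]
      have := Real.sin_sq_add_cos_sq s
      have : ((Real.sin s ^ 2 + Real.cos s ^ 2 : ℝ) : ℂ) = 1 := by rw [this]; simp
      push_cast at this ⊢
      linear_combination this - Complex.sin s ^ 2 * Complex.I_sq)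
    -- Likewise `iE' = -iE + i(E + E')`, with `i(E + E')` in the Lie algebra of `SU(2)`.
    have e : (Complex.I • !![0, 0; 1, 0] : Matrix (Fin 2) (Fin 2) ℂ) =
        -(Complex.I • !![0, 1; 0, 0]) + !![0, Complex.I; -conj Complex.I, conj 0] := by
      ext i j; fin_cases i <;> fin_cases j <;> simp
    rw [e, lieDeriv_matrix_add hf (mem_nearSL (det_borel y)),
      lieDeriv_matrix_neg hf (mem_nearSL (det_borel y)), fE, h3]
    simp only [map_zero, Complex.conj_I]
    ring
  have sd : ∀ v, ContDiff ℝ ∞ (fun y => b * dirDeriv v Q y) := fun v =>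
    contDiff_const.mul (contDiff_dirDeriv sQ v)
  have fHH : lieDeriv !![1, 0; 0, -1] (lieDeriv !![1, 0; 0, -1] (lift k n F))
      (Matrix.of (borel x)) = 4 * b * dirDeriv (0, 1) (dirDeriv (0, 1) Q) x := by
    rw [lieDeriv_H_borel (hf.lieDeriv _), funext fH, dirDeriv_const_mul (contDiff_dirDeriv sQ _)]
    ring
  have fHT : lieDeriv !![1, 0; 0, -1] (lieDeriv (Complex.I • !![1, 0; 0, -1]) (lift k n F))
      (Matrix.of (borel x)) = 2 * (Complex.I * (2 * k + 2 - 2 * n) * b * dirDeriv (0, 1) Q x) := by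
    rw [lieDeriv_H_borel (hf.lieDeriv _), funext fT, dirDeriv_const_mul sQ]
  have fEW : ∀ u : ℂ, lieDeriv (u • !![0, 1; 0, 0]) (lieDeriv !![0, 0; 1, 0] (lift k n F))
      (Matrix.of (borel x)) = Real.exp x.2 * (Real.exp x.2 *
        (b * dirDeriv (u, 0) (dirDeriv (1, 0) Q) x) + ((2 * k + 2 - n) * b * dirDeriv (u, 0) A x +
        (-n * b) * dirDeriv (u, 0) B x)) := fun u => by
    rw [lieDeriv_E_borel (hf.lieDeriv _), funext fW, dirDeriv_add (contDiff_exp_snd.mul (sd _))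
      ((contDiff_const.mul sA).add (contDiff_const.mul sB)), dirDeriv_exp_mul (sd _),
      dirDeriv_const_mul (contDiff_dirDeriv sQ _),
      dirDeriv_add (contDiff_const.mul sA) (contDiff_const.mul sB), dirDeriv_const_mul sA,
      dirDeriv_const_mul sB]
  have fEV : ∀ u : ℂ, lieDeriv (u • !![0, 1; 0, 0]) (lieDeriv (Complex.I • !![0, 0; 1, 0])
      (lift k n F)) (Matrix.of (borel x)) = Real.exp x.2 * (-1 * (Real.exp x.2 *
        (b * dirDeriv (u, 0) (dirDeriv (Complex.I, 0) Q) x)) + ((2 * k + 2 - n) * b * Complex.I *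
        dirDeriv (u, 0) A x + (n * b * Complex.I) * dirDeriv (u, 0) B x)) := fun u => by
    rw [lieDeriv_E_borel (hf.lieDeriv _), funext fV,
      dirDeriv_add (contDiff_const.mul (contDiff_exp_snd.mul (sd _)))
      ((contDiff_const.mul sA).add (contDiff_const.mul sB)),
      dirDeriv_const_mul (contDiff_exp_snd.mul (sd _)), dirDeriv_exp_mul (sd _),
      dirDeriv_const_mul (contDiff_dirDeriv sQ _),
      dirDeriv_add (contDiff_const.mul sA) (contDiff_const.mul sB), dirDeriv_const_mul sA,
      dirDeriv_const_mul sB]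
  -- The difference of the Casimir operators contains the mixed derivatives of `Q` in both orders
  -- with opposite signs. They cancel, so the first equation is of order one.
  have hsymm := dirDeriv_comm sQ (1, 0) (Complex.I, 0) x
  have fEW1 := fEW 1
  have fEV1 := fEV 1
  rw [one_smul] at fEW1 fEV1
  rw [fHH, fTT, fEW1, fEV, fH, congrFun hfb x] at hS
  rw [fHT, fEV1, fEW, fT] at hT
  refine ⟨mul_left_cancel₀ (mul_ne_zero (two_ne_zero (α := ℂ))
    (mul_ne_zero Complex.I_ne_zero hb0)) ?_, mul_left_cancel₀ (mul_ne_zero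
    (by norm_num : (4 : ℂ) ≠ 0) hb0) ?_⟩
  · rw [hsymm] at hT
    linear_combination hT + 2 * b * Real.exp x.2 *
      (-(2 * k + 2 - n) * dirDeriv (Complex.I, 0) A x + n * dirDeriv (Complex.I, 0) B x) *
      Complex.I_sq
  · linear_combination hS

end

section

/-! ### Fourier coefficients of functions periodic under a lattice -/

open UnitAddTorus MeasureTheory

/-- Periodicity under the lattice `ℤ + ℤ w`. -/
def LatticePeriodic (w : ℂ) (f : ℂ → ℂ) : Prop := ∀ z, f (z + 1) = f z ∧ f (z + w) = f z

/-- The representative in `(0, 1]` of a point of the circle. -/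
def circleRep (p : UnitAddCircle) : ℝ := (AddCircle.equivIoc 1 0 p).1

/-- The function on the torus given by a function that is periodic under `ℤ + ℤ w`. -/
def torusLift (w : ℂ) (f : ℂ → ℂ) (p : UnitAddTorus (Fin 2)) : ℂ :=
  f (circleRep (p 0) + circleRep (p 1) * w)

/-- The Fourier coefficients for the lattice `ℤ + ℤ w`. -/
def latticeCoeff (w : ℂ) (m : Fin 2 → ℤ) (f : ℂ → ℂ) : ℂ := mFourierCoeff (torusLift w f) m

/-- The invariant probability measure on the torus. -/
def torusMeasure : Measure (UnitAddTorus (Fin 2)) := Measure.pi fun _ => AddCircle.haarAddCircle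

instance : IsProbabilityMeasure torusMeasure :=
  inferInstanceAs (IsProbabilityMeasure
    (Measure.pi fun _ : Fin 2 => (AddCircle.haarAddCircle : Measure UnitAddCircle)))

instance : Measure.IsAddHaarMeasure torusMeasure :=
  inferInstanceAs (Measure.IsAddHaarMeasure
    (Measure.pi fun _ : Fin 2 => (AddCircle.haarAddCircle : Measure UnitAddCircle)))

lemma latticeCoeff_eq (w : ℂ) (m : Fin 2 → ℤ) (f : ℂ → ℂ) :
    latticeCoeff w m f = ∫ t, mFourier (-m) t * torusLift w f t ∂torusMeasure := rfl

lemma circleRep_mem (p : UnitAddCircle) : circleRep p ∈ Set.Ioc (0 : ℝ) 1 := by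
  simpa [circleRep] using (AddCircle.equivIoc 1 0 p).2

lemma coe_circleRep (p : UnitAddCircle) : ((circleRep p : ℝ) : UnitAddCircle) = p :=
  (AddCircle.equivIoc 1 0).symm_apply_apply p

lemma exists_int_circleRep (x : ℝ) : ∃ l : ℤ, circleRep (x : UnitAddCircle) = x + l := by
  have h : ((circleRep (x : UnitAddCircle) - x : ℝ) : UnitAddCircle) = 0 := by
    rw [AddCircle.coe_sub, coe_circleRep, sub_self]
  obtain ⟨l, hl⟩ := AddCircle.coe_eq_zero_iff 1 |>.1 h
  exact ⟨l, by simp at hl; linarith⟩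

variable {w : ℂ} {f g : ℂ → ℂ}

lemma LatticePeriodic.add_int (hf : LatticePeriodic w f) (z : ℂ) (a b : ℤ) :
    f (z + (a + b * w)) = f z := by
  have h1 : Function.Periodic f 1 := fun z => (hf z).1
  have h2 : Function.Periodic f w := fun z => (hf z).2
  have := (h2.int_mul b).add_period (h1.int_mul a) z
  rw [mul_one] at this
  rw [← this]; ring_nf

lemma torusLift_coe (hf : LatticePeriodic w f) (x : Fin 2 → ℝ) :
    torusLift w f (fun i => (x i : UnitAddCircle)) = f (x 0 + x 1 * w) := by
  obtain ⟨a, ha⟩ := exists_int_circleRep (x 0)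
  obtain ⟨b, hb⟩ := exists_int_circleRep (x 1)
  rw [torusLift, ha, hb, ← hf.add_int (x 0 + x 1 * w) a b]
  push_cast
  ring_nf

lemma torusLift_add_coe (hf : LatticePeriodic w f) (p : UnitAddTorus (Fin 2)) (x : Fin 2 → ℝ) :
    torusLift w f (p + fun i => (x i : UnitAddCircle)) =
      torusLift w (fun z => f (z + (x 0 + x 1 * w))) p := by
  have : p + (fun i => (x i : UnitAddCircle)) =
      fun i => (((fun i => circleRep (p i) + x i) i : ℝ) : UnitAddCircle) := by
    ext i; simp [coe_circleRep]
  rw [this, torusLift_coe hf, torusLift]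
  push_cast
  ring_nf

/-- The representative in `(0, 1]` jumps, but the pullback to `ℝ²` under the quotient map is `f` in
lattice coordinates, and continuity descends. -/
lemma continuous_torusLift (hf : LatticePeriodic w f) (hc : Continuous f) :
    Continuous (torusLift w f) := by
  have hq : IsOpenQuotientMap (Pi.map (fun _ : Fin 2 => ((↑) : ℝ → UnitAddCircle))) :=
    IsOpenQuotientMap.piMap fun _ => QuotientAddGroup.isOpenQuotientMap_mk
  refine hq.isQuotientMap.continuous_iff.2 ?_
  have : torusLift w f ∘ Pi.map (fun _ : Fin 2 => ((↑) : ℝ → UnitAddCircle)) =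
      fun x => f (x 0 + x 1 * w) := by
    ext x; exact torusLift_coe hf x
  rw [this]
  fun_prop

lemma integrable_torusLift (hf : LatticePeriodic w f) (hc : Continuous f) (m : Fin 2 → ℤ) :
    Integrable (fun t => mFourier (-m) t * torusLift w f t) torusMeasure :=
  (((mFourier (-m)).continuous.mul (continuous_torusLift hf hc))).integrable_of_hasCompactSupport
    (HasCompactSupport.of_compactSpace _)

lemma latticeCoeff_add (hf : LatticePeriodic w f) (hc : Continuous f) (hg : LatticePeriodic w g)
    (hc' : Continuous g) (m : Fin 2 → ℤ) :
    latticeCoeff w m (fun z => f z + g z) = latticeCoeff w m f + latticeCoeff w m g := by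
  rw [latticeCoeff_eq, latticeCoeff_eq, latticeCoeff_eq,
    ← integral_add (integrable_torusLift hf hc m) (integrable_torusLift hg hc' m)]
  congr 1; ext t; simp only [torusLift]; ring

lemma latticeCoeff_const_mul (c : ℂ) (f : ℂ → ℂ) (m : Fin 2 → ℤ) :
    latticeCoeff w m (fun z => c * f z) = c * latticeCoeff w m f := by
  rw [latticeCoeff_eq, latticeCoeff_eq, ← integral_const_mul]
  congr 1; ext t; simp only [torusLift]; ring

lemma norm_latticeCoeff_le (m : Fin 2 → ℤ) {C : ℝ} (h : ∀ z, ‖f z‖ ≤ C) :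
    ‖latticeCoeff w m f‖ ≤ C := by
  rw [latticeCoeff_eq]
  have := norm_integral_le_of_norm_le_const (μ := torusMeasure)
    (f := fun t => mFourier (-m) t * torusLift w f t) (C := C) (Filter.Eventually.of_forall
    fun t => by
      rw [norm_mul]
      have h1 := (mFourier (-m)).norm_coe_le_norm t
      rw [mFourier_norm] at h1
      exact (mul_le_mul h1 (h _) (norm_nonneg _) zero_le_one).trans (one_mul C).le)
  simpa using this

lemma mFourier_coe (m : Fin 2 → ℤ) (x : Fin 2 → ℝ) :
    mFourier m (fun i => (x i : UnitAddCircle)) =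
      Complex.exp (2 * Real.pi * Complex.I * (m 0 * x 0 + m 1 * x 1)) := by
  simp only [mFourier, ContinuousMap.coe_mk, Fin.prod_univ_two, fourier_coe_apply]
  rw [← Complex.exp_add]
  congr 1
  push_cast
  ring

lemma mFourier_apply_add (m : Fin 2 → ℤ) (s t : UnitAddTorus (Fin 2)) :
    mFourier m (s + t) = mFourier m s * mFourier m t := by
  simp only [mFourier, ContinuousMap.coe_mk, Fin.prod_univ_two, Pi.add_apply, fourier_apply,
    smul_add, AddCircle.toCircle_add, Circle.coe_mul]
  ring

/-- Translation by a vector of the plane is translation on the torus; the Haar measure is invariant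
and the character is multiplicative. -/
lemma latticeCoeff_translate (hf : LatticePeriodic w f) (m : Fin 2 → ℤ) (a b : ℝ) :
    latticeCoeff w m (fun z => f (z + (a + b * w))) =
      Complex.exp (2 * Real.pi * Complex.I * (m 0 * a + m 1 * b)) * latticeCoeff w m f := by
  set s : UnitAddTorus (Fin 2) := fun i => ((![a, b] i : ℝ) : UnitAddCircle) with hs
  have hms : Complex.exp (2 * Real.pi * Complex.I * (m 0 * a + m 1 * b)) = mFourier m s := by
    rw [hs, mFourier_coe]; simp
  rw [hms]
  have h := integral_add_right_eq_self (μ := torusMeasure)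
    (fun t => mFourier (-m) t * torusLift w f t) s
  rw [latticeCoeff_eq, latticeCoeff_eq, ← h, ← integral_const_mul]
  congr 1
  ext t
  have h1 := torusLift_add_coe hf t ![a, b]
  simp only [Matrix.cons_val_zero, Matrix.cons_val_one] at h1
  have h2 : mFourier m s * mFourier (-m) s = 1 := by
    rw [← mFourier_add, add_neg_cancel, mFourier_zero]; rfl
  rw [show s = fun i => ((![a, b] i : ℝ) : UnitAddCircle) from rfl] at *
  rw [h1, mFourier_apply_add]
  linear_combination (-mFourier (-m) t * torusLift w (fun z => f (z + (a + b * w))) t) * h2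

/-- The coefficient at `0` is the mean value. -/
lemma latticeCoeff_zero (hf : LatticePeriodic w f) (hc : Continuous f) :
    latticeCoeff w 0 f = ∫ x in (0 : ℝ)..1, ∫ y in (0 : ℝ)..1, f (x + y * w) := by
  rw [latticeCoeff, mFourierCoeff_eq_integral _ _ 0]
  have hset : {x : Fin 2 → ℝ | ∀ i, x i ∈ Set.Ioc ((0 : Fin 2 → ℝ) i) ((0 : Fin 2 → ℝ) i + 1)} =
      (MeasurableEquiv.finTwoArrow : (Fin 2 → ℝ) ≃ᵐ ℝ × ℝ) ⁻¹'
        (Set.Ioc 0 1 ×ˢ Set.Ioc 0 1) := by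
    ext x; simp [Fin.forall_fin_two]
  have hfun : ∀ x : Fin 2 → ℝ, mFourier (-(0 : Fin 2 → ℤ)) (fun i => (x i : UnitAddCircle)) •
      torusLift w f (fun i => (x i : UnitAddCircle)) =
      (fun p : ℝ × ℝ => f (p.1 + p.2 * w)) (MeasurableEquiv.finTwoArrow x) := fun x => by
    rw [torusLift_coe hf, neg_zero, mFourier_zero]; simp
  simp_rw [hfun]
  rw [hset, (volume_preserving_finTwoArrow ℝ).setIntegral_preimage_emb
    (MeasurableEquiv.measurableEmbedding _) (fun p : ℝ × ℝ => f (p.1 + p.2 * w)),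
    Measure.volume_eq_prod, setIntegral_prod]
  · rw [intervalIntegral.integral_of_le zero_le_one]
    simp_rw [intervalIntegral.integral_of_le zero_le_one]
  · have hcont : Continuous (fun p : ℝ × ℝ => f (p.1 + p.2 * w)) := by fun_prop
    rw [← Measure.volume_eq_prod]
    exact (hcont.continuousOn.integrableOn_compact
      (isCompact_Icc.prod isCompact_Icc)).mono_set
      (Set.prod_mono Set.Ioc_subset_Icc_self Set.Ioc_subset_Icc_self)

/-- A bound by the sum of the Fourier coefficients. -/
lemma norm_le_tsum_latticeCoeff (hw : w.im ≠ 0) (hf : LatticePeriodic w f) (hc : Continuous f)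
    {u : (Fin 2 → ℤ) → ℝ} (hu : Summable u) (h : ∀ m, ‖latticeCoeff w m f‖ ≤ u m) (z : ℂ) :
    ‖f z‖ ≤ ∑' m, u m := by
  set φ : C(UnitAddTorus (Fin 2), ℂ) := ⟨torusLift w f, continuous_torusLift hf hc⟩
  have hs : Summable (mFourierCoeff φ) := Summable.of_norm_bounded hu h
  -- The real coordinates of `z` in the basis `1, w`, which exist as `w` is not real.
  set x : Fin 2 → ℝ := ![z.re - z.im / w.im * w.re, z.im / w.im] with hx
  have hz : (x 0 + x 1 * w : ℂ) = z := by
    simp only [hx, Matrix.cons_val_zero, Matrix.cons_val_one]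
    apply Complex.ext
    · simp
    · simp; field_simp
  have h1 := hasSum_mFourier_series_apply_of_summable hs (fun i => (x i : UnitAddCircle))
  have h2 : φ (fun i => (x i : UnitAddCircle)) = f z := by
    rw [← hz]; exact torusLift_coe hf x
  rw [h2] at h1
  refine h1.norm_le_of_bounded hu.hasSum fun m => ?_
  rw [norm_smul]
  have h3 := (mFourier m).norm_coe_le_norm (fun i => (x i : UnitAddCircle))
  rw [mFourier_norm] at h3
  exact (mul_le_mul (h m) h3 (norm_nonneg _) ((norm_nonneg _).trans (h m))).trans
    (mul_one _).le

/-- The majorant zero is summable. This is the way back from identities between Fourier coefficients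
to identities between functions. -/
lemma eq_zero_of_latticeCoeff (hw : w.im ≠ 0) (hf : LatticePeriodic w f) (hc : Continuous f)
    (h : ∀ m, latticeCoeff w m f = 0) (z : ℂ) : f z = 0 := by
  have := norm_le_tsum_latticeCoeff hw hf hc (u := 0) summable_zero (fun m => by simp [h m]) z
  simpa using this

end

/-! ### Fourier coefficients of the derivatives of a periodic function. -/

section

open UnitAddTorus MeasureTheory

variable {w : ℂ} {q : ℂ × ℝ → ℂ}

lemma continuous_slice (hq : Continuous q) (τ : ℝ) : Continuous (fun z => q (z, τ)) := by fun_prop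

lemma latticePeriodic_dirDeriv (hp : ∀ τ, LatticePeriodic w (fun z => q (z, τ))) (v : ℂ × ℝ)
    (τ : ℝ) : LatticePeriodic w (fun z => dirDeriv v q (z, τ)) := by
  have key : ∀ a : ℂ, (∀ z τ, q (z + a, τ) = q (z, τ)) →
      ∀ z, dirDeriv v q (z + a, τ) = dirDeriv v q (z, τ) := fun a ha z => by
    have h1 : (fun x : ℂ × ℝ => q (x + (a, 0))) = q := by
      ext x; rw [← ha x.1 x.2]; congr 1; ext <;> simp
    rw [dirDeriv, dirDeriv]
    conv_rhs => rw [← h1, fderiv_comp_add_right]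
    simp
  exact fun z => ⟨key 1 (fun z τ => (hp τ z).1) z, key w (fun z τ => (hp τ z).2) z⟩

lemma hasDerivAt_line_at (hq : ContDiff ℝ ∞ q) (x v : ℂ × ℝ) (s : ℝ) :
    HasDerivAt (fun s : ℝ => q (x + s • v)) (dirDeriv v q (x + s • v)) s := by
  have h1 : HasFDerivAt q (fderiv ℝ q (x + s • v)) (x + s • v) :=
    (hq.differentiable (by simp) _).hasFDerivAt
  have h2 : HasDerivAt (fun s : ℝ => x + s • v) v s := by
    simpa using ((hasDerivAt_id s).smul_const v).const_add x
  exact h1.comp_hasDerivAt s h2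

/-- Differentiation under the integral sign. -/
lemma hasDerivAt_latticeCoeff (hq : ContDiff ℝ ∞ q)
    (hp : ∀ τ, LatticePeriodic w (fun z => q (z, τ))) (m : Fin 2 → ℤ) (v : ℂ × ℝ) (τ : ℝ) :
    HasDerivAt (fun s : ℝ => latticeCoeff w m (fun z => q ((z, τ) + s • v)))
      (latticeCoeff w m (fun z => dirDeriv v q (z, τ))) 0 := by
  have hper : ∀ s : ℝ, LatticePeriodic w (fun z => q ((z, τ) + s • v)) := fun s z => by
    have e : ∀ a : ℂ, (z + a, τ) + s • v = (z + s * v.1 + a, τ + s * v.2) := fun a => by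
      ext <;> simp; ring
    have e0 : (z, τ) + s • v = (z + s * v.1, τ + s * v.2) := by ext <;> simp
    simp only [e, e0]
    exact hp (τ + s * v.2) (z + s * v.1)
  have hcont : ∀ s : ℝ, Continuous (fun z => q ((z, τ) + s • v)) := fun s => by
    have := hq.continuous
    fun_prop
  have hd : Continuous (dirDeriv v q) := (contDiff_dirDeriv hq v).continuous
  set line : (ℂ × ℝ) → ℂ × ℝ := fun y => (y.1, τ) + y.2 • v with hline
  have hlc : Continuous line := by fun_prop
  -- The chosen representatives of points of the torus lie in a closed period parallelogram, so for
  -- `|s| ≤ 1` the derivative is only needed on a compact set, where it has a constant bound.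
  set box : Set (ℂ × ℝ) := ((fun p : ℝ × ℝ => (p.1 + p.2 * w : ℂ)) ''
    (Set.Icc 0 1 ×ˢ Set.Icc 0 1)) ×ˢ Set.Icc (-1 : ℝ) 1 with hbox
  have hcomp : IsCompact (line '' box) :=
    (((isCompact_Icc.prod isCompact_Icc).image (by fun_prop)).prod isCompact_Icc).image hlc
  obtain ⟨C, hC⟩ := hcomp.exists_bound_of_continuousOn hd.continuousOn
  have := hasDerivAt_integral_of_dominated_loc_of_deriv_le (μ := torusMeasure)
    (F := fun (s : ℝ) t => mFourier (-m) t * torusLift w (fun z => q ((z, τ) + s • v)) t)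
    (F' := fun (s : ℝ) t => mFourier (-m) t * torusLift w (fun z => dirDeriv v q ((z, τ) + s • v)) t)
    (x₀ := 0) (bound := fun _ => C) (s := Set.Icc (-1) 1) (Icc_mem_nhds (by norm_num) (by norm_num))
    (Filter.Eventually.of_forall fun s =>
      (integrable_torusLift (hper s) (hcont s) m).aestronglyMeasurable)
    (integrable_torusLift (hper 0) (hcont 0) m)
    (by
      have h1 := latticePeriodic_dirDeriv hp v τ
      have := (integrable_torusLift h1 (continuous_slice hd τ) m).aestronglyMeasurable
      simpa using this)
    (Filter.Eventually.of_forall fun t s hs => by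
      rw [norm_mul]
      have h1 := (mFourier (-m)).norm_coe_le_norm t
      rw [mFourier_norm] at h1
      have h2 := hC (line (circleRep (t 0) + circleRep (t 1) * w, s))
        ⟨_, ⟨⟨(circleRep (t 0), circleRep (t 1)), ⟨Set.Ioc_subset_Icc_self (circleRep_mem _),
          Set.Ioc_subset_Icc_self (circleRep_mem _)⟩, rfl⟩, hs⟩, rfl⟩
      exact (mul_le_mul h1 h2 (norm_nonneg _) zero_le_one).trans (one_mul C).le)
    (integrable_const C)
    (Filter.Eventually.of_forall fun t s _ =>
      (hasDerivAt_line_at hq (circleRep (t 0) + circleRep (t 1) * w, τ) v s).const_mul _)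
  have h2 := this.2
  simp only [zero_smul, add_zero] at h2
  exact h2

lemma hasDerivAt_latticeCoeff_height (hq : ContDiff ℝ ∞ q)
    (hp : ∀ τ, LatticePeriodic w (fun z => q (z, τ))) (m : Fin 2 → ℤ) (τ : ℝ) :
    HasDerivAt (fun τ : ℝ => latticeCoeff w m (fun z => q (z, τ)))
      (latticeCoeff w m (fun z => dirDeriv (0, 1) q (z, τ))) τ := by
  have h := hasDerivAt_latticeCoeff hq hp m (0, 1) τ
  have h1 : HasDerivAt (fun s : ℝ => s - τ) 1 τ := (hasDerivAt_id τ).sub_const τ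
  have h2 := HasDerivAt.scomp (x := τ) (h := fun s : ℝ => s - τ) (h' := 1)
    (by simpa using h) h1
  refine (h2.congr_deriv (by simp)).congr_of_eventuallyEq (Filter.Eventually.of_forall fun s => ?_)
  simp

/-- Translation along the direction multiplies the coefficient by a character of the real line; its
logarithmic derivative at `0` is the eigenvalue. -/
lemma latticeCoeff_dirDeriv_lattice (hq : ContDiff ℝ ∞ q)
    (hp : ∀ τ, LatticePeriodic w (fun z => q (z, τ))) (m : Fin 2 → ℤ) (a b τ : ℝ) :
    latticeCoeff w m (fun z => dirDeriv (a + b * w, 0) q (z, τ)) =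
      2 * Real.pi * Complex.I * (m 0 * a + m 1 * b) * latticeCoeff w m (fun z => q (z, τ)) := by
  have h := hasDerivAt_latticeCoeff hq hp m (a + b * w, 0) τ
  have e : ∀ s : ℝ, latticeCoeff w m (fun z => q ((z, τ) + s • ((a + b * w, 0) : ℂ × ℝ))) =
      Complex.exp (2 * Real.pi * Complex.I * (m 0 * a + m 1 * b) * s) *
        latticeCoeff w m (fun z => q (z, τ)) := fun s => by
    have := latticeCoeff_translate (hp τ) m (s * a) (s * b)
    rw [show (2 * Real.pi * Complex.I * (m 0 * a + m 1 * b) * s : ℂ) =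
      2 * Real.pi * Complex.I * (m 0 * (s * a : ℝ) + m 1 * (s * b : ℝ)) by push_cast; ring, ← this]
    congr 1; ext z; congr 1
    ext1
    · simp; ring
    · simp
  refine h.unique ?_
  simp_rw [e]
  have h3 : HasDerivAt (fun s : ℝ => (2 * Real.pi * Complex.I * (m 0 * a + m 1 * b) * s : ℂ))
      (2 * Real.pi * Complex.I * (m 0 * a + m 1 * b)) 0 := by
    have := (Complex.ofRealCLM.hasDerivAt (x := (0 : ℝ))).const_mul
      (2 * Real.pi * Complex.I * (m 0 * a + m 1 * b) : ℂ)
    simpa using this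
  refine (h3.cexp.mul_const _).congr_deriv ?_
  simp

/-- The eigenvalue of `∂/∂z` on the character `m` of the lattice. -/
def freq (w : ℂ) (m : Fin 2 → ℤ) : ℂ := Real.pi * (m 1 - conj w * m 0) / w.im

/-- On the character `m`, the operator `∂/∂z` acts by `freq w m` and `∂/∂z̄` by minus its conjugate.
The derivatives in the directions `1` and `i` are `∂/∂z + ∂/∂z̄` and `i (∂/∂z - ∂/∂z̄)`. -/
lemma latticeCoeff_one_I (hw : w.im ≠ 0) (hq : ContDiff ℝ ∞ q)
    (hp : ∀ τ, LatticePeriodic w (fun z => q (z, τ))) (m : Fin 2 → ℤ) (τ : ℝ) :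
    latticeCoeff w m (fun z => dirDeriv (1, 0) q (z, τ)) =
      (freq w m - conj (freq w m)) * latticeCoeff w m (fun z => q (z, τ)) ∧
    latticeCoeff w m (fun z => dirDeriv (Complex.I, 0) q (z, τ)) =
      Complex.I * (freq w m + conj (freq w m)) * latticeCoeff w m (fun z => q (z, τ)) := by
  have hw' : (w.im : ℂ) ≠ 0 := by exact_mod_cast hw
  have hc : conj w = w - 2 * w.im * Complex.I := by
    apply Complex.ext <;> simp; ring
  have hre : (w.re : ℂ) = w - w.im * Complex.I := by
    apply Complex.ext <;> simp
  -- The direction `i` in the basis `1, w`.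
  have hI : ((-w.re / w.im : ℝ) + (1 / w.im : ℝ) * w : ℂ) = Complex.I := by
    apply Complex.ext <;> simp <;> field_simp; ring
  constructor
  · have := latticeCoeff_dirDeriv_lattice hq hp m 1 0 τ
    simp only [Complex.ofReal_one, Complex.ofReal_zero, zero_mul, add_zero, mul_one, mul_zero]
      at this
    rw [this, freq]
    simp only [map_div₀, map_mul, map_sub, Complex.conj_conj, Complex.conj_ofReal, map_intCast]
    rw [hc]
    field_simp
    ring
  · have := latticeCoeff_dirDeriv_lattice hq hp m (-w.re / w.im) (1 / w.im) τ
    rw [hI] at this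
    rw [this, freq]
    simp only [map_div₀, map_mul, map_sub, Complex.conj_conj, Complex.conj_ofReal, map_intCast]
    rw [hc]
    push_cast
    rw [hre]
    field_simp
    ring

end

section

/-! ### The differential equations of the Fourier coefficients -/

section Modes

variable {k : ℕ} {c d dd : ℕ → ℝ → ℂ} {l : ℂ}
  (hc : ∀ n τ, HasDerivAt (c n) (d n τ) τ) (hd : ∀ n τ, HasDerivAt (d n) (dd n τ) τ)
  (hT : ∀ n ≤ 2 * k + 2, ∀ τ : ℝ, (2 * k + 2 - 2 * n : ℂ) * (d n τ - c n τ) +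
    Real.exp τ * ((2 * k + 2 - n : ℂ) * (2 * l * c (n + 1) τ) -
      n * (2 * conj l * c (n - 1) τ)) = 0)
  (hS : ∀ n ≤ 2 * k + 2, ∀ τ : ℝ, dd n τ - 2 * d n τ + (k + 1 - n : ℂ) ^ 2 * c n τ -
    4 * (l * conj l) * (Real.exp τ : ℂ) ^ 2 * c n τ +
    Real.exp τ * ((2 * k + 2 - n : ℂ) * (2 * l * c (n + 1) τ) +
      n * (2 * conj l * c (n - 1) τ)) = (k ^ 2 + 2 * k : ℂ) * c n τ)
include hc hd hT hS

/-- The derivative of the lowering relation expresses `dd n`; eliminating it with `hS` and `hT`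
leaves the raising relation multiplied by `2 l e^τ`, which is nonzero because `l ≠ 0`. -/
lemma mode_raising_of_lowering (hl : l ≠ 0) {n : ℕ} (hn : n < 2 * k + 2)
    (h : ∀ τ : ℝ, d n τ = (n + 1) * c n τ - 2 * Real.exp τ * l * c (n + 1) τ) (τ : ℝ) :
    d (n + 1) τ = (2 * k + 2 - n) * c (n + 1) τ - 2 * Real.exp τ * conj l * c n τ := by
  have he : HasDerivAt (fun τ : ℝ => (Real.exp τ : ℂ)) (Real.exp τ : ℂ) τ :=
    (Real.hasDerivAt_exp τ).ofReal_comp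
  have h1 : HasDerivAt (d n) ((n + 1) * d n τ -
      2 * l * (Real.exp τ * c (n + 1) τ + Real.exp τ * d (n + 1) τ)) τ := by
    have h2 : d n = fun τ : ℝ => (n + 1) * c n τ - 2 * l * (Real.exp τ * c (n + 1) τ) := by
      ext τ; rw [h τ]; ring
    have h3 : HasDerivAt (fun τ : ℝ => (n + 1) * c n τ - 2 * l * (Real.exp τ * c (n + 1) τ))
        ((n + 1) * d n τ - 2 * l * (Real.exp τ * c (n + 1) τ + Real.exp τ * d (n + 1) τ)) τ :=
      ((hc n τ).const_mul _).sub ((he.mul (hc (n + 1) τ)).const_mul _)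
    exact h3.congr_of_eventuallyEq (Filter.Eventually.of_forall (congrFun h2))
  have h4 := (hd n τ).unique h1
  have h5 : 2 * l * (Real.exp τ : ℂ) ≠ 0 :=
    mul_ne_zero (mul_ne_zero two_ne_zero hl) (by exact_mod_cast (Real.exp_pos τ).ne')
  refine mul_left_cancel₀ h5 ?_
  have hT' := hT n hn.le τ
  have hS' := hS n hn.le τ
  linear_combination h4 - hT' - hS' + (2 * k + 2 - n - 1 : ℂ) * h τ

/-- At `n = 0` the term of index `n - 1` has coefficient zero, and `hT` is the lowering relation
times `2k + 2`. In the induction the relation at `n` yields the raising relation at `n + 1`; it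
removes the lower neighbour from `hT` at `n + 1`, and the remaining factor `2k + 2 - (n + 1)` is
nonzero. -/
lemma mode_lowering (hl : l ≠ 0) {n : ℕ} (hn : n < 2 * k + 2) (τ : ℝ) :
    d n τ = (n + 1) * c n τ - 2 * Real.exp τ * l * c (n + 1) τ := by
  induction n generalizing τ with
  | zero =>
    have := hT 0 (Nat.zero_le _) τ
    have h2 : (2 * k + 2 : ℂ) ≠ 0 := by exact_mod_cast (by omega : 2 * k + 2 ≠ 0)
    refine mul_left_cancel₀ h2 ?_
    push_cast at this ⊢
    simp only [zero_add] at this ⊢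
    linear_combination this
  | succ n ih =>
    have h1 := mode_raising_of_lowering hc hd hT hS hl (by omega : n < 2 * k + 2)
      (ih (by omega)) τ
    have h2 : (2 * k + 2 - n - 1 : ℂ) ≠ 0 := by
      intro h3
      have : (2 * k + 2 : ℂ) = (n + 1 : ℕ) := by push_cast; linear_combination h3
      exact hn.ne' (by exact_mod_cast this)
    have h4 := hT (n + 1) hn.le τ
    refine mul_left_cancel₀ h2 ?_
    simp only [Nat.cast_add, Nat.cast_one, Nat.add_sub_cancel] at h4 ⊢
    linear_combination h4 + (n + 1 : ℂ) * h1

lemma mode_raising (hl : l ≠ 0) {n : ℕ} (hn : n < 2 * k + 2) (τ : ℝ) :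
    d (n + 1) τ = (2 * k + 2 - n) * c (n + 1) τ - 2 * Real.exp τ * conj l * c n τ :=
  mode_raising_of_lowering hc hd hT hS hl hn (mode_lowering hc hd hT hS hl hn) τ

/-- In `hT + hS` the neighbour of index `n - 1` cancels, and `mode_lowering` removes the one of
index `n + 1`. At `n = 2k + 2` the latter already has coefficient zero. -/
lemma mode_second_order (hl : l ≠ 0) {n : ℕ} (hn : n ≤ 2 * k + 2) (τ : ℝ) :
    dd n τ = (2 * k + 4) * d n τ +
      (4 * (l * conj l) * (Real.exp τ : ℂ) ^ 2 - (2 * k + 3 - n) * (n + 1)) * c n τ := by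
  have hT' := hT n hn τ
  have hS' := hS n hn τ
  rcases hn.lt_or_eq with h | h
  · have h1 := mode_lowering hc hd hT hS hl h τ
    linear_combination hT' + hS' - 2 * (2 * k + 2 - n : ℂ) * h1
  · have : (n : ℂ) = 2 * k + 2 := by rw [h]; push_cast; ring
    rw [this] at hT' hS' ⊢
    linear_combination hT' + hS'

end Modes

/-! ### Decay of solutions of convex equations -/

open Filter Topology

/-- A function of growth less than `e^{cτ}` with `E'' ≥ c² E` decays like `e^{-cτ}`. -/
lemma decay_of_convex {E E' E'' : ℝ → ℝ} {c a : ℝ} (hcpos : 0 < c)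
    (h1 : ∀ τ, HasDerivAt E (E' τ) τ) (h2 : ∀ τ, HasDerivAt E' (E'' τ) τ)
    (h : ∀ τ ≥ a, c ^ 2 * E τ ≤ E'' τ)
    (hlim : Tendsto (fun τ => E τ * Real.exp (-(c * τ))) atTop (𝓝 0)) {s : ℝ} (hs : 0 ≤ s) :
    E (a + s) ≤ Real.exp (-(c * s)) * E a := by
  have hexp : ∀ (b τ : ℝ), HasDerivAt (fun τ => Real.exp (b * τ)) (b * Real.exp (b * τ)) τ :=
    fun b τ => by
      have := ((hasDerivAt_id τ).const_mul b).exp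
      simpa [mul_comm] using this
  -- The derivative of `e^{-cτ}(E' + cE)` is `e^{-cτ}(E'' - c²E)`, nonnegative by hypothesis.
  have hW : MonotoneOn (fun τ => Real.exp (-c * τ) * (E' τ + c * E τ)) (Set.Ici a) := by
    have hd : ∀ τ, HasDerivAt (fun τ => Real.exp (-c * τ) * (E' τ + c * E τ))
        (Real.exp (-c * τ) * (E'' τ - c ^ 2 * E τ)) τ := fun τ => by
      refine ((hexp (-c) τ).mul ((h2 τ).add ((h1 τ).const_mul c))).congr_deriv ?_
      simp only [Pi.add_apply]
      ring
    refine monotoneOn_of_deriv_nonneg (convex_Ici a)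
      (fun τ _ => (hd τ).continuousAt.continuousWithinAt)
      (fun τ _ => (hd τ).differentiableAt.differentiableWithinAt) fun τ hτ => ?_
    rw [interior_Ici] at hτ
    rw [(hd τ).deriv]
    exact mul_nonneg (Real.exp_pos _).le (sub_nonneg.2 (h τ (le_of_lt hτ)))
  -- If `E' + cE` were positive at `b`, then `e^{-cτ}(E' + cE)` would stay above a constant `A > 0`.
  -- Integrating, `E e^{-cτ}` would have a lower bound tending to `A/(2c)`, against the hypothesis
  -- on its limit.
  have hneg : ∀ τ ≥ a, E' τ + c * E τ ≤ 0 := by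
    by_contra! hcon
    obtain ⟨b, hb, hpos⟩ := hcon
    set A := Real.exp (-c * b) * (E' b + c * E b) with hA
    have hApos : 0 < A := mul_pos (Real.exp_pos _) hpos
    have hM : MonotoneOn (fun τ => Real.exp (c * τ) * E τ - A / (2 * c) * Real.exp (2 * c * τ))
        (Set.Ici b) := by
      have hd : ∀ τ, HasDerivAt
          (fun τ => Real.exp (c * τ) * E τ - A / (2 * c) * Real.exp (2 * c * τ))
          (Real.exp (2 * c * τ) * (Real.exp (-c * τ) * (E' τ + c * E τ) - A)) τ := fun τ => by
        refine (((hexp c τ).mul (h1 τ)).sub ((hexp (2 * c) τ).const_mul (A / (2 * c)))).congr_deriv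
          ?_
        have e1 : Real.exp (2 * c * τ) * Real.exp (-c * τ) = Real.exp (c * τ) := by
          rw [← Real.exp_add]; ring_nf
        have e2 : A / (2 * c) * (2 * c * Real.exp (2 * c * τ)) = A * Real.exp (2 * c * τ) := by
          field_simp
        rw [e2, mul_sub, ← mul_assoc, e1]
        ring
      refine monotoneOn_of_deriv_nonneg (convex_Ici b)
        (fun τ _ => (hd τ).continuousAt.continuousWithinAt)
        (fun τ _ => (hd τ).differentiableAt.differentiableWithinAt) fun τ hτ => ?_
      rw [interior_Ici] at hτ
      rw [(hd τ).deriv]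
      refine mul_nonneg (Real.exp_pos _).le (sub_nonneg.2 ?_)
      exact hW hb (hb.trans (le_of_lt hτ)) (le_of_lt hτ)
    set B := Real.exp (c * b) * E b - A / (2 * c) * Real.exp (2 * c * b)
    have hle : ∀ τ ≥ b, A / (2 * c) + B * Real.exp (-(2 * c * τ)) ≤ E τ * Real.exp (-(c * τ)) := by
      intro τ hτ
      have h3 : B ≤ Real.exp (c * τ) * E τ - A / (2 * c) * Real.exp (2 * c * τ) :=
        hM Set.self_mem_Ici hτ hτ
      have h4 := mul_le_mul_of_nonneg_right h3 (Real.exp_pos (-(2 * c * τ))).le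
      have e1 : Real.exp (2 * c * τ) * Real.exp (-(2 * c * τ)) = 1 := by
        rw [← Real.exp_add]; simp
      have e2 : Real.exp (c * τ) * Real.exp (-(2 * c * τ)) = Real.exp (-(c * τ)) := by
        rw [← Real.exp_add]; ring_nf
      have e3 : (Real.exp (c * τ) * E τ - A / (2 * c) * Real.exp (2 * c * τ)) *
          Real.exp (-(2 * c * τ)) = E τ * Real.exp (-(c * τ)) - A / (2 * c) := by
        linear_combination E τ * e2 - A / (2 * c) * e1
      rw [e3] at h4
      linarith
    have hl1 : Tendsto (fun τ => A / (2 * c) + B * Real.exp (-(2 * c * τ))) atTop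
        (𝓝 (A / (2 * c) + B * 0)) := by
      refine tendsto_const_nhds.add (tendsto_const_nhds.mul ?_)
      exact Real.tendsto_exp_neg_atTop_nhds_zero.comp
        (tendsto_id.const_mul_atTop (by positivity))
    have := le_of_tendsto_of_tendsto hl1 hlim
      ((eventually_ge_atTop b).mono fun τ hτ => hle τ hτ)
    have : 0 < A / (2 * c) := by positivity
    linarith
  -- The inequality `E' + cE ≤ 0` says that `e^{cτ} E` decreases.
  have hanti : AntitoneOn (fun τ => Real.exp (c * τ) * E τ) (Set.Ici a) := by
    have hd : ∀ τ, HasDerivAt (fun τ => Real.exp (c * τ) * E τ)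
        (Real.exp (c * τ) * (E' τ + c * E τ)) τ := fun τ => by
      refine ((hexp c τ).mul (h1 τ)).congr_deriv ?_
      ring
    refine antitoneOn_of_deriv_nonpos (convex_Ici a)
      (fun τ _ => (hd τ).continuousAt.continuousWithinAt)
      (fun τ _ => (hd τ).differentiableAt.differentiableWithinAt) fun τ hτ => ?_
    rw [interior_Ici] at hτ
    rw [(hd τ).deriv]
    exact mul_nonpos_of_nonneg_of_nonpos (Real.exp_pos _).le (hneg τ (le_of_lt hτ))
  have h5 : Real.exp (c * (a + s)) * E (a + s) ≤ Real.exp (c * a) * E a :=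
    hanti Set.self_mem_Ici (by simpa using hs) (by linarith)
  have h6 := mul_le_mul_of_nonneg_left h5 (Real.exp_pos (-(c * (a + s)))).le
  rw [← mul_assoc, ← mul_assoc, ← Real.exp_add, ← Real.exp_add] at h6
  ring_nf at h6 ⊢
  simpa using h6

/-- A solution of `v'' = p v` with `p ≥ μ² e^{2τ}` that has at most exponential growth decays
superexponentially. -/
lemma norm_decay_of_ode {v v' v'' : ℝ → ℂ} {p : ℝ → ℝ} {μ C M a : ℝ} (hμ : 0 < μ)
    (h1 : ∀ τ, HasDerivAt v (v' τ) τ) (h2 : ∀ τ, HasDerivAt v' (v'' τ) τ)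
    (h : ∀ τ, v'' τ = p τ * v τ) (hp : ∀ τ, (μ * Real.exp τ) ^ 2 ≤ p τ)
    (hC : ∀ τ ≥ 0, ‖v τ‖ ≤ C * Real.exp (M * τ)) (ha : 2 * M < μ * Real.exp a) :
    ‖v (a + 1)‖ ≤ Real.exp (-(μ * Real.exp a / 2)) * ‖v a‖ := by
  have hE : ∀ τ, HasDerivAt (fun τ => ‖v τ‖ ^ 2) (2 * inner ℝ (v τ) (v' τ)) τ := fun τ =>
    (h1 τ).norm_sq
  have hE' : ∀ τ, HasDerivAt (fun τ => 2 * inner ℝ (v τ) (v' τ))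
      (2 * (inner ℝ (v τ) (v'' τ) + inner ℝ (v' τ) (v' τ))) τ := fun τ =>
    ((h1 τ).inner ℝ (h2 τ)).const_mul 2
  -- The criterion is applied to `E = |v|²` on `[a, ∞)` with the constant `c = μ e^a`. Here `E'' =
  -- 2p|v|² + 2|v'|²`, and `p` is at least `c²` beyond `a`.
  have hconv : ∀ τ ≥ a, (μ * Real.exp a) ^ 2 * ‖v τ‖ ^ 2 ≤
      2 * (inner ℝ (v τ) (v'' τ) + inner ℝ (v' τ) (v' τ)) := by
    intro τ hτ
    have e1 : inner ℝ (v τ) (v'' τ) = p τ * ‖v τ‖ ^ 2 := by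
      rw [h, ← Complex.real_smul, inner_smul_right, real_inner_self_eq_norm_sq]
    rw [e1, real_inner_self_eq_norm_sq]
    have e2 : (μ * Real.exp a) ^ 2 ≤ p τ := by
      refine le_trans ?_ (hp τ)
      have := Real.exp_le_exp.2 hτ
      gcongr
    have := mul_le_mul_of_nonneg_right e2 (sq_nonneg ‖v τ‖)
    nlinarith [sq_nonneg ‖v' τ‖, mul_nonneg (sq_nonneg (μ * Real.exp a)) (sq_nonneg ‖v τ‖)]
  -- The growth exponent of `|v|²` is `2M`, and `2M < μ e^a`. The criterion over an interval of
  -- length one then gives a factor `e^{-c}` for `|v|²`, hence `e^{-c/2}` for `|v|`.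
  have hlim : Tendsto (fun τ => ‖v τ‖ ^ 2 * Real.exp (-(μ * Real.exp a * τ))) atTop (𝓝 0) := by
    refine squeeze_zero' (Eventually.of_forall fun τ => by positivity)
      (g := fun τ => C ^ 2 * Real.exp (-((μ * Real.exp a - 2 * M) * τ))) ?_ ?_
    · filter_upwards [eventually_ge_atTop 0] with τ hτ
      have h3 := pow_le_pow_left₀ (norm_nonneg _) (hC τ hτ) 2
      have h4 := mul_le_mul_of_nonneg_right h3 (Real.exp_pos (-(μ * Real.exp a * τ))).le
      refine h4.trans (le_of_eq ?_)
      rw [mul_pow, ← Real.exp_nat_mul, mul_assoc, ← Real.exp_add]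
      congr 2
      push_cast
      ring
    · rw [← mul_zero (C ^ 2)]
      refine tendsto_const_nhds.mul (Real.tendsto_exp_neg_atTop_nhds_zero.comp
        (tendsto_id.const_mul_atTop (by linarith)))
  have := decay_of_convex (mul_pos hμ (Real.exp_pos a)) hE hE' hconv hlim zero_le_one
  refine le_of_sq_le_sq ?_ (by positivity)
  refine this.trans (le_of_eq ?_)
  rw [mul_pow, ← Real.exp_nat_mul]
  congr 2
  push_cast
  ring

end

section

/-! ### The Fourier expansion of a cusp form -/

lemma pos_of_mem_euclidean {D : ℕ} (hD : D ∈ ({1, 2, 3, 7, 11} : Finset ℕ)) : 0 < D := by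
  rcases Nat.eq_zero_or_pos D with rfl | h
  · simp at hD
  · exact h

lemma sqrt_sq_complex (D : ℕ) : (Real.sqrt D : ℂ) ^ 2 = D := by
  rw [← Complex.ofReal_pow, Real.sq_sqrt (Nat.cast_nonneg D)]; simp

/-- In each case `ω` is a root of a monic integral quadratic polynomial. Only the inclusion of `ℤ +
ℤω` in `𝓞_K` is needed: it gives the periodicity of `F`, and later approximations by integers. -/
lemma exists_toC_eq_omega (D : ℕ) : ∃ b : OK D, toC b = omega D := by
  have hI := Complex.I_sq
  have hs := sqrt_sq_complex D
  have hθ : Complex.I * (Real.sqrt D : ℂ) ∈ K D := IntermediateField.mem_adjoin_simple_self ℚ _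
  have h2 : (2 : ℂ) ∈ K D := (K D).natCast_mem 2
  have key : omega D ∈ K D ∧ ∃ s t : ℤ, omega D ^ 2 + s * omega D + t = 0 := by
    unfold omega
    split_ifs with h3 h4
    · refine ⟨(K D).div_mem ((K D).add_mem ((K D).neg_mem (K D).one_mem) hθ) h2, 1, 1, ?_⟩
      rw [h3] at hs ⊢
      push_cast at hs ⊢
      linear_combination (1 / 4 : ℂ) * (Real.sqrt (3 : ℕ) : ℂ) ^ 2 * hI - (1 / 4 : ℂ) * hs
    · obtain ⟨r, hr⟩ : ∃ r : ℕ, D = 4 * r + 3 := ⟨D / 4, by omega⟩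
      refine ⟨(K D).div_mem ((K D).add_mem (K D).one_mem hθ) h2, -1, r + 1, ?_⟩
      have h5 : (D : ℂ) = 4 * r + 3 := by exact_mod_cast hr
      push_cast
      linear_combination (1 / 4 : ℂ) * (Real.sqrt D : ℂ) ^ 2 * hI - (1 / 4 : ℂ) * hs -
        (1 / 4 : ℂ) * h5
    · refine ⟨hθ, 0, D, ?_⟩
      push_cast
      linear_combination (Real.sqrt D : ℂ) ^ 2 * hI - hs
  obtain ⟨hmem, s, t, hst⟩ := key
  have hint : IsIntegral ℤ (⟨omega D, hmem⟩ : K D) := by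
    refine ⟨Polynomial.X ^ 2 + Polynomial.C s * Polynomial.X + Polynomial.C t, ?_, ?_⟩
    · monicity!
    · simp only [Polynomial.eval₂_add, Polynomial.eval₂_mul, Polynomial.eval₂_C,
        Polynomial.eval₂_X, Polynomial.eval₂_pow]
      apply Subtype.ext
      simpa using hst
  exact ⟨⟨⟨omega D, hmem⟩, hint⟩, rfl⟩

lemma omega_im_ne_zero {D : ℕ} (hD : 0 < D) : (omega D).im ≠ 0 := by
  have : Real.sqrt D ≠ 0 := (Real.sqrt_pos.2 (by exact_mod_cast hD)).ne'
  unfold omega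
  split_ifs <;> simp [this]

variable {D k : ℕ} {F : ℂ × ℝ → MvPolynomial (Fin 2) ℂ} {w : ℂ}

lemma toC_one : toC (1 : OK D) = 1 := by simp [toC]

lemma IsCuspForm.latticePeriodic (hF : IsCuspForm D k F) {b : OK D} (hb : toC b = w) (n : ℕ)
    (τ : ℝ) : LatticePeriodic w (fun z => expCoef k n F (z, τ)) := fun z => by
  have h1 := hF.apply_add 1 z (Real.exp_pos τ)
  have h2 := hF.apply_add b z (Real.exp_pos τ)
  rw [toC_one] at h1
  rw [hb] at h2
  simp only [expCoef, h1, h2, and_self]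

/-- The continuous functions that are periodic under `ℤ + ℤ w`. -/
def periodicFunctions (w : ℂ) : Submodule ℂ (ℂ → ℂ) where
  carrier := {f | LatticePeriodic w f ∧ Continuous f}
  zero_mem' := ⟨fun _ => ⟨rfl, rfl⟩, continuous_const⟩
  add_mem' := fun {f g} hf hg => ⟨fun z => by
    simp only [Pi.add_apply, (hf.1 z).1, (hf.1 z).2, (hg.1 z).1, (hg.1 z).2, and_self],
    hf.2.add hg.2⟩
  smul_mem' := fun c f hf => ⟨fun z => by
    simp only [Pi.smul_apply, (hf.1 z).1, (hf.1 z).2, and_self], hf.2.const_smul c⟩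

/-- The Fourier coefficient as a linear map. -/
def latticeCoeffMap (w : ℂ) (m : Fin 2 → ℤ) : periodicFunctions w →ₗ[ℂ] ℂ where
  toFun f := latticeCoeff w m f.1
  map_add' f g := latticeCoeff_add f.2.1 f.2.2 g.2.1 g.2.2 m
  map_smul' c f := latticeCoeff_const_mul c f.1 m

/-- The restriction of a smooth periodic function to a horosphere. -/
def slice {q : ℂ × ℝ → ℂ} (hq : ContDiff ℝ ∞ q)
    (hp : ∀ τ, LatticePeriodic w (fun z => q (z, τ))) (τ : ℝ) : periodicFunctions w :=
  ⟨fun z => q (z, τ), hp τ, continuous_slice hq.continuous τ⟩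

/-- The Fourier coefficients of a form. -/
def fourierMode (k : ℕ) (F : ℂ × ℝ → MvPolynomial (Fin 2) ℂ) (w : ℂ) (m : Fin 2 → ℤ) (n : ℕ)
    (τ : ℝ) : ℂ := latticeCoeff w m (fun z => expCoef k n F (z, τ))

/-- The Fourier coefficients of the derivative of a form in the vertical direction. -/
def fourierModeDeriv (k : ℕ) (F : ℂ × ℝ → MvPolynomial (Fin 2) ℂ) (w : ℂ) (m : Fin 2 → ℤ) (n : ℕ)
    (τ : ℝ) : ℂ := latticeCoeff w m (fun z => dirDeriv (0, 1) (expCoef k n F) (z, τ))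

/-- The Fourier coefficients of the second derivative of a form in the vertical direction. -/
def fourierModeDeriv₂ (k : ℕ) (F : ℂ × ℝ → MvPolynomial (Fin 2) ℂ) (w : ℂ) (m : Fin 2 → ℤ)
    (n : ℕ) (τ : ℝ) : ℂ :=
  latticeCoeff w m (fun z => dirDeriv (0, 1) (dirDeriv (0, 1) (expCoef k n F)) (z, τ))

lemma IsCuspForm.hasDerivAt_fourierMode (hF : IsCuspForm D k F) {b : OK D} (hb : toC b = w)
    (m : Fin 2 → ℤ) (n : ℕ) (τ : ℝ) :
    HasDerivAt (fourierMode k F w m n) (fourierModeDeriv k F w m n τ) τ :=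
  hasDerivAt_latticeCoeff_height (contDiff_expCoef hF n) (hF.latticePeriodic hb n) m τ

lemma IsCuspForm.hasDerivAt_fourierModeDeriv (hF : IsCuspForm D k F) {b : OK D} (hb : toC b = w)
    (m : Fin 2 → ℤ) (n : ℕ) (τ : ℝ) :
    HasDerivAt (fourierModeDeriv k F w m n) (fourierModeDeriv₂ k F w m n τ) τ :=
  hasDerivAt_latticeCoeff_height (contDiff_dirDeriv (contDiff_expCoef hF n) _)
    (latticePeriodic_dirDeriv (hF.latticePeriodic hb n) _) m τ

section

variable (hF : IsCuspForm D k F) {b : OK D} (hb : toC b = w) (hw : w.im ≠ 0)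
include hF hb hw

lemma IsCuspForm.casimir_modes (m : Fin 2 → ℤ) {n : ℕ} (hn : n ≤ 2 * k + 2) (τ : ℝ) :
    ((2 * k + 2 - 2 * n : ℂ) * (fourierModeDeriv k F w m n τ - fourierMode k F w m n τ) +
      Real.exp τ * ((2 * k + 2 - n : ℂ) * (2 * freq w m * fourierMode k F w m (n + 1) τ) -
        n * (2 * conj (freq w m) * fourierMode k F w m (n - 1) τ)) = 0) ∧
    (fourierModeDeriv₂ k F w m n τ - 2 * fourierModeDeriv k F w m n τ +
      (k + 1 - n : ℂ) ^ 2 * fourierMode k F w m n τ -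
      4 * (freq w m * conj (freq w m)) * (Real.exp τ : ℂ) ^ 2 * fourierMode k F w m n τ +
      Real.exp τ * ((2 * k + 2 - n : ℂ) * (2 * freq w m * fourierMode k F w m (n + 1) τ) +
        n * (2 * conj (freq w m) * fourierMode k F w m (n - 1) τ)) =
      (k ^ 2 + 2 * k : ℂ) * fourierMode k F w m n τ) := by
  have hs := fun n => contDiff_expCoef hF n
  have hp := fun n => hF.latticePeriodic hb n
  have hs' := fun n v => contDiff_dirDeriv (hs n) v
  have hp' := fun n v => latticePeriodic_dirDeriv (hp n) v
  have hs'' := fun n v => contDiff_dirDeriv (hs' n v) v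
  have hp'' := fun n v => latticePeriodic_dirDeriv (hp' n v) v
  set Q := slice (hs n) (hp n) τ
  set Qt := slice (hs' n (0, 1)) (hp' n (0, 1)) τ
  set Qtt := slice (hs'' n (0, 1)) (hp'' n (0, 1)) τ
  set Q11 := slice (hs'' n (1, 0)) (hp'' n (1, 0)) τ
  set QII := slice (hs'' n (Complex.I, 0)) (hp'' n (Complex.I, 0)) τ
  set A1 := slice (hs' (n + 1) (1, 0)) (hp' (n + 1) (1, 0)) τ
  set AI := slice (hs' (n + 1) (Complex.I, 0)) (hp' (n + 1) (Complex.I, 0)) τ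
  set B1 := slice (hs' (n - 1) (1, 0)) (hp' (n - 1) (1, 0)) τ
  set BI := slice (hs' (n - 1) (Complex.I, 0)) (hp' (n - 1) (Complex.I, 0)) τ
  have hcas := fun z => hF.casimir_coordinates hn (z, τ)
  -- The pointwise Casimir equations are written as identities in the space of periodic functions,
  -- so that the linear map `latticeCoeffMap` applies to them.
  have e1 : (2 * k + 2 - 2 * n : ℂ) • (Qt - Q) + (Real.exp τ : ℂ) •
      ((2 * k + 2 - n : ℂ) • (A1 - Complex.I • AI) + (n : ℂ) • (B1 + Complex.I • BI)) = 0 := by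
    apply Subtype.ext
    ext z
    exact (hcas z).1
  have e2 : Qtt - (2 : ℂ) • Qt + ((k + 1 - n : ℂ) ^ 2) • Q +
      ((Real.exp τ : ℂ) ^ 2) • (Q11 + QII) + (Real.exp τ : ℂ) •
      ((2 * k + 2 - n : ℂ) • (A1 - Complex.I • AI) - (n : ℂ) • (B1 + Complex.I • BI)) =
      (k ^ 2 + 2 * k : ℂ) • Q := by
    apply Subtype.ext
    ext z
    exact (hcas z).2
  have f1 := congrArg (latticeCoeffMap w m) e1
  have f2 := congrArg (latticeCoeffMap w m) e2
  simp only [map_add, map_sub, map_smul, map_zero, smul_eq_mul] at f1 f2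
  have hA := latticeCoeff_one_I hw (hs (n + 1)) (hp (n + 1)) m τ
  have hB := latticeCoeff_one_I hw (hs (n - 1)) (hp (n - 1)) m τ
  have hQ1 := latticeCoeff_one_I hw (hs n) (hp n) m τ
  have hQ11 := (latticeCoeff_one_I hw (hs' n (1, 0)) (hp' n (1, 0)) m τ).1
  have hQII := (latticeCoeff_one_I hw (hs' n (Complex.I, 0)) (hp' n (Complex.I, 0)) m τ).2
  rw [hQ1.1] at hQ11
  rw [hQ1.2] at hQII
  change latticeCoeffMap w m A1 = _ * fourierMode k F w m (n + 1) τ ∧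
    latticeCoeffMap w m AI = _ * fourierMode k F w m (n + 1) τ at hA
  change latticeCoeffMap w m B1 = _ * fourierMode k F w m (n - 1) τ ∧
    latticeCoeffMap w m BI = _ * fourierMode k F w m (n - 1) τ at hB
  change latticeCoeffMap w m Q11 = _ * (_ * fourierMode k F w m n τ) at hQ11
  change latticeCoeffMap w m QII = _ * (_ * fourierMode k F w m n τ) at hQII
  rw [hA.1, hA.2, hB.1, hB.2] at f1 f2
  rw [hQ11, hQII] at f2
  change _ * (fourierModeDeriv k F w m n τ - fourierMode k F w m n τ) + _ = _ at f1
  change fourierModeDeriv₂ k F w m n τ - _ * fourierModeDeriv k F w m n τ +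
    _ * fourierMode k F w m n τ + _ + _ = _ * fourierMode k F w m n τ at f2
  have hI := Complex.I_sq
  constructor
  · linear_combination f1 + Real.exp τ * ((2 * k + 2 - n : ℂ) * (freq w m + conj (freq w m)) *
      fourierMode k F w m (n + 1) τ - n * (freq w m + conj (freq w m)) *
      fourierMode k F w m (n - 1) τ) * hI
  · linear_combination f2 + Real.exp τ * ((2 * k + 2 - n : ℂ) * (freq w m + conj (freq w m)) *
      fourierMode k F w m (n + 1) τ + n * (freq w m + conj (freq w m)) *
      fourierMode k F w m (n - 1) τ) * hI - (Real.exp τ : ℂ) ^ 2 *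
      (freq w m + conj (freq w m)) ^ 2 * fourierMode k F w m n τ * hI

end

end

/-! ### First order equations and rapid decay of cusp forms. -/

section

variable {D k : ℕ} {F : ℂ × ℝ → MvPolynomial (Fin 2) ℂ} {w : ℂ}

/-- The imaginary part of `m₁ - w̄ m₀` bounds `m₀`, and the triangle inequality then bounds `m₁`.
The linear lower bound makes exponentials of the frequencies summable. -/
lemma le_norm_freq (hw : w.im ≠ 0) : ∃ c > 0, ∀ m : Fin 2 → ℤ,
    c * (|(m 0 : ℝ)| + |(m 1 : ℝ)|) ≤ ‖freq w m‖ := by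
  have hpos : 0 < |w.im| := abs_pos.2 hw
  set A := (1 + ‖w‖) / |w.im| + 1 with hA
  have hApos : 0 < A := by positivity
  refine ⟨Real.pi / (|w.im| * A), by positivity, fun m => ?_⟩
  have h0 : ‖freq w m‖ = Real.pi * ‖(m 1 - conj w * m 0 : ℂ)‖ / |w.im| := by
    rw [freq, norm_div, norm_mul, Complex.norm_real, Complex.norm_real, Real.norm_eq_abs,
      Real.norm_eq_abs, abs_of_pos Real.pi_pos]
  set y := ‖(m 1 - conj w * m 0 : ℂ)‖ with hy
  have h1 : |w.im| * |(m 0 : ℝ)| ≤ y := by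
    have := Complex.abs_im_le_norm (m 1 - conj w * m 0 : ℂ)
    simpa [abs_mul] using this
  have h2 : |(m 1 : ℝ)| ≤ y + ‖w‖ * |(m 0 : ℝ)| := by
    have := norm_add_le (m 1 - conj w * m 0 : ℂ) (conj w * m 0)
    simpa using this
  have h3 : |(m 0 : ℝ)| ≤ y / |w.im| := by rw [le_div_iff₀ hpos]; linarith
  have h4 : |(m 0 : ℝ)| + |(m 1 : ℝ)| ≤ A * y := by
    have := mul_le_mul_of_nonneg_left h3 (by positivity : 0 ≤ 1 + ‖w‖)
    have e : A * y = (1 + ‖w‖) * (y / |w.im|) + y := by rw [hA]; ring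
    rw [e]; linarith
  rw [h0, div_mul_eq_mul_div, div_le_div_iff₀ (by positivity) hpos]
  have := mul_le_mul_of_nonneg_left h4 (by positivity : 0 ≤ Real.pi * |w.im|)
  linarith

lemma freq_ne_zero (hw : w.im ≠ 0) {m : Fin 2 → ℤ} (hm : m ≠ 0) : freq w m ≠ 0 := by
  obtain ⟨c, hc, h⟩ := le_norm_freq hw
  intro h0
  have h1 := h m
  rw [h0, norm_zero] at h1
  have h2 : |(m 0 : ℝ)| + |(m 1 : ℝ)| ≤ 0 := by
    by_contra! h3
    have := mul_pos hc h3
    linarith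
  have h3 : (m 0 : ℝ) = 0 := by
    rw [← abs_nonpos_iff]; linarith [abs_nonneg (m 1 : ℝ)]
  have h4 : (m 1 : ℝ) = 0 := by
    rw [← abs_nonpos_iff]; linarith [abs_nonneg (m 0 : ℝ)]
  apply hm
  ext i
  fin_cases i
  · exact_mod_cast h3
  · exact_mod_cast h4

lemma IsCuspForm.fourierMode_zero (hF : IsCuspForm D k F) {b : OK D} (hb : toC b = omega D) {n : ℕ}
    (hn : n ≤ 2 * k + 2) (τ : ℝ) : fourierMode k F (omega D) 0 n τ = 0 := by
  rw [fourierMode, latticeCoeff_zero (hF.latticePeriodic hb n τ)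
    (continuous_slice (contDiff_expCoef hF n).continuous τ)]
  have h := hF.cuspidal_infty hn (Real.exp_pos τ)
  simp only [expCoef, ncoef, intervalIntegral.integral_const_mul, intervalIntegral.integral_div, h,
    zero_div, mul_zero]

lemma IsCuspForm.fourierModeDeriv_zero (hF : IsCuspForm D k F) {b : OK D} (hb : toC b = omega D)
    {n : ℕ} (hn : n ≤ 2 * k + 2) (τ : ℝ) : fourierModeDeriv k F (omega D) 0 n τ = 0 := by
  have h1 := hF.hasDerivAt_fourierMode hb 0 n τ
  have h2 : fourierMode k F (omega D) 0 n = fun _ => 0 := funext fun τ => hF.fourierMode_zero hb hn τ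
  rw [h2] at h1
  exact h1.unique (hasDerivAt_const τ 0)

section

variable (hF : IsCuspForm D k F) {b : OK D} (hb : toC b = omega D) (hw : (omega D).im ≠ 0)
include hF hb hw

/-- `mode_lowering` divides by the frequency, which vanishes only for `m = 0`; there both sides are
zero because `F` is cuspidal. -/
lemma IsCuspForm.fourierMode_lowering (m : Fin 2 → ℤ) {n : ℕ} (hn : n < 2 * k + 2) (τ : ℝ) :
    fourierModeDeriv k F (omega D) m n τ = (n + 1) * fourierMode k F (omega D) m n τ -
      2 * Real.exp τ * freq (omega D) m * fourierMode k F (omega D) m (n + 1) τ := by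
  by_cases hm : m = 0
  · rw [hm, hF.fourierModeDeriv_zero hb hn.le, hF.fourierMode_zero hb hn.le,
      hF.fourierMode_zero hb (by omega : n + 1 ≤ 2 * k + 2)]
    ring
  · exact mode_lowering (hF.hasDerivAt_fourierMode hb m) (hF.hasDerivAt_fourierModeDeriv hb m)
      (fun _ hn τ => (hF.casimir_modes hb hw m hn τ).1)
      (fun _ hn τ => (hF.casimir_modes hb hw m hn τ).2) (freq_ne_zero hw hm) hn τ

lemma IsCuspForm.fourierMode_raising (m : Fin 2 → ℤ) {n : ℕ} (hn : n < 2 * k + 2) (τ : ℝ) :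
    fourierModeDeriv k F (omega D) m (n + 1) τ =
      (2 * k + 2 - n) * fourierMode k F (omega D) m (n + 1) τ -
      2 * Real.exp τ * conj (freq (omega D) m) * fourierMode k F (omega D) m n τ := by
  by_cases hm : m = 0
  · rw [hm, hF.fourierModeDeriv_zero hb (by omega), hF.fourierMode_zero hb hn.le,
      hF.fourierMode_zero hb (by omega : n + 1 ≤ 2 * k + 2)]
    ring
  · exact mode_raising (hF.hasDerivAt_fourierMode hb m) (hF.hasDerivAt_fourierModeDeriv hb m)
      (fun _ hn τ => (hF.casimir_modes hb hw m hn τ).1)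
      (fun _ hn τ => (hF.casimir_modes hb hw m hn τ).2) (freq_ne_zero hw hm) hn τ

lemma IsCuspForm.fourierMode_second_order {m : Fin 2 → ℤ} (hm : m ≠ 0) {n : ℕ}
    (hn : n ≤ 2 * k + 2) (τ : ℝ) :
    fourierModeDeriv₂ k F (omega D) m n τ =
      (2 * k + 4) * fourierModeDeriv k F (omega D) m n τ +
      (4 * (freq (omega D) m * conj (freq (omega D) m)) * (Real.exp τ : ℂ) ^ 2 -
        (2 * k + 3 - n) * (n + 1)) * fourierMode k F (omega D) m n τ :=
  mode_second_order (hF.hasDerivAt_fourierMode hb m) (hF.hasDerivAt_fourierModeDeriv hb m)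
    (fun _ hn τ => (hF.casimir_modes hb hw m hn τ).1)
    (fun _ hn τ => (hF.casimir_modes hb hw m hn τ).2) (freq_ne_zero hw hm) hn τ

/-- The first of the two systems of equations of first order for the coefficients. -/
lemma IsCuspForm.expCoef_lowering {n : ℕ} (hn : n < 2 * k + 2) (x : ℂ × ℝ) :
    dirDeriv (0, 1) (expCoef k n F) x = (n + 1) * expCoef k n F x -
      Real.exp x.2 * (dirDeriv (1, 0) (expCoef k (n + 1) F) x -
        Complex.I * dirDeriv (Complex.I, 0) (expCoef k (n + 1) F) x) := by
  obtain ⟨z, τ⟩ := x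
  have hs := fun n => contDiff_expCoef hF n
  have hp := fun n => hF.latticePeriodic hb n
  have hs' := fun n v => contDiff_dirDeriv (hs n) v
  have hp' := fun n v => latticePeriodic_dirDeriv (hp n) v
  set Q := slice (hs n) (hp n) τ
  set Qt := slice (hs' n (0, 1)) (hp' n (0, 1)) τ
  set A1 := slice (hs' (n + 1) (1, 0)) (hp' (n + 1) (1, 0)) τ
  set AI := slice (hs' (n + 1) (Complex.I, 0)) (hp' (n + 1) (Complex.I, 0)) τ
  set f := Qt - ((n + 1 : ℂ) • Q - (Real.exp τ : ℂ) • (A1 - Complex.I • AI)) with hf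
  have h0 : ∀ m, latticeCoeff (omega D) m f.1 = 0 := fun m => by
    change latticeCoeffMap (omega D) m f = 0
    have hA := latticeCoeff_one_I hw (hs (n + 1)) (hp (n + 1)) m τ
    change latticeCoeffMap (omega D) m A1 = _ * fourierMode k F (omega D) m (n + 1) τ ∧
      latticeCoeffMap (omega D) m AI = _ * fourierMode k F (omega D) m (n + 1) τ at hA
    have h := hF.fourierMode_lowering hb hw m hn τ
    simp only [hf, map_sub, map_smul, smul_eq_mul, hA.1, hA.2]
    change fourierModeDeriv k F (omega D) m n τ - (_ * fourierMode k F (omega D) m n τ - _) = 0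
    linear_combination h - Real.exp τ * ((freq (omega D) m + conj (freq (omega D) m)) *
      fourierMode k F (omega D) m (n + 1) τ) * Complex.I_sq
  exact sub_eq_zero.1 (eq_zero_of_latticeCoeff hw f.2.1 f.2.2 h0 z)

/-- The second of the two systems of equations of first order for the coefficients. -/
lemma IsCuspForm.expCoef_raising {n : ℕ} (hn : n < 2 * k + 2) (x : ℂ × ℝ) :
    dirDeriv (0, 1) (expCoef k (n + 1) F) x = (2 * k + 2 - n) * expCoef k (n + 1) F x +
      Real.exp x.2 * (dirDeriv (1, 0) (expCoef k n F) x +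
        Complex.I * dirDeriv (Complex.I, 0) (expCoef k n F) x) := by
  obtain ⟨z, τ⟩ := x
  have hs := fun n => contDiff_expCoef hF n
  have hp := fun n => hF.latticePeriodic hb n
  have hs' := fun n v => contDiff_dirDeriv (hs n) v
  have hp' := fun n v => latticePeriodic_dirDeriv (hp n) v
  set Q := slice (hs (n + 1)) (hp (n + 1)) τ
  set Qt := slice (hs' (n + 1) (0, 1)) (hp' (n + 1) (0, 1)) τ
  set B1 := slice (hs' n (1, 0)) (hp' n (1, 0)) τ
  set BI := slice (hs' n (Complex.I, 0)) (hp' n (Complex.I, 0)) τ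
  set f := Qt - ((2 * k + 2 - n : ℂ) • Q + (Real.exp τ : ℂ) • (B1 + Complex.I • BI)) with hf
  have h0 : ∀ m, latticeCoeff (omega D) m f.1 = 0 := fun m => by
    change latticeCoeffMap (omega D) m f = 0
    have hB := latticeCoeff_one_I hw (hs n) (hp n) m τ
    change latticeCoeffMap (omega D) m B1 = _ * fourierMode k F (omega D) m n τ ∧
      latticeCoeffMap (omega D) m BI = _ * fourierMode k F (omega D) m n τ at hB
    have h := hF.fourierMode_raising hb hw m hn τ
    simp only [hf, map_sub, map_add, map_smul, smul_eq_mul, hB.1, hB.2]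
    change fourierModeDeriv k F (omega D) m (n + 1) τ -
      (_ * fourierMode k F (omega D) m (n + 1) τ + _) = 0
    linear_combination h - Real.exp τ * ((freq (omega D) m + conj (freq (omega D) m)) *
      fourierMode k F (omega D) m n τ) * Complex.I_sq
  exact sub_eq_zero.1 (eq_zero_of_latticeCoeff hw f.2.1 f.2.2 h0 z)

end

lemma summable_exp_neg_abs {b : ℝ} (hb : 0 < b) :
    Summable (fun m : Fin 2 → ℤ => Real.exp (-(b * (|(m 0 : ℝ)| + |(m 1 : ℝ)|)))) := by
  have h1 : Summable (fun n : ℤ => Real.exp (-(b * |(n : ℝ)|))) := by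
    have h2 : Summable (fun n : ℕ => Real.exp (-(b * n))) := by
      have := Real.summable_exp_nat_mul_iff.2 (neg_lt_zero.2 hb)
      refine this.congr fun n => ?_
      ring_nf
    refine Summable.of_nat_of_neg ?_ ?_ <;> simpa using h2
  have h2 := h1.mul_of_nonneg h1 (fun _ => (Real.exp_pos _).le) (fun _ => (Real.exp_pos _).le)
  refine ((finTwoArrowEquiv ℤ).summable_iff.2 h2).congr fun m => ?_
  simp only [Function.comp_apply, finTwoArrowEquiv_apply, ← Real.exp_add]
  ring_nf
  rfl

lemma norm_expCoef_eq {n : ℕ} (hn : n ≤ 2 * k + 2) (F : ℂ × ℝ → MvPolynomial (Fin 2) ℂ)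
    (x : ℂ × ℝ) : ‖coef k n (F (x.1, Real.exp x.2))‖ =
      (2 * k + 2).choose n * Real.exp (-((k + 1) * x.2)) * ‖expCoef k n F x‖ := by
  have h : Real.exp (-((k + 1) * x.2)) * Real.exp ((k + 1) * x.2) = 1 := by
    rw [← Real.exp_add]; simp
  rw [coef_eq_ncoef hn, expCoef, norm_mul, norm_mul, Complex.norm_real, Real.norm_of_nonneg
    (Real.exp_pos _).le, Complex.norm_natCast]
  linear_combination (-((2 * k + 2).choose n : ℝ) * ‖ncoef k n (F (x.1, Real.exp x.2))‖) * h

lemma IsCuspForm.norm_expCoef_le (hF : IsCuspForm D k F) : ∃ (C : ℝ) (N : ℕ), 0 ≤ C ∧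
    ∀ n ≤ 2 * k + 2, ∀ (z : ℂ), ∀ τ ≥ 0,
      ‖expCoef k n F (z, τ)‖ ≤ C * Real.exp ((N + k + 1) * τ) := by
  obtain ⟨C, N, h⟩ := hF.growth_infty
  refine ⟨C, N, ?_, fun n hn z τ hτ => ?_⟩
  · have := (norm_nonneg _).trans (h 0 (Nat.zero_le _) 0 1 le_rfl)
    simpa using this
  · have h1 := h n hn z _ (Real.one_le_exp hτ)
    rw [← Real.exp_nat_mul] at h1
    have h2 : (1 : ℝ) ≤ (2 * k + 2).choose n := by exact_mod_cast Nat.choose_pos hn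
    have h3 : ‖expCoef k n F (z, τ)‖ ≤ Real.exp ((k + 1) * τ) * ‖coef k n (F (z, Real.exp τ))‖ := by
      rw [expCoef, ncoef, norm_mul, norm_div, Complex.norm_real,
        Real.norm_of_nonneg (Real.exp_pos _).le, Complex.norm_natCast]
      gcongr
      exact div_le_self (norm_nonneg _) h2
    refine h3.trans ((mul_le_mul_of_nonneg_left h1 (Real.exp_pos _).le).trans (le_of_eq ?_))
    rw [show ((N : ℝ) + k + 1) * τ = (k + 1) * τ + N * τ by ring, Real.exp_add]
    ring

/-- Multiplied by `e^{-(k+2)τ}` a mode solves an equation without first order term, whose potential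
is at least `(2|l| e^τ)²`. Its growth is at most exponential in `τ`, so `norm_decay_of_ode` gives a
factor `e^{-|l| e^τ}`. Half of the exponent is spent on decay in `τ`, the other half on summability
over `m`. -/
lemma IsCuspForm.norm_fourierMode_le (hF : IsCuspForm D k F) {b : OK D} (hb : toC b = omega D)
    (hw : (omega D).im ≠ 0) : ∃ (C : ℝ) (N : ℕ) (c T : ℝ), 0 < c ∧ 0 ≤ T ∧ 0 ≤ C ∧
    ∀ n ≤ 2 * k + 2, ∀ m, ∀ τ ≥ T, ‖fourierMode k F (omega D) m n (τ + 1)‖ ≤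
      C * Real.exp (N * τ) * Real.exp (-(c * Real.exp τ)) *
        Real.exp (-(c * (|(m 0 : ℝ)| + |(m 1 : ℝ)|))) := by
  obtain ⟨C, N, hC0, hC⟩ := hF.norm_expCoef_le
  obtain ⟨c, hc, hfreq⟩ := le_norm_freq hw
  -- The threshold makes `2N < 2c e^τ`, the growth condition of `norm_decay_of_ode` for `μ = 2|l| ≥
  -- 2c`; here `c` bounds all nonzero frequencies from below.
  obtain ⟨T, hT⟩ := Filter.eventually_atTop.1 ((Filter.Tendsto.const_mul_atTop
    (by positivity : 0 < 2 * c) Real.tendsto_exp_atTop).eventually_gt_atTop (2 * N : ℝ))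
  refine ⟨C * Real.exp (k + 2), N + k + 1, c / 2, max T 0, by positivity, le_max_right _ _,
    by positivity, fun n hn m τ hτ => ?_⟩
  have hτT := hT τ ((le_max_left _ _).trans hτ)
  have hτ0 : 0 ≤ τ := (le_max_right _ _).trans hτ
  by_cases hm : m = 0
  · rw [hm, hF.fourierMode_zero hb hn, norm_zero]
    positivity
  set l := freq (omega D) m with hl
  have hl0 : 0 < ‖l‖ := norm_pos_iff.2 (freq_ne_zero hw hm)
  have hone : (1 : ℝ) ≤ |(m 0 : ℝ)| + |(m 1 : ℝ)| := by
    have : 1 ≤ |m 0| + |m 1| := by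
      by_contra! h
      apply hm
      have h1 := abs_nonneg (m 0)
      have h2 := abs_nonneg (m 1)
      ext i
      fin_cases i
      · exact abs_eq_zero.1 (by omega : |m 0| = 0)
      · exact abs_eq_zero.1 (by omega : |m 1| = 0)
    exact_mod_cast this
  have hcl := hfreq m
  have hcl1 : c ≤ ‖l‖ := le_trans (by nlinarith) hcl
  have hE : ∀ τ, HasDerivAt (fun τ : ℝ => (Real.exp (-((k + 2) * τ)) : ℂ))
      (-(k + 2) * Real.exp (-((k + 2) * τ)) : ℂ) τ := fun τ => by
    have h1 : HasDerivAt (fun τ : ℝ => -((k + 2) * τ)) (-((k : ℝ) + 2)) τ :=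
      ((hasDerivAt_id τ).const_mul ((k : ℝ) + 2)).neg.congr_deriv (by ring)
    refine (h1.exp.ofReal_comp).congr_deriv ?_
    push_cast
    ring
  set q := fourierMode k F (omega D) m n with hq
  set d := fourierModeDeriv k F (omega D) m n with hd
  set dd := fourierModeDeriv₂ k F (omega D) m n with hdd
  have h1 := fun τ => (hE τ).mul (hF.hasDerivAt_fourierMode hb m n τ)
  have h2 := fun τ => (((hE τ).const_mul (-(k + 2) : ℂ)).mul
    (hF.hasDerivAt_fourierMode hb m n τ)).add ((hE τ).mul (hF.hasDerivAt_fourierModeDeriv hb m n τ))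
  -- The constant in the potential comes from `(k+2)² - (2k+3-n)(n+1) = (k+1-n)²`, which is
  -- nonnegative.
  have h3 : ∀ τ : ℝ, (-(k + 2) * (-(k + 2) * Real.exp (-((k + 2) * τ)) : ℂ)) * q τ +
      -(k + 2) * Real.exp (-((k + 2) * τ)) * d τ + (-(k + 2) * Real.exp (-((k + 2) * τ)) * d τ +
        Real.exp (-((k + 2) * τ)) * dd τ) =
      ((4 * ‖l‖ ^ 2 * Real.exp τ ^ 2 + (k + 1 - n) ^ 2 : ℝ) : ℂ) *
        (Real.exp (-((k + 2) * τ)) * q τ) := fun τ => by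
    have h4 := hF.fourierMode_second_order hb hw hm hn τ
    rw [Complex.mul_conj', ← hdd, ← hd, ← hq, ← hl] at h4
    rw [h4, Complex.ofReal_add, Complex.ofReal_mul, Complex.ofReal_mul, Complex.ofReal_pow,
      Complex.ofReal_pow]
    simp only [Complex.ofReal_sub, Complex.ofReal_add, Complex.ofReal_natCast, Complex.ofReal_one,
      Complex.ofReal_pow, Complex.ofReal_ofNat]
    ring
  have hbound : ∀ τ ≥ 0, ‖q τ‖ ≤ C * Real.exp ((N + k + 1) * τ) := fun τ hτ =>
    norm_latticeCoeff_le m fun z => hC n hn z τ hτ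
  -- The growth exponent `N + k + 1` of the mode becomes `N - 1 ≤ N` after multiplication by
  -- `e^{-(k+2)τ}`.
  have hv := norm_decay_of_ode (v := fun τ => (Real.exp (-((k + 2) * τ)) : ℂ) * q τ)
    (v' := fun τ => -(k + 2) * Real.exp (-((k + 2) * τ)) * q τ + Real.exp (-((k + 2) * τ)) * d τ)
    (v'' := fun τ => (-(k + 2) * (-(k + 2) * Real.exp (-((k + 2) * τ)) : ℂ)) * q τ +
      -(k + 2) * Real.exp (-((k + 2) * τ)) * d τ + (-(k + 2) * Real.exp (-((k + 2) * τ)) * d τ +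
        Real.exp (-((k + 2) * τ)) * dd τ))
    (p := fun τ => 4 * ‖l‖ ^ 2 * Real.exp τ ^ 2 + (k + 1 - n) ^ 2) (μ := 2 * ‖l‖) (C := C)
    (M := N) (a := τ) (by positivity) h1 h2 h3
    (fun τ => by nlinarith [sq_nonneg ((k : ℝ) + 1 - n)])
    (fun τ hτ => by
      rw [norm_mul, Complex.norm_real, Real.norm_of_nonneg (Real.exp_pos _).le]
      refine (mul_le_mul_of_nonneg_left (hbound τ hτ) (Real.exp_pos _).le).trans ?_
      rw [mul_left_comm, ← Real.exp_add]
      gcongr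
      nlinarith)
    (by
      have := mul_le_mul_of_nonneg_right hcl1 (Real.exp_pos τ).le
      linarith)
  simp only [norm_mul, Complex.norm_real, Real.norm_of_nonneg (Real.exp_pos _).le] at hv
  have h5 := mul_le_mul_of_nonneg_left hv (Real.exp_pos ((k + 2) * (τ + 1))).le
  rw [← mul_assoc, ← Real.exp_add] at h5
  simp only [add_neg_cancel, Real.exp_zero, one_mul] at h5
  refine h5.trans ?_
  have h6 : Real.exp (-(2 * ‖l‖ * Real.exp τ / 2)) ≤ Real.exp (-(c / 2 * Real.exp τ)) *
      Real.exp (-(c / 2 * (|(m 0 : ℝ)| + |(m 1 : ℝ)|))) := by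
    rw [← Real.exp_add]
    refine Real.exp_le_exp.2 ?_
    have h7 := Real.one_le_exp hτ0
    have h8 := mul_le_mul_of_nonneg_right hcl1 (Real.exp_pos τ).le
    have h9 := mul_le_mul_of_nonneg_left h7 hl0.le
    linarith
  calc Real.exp ((k + 2) * (τ + 1)) * (Real.exp (-(2 * ‖l‖ * Real.exp τ / 2)) *
        (Real.exp (-((k + 2) * τ)) * ‖q τ‖))
      ≤ Real.exp ((k + 2) * (τ + 1)) * ((Real.exp (-(c / 2 * Real.exp τ)) *
        Real.exp (-(c / 2 * (|(m 0 : ℝ)| + |(m 1 : ℝ)|)))) *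
        (Real.exp (-((k + 2) * τ)) * (C * Real.exp ((N + k + 1) * τ)))) := by
        gcongr
        exact hbound τ hτ0
    _ = C * (Real.exp ((k + 2) * (τ + 1)) * Real.exp (-((k + 2) * τ))) *
        Real.exp ((N + k + 1) * τ) * Real.exp (-(c / 2 * Real.exp τ)) *
        Real.exp (-(c / 2 * (|(m 0 : ℝ)| + |(m 1 : ℝ)|))) := by ring
    _ = _ := by
        rw [← Real.exp_add]
        push_cast
        ring_nf

/-- Cusp forms decay rapidly at infinity. -/
lemma IsCuspForm.rapid_decay (hF : IsCuspForm D k F) {b : OK D} (hb : toC b = omega D)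
    (hw : (omega D).im ≠ 0) (M : ℕ) : ∃ (C T : ℝ), 1 ≤ T ∧ 0 ≤ C ∧
    ∀ n ≤ 2 * k + 2, ∀ z : ℂ, ∀ t ≥ T, ‖coef k n (F (z, t))‖ ≤ C * (t ^ M)⁻¹ := by
  obtain ⟨C, N, c, T, hc, hT, hC, h⟩ := hF.norm_fourierMode_le hb hw
  set S := ∑' m : Fin 2 → ℤ, Real.exp (-(c * (|(m 0 : ℝ)| + |(m 1 : ℝ)|))) with hS
  have hS0 : 0 ≤ S := tsum_nonneg fun m => (Real.exp_pos _).le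
  -- Of the exponent `N + M`, the part `N` absorbs the factor `e^{Nτ}` of the bound and the part `M`
  -- is the decay that is claimed.
  have hlim := Real.tendsto_pow_mul_exp_neg_atTop_nhds_zero (N + M)
  have hev := (hlim.comp (Real.tendsto_exp_atTop.const_mul_atTop hc)).eventually
    (eventually_le_nhds zero_lt_one)
  obtain ⟨T₁, hT₁⟩ := Filter.eventually_atTop.1 hev
  set B : ℝ := ((Finset.range (2 * k + 3)).sup' ⟨0, by simp⟩ fun n => ((2 * k + 2).choose n : ℝ))
  have hB : ∀ n ≤ 2 * k + 2, ((2 * k + 2).choose n : ℝ) ≤ B := fun n hn =>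
    Finset.le_sup' (fun n => ((2 * k + 2).choose n : ℝ)) (Finset.mem_range.2 (by omega))
  have hB0 : 0 ≤ B := le_trans (by positivity) (hB 0 (Nat.zero_le _))
  refine ⟨B * (C * (c ^ (N + M))⁻¹ * Real.exp M * S), Real.exp (max T T₁ + 1),
    Real.one_le_exp (by positivity), by positivity, fun n hn z t ht => ?_⟩
  have htpos : 0 < t := (Real.exp_pos _).trans_le ht
  -- The bound on the modes is stated at `τ + 1`, whence the shift by one of `log t`.
  obtain ⟨τ, rfl⟩ : ∃ τ, t = Real.exp (τ + 1) := ⟨Real.log t - 1, by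
    rw [sub_add_cancel, Real.exp_log htpos]⟩
  have hτ : max T T₁ ≤ τ := by
    have := Real.exp_le_exp.1 ht
    linarith
  have hτ0 : 0 ≤ τ := hT.trans ((le_max_left _ _).trans hτ)
  have h1 := norm_le_tsum_latticeCoeff hw (hF.latticePeriodic hb n (τ + 1))
    (continuous_slice (contDiff_expCoef hF n).continuous (τ + 1))
    ((summable_exp_neg_abs hc).mul_left (C * Real.exp (N * τ) * Real.exp (-(c * Real.exp τ))))
    (fun m => h n hn m τ ((le_max_left _ _).trans hτ)) z
  rw [tsum_mul_left, ← hS] at h1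
  have h2 := hT₁ τ ((le_max_right _ _).trans hτ)
  simp only [Function.comp_apply] at h2
  have h3 : Real.exp (N * τ) * Real.exp (-(c * Real.exp τ)) ≤
      (c ^ (N + M))⁻¹ * Real.exp M * (Real.exp (τ + 1) ^ M)⁻¹ := by
    have e1 : Real.exp (N * τ) * Real.exp (-(c * Real.exp τ)) =
        (c ^ (N + M))⁻¹ * Real.exp M * (Real.exp (τ + 1) ^ M)⁻¹ *
        ((c * Real.exp τ) ^ (N + M) * Real.exp (-(c * Real.exp τ))) := by
      rw [Real.exp_add, mul_pow, mul_pow, pow_add (Real.exp τ), ← Real.exp_nat_mul τ N,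
        ← Real.exp_nat_mul 1 M, mul_one]
      have := Real.exp_pos τ
      field_simp
    rw [e1]
    exact mul_le_of_le_one_right (by positivity) h2
  have h4 := norm_expCoef_eq hn F (z, τ + 1)
  simp only at h4
  rw [h4]
  have h5 : Real.exp (-((k + 1) * (τ + 1))) ≤ 1 := Real.exp_le_one_iff.2 (by
    have : 0 ≤ ((k : ℝ) + 1) * (τ + 1) := by positivity
    linarith)
  calc ((2 * k + 2).choose n : ℝ) * Real.exp (-((k + 1) * (τ + 1))) * ‖expCoef k n F (z, τ + 1)‖
      ≤ B * 1 * (C * ((c ^ (N + M))⁻¹ * Real.exp M * (Real.exp (τ + 1) ^ M)⁻¹) * S) := by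
        refine mul_le_mul (mul_le_mul (hB n hn) h5 (Real.exp_pos _).le hB0) (h1.trans ?_)
          (norm_nonneg _) (by positivity)
        rw [mul_assoc C]
        gcongr
    _ = _ := by ring

end

section

/-! ### Calculus with `dz`, `dz̄` and `dt` -/

/-- The real linear form `p dz + q dz̄ + r dt`. -/
def wirt (p q r : ℂ) : ℂ × ℝ →L[ℝ] ℂ :=
  p • ContinuousLinearMap.fst ℝ ℂ ℝ +
    q • ((Complex.conjCLE : ℂ →L[ℝ] ℂ).comp (ContinuousLinearMap.fst ℝ ℂ ℝ)) +
    r • (Complex.ofRealCLM.comp (ContinuousLinearMap.snd ℝ ℂ ℝ))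

@[simp] lemma wirt_apply (p q r : ℂ) (h : ℂ × ℝ) :
    wirt p q r h = p * h.1 + q * conj h.1 + r * h.2 := by
  simp [wirt]

lemma eq_wirt (L : ℂ × ℝ →L[ℝ] ℂ) :
    L = wirt ((L (1, 0) - Complex.I * L (Complex.I, 0)) / 2)
      ((L (1, 0) + Complex.I * L (Complex.I, 0)) / 2) (L (0, 1)) := by
  refine ContinuousLinearMap.ext fun h => ?_
  have e : h = h.1.re • ((1, 0) : ℂ × ℝ) + h.1.im • ((Complex.I, 0) : ℂ × ℝ) +
      h.2 • ((0, 1) : ℂ × ℝ) := by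
    ext1
    · apply Complex.ext <;> simp
    · simp
  have h1 : (h.1.re : ℂ) = (h.1 + conj h.1) / 2 := by
    apply Complex.ext <;> simp
  have h2 : (h.1.im : ℂ) = -Complex.I * (h.1 - conj h.1) / 2 := by
    apply Complex.ext <;> simp
  conv_lhs => rw [e]
  simp only [map_add, map_smul, wirt_apply, Complex.real_smul, h1, h2]
  ring

section

variable {f g : ℂ × ℝ → ℂ} {p q r p' q' r' : ℂ} {x : ℂ × ℝ}

lemma hasFDerivAt_wirt_mul (hf : HasFDerivAt f (wirt p q r) x)
    (hg : HasFDerivAt g (wirt p' q' r') x) :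
    HasFDerivAt (fun x => f x * g x)
      (wirt (p * g x + f x * p') (q * g x + f x * q') (r * g x + f x * r')) x := by
  refine (hf.mul hg).congr_fderiv (ContinuousLinearMap.ext fun h => ?_)
  simp
  ring

lemma hasFDerivAt_wirt_const_mul (c : ℂ) (hf : HasFDerivAt f (wirt p q r) x) :
    HasFDerivAt (fun x => c * f x) (wirt (c * p) (c * q) (c * r)) x := by
  refine (hf.const_mul c).congr_fderiv (ContinuousLinearMap.ext fun h => ?_)
  simp
  ring

lemma hasFDerivAt_wirt_pow (n : ℕ) (hf : HasFDerivAt f (wirt p q r) x) :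
    HasFDerivAt (fun x => f x ^ n)
      (wirt (n * f x ^ (n - 1) * p) (n * f x ^ (n - 1) * q) (n * f x ^ (n - 1) * r)) x := by
  refine ((hasDerivAt_pow n (f x)).comp_hasFDerivAt x hf).congr_fderiv (ContinuousLinearMap.ext fun h => ?_)
  simp
  ring

lemma hasFDerivAt_wirt_sum {ι : Type*} (s : Finset ι) {f : ι → ℂ × ℝ → ℂ} {p q r : ι → ℂ}
    (hf : ∀ i ∈ s, HasFDerivAt (f i) (wirt (p i) (q i) (r i)) x) :
    HasFDerivAt (fun x => ∑ i ∈ s, f i x)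
      (wirt (∑ i ∈ s, p i) (∑ i ∈ s, q i) (∑ i ∈ s, r i)) x := by
  refine (HasFDerivAt.fun_sum hf).congr_fderiv (ContinuousLinearMap.ext fun h => ?_)
  simp [Finset.sum_add_distrib, Finset.sum_mul]

end

lemma convex_H3 : Convex ℝ H3 := by
  have : H3 = (Prod.snd : ℂ × ℝ → ℝ) ⁻¹' Set.Ioi 0 := rfl
  rw [this]
  exact (convex_Ioi 0).is_linear_preimage (IsLinearMap.mk (fun _ _ => rfl) (fun _ _ => rfl))

lemma isOpen_H3 : IsOpen H3 := isOpen_Ioi.preimage continuous_snd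

/-- Poincaré's lemma on hyperbolic space. -/
lemma exists_primitive {A B C : ℂ × ℝ → ℂ} {Az Ab At Bz Bb Bt Cz Cb Ct : ℂ × ℝ → ℂ}
    (hA : ∀ x ∈ H3, HasFDerivAt A (wirt (Az x) (Ab x) (At x)) x)
    (hB : ∀ x ∈ H3, HasFDerivAt B (wirt (Bz x) (Bb x) (Bt x)) x)
    (hC : ∀ x ∈ H3, HasFDerivAt C (wirt (Cz x) (Cb x) (Ct x)) x)
    (h1 : ∀ x ∈ H3, Bt x = Az x) (h2 : ∀ x ∈ H3, Ct x = Ab x) (h3 : ∀ x ∈ H3, Bb x = Cz x) :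
    ∃ G : ℂ × ℝ → ℂ, ∀ x ∈ H3, HasFDerivAt G (wirt (B x) (C x) (A x)) x := by
  have hd : ∀ x ∈ H3, HasFDerivAt (fun x => wirt (B x) (C x) (A x))
      ((wirt (Bz x) (Bb x) (Bt x)).smulRight (wirt 1 0 0) +
        (wirt (Cz x) (Cb x) (Ct x)).smulRight (wirt 0 1 0) +
        (wirt (Az x) (Ab x) (At x)).smulRight (wirt 0 0 1)) x := fun x hx => by
    have := (((hB x hx).smul_const (wirt 1 0 0)).add ((hC x hx).smul_const (wirt 0 1 0))).add
      ((hA x hx).smul_const (wirt 0 0 1))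
    refine this.congr_of_eventuallyEq (Filter.Eventually.of_forall fun y => ?_)
    refine ContinuousLinearMap.ext fun h => ?_
    simp
  refine convex_H3.exists_forall_hasFDerivAt_of_fderiv_symmetric isOpen_H3
    (fun x hx => (hd x hx).differentiableAt.differentiableWithinAt) fun x hx y z => ?_
  rw [(hd x hx).fderiv]
  simp only [add_apply, ContinuousLinearMap.smulRight_apply,
    smul_apply, wirt_apply, smul_eq_mul]
  rw [h1 x hx, h2 x hx, h3 x hx]
  ring

variable {D k : ℕ} {F : ℂ × ℝ → MvPolynomial (Fin 2) ℂ}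

/-- The equations of first order in the coordinates `(z, t)`. -/
lemma IsCuspForm.exists_hasFDerivAt_ncoef (hF : IsCuspForm D k F) {b : OK D}
    (hb : toC b = omega D) (hw : (omega D).im ≠ 0) : ∃ pz pb pt : ℕ → ℂ × ℝ → ℂ,
    (∀ n, ∀ x ∈ H3, HasFDerivAt (fun x => ncoef k n (F x)) (wirt (pz n x) (pb n x) (pt n x)) x) ∧
    (∀ n < 2 * k + 2, ∀ x ∈ H3, x.2 * pt n x = (n - k) * ncoef k n (F x) -
      2 * (x.2 * pz (n + 1) x)) ∧
    (∀ n < 2 * k + 2, ∀ x ∈ H3, x.2 * pt (n + 1) x = (k + 1 - n) * ncoef k (n + 1) (F x) +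
      2 * (x.2 * pb n x)) := by
  -- Return from `τ` to `t = e^τ`. The coefficient of `F` is `t^{-(k+1)}` times `expCoef`. Since
  -- `pz` and `pb` are the derivatives in `z` and `z̄`, the combinations `∂₁ ∓ i ∂ᵢ` become twice
  -- these.
  set y : ℂ × ℝ → ℂ × ℝ := fun x => (x.1, Real.log x.2) with hy
  have hinv : ∀ x ∈ H3, HasFDerivAt (fun x : ℂ × ℝ => ((x.2 : ℂ) ^ (k + 1))⁻¹)
      (wirt 0 0 (-(k + 1) * ((x.2 : ℂ) ^ (k + 2))⁻¹)) x := fun x hx => by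
    have hx' : (x.2 : ℂ) ≠ 0 := by exact_mod_cast (ne_of_gt hx)
    have h1 : HasFDerivAt (fun x : ℂ × ℝ => (x.2 : ℂ)) (wirt 0 0 1) x := by
      have : wirt 0 0 1 = Complex.ofRealCLM.comp (ContinuousLinearMap.snd ℝ ℂ ℝ) :=
        ContinuousLinearMap.ext fun h => by simp
      rw [this]
      exact (Complex.ofRealCLM.comp (ContinuousLinearMap.snd ℝ ℂ ℝ)).hasFDerivAt
    have h2 := (hasDerivAt_inv (pow_ne_zero (k + 1) hx')).comp_hasFDerivAt x
      ((hasDerivAt_pow (k + 1) (x.2 : ℂ)).comp_hasFDerivAt x h1)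
    refine h2.congr_fderiv (ContinuousLinearMap.ext fun h => ?_)
    simp
    field_simp
    ring
  have hexp : ∀ n, ∀ x ∈ H3, HasFDerivAt (fun x => expCoef k n F (y x))
      (wirt ((dirDeriv (1, 0) (expCoef k n F) (y x) -
          Complex.I * dirDeriv (Complex.I, 0) (expCoef k n F) (y x)) / 2)
        ((dirDeriv (1, 0) (expCoef k n F) (y x) +
          Complex.I * dirDeriv (Complex.I, 0) (expCoef k n F) (y x)) / 2)
        (dirDeriv (0, 1) (expCoef k n F) (y x) * (x.2 : ℂ)⁻¹)) x := fun n x hx => by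
    have h1 : HasFDerivAt (expCoef k n F) (fderiv ℝ (expCoef k n F) (y x)) (y x) :=
      ((contDiff_expCoef hF n).differentiable (by simp) _).hasFDerivAt
    have h2 : HasFDerivAt y ((ContinuousLinearMap.fst ℝ ℂ ℝ).prod
        (x.2⁻¹ • ContinuousLinearMap.snd ℝ ℂ ℝ)) x :=
      hasFDerivAt_fst.prodMk (hasFDerivAt_snd.log (ne_of_gt hx))
    refine (h1.comp x h2).congr_fderiv (ContinuousLinearMap.ext fun h => ?_)
    rw [eq_wirt (fderiv ℝ (expCoef k n F) (y x))]
    simp [dirDeriv]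
    ring
  have hval : ∀ n, ∀ x ∈ H3, ((x.2 : ℂ) ^ (k + 1))⁻¹ * expCoef k n F (y x) = ncoef k n (F x) := by
    intro n x hx
    have hx' : (x.2 : ℂ) ≠ 0 := by exact_mod_cast (ne_of_gt hx)
    simp only [expCoef, hy]
    rw [Real.exp_log hx, show ((k : ℝ) + 1) * Real.log x.2 = (k + 1 : ℕ) * Real.log x.2 by
      push_cast; ring, Real.exp_nat_mul, Real.exp_log hx]
    push_cast
    field_simp
  refine ⟨fun n x => ((x.2 : ℂ) ^ (k + 1))⁻¹ * ((dirDeriv (1, 0) (expCoef k n F) (y x) -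
      Complex.I * dirDeriv (Complex.I, 0) (expCoef k n F) (y x)) / 2),
    fun n x => ((x.2 : ℂ) ^ (k + 1))⁻¹ * ((dirDeriv (1, 0) (expCoef k n F) (y x) +
      Complex.I * dirDeriv (Complex.I, 0) (expCoef k n F) (y x)) / 2),
    fun n x => -(k + 1) * ((x.2 : ℂ) ^ (k + 2))⁻¹ * expCoef k n F (y x) +
      ((x.2 : ℂ) ^ (k + 1))⁻¹ * (dirDeriv (0, 1) (expCoef k n F) (y x) * (x.2 : ℂ)⁻¹), ?_, ?_, ?_⟩
  · intro n x hx
    have h := hasFDerivAt_wirt_mul (hinv x hx) (hexp n x hx)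
    simp only [zero_mul, zero_add] at h
    exact h.congr_of_eventuallyEq (Filter.eventually_of_mem (isOpen_H3.mem_nhds hx)
      fun y hy => (hval n y hy).symm)
  · intro n hn x hx
    have hx' : (x.2 : ℂ) ≠ 0 := by exact_mod_cast (ne_of_gt hx)
    have h := hF.expCoef_lowering hb hw hn (y x)
    have e : Real.exp (y x).2 = x.2 := Real.exp_log hx
    rw [e] at h
    beta_reduce
    rw [← hval n x hx, h]
    field_simp
    ring
  · intro n hn x hx
    have hx' : (x.2 : ℂ) ≠ 0 := by exact_mod_cast (ne_of_gt hx)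
    have h := hF.expCoef_raising hb hw hn (y x)
    have e : Real.exp (y x).2 = x.2 := Real.exp_log hx
    rw [e] at h
    beta_reduce
    rw [← hval (n + 1) x hx, h]
    field_simp
    ring

end

section

/-! ### The closed differential form -/

/-- The coefficient of `α^{k-i} β^i` in `(α (v₀ - z v₁) + β t v₁)^k`. -/
def eTerm (k : ℕ) (v : Fin 2 → ℂ) (i : ℕ) (x : ℂ × ℝ) : ℂ :=
  k.choose i * ((v 0 - x.1 * v 1) ^ (k - i) * (x.2 * v 1) ^ i)

/-- The coefficient of `β^{k-j} α^j` in `(β (u₀ - z̄ u₁) - α t u₁)^k`. -/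
def fTerm (k : ℕ) (u : Fin 2 → ℂ) (j : ℕ) (x : ℂ × ℝ) : ℂ :=
  k.choose j * ((u 0 - conj x.1 * u 1) ^ (k - j) * (-(x.2 * u 1)) ^ j)

/-- The sums that are, up to constants, the components of the differential form. -/
def formComp (k : ℕ) (F : ℂ × ℝ → MvPolynomial (Fin 2) ℂ) (v u : Fin 2 → ℂ) (s : ℕ)
    (x : ℂ × ℝ) : ℂ :=
  ∑ i ∈ Finset.range (k + 1), ∑ j ∈ Finset.range (k + 1),
    eTerm k v i x * fTerm k u j x * ncoef k (k + s + i - j) (F x)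

/-- The differential form attached to `F`. -/
def periodForm (k : ℕ) (F : ℂ × ℝ → MvPolynomial (Fin 2) ℂ) (v u : Fin 2 → ℂ) (x : ℂ × ℝ) :
    ℂ × ℝ →L[ℝ] ℂ :=
  wirt (-(1 / 2) * formComp k F v u 0 x) (1 / 2 * formComp k F v u 2 x) (formComp k F v u 1 x)

variable {k : ℕ}

lemma hasFDerivAt_fst_wirt (x : ℂ × ℝ) : HasFDerivAt (fun x : ℂ × ℝ => x.1) (wirt 1 0 0) x :=
  hasFDerivAt_fst.congr_fderiv (ContinuousLinearMap.ext fun h => by simp)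

lemma hasFDerivAt_conj_wirt (x : ℂ × ℝ) :
    HasFDerivAt (fun x : ℂ × ℝ => conj x.1) (wirt 0 1 0) x :=
  (((Complex.conjCLE : ℂ →L[ℝ] ℂ).comp (ContinuousLinearMap.fst ℝ ℂ ℝ)).hasFDerivAt).congr_fderiv
    (ContinuousLinearMap.ext fun h => by simp)

lemma hasFDerivAt_height_wirt (x : ℂ × ℝ) :
    HasFDerivAt (fun x : ℂ × ℝ => (x.2 : ℂ)) (wirt 0 0 1) x :=
  (Complex.ofRealCLM.comp (ContinuousLinearMap.snd ℝ ℂ ℝ)).hasFDerivAt.congr_fderiv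
    (ContinuousLinearMap.ext fun h => by simp)

lemma cast_choose_succ (k i : ℕ) :
    ((k - i : ℕ) : ℂ) * k.choose i = (i + 1) * k.choose (i + 1) := by
  have := Nat.choose_succ_right_eq k i
  have h2 : ((k.choose (i + 1) * (i + 1) : ℕ) : ℂ) = (k.choose i * (k - i) : ℕ) := by rw [this]
  push_cast at h2
  linear_combination -h2

lemma pow_sub_one_mul_self (a : ℂ) (i : ℕ) : (i : ℂ) * (a ^ (i - 1) * a) = i * a ^ i := by
  rcases i with _ | i
  · simp
  · rw [Nat.add_sub_cancel, pow_succ]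

/-- Differentiating in `z` trades a factor `v₀ - z v₁` for `-v₁`, so `t ∂/∂z` raises the index `i`
by one, while `t ∂/∂t` multiplies by `i`. The factors `t` keep the formulas free of denominators. -/
lemma exists_hasFDerivAt_eTerm (v : Fin 2 → ℂ) (i : ℕ) (x : ℂ × ℝ) : ∃ p r : ℂ,
    HasFDerivAt (eTerm k v i) (wirt p 0 r) x ∧ x.2 * p = -((i + 1) * eTerm k v (i + 1) x) ∧
      x.2 * r = i * eTerm k v i x := by
  have h1 : HasFDerivAt (fun x : ℂ × ℝ => v 0 - x.1 * v 1) (wirt (-v 1) 0 0) x := by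
    refine (((hasFDerivAt_fst_wirt x).mul_const (v 1)).const_sub (v 0)).congr_fderiv
      (ContinuousLinearMap.ext fun h => ?_)
    simp
  have h2 : HasFDerivAt (fun x : ℂ × ℝ => x.2 * v 1) (wirt 0 0 (v 1)) x := by
    refine ((hasFDerivAt_height_wirt x).mul_const (v 1)).congr_fderiv
      (ContinuousLinearMap.ext fun h => ?_)
    simp
  have h3 := hasFDerivAt_wirt_const_mul (k.choose i : ℂ)
    (hasFDerivAt_wirt_mul (hasFDerivAt_wirt_pow (k - i) h1) (hasFDerivAt_wirt_pow i h2))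
  refine ⟨k.choose i * ((k - i : ℕ) * (v 0 - x.1 * v 1) ^ (k - i - 1) * -v 1 * (x.2 * v 1) ^ i),
    k.choose i * ((v 0 - x.1 * v 1) ^ (k - i) * (i * (x.2 * v 1) ^ (i - 1) * v 1)),
    h3.congr_fderiv (ContinuousLinearMap.ext fun h => by simp), ?_, ?_⟩
  · have := cast_choose_succ k i
    rw [eTerm, Nat.sub_add_eq, pow_succ (x.2 * v 1) i]
    linear_combination (-((v 0 - x.1 * v 1) ^ (k - i - 1) * v 1 * (x.2 * v 1) ^ i) * x.2) * this
  · have := pow_sub_one_mul_self (x.2 * v 1) i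
    rw [eTerm]
    linear_combination (k.choose i * (v 0 - x.1 * v 1) ^ (k - i)) * this

lemma exists_hasFDerivAt_fTerm (u : Fin 2 → ℂ) (j : ℕ) (x : ℂ × ℝ) : ∃ q r : ℂ,
    HasFDerivAt (fTerm k u j) (wirt 0 q r) x ∧ x.2 * q = (j + 1) * fTerm k u (j + 1) x ∧
      x.2 * r = j * fTerm k u j x := by
  have h1 : HasFDerivAt (fun x : ℂ × ℝ => u 0 - conj x.1 * u 1) (wirt 0 (-u 1) 0) x := by
    refine (((hasFDerivAt_conj_wirt x).mul_const (u 1)).const_sub (u 0)).congr_fderiv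
      (ContinuousLinearMap.ext fun h => ?_)
    simp
  have h2 : HasFDerivAt (fun x : ℂ × ℝ => -(x.2 * u 1)) (wirt 0 0 (-u 1)) x := by
    refine ((hasFDerivAt_height_wirt x).mul_const (u 1)).neg.congr_fderiv
      (ContinuousLinearMap.ext fun h => ?_)
    simp
  have h3 := hasFDerivAt_wirt_const_mul (k.choose j : ℂ)
    (hasFDerivAt_wirt_mul (hasFDerivAt_wirt_pow (k - j) h1) (hasFDerivAt_wirt_pow j h2))
  refine ⟨k.choose j * ((k - j : ℕ) * (u 0 - conj x.1 * u 1) ^ (k - j - 1) * -u 1 *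
      (-(x.2 * u 1)) ^ j),
    k.choose j * ((u 0 - conj x.1 * u 1) ^ (k - j) * (j * (-(x.2 * u 1)) ^ (j - 1) * -u 1)),
    h3.congr_fderiv (ContinuousLinearMap.ext fun h => by simp), ?_, ?_⟩
  · have := cast_choose_succ k j
    rw [fTerm, Nat.sub_add_eq, pow_succ (-(x.2 * u 1)) j]
    linear_combination (-((u 0 - conj x.1 * u 1) ^ (k - j - 1) * u 1 * (-(x.2 * u 1)) ^ j) * x.2) *
      this
  · have := pow_sub_one_mul_self (-(x.2 * u 1)) j
    rw [fTerm]
    linear_combination (k.choose j * (u 0 - conj x.1 * u 1) ^ (k - j)) * this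

lemma eTerm_succ_eq_zero (v : Fin 2 → ℂ) (x : ℂ × ℝ) : eTerm k v (k + 1) x = 0 := by
  simp [eTerm]

lemma fTerm_succ_eq_zero (u : Fin 2 → ℂ) (x : ℂ × ℝ) : fTerm k u (k + 1) x = 0 := by
  simp [fTerm]

lemma sum_range_shift {g : ℕ → ℂ} (h0 : g 0 = 0) (hk : g (k + 1) = 0) :
    ∑ i ∈ Finset.range (k + 1), g (i + 1) = ∑ i ∈ Finset.range (k + 1), g i := by
  have h1 := Finset.sum_range_succ' g (k + 1)
  rw [Finset.sum_range_succ, h0, hk, add_zero, add_zero] at h1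
  exact h1.symm

lemma sum_range_shift_left {g : ℕ → ℕ → ℂ} (h0 : ∀ j, g 0 j = 0) (hk : ∀ j, g (k + 1) j = 0) :
    ∑ i ∈ Finset.range (k + 1), ∑ j ∈ Finset.range (k + 1), g (i + 1) j =
      ∑ i ∈ Finset.range (k + 1), ∑ j ∈ Finset.range (k + 1), g i j := by
  rw [Finset.sum_comm]
  conv_rhs => rw [Finset.sum_comm]
  exact Finset.sum_congr rfl fun j _ => sum_range_shift (g := fun i => g i j) (h0 j) (hk j)

lemma sum_range_shift_right {g : ℕ → ℕ → ℂ} (h0 : ∀ i, g i 0 = 0) (hk : ∀ i, g i (k + 1) = 0) :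
    ∑ i ∈ Finset.range (k + 1), ∑ j ∈ Finset.range (k + 1), g i (j + 1) =
      ∑ i ∈ Finset.range (k + 1), ∑ j ∈ Finset.range (k + 1), g i j :=
  Finset.sum_congr rfl fun i _ => sum_range_shift (h0 i) (hk i)

variable {D : ℕ} {F : ℂ × ℝ → MvPolynomial (Fin 2) ℂ}

/-- The three closedness conditions, multiplied by `t`, hold summand by summand up to a shift of `i`
or `j`. Comparing `dz` with `dt` uses the lowering equations, `dz̄` with `dt` the raising equations,
and `dz` with `dz̄` both. -/
lemma IsCuspForm.exists_periodForm_primitive (hF : IsCuspForm D k F) {b : OK D}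
    (hb : toC b = omega D) (hw : (omega D).im ≠ 0) (v u : Fin 2 → ℂ) :
    ∃ G : ℂ × ℝ → ℂ, ∀ x ∈ H3, HasFDerivAt G (periodForm k F v u x) x := by
  obtain ⟨pz, pb, pt, hd, hlow, hrai⟩ := hF.exists_hasFDerivAt_ncoef hb hw
  choose ez er he hez her using exists_hasFDerivAt_eTerm (k := k) v
  choose fb fr hf hfb hfr using exists_hasFDerivAt_fTerm (k := k) u
  have key : ∀ s, ∀ x ∈ H3, HasFDerivAt (formComp k F v u s) (wirt
      (∑ i ∈ Finset.range (k + 1), ∑ j ∈ Finset.range (k + 1),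
        (ez i x * fTerm k u j x * ncoef k (k + s + i - j) (F x) +
          eTerm k v i x * fTerm k u j x * pz (k + s + i - j) x))
      (∑ i ∈ Finset.range (k + 1), ∑ j ∈ Finset.range (k + 1),
        (eTerm k v i x * fb j x * ncoef k (k + s + i - j) (F x) +
          eTerm k v i x * fTerm k u j x * pb (k + s + i - j) x))
      (∑ i ∈ Finset.range (k + 1), ∑ j ∈ Finset.range (k + 1),
        ((er i x * fTerm k u j x + eTerm k v i x * fr j x) * ncoef k (k + s + i - j) (F x) +
          eTerm k v i x * fTerm k u j x * pt (k + s + i - j) x))) x := by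
    intro s x hx
    refine hasFDerivAt_wirt_sum _ fun i _ => hasFDerivAt_wirt_sum _ fun j _ => ?_
    have := hasFDerivAt_wirt_mul (hasFDerivAt_wirt_mul (he i x) (hf j x)) (hd (k + s + i - j) x hx)
    refine this.congr_fderiv (ContinuousLinearMap.ext fun h => ?_)
    simp
  have hne : ∀ x ∈ H3, (x.2 : ℂ) ≠ 0 := fun x hx => by exact_mod_cast (ne_of_gt hx)
  refine exists_primitive (key 1) (fun x hx => hasFDerivAt_wirt_const_mul _ (key 0 x hx))
    (fun x hx => hasFDerivAt_wirt_const_mul _ (key 2 x hx)) (fun x hx => ?_) (fun x hx => ?_)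
    (fun x hx => ?_)
  · refine mul_left_cancel₀ (hne x hx) ?_
    -- The shifted double sums agree: the weight `i` kills the term at `i = 0`, and `eTerm` vanishes
    -- at `i = k + 1`.
    have hshift := sum_range_shift_left (k := k)
      (g := fun i j => i * eTerm k v i x * fTerm k u j x * ncoef k (k + i - j) (F x))
      (by simp) (by simp [eTerm_succ_eq_zero])
    rw [← sub_eq_zero] at hshift ⊢
    rw [← hshift]
    simp only [Finset.mul_sum, ← Finset.sum_sub_distrib]
    refine Finset.sum_congr rfl fun i hi => Finset.sum_congr rfl fun j hj => ?_
    rw [Finset.mem_range] at hi hj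
    have e1 : k + 1 + i - j = k + i - j + 1 := by omega
    have e2 : k + (i + 1) - j = k + i - j + 1 := by omega
    rw [e1, e2, add_zero]
    have e3 : ((k + i - j : ℕ) : ℂ) = k + i - j := by
      rw [Nat.cast_sub (by omega)]; push_cast; ring
    have hl := hlow (k + i - j) (by omega) x hx
    rw [e3] at hl
    push_cast
    linear_combination (-(1 / 2) * fTerm k u j x * ncoef k (k + i - j) (F x)) * her i x -
      (1 / 2) * eTerm k v i x * ncoef k (k + i - j) (F x) * hfr j x -
      (1 / 2) * eTerm k v i x * fTerm k u j x * hl -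
      fTerm k u j x * ncoef k (k + i - j + 1) (F x) * hez i x
  · refine mul_left_cancel₀ (hne x hx) ?_
    have hshift := sum_range_shift_right (k := k)
      (g := fun i j => j * eTerm k v i x * fTerm k u j x * ncoef k (k + 2 + i - j) (F x))
      (by simp) (by simp [fTerm_succ_eq_zero])
    rw [← sub_eq_zero] at hshift ⊢
    rw [← neg_eq_zero, ← hshift]
    simp only [Finset.mul_sum, ← Finset.sum_sub_distrib, ← Finset.sum_neg_distrib]
    refine Finset.sum_congr rfl fun i hi => Finset.sum_congr rfl fun j hj => ?_
    rw [Finset.mem_range] at hi hj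
    have e1 : k + 2 + i - (j + 1) = k + 1 + i - j := by omega
    have e2 : k + 2 + i - j = k + 1 + i - j + 1 := by omega
    rw [e1, e2]
    have e3 : ((k + 1 + i - j : ℕ) : ℂ) = k + 1 + i - j := by
      rw [Nat.cast_sub (by omega)]; push_cast; ring
    have hl := hrai (k + 1 + i - j) (by omega) x hx
    rw [e3] at hl
    push_cast
    linear_combination (-(1 / 2) * fTerm k u j x * ncoef k (k + 1 + i - j + 1) (F x)) * her i x -
      (1 / 2) * eTerm k v i x * ncoef k (k + 1 + i - j + 1) (F x) * hfr j x -
      (1 / 2) * eTerm k v i x * fTerm k u j x * hl +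
      eTerm k v i x * ncoef k (k + 1 + i - j) (F x) * hfb j x
  · refine mul_left_cancel₀ (hne x hx) ?_
    have hl := sum_range_shift_left (k := k)
      (g := fun i j => i * eTerm k v i x * fTerm k u j x * ncoef k (k + 1 + i - j) (F x))
      (by simp) (by simp [eTerm_succ_eq_zero])
    have hr := sum_range_shift_right (k := k)
      (g := fun i j => j * eTerm k v i x * fTerm k u j x * ncoef k (k + 1 + i - j) (F x))
      (by simp) (by simp [fTerm_succ_eq_zero])
    have hlr : ∀ a b c d : ℂ, a = b → c = d → a - b - (c - d) = 0 := fun a b c d h1 h2 => by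
      rw [h1, h2]; ring
    have hshift := hlr _ _ _ _ hl hr
    refine mul_left_cancel₀ (two_ne_zero (α := ℂ)) ?_
    rw [← sub_eq_zero]
    rw [← hshift]
    simp only [Finset.mul_sum, ← Finset.sum_sub_distrib]
    refine Finset.sum_congr rfl fun i hi => Finset.sum_congr rfl fun j hj => ?_
    rw [Finset.mem_range] at hi hj
    have e1 : k + 2 + i - j = k + i - j + 2 := by omega
    have e2 : k + 1 + (i + 1) - j = k + i - j + 2 := by omega
    have e4 : k + 1 + i - (j + 1) = k + i - j := by omega
    have e5 : k + 1 + i - j = k + i - j + 1 := by omega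
    rw [e1, e2, e4, e5, add_zero]
    have e3 : ((k + i - j : ℕ) : ℂ) = k + i - j := by
      rw [Nat.cast_sub (by omega)]; push_cast; ring
    have h1 := hrai (k + i - j) (by omega) x hx
    have h2 := hlow (k + i - j + 1) (by omega) x hx
    push_cast at h2
    rw [e3] at h1 h2
    push_cast
    linear_combination (1 / 2) * eTerm k v i x * fTerm k u j x * (h1 - h2) -
      eTerm k v i x * ncoef k (k + i - j) (F x) * hfb j x -
      fTerm k u j x * ncoef k (k + i - j + 2) (F x) * hez i x

end

section

open MvPolynomial (C X)

/-! ### Equivariance of the differential form under the inversion -/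

/-- The polynomial whose pairing with `F x` is the value of the differential form. -/
def formPoly (k : ℕ) (v u : Fin 2 → ℂ) (x h : ℂ × ℝ) : MvPolynomial (Fin 2) ℂ :=
  (C (h.2 : ℂ) * (X 0 * X 1) + C (-(1 / 2) * h.1) * X 0 ^ 2 + C (1 / 2 * conj h.1) * X 1 ^ 2) *
    ((C (v 0 - x.1 * v 1) * X 0 + C (x.2 * v 1) * X 1) ^ k *
      (C (u 0 - conj x.1 * u 1) * X 1 + C (-(x.2 * u 1)) * X 0) ^ k)

variable {k : ℕ}

lemma isHomogeneous_formPoly (v u : Fin 2 → ℂ) (x h : ℂ × ℝ) :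
    (formPoly k v u x h).IsHomogeneous (2 * k + 2) := by
  have hX := fun i : Fin 2 => MvPolynomial.isHomogeneous_X ℂ i
  have hlin : ∀ (a b : ℂ) (i j : Fin 2),
      (C a * X i + C b * X j : MvPolynomial (Fin 2) ℂ).IsHomogeneous 1 := fun a b i j =>
    ((hX i).C_mul a).add ((hX j).C_mul b)
  have h1 := ((hlin (v 0 - x.1 * v 1) (x.2 * v 1) 0 1).pow k).mul
    ((hlin (u 0 - conj x.1 * u 1) (-(x.2 * u 1)) 1 0).pow k)
  have h2 : (C (h.2 : ℂ) * (X 0 * X 1) + C (-(1 / 2) * h.1) * X 0 ^ 2 +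
      C (1 / 2 * conj h.1) * X 1 ^ 2 : MvPolynomial (Fin 2) ℂ).IsHomogeneous 2 :=
    ((((hX 0).mul (hX 1)).C_mul _).add (((hX 0).pow 2).C_mul _)).add (((hX 1).pow 2).C_mul _)
  have := h2.mul h1
  rwa [show 2 + (1 * k + 1 * k) = 2 * k + 2 by ring] at this

/-- Once the form is a pairing with `F x`, its equivariance follows from `apolar_subst` and an
identity between explicit polynomials. -/
lemma apolar_formPoly (F : ℂ × ℝ → MvPolynomial (Fin 2) ℂ) (v u : Fin 2 → ℂ) (x h : ℂ × ℝ) :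
    apolar k (F x) (formPoly k v u x h) = periodForm k F v u x h := by
  rw [formPoly, add_pow_eq_sum, add_pow_eq_sum, Finset.sum_mul_sum, Finset.mul_sum, map_sum,
    periodForm, wirt_apply, formComp, formComp, formComp]
  simp only [Finset.mul_sum, Finset.sum_mul, map_sum]
  rw [← Finset.sum_add_distrib, ← Finset.sum_add_distrib]
  refine Finset.sum_congr rfl fun i hi => ?_
  rw [← Finset.sum_add_distrib, ← Finset.sum_add_distrib]
  refine Finset.sum_congr rfl fun j hj => ?_
  rw [Finset.mem_range] at hi hj
  set e : ℂ := k.choose i * (v 0 - x.1 * v 1) ^ (k - i) * (x.2 * v 1) ^ i with he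
  set f : ℂ := k.choose j * (u 0 - conj x.1 * u 1) ^ (k - j) * (-(x.2 * u 1)) ^ j with hf
  have he' : eTerm k v i x = e := by rw [eTerm, he, mul_assoc]
  have hf' : fTerm k u j x = f := by rw [fTerm, hf, mul_assoc]
  obtain ⟨a, rfl⟩ : ∃ a, k = i + a := ⟨k - i, by omega⟩
  obtain ⟨b, hb⟩ : ∃ b, i + a = j + b := ⟨i + a - j, by omega⟩
  have hexp : (C (h.2 : ℂ) * (X 0 * X 1) + C (-(1 / 2) * h.1) * X 0 ^ 2 +
      C (1 / 2 * conj h.1) * X 1 ^ 2) * ((e • (X 0 ^ (i + a - i) * X 1 ^ i)) *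
        (f • (X 1 ^ (i + a - j) * X 0 ^ j))) =
      (h.2 * (e * f)) • (X 0 ^ (a + j + 1) * X 1 ^ (i + b + 1)) +
      (-(1 / 2) * h.1 * (e * f)) • (X 0 ^ (a + j + 2) * X 1 ^ (i + b)) +
      (1 / 2 * conj h.1 * (e * f)) • (X 0 ^ (a + j) * X 1 ^ (i + b + 2) :
        MvPolynomial (Fin 2) ℂ) := by
    rw [show i + a - i = a by omega, show i + a - j = b by omega]
    simp only [MvPolynomial.smul_eq_C_mul, map_mul, pow_add]
    ring
  rw [hexp, map_add, map_add, map_smul, map_smul, map_smul,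
    apolar_X_pow_mul_X_pow' (by omega), apolar_X_pow_mul_X_pow' (by omega),
    apolar_X_pow_mul_X_pow' (by omega), he', hf', show i + a + 0 + i - j = i + b by omega,
    show i + a + 1 + i - j = i + b + 1 by omega, show i + a + 2 + i - j = i + b + 2 by omega]
  simp only [smul_eq_mul]
  ring

/-- The derivative of the inversion. -/
lemma exists_hasFDerivAt_inv3 {x : ℂ × ℝ} (hx : x ∈ H3) : ∃ L : ℂ × ℝ →L[ℝ] ℂ × ℝ,
    HasFDerivAt inv3 L x ∧ ∀ h, L h =
      (-conj h.1 / (x.1 * conj x.1 + x.2 ^ 2) + conj x.1 *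
        (conj x.1 * h.1 + x.1 * conj h.1 + 2 * x.2 * h.2) / (x.1 * conj x.1 + x.2 ^ 2) ^ 2,
      h.2 / (‖x.1‖ ^ 2 + x.2 ^ 2) - x.2 * (2 * (conj x.1 * h.1).re + 2 * x.2 * h.2) /
        (‖x.1‖ ^ 2 + x.2 ^ 2) ^ 2) := by
  have hx' : 0 < x.2 := hx
  have hr : ‖x.1‖ ^ 2 + x.2 ^ 2 ≠ 0 := by positivity
  have h1 : HasFDerivAt (fun x : ℂ × ℝ => (‖x.1‖ ^ 2 + x.2 ^ 2)) _ x :=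
    (hasFDerivAt_fst (𝕜 := ℝ) (p := x)).norm_sq.add
      ((hasDerivAt_pow 2 x.2).comp_hasFDerivAt x (hasFDerivAt_snd (𝕜 := ℝ) (p := x)))
  have h2 := (hasDerivAt_inv hr).comp_hasFDerivAt x h1
  have h3 := (hasFDerivAt_snd (𝕜 := ℝ) (p := x)).mul h2
  have h4 := ((((Complex.conjCLE : ℂ →L[ℝ] ℂ).comp
    (ContinuousLinearMap.fst ℝ ℂ ℝ)).hasFDerivAt (x := x)).neg).mul
    (Complex.ofRealCLM.hasFDerivAt.comp x h2)
  have hc : (x.1 * conj x.1 + x.2 ^ 2 : ℂ) = ((‖x.1‖ ^ 2 + x.2 ^ 2 : ℝ) : ℂ) := by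
    rw [Complex.mul_conj']; push_cast; rfl
  have hrc : ((‖x.1‖ ^ 2 + x.2 ^ 2 : ℝ) : ℂ) ≠ 0 := by exact_mod_cast hr
  refine ⟨_, (h4.prodMk h3).congr_of_eventuallyEq (Filter.Eventually.of_forall fun y => ?_),
    fun h => ?_⟩
  · ext1
    · simp [inv3, div_eq_mul_inv]
    · simp [inv3, div_eq_mul_inv]
  · rw [hc]
    have hre : (2 * (conj x.1 * h.1).re : ℂ) = conj x.1 * h.1 + x.1 * conj h.1 := by
      have := Complex.add_conj (conj x.1 * h.1)
      rw [map_mul, Complex.conj_conj] at this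
      rw [this]; push_cast; ring
    ext1
    · simp [Complex.inner, -Complex.mul_re, -Complex.add_re]
      rw [mul_comm h.1, ← hre]; ring
    · simp [Complex.inner, -Complex.mul_re]
      rw [mul_comm h.1]; ring

/-- The matrix `(0 -1; 1 0)` on vectors. -/
def rot (v : Fin 2 → ℂ) : Fin 2 → ℂ := ![-v 1, v 0]

set_option maxHeartbeats 1000000 in
-- The quadratic factor, which contains the tangent vector, and the two linear factors are
-- transformed separately, without any scalar: the powers of `|z|² + t²` from the inversion and its
-- derivative cancel those from the multiplier.
lemma subst_formPoly_inv3 (v u : Fin 2 → ℂ) {x : ℂ × ℝ} (hx : x ∈ H3) (h h' : ℂ × ℝ)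
    (h1 : h'.1 = -conj h.1 / (x.1 * conj x.1 + x.2 ^ 2) + conj x.1 *
      (conj x.1 * h.1 + x.1 * conj h.1 + 2 * x.2 * h.2) / (x.1 * conj x.1 + x.2 ^ 2) ^ 2)
    (h2 : (h'.2 : ℂ) = h.2 / (x.1 * conj x.1 + x.2 ^ 2) - x.2 *
      (conj x.1 * h.1 + x.1 * conj h.1 + 2 * x.2 * h.2) / (x.1 * conj x.1 + x.2 ^ 2) ^ 2) :
    subst (!![x.1, (x.2 : ℂ); -(x.2 : ℂ), conj x.1] : Matrix (Fin 2) (Fin 2) ℂ).transpose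
      (formPoly k (rot v) (rot u) (inv3 x) h') = formPoly k v u x h := by
  have hx' : 0 < x.2 := hx
  have hc : (x.1 * conj x.1 + x.2 ^ 2 : ℂ) = ((‖x.1‖ ^ 2 + x.2 ^ 2 : ℝ) : ℂ) := by
    rw [Complex.mul_conj']; push_cast; rfl
  have hr : (x.1 * conj x.1 + x.2 ^ 2 : ℂ) ≠ 0 := by
    rw [hc]; exact_mod_cast (by positivity : ‖x.1‖ ^ 2 + x.2 ^ 2 ≠ 0)
  have e1 : (inv3 x).1 = -conj x.1 / (x.1 * conj x.1 + x.2 ^ 2) := by rw [inv3, hc]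
  have e2 : ((inv3 x).2 : ℂ) = x.2 / (x.1 * conj x.1 + x.2 ^ 2) := by
    rw [inv3, hc]; push_cast; rfl
  have e3 : conj (inv3 x).1 = -x.1 / (x.1 * conj x.1 + x.2 ^ 2) := by
    rw [e1]; simp [mul_comm]
  have h3 : conj h'.1 = -h.1 / (x.1 * conj x.1 + x.2 ^ 2) + x.1 *
      (conj x.1 * h.1 + x.1 * conj h.1 + 2 * x.2 * h.2) / (x.1 * conj x.1 + x.2 ^ 2) ^ 2 := by
    rw [h1]; simp only [map_add, map_div₀, map_neg, map_mul, map_pow, Complex.conj_conj,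
      Complex.conj_ofReal, map_ofNat]; ring
  simp only [formPoly, subst_mul, subst_add, subst_pow, subst_C, subst_X, Matrix.transpose_apply,
    Matrix.of_apply, Matrix.cons_val', Matrix.cons_val_zero, Matrix.cons_val_one,
    Matrix.cons_val_fin_one, rot]
  have lin : ∀ a b z w z' w' c d : ℂ, a * z + b * z' = c → a * w + b * w' = d →
      (C a * (C z * X 0 + C w * X 1) + C b * (C z' * X 0 + C w' * X 1) : MvPolynomial (Fin 2) ℂ) =
        C c * X 0 + C d * X 1 := by
    intro a b z w z' w' c d h h'
    rw [← h, ← h']; simp only [map_add, map_mul]; ring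
  have quad : ∀ s p q z w z' w' a b c : ℂ, s * (z * z') + p * z ^ 2 + q * z' ^ 2 = a →
      s * (z * w' + w * z') + p * (2 * z * w) + q * (2 * z' * w') = b →
      s * (w * w') + p * w ^ 2 + q * w' ^ 2 = c →
      (C s * ((C z * X 0 + C w * X 1) * (C z' * X 0 + C w' * X 1)) +
        C p * (C z * X 0 + C w * X 1) ^ 2 + C q * (C z' * X 0 + C w' * X 1) ^ 2 :
          MvPolynomial (Fin 2) ℂ) = C b * (X 0 * X 1) + C a * X 0 ^ 2 + C c * X 1 ^ 2 := by
    intro s p q z w z' w' a b c h h' h''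
    rw [← h, ← h', ← h'']
    simp only [map_add, map_mul, map_pow, map_ofNat]; ring
  have e4 : (C (u 0 - conj x.1 * u 1) * X 1 + C (-(x.2 * u 1)) * X 0 : MvPolynomial (Fin 2) ℂ) =
      C (-(x.2 * u 1)) * X 0 + C (u 0 - conj x.1 * u 1) * X 1 := add_comm _ _
  rw [h3, h1, h2, e3, e1, e2, e4]
  -- From here `z`, `z̄`, `t` and `r` are unknowns with the single relation `z z̄ + t² = r`, and the
  -- identities are rational.
  generalize hr' : (x.1 * conj x.1 + x.2 ^ 2 : ℂ) = r at hr
  generalize x.1 = z at hr'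
  generalize conj z = z' at hr'
  generalize (x.2 : ℂ) = t at hr'
  refine congrArg₂ (· * ·) (quad _ _ _ _ _ _ _ _ _ _ ?_ ?_ ?_) (congrArg₂ (fun a b => a ^ k * b ^ k)
    (lin _ _ _ _ _ _ _ _ ?_ ?_) (lin _ _ _ _ _ _ _ _ ?_ ?_))
  all_goals field_simp; rw [← hr']; ring

end

section

open MeasureTheory Filter Topology

/-! ### Primitives that vanish at infinity -/

variable {D k : ℕ} {F : ℂ × ℝ → MvPolynomial (Fin 2) ℂ}

lemma norm_ncoef_le {n : ℕ} (hn : n ≤ 2 * k + 2) (P : MvPolynomial (Fin 2) ℂ) :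
    ‖ncoef k n P‖ ≤ ‖coef k n P‖ := by
  rw [ncoef, norm_div, Complex.norm_natCast]
  exact div_le_self (norm_nonneg _) (by exact_mod_cast Nat.choose_pos hn)

lemma eTerm_height (v : Fin 2 → ℂ) (i : ℕ) (z : ℂ) (t : ℝ) :
    eTerm k v i (z, t) = t ^ i * eTerm k v i (z, 1) := by
  simp only [eTerm, mul_pow, Complex.ofReal_one, one_pow]; ring

lemma fTerm_height (u : Fin 2 → ℂ) (j : ℕ) (z : ℂ) (t : ℝ) :
    fTerm k u j (z, t) = t ^ j * fTerm k u j (z, 1) := by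
  simp only [fTerm, neg_pow (_ * _), mul_pow, Complex.ofReal_one, one_pow]; ring

lemma IsCuspForm.continuousOn_ncoef (hF : IsCuspForm D k F) {n : ℕ} (hn : n ≤ 2 * k + 2) :
    ContinuousOn (fun x => ncoef k n (F x)) H3 := by
  simp only [ncoef]
  exact (hF.smooth n hn).continuousOn.div_const _

lemma IsCuspForm.continuousOn_formComp (hF : IsCuspForm D k F) (v u : Fin 2 → ℂ) {s : ℕ}
    (hs : s ≤ 2) : ContinuousOn (formComp k F v u s) H3 := by
  refine continuousOn_finsetSum _ fun i hi => continuousOn_finsetSum _ fun j hj => ?_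
  rw [Finset.mem_range] at hi hj
  refine ContinuousOn.mul (Continuous.continuousOn ?_) (hF.continuousOn_ncoef (by omega))
  unfold eTerm fTerm
  fun_prop

/-- The polynomial weights grow at most like `t^{2k}`, and decay of order `2k + 2` leaves an
integrable `t^{-2}`. Uniformity in `|z| ≤ R` serves to compare different vertical lines. -/
lemma IsCuspForm.norm_formComp_le (hF : IsCuspForm D k F) {b : OK D} (hb : toC b = omega D)
    (hw : (omega D).im ≠ 0) (v u : Fin 2 → ℂ) (R : ℝ) : ∃ C T : ℝ, 1 ≤ T ∧ ∀ s ≤ 2, ∀ z : ℂ,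
      ‖z‖ ≤ R → ∀ t ≥ T, ‖formComp k F v u s (z, t)‖ ≤ C * (t ^ 2)⁻¹ := by
  obtain ⟨C, T, hT, hC, h⟩ := hF.rapid_decay hb hw (2 * k + 2)
  have hcont : Continuous fun z : ℂ => ∑ i ∈ Finset.range (k + 1), ∑ j ∈ Finset.range (k + 1),
      ‖eTerm k v i (z, 1) * fTerm k u j (z, 1)‖ := by
    unfold eTerm fTerm
    fun_prop
  obtain ⟨K, hK⟩ := (isCompact_closedBall (0 : ℂ) R).exists_bound_of_continuousOn hcont.continuousOn
  refine ⟨K * C, T, hT, fun s hs z hz t ht => ?_⟩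
  have ht1 : 1 ≤ t := hT.trans ht
  have hK' := (le_abs_self _).trans (hK z (by simpa using hz))
  calc ‖formComp k F v u s (z, t)‖ ≤ ∑ i ∈ Finset.range (k + 1), ∑ j ∈ Finset.range (k + 1),
        ‖eTerm k v i (z, 1) * fTerm k u j (z, 1)‖ * (C * (t ^ 2)⁻¹) := by
        refine (norm_sum_le _ _).trans (Finset.sum_le_sum fun i hi => (norm_sum_le _ _).trans
          (Finset.sum_le_sum fun j hj => ?_))
        rw [Finset.mem_range] at hi hj
        rw [eTerm_height, fTerm_height, mul_mul_mul_comm, norm_mul, norm_mul, mul_comm (‖_‖),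
          mul_assoc]
        refine mul_le_mul_of_nonneg_left ?_ (norm_nonneg _)
        have h1 := (norm_ncoef_le (k := k) (n := k + s + i - j) (by omega) (F (z, t))).trans
          (h (k + s + i - j) (by omega) z t ht)
        rw [← pow_add, norm_pow, Complex.norm_real, Real.norm_of_nonneg (by linarith)]
        calc t ^ (i + j) * ‖ncoef k (k + s + i - j) (F (z, t))‖
            ≤ t ^ (2 * k) * (C * (t ^ (2 * k + 2))⁻¹) :=
              mul_le_mul (pow_le_pow_right₀ ht1 (by omega)) h1 (norm_nonneg _) (by positivity)
          _ = C * (t ^ 2)⁻¹ := by rw [pow_add]; field_simp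
    _ = (∑ i ∈ Finset.range (k + 1), ∑ j ∈ Finset.range (k + 1),
        ‖eTerm k v i (z, 1) * fTerm k u j (z, 1)‖) * (C * (t ^ 2)⁻¹) := by
        simp only [Finset.sum_mul]
    _ ≤ K * (C * (t ^ 2)⁻¹) := mul_le_mul_of_nonneg_right hK' (by positivity)
    _ = _ := by ring

/-- `G` is a primitive of the differential form, and vanishes at infinity. -/
def IsPeriodPrimitive (k : ℕ) (F : ℂ × ℝ → MvPolynomial (Fin 2) ℂ) (v u : Fin 2 → ℂ)
    (G : ℂ × ℝ → ℂ) : Prop :=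
  (∀ x ∈ H3, HasFDerivAt G (periodForm k F v u x) x) ∧
    ∀ z, Tendsto (fun t => G (z, t)) atTop (𝓝 0)

lemma hasDerivAt_vertical {G : ℂ × ℝ → ℂ} {v u : Fin 2 → ℂ}
    (hG : ∀ x ∈ H3, HasFDerivAt G (periodForm k F v u x) x) (z : ℂ) {t : ℝ} (ht : 0 < t) :
    HasDerivAt (fun t => G (z, t)) (formComp k F v u 1 (z, t)) t := by
  have h1 : HasDerivAt (fun t : ℝ => (z, t)) ((0, 1) : ℂ × ℝ) t :=
    (hasDerivAt_const t z).prodMk (hasDerivAt_id t)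
  exact ((hG (z, t) ht).comp_hasDerivAt t h1).congr_deriv (by simp [periodForm])

lemma integrableOn_Ioi_of_norm_le {f : ℝ → ℂ} {C T : ℝ} (hT : 0 < T)
    (hf : ContinuousOn f (Set.Ioi 0)) (h : ∀ t ≥ T, ‖f t‖ ≤ C * (t ^ 2)⁻¹) :
    IntegrableOn f (Set.Ioi T) := by
  have h1 : IntegrableOn (fun t : ℝ => C * t ^ (-2 : ℝ)) (Set.Ioi T) :=
    (integrableOn_Ioi_rpow_of_lt (by norm_num) hT).const_mul C
  refine Integrable.mono' h1 ((hf.mono (Set.Ioi_subset_Ioi hT.le)).aestronglyMeasurable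
    measurableSet_Ioi) ?_
  filter_upwards [ae_restrict_mem measurableSet_Ioi] with t ht
  have ht' : 0 < t := hT.trans ht
  rw [Real.rpow_neg ht'.le]
  exact_mod_cast h t (le_of_lt ht)

lemma continuousOn_vertical {f : ℂ × ℝ → ℂ} (hf : ContinuousOn f H3) (z : ℂ) :
    ContinuousOn (fun t : ℝ => f (z, t)) (Set.Ioi 0) :=
  hf.comp (by fun_prop) fun _ ht => ht

lemma tendsto_const_mul_inv_sq (C : ℝ) : Tendsto (fun t : ℝ => C * (t ^ 2)⁻¹) atTop (𝓝 0) := by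
  rw [← mul_zero C]
  exact ((tendsto_pow_atTop two_ne_zero).inv_tendsto_atTop).const_mul C

/-- Along a vertical line the derivative of a primitive is integrable near infinity, so a limit
exists. The limits over `z` and over `0` agree, as the horizontal components of the form are
`O(t^{-2})` on the segment between them; subtracting the common limit normalizes the primitive. -/
lemma IsCuspForm.exists_isPeriodPrimitive (hF : IsCuspForm D k F) {b : OK D}
    (hb : toC b = omega D) (hw : (omega D).im ≠ 0) (v u : Fin 2 → ℂ) :
    ∃ G, IsPeriodPrimitive k F v u G := by
  obtain ⟨G, hG⟩ := hF.exists_periodForm_primitive hb hw v u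
  have hlim : ∀ z, ∃ L, Tendsto (fun t => G (z, t)) atTop (𝓝 L) := fun z => by
    obtain ⟨C, T, hT, h⟩ := hF.norm_formComp_le hb hw v u ‖z‖
    exact ⟨_, tendsto_limUnder_of_hasDerivAt_of_integrableOn_Ioi (a := T)
      (fun t ht => hasDerivAt_vertical hG z (by have : T < t := ht; linarith))
      (integrableOn_Ioi_of_norm_le (by linarith)
        (continuousOn_vertical (hF.continuousOn_formComp v u one_le_two) z)
        (fun t ht => h 1 one_le_two z le_rfl t ht))⟩
  choose L hL using hlim
  have hconst : ∀ z, L z = L 0 := fun z => by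
    obtain ⟨C, T, hT, h⟩ := hF.norm_formComp_le hb hw v u ‖z‖
    have hdiff : Tendsto (fun t => G (z, t) - G (0, t)) atTop (𝓝 0) := by
      refine squeeze_zero_norm' (a := fun t => (C * ‖z‖) * (t ^ 2)⁻¹) ?_
        (tendsto_const_mul_inv_sq _)
      filter_upwards [eventually_ge_atTop T] with t ht
      have hseg : ∀ s : ℝ, HasDerivAt (fun s : ℝ => G (s * z, t))
          (periodForm k F v u (s * z, t) (z, 0)) s := fun s => by
        have h1 : HasDerivAt (fun s : ℝ => ((s * z : ℂ), t)) ((z, 0) : ℂ × ℝ) s := by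
          refine HasDerivAt.prodMk ?_ (hasDerivAt_const s t)
          simpa using (Complex.ofRealCLM.hasDerivAt (x := s)).mul_const z
        have hx : ((s * z : ℂ), t) ∈ H3 := show (0 : ℝ) < t by linarith
        exact (hG _ hx).comp_hasDerivAt s h1
      have := norm_image_sub_le_of_norm_deriv_le_segment_01'
        (f := fun s : ℝ => G (s * z, t)) (C := C * ‖z‖ * (t ^ 2)⁻¹)
        (fun s _ => (hseg s).hasDerivWithinAt) (fun s hs => ?_)
      · simpa using this
      · have hsz : ‖(s * z : ℂ)‖ ≤ ‖z‖ := by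
          rw [norm_mul, Complex.norm_real, Real.norm_of_nonneg hs.1]
          exact mul_le_of_le_one_left (norm_nonneg _) hs.2.le
        have h0 := h 0 (by norm_num) _ hsz t ht
        have h2 := h 2 le_rfl _ hsz t ht
        rw [periodForm, wirt_apply]
        simp only [Complex.ofReal_zero, mul_zero, add_zero]
        refine (norm_add_le _ _).trans ?_
        simp only [norm_mul, norm_neg, norm_div, norm_one, Complex.norm_ofNat, RCLike.norm_conj]
        nlinarith [mul_le_mul_of_nonneg_right h0 (norm_nonneg z),
          mul_le_mul_of_nonneg_right h2 (norm_nonneg z)]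
    have := tendsto_nhds_unique hdiff ((hL z).sub (hL 0))
    exact (sub_eq_zero.1 this.symm)
  refine ⟨fun x => G x - L 0, fun x hx => (hG x hx).sub_const _, fun z => ?_⟩
  have := (hL z).sub_const (L 0)
  rwa [hconst z, sub_self] at this

lemma exists_const_of_hasFDerivAt {G G' : ℂ × ℝ → ℂ} {ψ : ℂ × ℝ → ℂ × ℝ →L[ℝ] ℂ}
    (h : ∀ x ∈ H3, HasFDerivAt G (ψ x) x) (h' : ∀ x ∈ H3, HasFDerivAt G' (ψ x) x) :
    ∃ c, ∀ x ∈ H3, G' x = G x + c := by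
  have hd : ∀ x ∈ H3, HasFDerivAt (fun x => G' x - G x) 0 x := fun x hx =>
    ((h' x hx).sub (h x hx)).congr_fderiv (sub_self _)
  obtain ⟨c, hc⟩ := isOpen_H3.exists_is_const_of_fderiv_eq_zero convex_H3.isPreconnected
    (fun x hx => (hd x hx).differentiableAt.differentiableWithinAt)
    (fun x hx => (hd x hx).fderiv)
  exact ⟨c, fun x hx => by have := hc x hx; linear_combination this⟩

lemma IsPeriodPrimitive.unique {v u : Fin 2 → ℂ} {G G' : ℂ × ℝ → ℂ}
    (h : IsPeriodPrimitive k F v u G) (h' : IsPeriodPrimitive k F v u G') {x : ℂ × ℝ}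
    (hx : x ∈ H3) : G' x = G x := by
  obtain ⟨c, hc⟩ := exists_const_of_hasFDerivAt h.1 h'.1
  have h1 : Tendsto (fun t => G' (0, t)) atTop (𝓝 (0 + c)) :=
    ((h.2 0).add_const c).congr' (by
      filter_upwards [eventually_gt_atTop 0] with t ht using (hc (0, t) ht).symm)
  have := tendsto_nhds_unique h1 (h'.2 0)
  rw [hc x hx, ← zero_add c, this, add_zero]

/-- The form is homogeneous of degree `k` in `v` and of degree `k` in `u`, so a common sign
disappears. The matrices of the continued fraction satisfy their recursion only up to sign. -/
lemma periodForm_neg (v u : Fin 2 → ℂ) (x : ℂ × ℝ) :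
    periodForm k F (-v) (-u) x = periodForm k F v u x := by
  have h : ∀ s, formComp k F (-v) (-u) s x = formComp k F v u s x := fun s => by
    refine Finset.sum_congr rfl fun i hi => Finset.sum_congr rfl fun j hj => ?_
    rw [Finset.mem_range] at hi hj
    have he : eTerm k (-v) i x = (-1) ^ k * eTerm k v i x := by
      simp only [eTerm, Pi.neg_apply]
      rw [show -v 0 - x.1 * -v 1 = (-1) * (v 0 - x.1 * v 1) by ring,
        show (x.2 * -v 1 : ℂ) = (-1) * (x.2 * v 1) by ring, mul_pow, mul_pow (-1 : ℂ)]
      conv_rhs => rw [← Nat.sub_add_cancel (Nat.le_of_lt_succ hi), pow_add]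
      rw [Nat.sub_add_cancel (Nat.le_of_lt_succ hi)]
      ring
    have hf : fTerm k (-u) j x = (-1) ^ k * fTerm k u j x := by
      simp only [fTerm, Pi.neg_apply]
      rw [show -u 0 - conj x.1 * -u 1 = (-1) * (u 0 - conj x.1 * u 1) by ring,
        show (-(x.2 * -u 1) : ℂ) = (-1) * (-(x.2 * u 1)) by ring, mul_pow, mul_pow (-1 : ℂ)]
      conv_rhs => rw [← Nat.sub_add_cancel (Nat.le_of_lt_succ hj), pow_add]
      rw [Nat.sub_add_cancel (Nat.le_of_lt_succ hj)]
      ring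
    rw [he, hf]
    have : ((-1 : ℂ) ^ k) * (-1) ^ k = 1 := by rw [← mul_pow]; simp
    linear_combination (eTerm k v i x * fTerm k u j x * ncoef k (k + s + i - j) (F x)) * this
  rw [periodForm, periodForm, h, h, h]

/-- The translate of a vector by the matrix `(1 b; 0 1)`. -/
def shear (b : ℂ) (v : Fin 2 → ℂ) : Fin 2 → ℂ := ![v 0 + b * v 1, v 1]

/-- The shear of `v` compensates the translation in `v₀ - z v₁`, likewise for `u`, and `F` is
periodic. -/
lemma IsPeriodPrimitive.translate (hF : IsCuspForm D k F) {v u : Fin 2 → ℂ} {G : ℂ × ℝ → ℂ}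
    (b : OK D) (h : IsPeriodPrimitive k F (shear (toC b) v) (shear (conj (toC b)) u) G) :
    IsPeriodPrimitive k F v u (fun x => G (x.1 + toC b, x.2)) := by
  refine ⟨fun x hx => ?_, fun z => h.2 (z + toC b)⟩
  have e : (fun x : ℂ × ℝ => G (x.1 + toC b, x.2)) = fun x => G (x + (toC b, 0)) := by
    ext x; congr 1; ext <;> simp
  have hx' : x + (toC b, 0) ∈ H3 := by simpa [H3] using hx
  rw [e]
  refine ((h.1 _ hx').comp x ((hasFDerivAt_id x).add_const _)).congr_fderiv ?_
  rw [ContinuousLinearMap.comp_id]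
  have h2 : ∀ s, formComp k F (shear (toC b) v) (shear (conj (toC b)) u) s (x + (toC b, 0)) =
      formComp k F v u s x := fun s => by
    refine Finset.sum_congr rfl fun i _ => Finset.sum_congr rfl fun j _ => ?_
    have h3 : F (x + (toC b, 0)) = F x := by
      rw [← hF.apply_add b x.1 hx]; congr 1; ext <;> simp
    rw [h3]
    congr 2
    · simp only [eTerm, shear, Matrix.cons_val_zero, Matrix.cons_val_one, Prod.fst_add, Prod.snd_add,
        add_zero]
      ring_nf
    · simp only [fTerm, shear, Matrix.cons_val_zero, Matrix.cons_val_one, Prod.fst_add, Prod.snd_add,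
        add_zero,
        map_add]
      ring_nf
  rw [periodForm, periodForm, h2, h2, h2]

lemma inv3_mem {x : ℂ × ℝ} (hx : x ∈ H3) : inv3 x ∈ H3 := by
  have hx' : 0 < x.2 := hx
  exact show 0 < x.2 / (‖x.1‖ ^ 2 + x.2 ^ 2) by positivity

/-- By equivariance `G' ∘ inv3` is a primitive of the same form as `G`, hence differs from it by a
constant. The inversion sends `(0, 1/t)` to `(0, t)` and `G` vanishes at infinity, so the constant
is the boundary value of `G'` at the cusp `0`. -/
lemma IsPeriodPrimitive.exists_const_inv3 (hF : IsCuspForm D k F) {v u : Fin 2 → ℂ}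
    {G G' : ℂ × ℝ → ℂ} (h : IsPeriodPrimitive k F v u G)
    (h' : IsPeriodPrimitive k F (rot v) (rot u) G') :
    ∃ c, (∀ x ∈ H3, G' (inv3 x) = G x + c) ∧ Tendsto (fun t => G' (0, t)) (𝓝[>] 0) (𝓝 c) := by
  have hd : ∀ x ∈ H3, HasFDerivAt (fun x => G' (inv3 x)) (periodForm k F v u x) x := fun x hx => by
    obtain ⟨L, hL, hval⟩ := exists_hasFDerivAt_inv3 hx
    refine ((h'.1 _ (inv3_mem hx)).comp x hL).congr_fderiv (ContinuousLinearMap.ext fun y => ?_)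
    rw [ContinuousLinearMap.comp_apply, ← apolar_formPoly, ← apolar_formPoly, hF.apply_inv3 hx,
      apolar_subst (hF.homogeneous x hx) (isHomogeneous_formPoly _ _ _ _)]
    rw [subst_formPoly_inv3 v u hx y (L y) (by rw [hval])]
    rw [hval]
    have hre : (2 * (conj x.1 * y.1).re : ℂ) = conj x.1 * y.1 + x.1 * conj y.1 := by
      have := Complex.add_conj (conj x.1 * y.1)
      rw [map_mul, Complex.conj_conj] at this
      rw [this]; push_cast; ring
    have hc : (x.1 * conj x.1 + x.2 ^ 2 : ℂ) = ((‖x.1‖ ^ 2 + x.2 ^ 2 : ℝ) : ℂ) := by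
      rw [Complex.mul_conj']; push_cast; rfl
    rw [hc, ← hre]
    push_cast
    ring
  obtain ⟨c, hc⟩ := exists_const_of_hasFDerivAt h.1 hd
  refine ⟨c, hc, ?_⟩
  have h1 : Tendsto (fun t => G (0, t⁻¹) + c) (𝓝[>] (0 : ℝ)) (𝓝 (0 + c)) :=
    ((h.2 0).comp tendsto_inv_nhdsGT_zero).add_const c
  rw [zero_add] at h1
  refine h1.congr' ?_
  filter_upwards [self_mem_nhdsWithin] with t ht
  have ht' : (0 : ℝ) < t := ht
  have := hc (0, t⁻¹) (show (0 : ℝ) < t⁻¹ by positivity)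
  rw [← this]
  congr 1
  ext1
  · simp [inv3]
  · simp only [inv3, norm_zero]; field_simp; ring

end

section

open MeasureTheory Filter Topology

/-! ### Integrals along vertical lines -/

variable {D k : ℕ} {F : ℂ × ℝ → MvPolynomial (Fin 2) ℂ}

lemma integrableOn_Ioi_zero {f : ℝ → ℂ} {B C t₀ T : ℝ} (ht₀ : 0 < t₀) (hT : 0 < T)
    (hf : ContinuousOn f (Set.Ioi 0)) (h0 : ∀ t, 0 < t → t ≤ t₀ → ‖f t‖ ≤ B)
    (h : ∀ t ≥ T, ‖f t‖ ≤ C * (t ^ 2)⁻¹) : IntegrableOn f (Set.Ioi 0) := by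
  have h1 : IntegrableOn f (Set.Ioc 0 t₀) := by
    refine Integrable.mono' (g := fun _ => B) (integrableOn_const (by simp))
      ((hf.mono Set.Ioc_subset_Ioi_self).aestronglyMeasurable measurableSet_Ioc) ?_
    filter_upwards [ae_restrict_mem measurableSet_Ioc] with t ht using h0 t ht.1 ht.2
  have h2 : IntegrableOn f (Set.Icc t₀ T) :=
    (hf.mono fun t ht => ht₀.trans_le ht.1).integrableOn_Icc
  refine ((h1.union h2).union (integrableOn_Ioi_of_norm_le hT hf h)).mono_set fun t ht => ?_
  have ht' : 0 < t := ht
  rcases le_total t t₀ with h' | h'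
  · exact Or.inl (Or.inl ⟨ht', h'⟩)
  · rcases le_or_gt t T with h'' | h''
    · exact Or.inl (Or.inr ⟨h', h''⟩)
    · exact Or.inr h''

/-- `κ` is taken to `∞` by an element of `SL₂(𝓞_K)`. -/
def IsFiniteCusp (D : ℕ) (κ : ℂ) : Prop :=
  ∃ a b c d : OK D, a * d - b * c = 1 ∧ c ≠ 0 ∧ toC c * κ + toC d = 0

lemma isFiniteCusp_zero (D : ℕ) : IsFiniteCusp D 0 :=
  ⟨0, -1, 1, 0, by ring, one_ne_zero, by simp [toC]⟩

/-- For large `t` this is rapid decay. For small `t` the cusp is moved to infinity by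
`apply_near_cusp`: its factor of order `t^{-(2k+2)}` is compensated by decay of the same order at
height `1/(|c|² t)`, so the integrand stays bounded. -/
lemma IsCuspForm.integrableOn_pow_mul_coef (hF : IsCuspForm D k F) {b : OK D}
    (hb : toC b = omega D) (hw : (omega D).im ≠ 0) {κ : ℂ} (hκ : IsFiniteCusp D κ) {m n : ℕ}
    (hm : m ≤ 2 * k) (hn : n ≤ 2 * k + 2) :
    IntegrableOn (fun t : ℝ => (t : ℂ) ^ m * coef k n (F (κ, t))) (Set.Ioi 0) := by
  obtain ⟨C, T, hT, hC, h⟩ := hF.rapid_decay hb hw (2 * k + 2)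
  obtain ⟨a, b', c, d, hdet, hc, hκ⟩ := hκ
  have hc' : 0 < ‖toC c‖ := norm_pos_iff.2 (by simpa [toC] using hc)
  have hT' : 0 < T := by linarith
  refine integrableOn_Ioi_zero (t₀ := (‖toC c‖ ^ 2 * T)⁻¹) (T := T)
    (B := ((‖toC c‖ ^ 2 * T)⁻¹) ^ m * (C * ‖toC c‖ ^ (2 * k + 2))) (C := C) (by positivity) hT'
    (((Complex.continuous_ofReal.pow m).continuousOn).mul
      (continuousOn_vertical (hF.smooth n hn).continuousOn κ)) ?_ ?_
  · intro t ht htt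
    rw [norm_mul, norm_pow, Complex.norm_real, Real.norm_of_nonneg ht.le]
    refine mul_le_mul (pow_le_pow_left₀ ht.le htt m) ?_ (norm_nonneg _) (by positivity)
    have hs : T ≤ (‖toC c‖ ^ 2 * t)⁻¹ := by
      rw [le_inv_comm₀ hT' (by positivity)]
      calc ‖toC c‖ ^ 2 * t ≤ ‖toC c‖ ^ 2 * (‖toC c‖ ^ 2 * T)⁻¹ := by gcongr
        _ = T⁻¹ := by field_simp
    rw [hF.apply_near_cusp hdet hc hκ ht hn, norm_mul, norm_mul]
    simp only [norm_pow, norm_inv, norm_neg, norm_mul, RCLike.norm_conj, Complex.norm_real,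
      Real.norm_of_nonneg ht.le]
    rw [← pow_add, Nat.add_sub_cancel' hn]
    calc (‖toC c‖ * t)⁻¹ ^ (2 * k + 2) *
          ‖coef k (2 * k + 2 - n) (F (toC a / toC c, (‖toC c‖ ^ 2 * t)⁻¹))‖
        ≤ (‖toC c‖ * t)⁻¹ ^ (2 * k + 2) * (C * (((‖toC c‖ ^ 2 * t)⁻¹) ^ (2 * k + 2))⁻¹) := by
          gcongr
          exact h _ (by omega) _ _ hs
      _ = C * ((‖toC c‖ * t)⁻¹ * (‖toC c‖ ^ 2 * t)) ^ (2 * k + 2) := by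
          rw [inv_pow (‖toC c‖ ^ 2 * t), inv_inv, mul_pow]; ring
      _ = C * ‖toC c‖ ^ (2 * k + 2) := by congr 2; field_simp
  · intro t ht
    have ht1 : 1 ≤ t := hT.trans ht
    rw [norm_mul, norm_pow, Complex.norm_real, Real.norm_of_nonneg (by linarith)]
    calc t ^ m * ‖coef k n (F (κ, t))‖ ≤ t ^ (2 * k) * (C * (t ^ (2 * k + 2))⁻¹) :=
          mul_le_mul (pow_le_pow_right₀ ht1 hm) (h n hn κ t ht) (norm_nonneg _) (by positivity)
      _ = C * (t ^ 2)⁻¹ := by rw [pow_add]; field_simp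

/-- The integral of the differential form over the geodesic from `κ` to `∞`. -/
def linePeriod (k : ℕ) (F : ℂ × ℝ → MvPolynomial (Fin 2) ℂ) (v u : Fin 2 → ℂ) (κ : ℂ) : ℂ :=
  ∫ t in Set.Ioi (0 : ℝ), formComp k F v u 1 (κ, t)

lemma formComp_one_vertical (v u : Fin 2 → ℂ) (κ : ℂ) (t : ℝ) :
    formComp k F v u 1 (κ, t) = ∑ i ∈ Finset.range (k + 1), ∑ j ∈ Finset.range (k + 1),
      (k.choose i * ((v 0 - κ * v 1) ^ (k - i) * v 1 ^ i) *
        (k.choose j * ((u 0 - conj κ * u 1) ^ (k - j) * (-u 1) ^ j)) *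
        ((2 * k + 2).choose (k + 1 + i - j) : ℂ)⁻¹) *
      ((t : ℂ) ^ (i + j) * coef k (k + 1 + i - j) (F (κ, t))) := by
  refine Finset.sum_congr rfl fun i _ => Finset.sum_congr rfl fun j _ => ?_
  simp only [eTerm, fTerm, ncoef, ← mul_neg, mul_pow, pow_add]
  ring

lemma IsCuspForm.integrableOn_formComp_one (hF : IsCuspForm D k F) {b : OK D}
    (hb : toC b = omega D) (hw : (omega D).im ≠ 0) {κ : ℂ} (hκ : IsFiniteCusp D κ)
    (v u : Fin 2 → ℂ) :
    IntegrableOn (fun t : ℝ => formComp k F v u 1 (κ, t)) (Set.Ioi 0) := by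
  simp only [formComp_one_vertical]
  refine integrable_finsetSum _ fun i hi => integrable_finsetSum _ fun j hj => ?_
  rw [Finset.mem_range] at hi hj
  exact (hF.integrableOn_pow_mul_coef hb hw hκ (by omega) (by omega)).const_mul _

/-- The factor `2 (-1)^{k+1}` and the signs `(-1)^j` of `fTerm` produce the normalization of
`c_{i,j}`. -/
lemma IsCuspForm.linePeriod_eq_sum (hF : IsCuspForm D k F) {b : OK D}
    (hb : toC b = omega D) (hw : (omega D).im ≠ 0) {κ : ℂ} (hκ : IsFiniteCusp D κ)
    (v u : Fin 2 → ℂ) :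
    2 * (-1) ^ (k + 1) * linePeriod k F v u κ =
      ∑ i ∈ Finset.range (k + 1), ∑ j ∈ Finset.range (k + 1),
        k.choose i * k.choose j * cPeriod k i j κ F * ((v 0 - κ * v 1) ^ (k - i) * v 1 ^ i) *
          ((u 0 - conj κ * u 1) ^ (k - j) * u 1 ^ j) := by
  simp only [linePeriod, formComp_one_vertical]
  have hint : ∀ (a : ℂ), ∀ i ∈ Finset.range (k + 1), ∀ j ∈ Finset.range (k + 1),
      IntegrableOn (fun t : ℝ => a * ((t : ℂ) ^ (i + j) * coef k (k + 1 + i - j) (F (κ, t))))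
        (Set.Ioi 0) := fun a i hi j hj => by
    rw [Finset.mem_range] at hi hj
    exact (hF.integrableOn_pow_mul_coef hb hw hκ (by omega) (by omega)).const_mul _
  rw [integral_finsetSum _ fun i hi => integrable_finsetSum _ fun j hj => hint _ i hi j hj,
    Finset.mul_sum]
  refine Finset.sum_congr rfl fun i hi => ?_
  rw [integral_finsetSum _ fun j hj => hint _ i hi j hj, Finset.mul_sum]
  refine Finset.sum_congr rfl fun j hj => ?_
  rw [integral_const_mul, cPeriod, neg_pow (u 1) j]
  simp only [periodIntegrand]
  ring

/-- The fundamental theorem of calculus on `(0, ∞)`, the primitive being zero at infinity. Its value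
at `t = 0` carries no information and is replaced by the limit `L`. -/
lemma IsCuspForm.linePeriod_eq_neg (hF : IsCuspForm D k F) {b : OK D}
    (hb : toC b = omega D) (hw : (omega D).im ≠ 0) {κ : ℂ} (hκ : IsFiniteCusp D κ)
    {v u : Fin 2 → ℂ} {G : ℂ × ℝ → ℂ} (hG : IsPeriodPrimitive k F v u G) {L : ℂ}
    (hL : Tendsto (fun t => G (κ, t)) (𝓝[>] 0) (𝓝 L)) : linePeriod k F v u κ = -L := by
  have h := integral_Ioi_of_hasDerivAt_of_tendsto
    (f := Function.update (fun t => G (κ, t)) 0 L) (a := 0) (m := 0)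
    (f' := fun t => formComp k F v u 1 (κ, t)) ?_ (fun t ht => ?_)
    (hF.integrableOn_formComp_one hb hw hκ v u) ?_
  · rw [linePeriod, h]; simp
  · rw [← continuousWithinAt_Ioi_iff_Ici, ContinuousWithinAt, Function.update_self]
    refine hL.congr' ?_
    filter_upwards [self_mem_nhdsWithin] with t ht
    rw [Function.update_of_ne (ne_of_gt ht)]
  · refine (hasDerivAt_vertical hG.1 κ ht).congr_of_eventuallyEq ?_
    filter_upwards [Ioi_mem_nhds ht] with s hs
    rw [Function.update_of_ne (ne_of_gt hs)]
  · refine (hG.2 κ).congr' ?_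
    filter_upwards [eventually_gt_atTop 0] with s hs
    rw [Function.update_of_ne (ne_of_gt hs)]

end

section

open MeasureTheory Filter Topology

/-! ### The line periods along a continued fraction -/

variable {D k : ℕ} {F : ℂ × ℝ → MvPolynomial (Fin 2) ℂ}

lemma ofReal_norm_sq (z : ℂ) : ((‖z‖ : ℂ)) ^ 2 = z * conj z := (Complex.mul_conj' z).symm

/-- The matrix on the right is the product with the matrix `(0 -1; 1 0)` of the inversion. -/
lemma act_inv3 (a b c d : ℂ) {x : ℂ × ℝ} (hx : x ∈ H3) :
    act !![a, b; c, d] (inv3 x) = act !![b, -a; d, -c] x := by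
  obtain ⟨z, t⟩ := x
  have ht : 0 < t := hx
  have hn : 0 < ‖z‖ ^ 2 + t ^ 2 := by positivity
  obtain ⟨n, hnC⟩ : ∃ n : ℂ, ((‖z‖ ^ 2 + t ^ 2 : ℝ) : ℂ) = n := ⟨_, rfl⟩
  have hn0 : n ≠ 0 := by rw [← hnC]; exact_mod_cast hn.ne'
  have e : z * conj z + (t : ℂ) ^ 2 = n := by rw [← hnC, ← ofReal_norm_sq]; push_cast; rfl
  have hden : ‖c * (inv3 (z, t)).1 + d‖ ^ 2 + ‖c‖ ^ 2 * (inv3 (z, t)).2 ^ 2 =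
      (‖d * z + -c‖ ^ 2 + ‖d‖ ^ 2 * t ^ 2) / (‖z‖ ^ 2 + t ^ 2) := by
    have hnbar : conj n = n := by rw [← hnC, Complex.conj_ofReal]
    apply Complex.ofReal_injective
    rw [Complex.ofReal_div, hnC]
    push_cast
    simp only [inv3, ofReal_norm_sq, map_add, map_mul, map_neg, Complex.ofReal_div, hnC, map_div₀,
      Complex.conj_conj, hnbar]
    field_simp
    linear_combination (c * conj c - n * d * conj d) * e
  simp only [act, Matrix.of_apply, Matrix.cons_val', Matrix.cons_val_zero, Matrix.cons_val_one,
    Matrix.cons_val_fin_one, Matrix.det_fin_two_of, hden]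
  ext1
  · have hnbar : conj n = n := by rw [← hnC, Complex.conj_ofReal]
    simp only [Complex.ofReal_div, div_div_eq_mul_div]
    congr 1
    simp only [inv3, map_add, map_mul, map_neg, Complex.ofReal_div, hnC, map_div₀,
      Complex.conj_conj, hnbar]
    field_simp
    linear_combination (a * conj c - n * b * conj d) * e
  · simp only [inv3]
    rw [show b * -c - -a * d = a * d - b * c by ring, div_div_eq_mul_div]
    congr 1
    field_simp

lemma act_add (a b c d e : ℂ) (x : ℂ × ℝ) :
    act !![a, b; c, d] (x.1 + e, x.2) = act !![a, a * e + b; c, c * e + d] x := by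
  simp only [act, Matrix.of_apply, Matrix.cons_val', Matrix.cons_val_zero, Matrix.cons_val_one,
    Matrix.cons_val_fin_one, Matrix.det_fin_two_of]
  rw [show a * (x.1 + e) + b = a * x.1 + (a * e + b) by ring,
    show c * (x.1 + e) + d = c * x.1 + (c * e + d) by ring,
    show a * (c * e + d) - (a * e + b) * c = a * d - b * c by ring]

lemma act_neg (g : Matrix (Fin 2) (Fin 2) ℂ) (x : ℂ × ℝ) : act (-g) x = act g x := by
  simp only [act, Matrix.neg_apply, Matrix.det_neg, norm_neg]
  rw [show -g 0 0 * x.1 + -g 0 1 = -(g 0 0 * x.1 + g 0 1) by ring,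
    show -g 1 0 * x.1 + -g 1 1 = -(g 1 0 * x.1 + g 1 1) by ring]
  simp only [map_neg, neg_mul_neg, norm_neg, norm_mul, norm_pow, norm_one, one_pow, one_mul]

/-- The `l`-th matrix of the convergents. -/
def cfMatrix (μ ν : ℕ → ℂ) (l : ℕ) : Matrix (Fin 2) (Fin 2) ℂ :=
  !![(-1) ^ l * μ l, μ (l + 1); (-1) ^ l * ν l, ν (l + 1)]

/-- The image of `w` under the inverse of the `l`-th matrix of the convergents. -/
def cfVec (μ ν : ℕ → ℂ) (l : ℕ) (w : Fin 2 → ℂ) : Fin 2 → ℂ :=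
  ![ν (l + 1) * w 0 - μ (l + 1) * w 1, (-1) ^ l * (μ l * w 1 - ν l * w 0)]

/-- `μ` and `ν` are the numerators and denominators of a continued fraction with digits `β`. -/
structure IsConvergents (β μ ν : ℕ → ℂ) : Prop where
  num_zero : μ 0 = 1
  num_one : μ 1 = β 0
  num_add_two : ∀ l, μ (l + 2) = β (l + 1) * μ (l + 1) + μ l
  den_zero : ν 0 = 0
  den_one : ν 1 = 1
  den_add_two : ∀ l, ν (l + 2) = β (l + 1) * ν (l + 1) + ν l

lemma isConvergents_num_den (ρ : ℂ → OK D) (κ : ℂ) :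
    IsConvergents (fun l => toC (digit ρ κ l)) (fun l => toC (num ρ κ l))
      (fun l => toC (den ρ κ l)) :=
  ⟨by simp [num, toC], by simp [num], fun l => by simp [num, toC], by simp [den, toC],
    by simp [den, toC], fun l => by simp [den, toC]⟩

lemma IsConvergents.conj {β μ ν : ℕ → ℂ} (h : IsConvergents β μ ν) :
    IsConvergents (fun l => conj (β l)) (fun l => conj (μ l)) (fun l => conj (ν l)) :=
  ⟨by simp [h.num_zero], by simp [h.num_one], fun l => by simp [h.num_add_two],
    by simp [h.den_zero], by simp [h.den_one], fun l => by simp [h.den_add_two]⟩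

/-- The sign `(-1)^l` is the one built into `cfMatrix`, which therefore has determinant one. -/
lemma IsConvergents.det {β μ ν : ℕ → ℂ} (h : IsConvergents β μ ν) (l : ℕ) :
    (-1) ^ l * (μ l * ν (l + 1) - μ (l + 1) * ν l) = 1 := by
  induction l with
  | zero => simp [h.num_zero, h.den_one, h.den_zero]
  | succ l ih => rw [h.num_add_two, h.den_add_two, pow_succ]; linear_combination ih

/-- Up to a sign, which acts trivially, the next matrix is the present one times the inversion and
the translation by `(-1)^{l+1} β_{l+1}`; this is the recursion of the convergents. -/
lemma IsConvergents.act_cfMatrix_succ {β μ ν : ℕ → ℂ} (h : IsConvergents β μ ν) (l : ℕ)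
    {x : ℂ × ℝ} (hx : x ∈ H3) :
    act (cfMatrix μ ν (l + 1)) x =
      act (cfMatrix μ ν l) (inv3 (x.1 + (-1) ^ (l + 1) * β (l + 1), x.2)) := by
  rw [cfMatrix, cfMatrix, act_inv3 _ _ _ _ (x := (x.1 + (-1) ^ (l + 1) * β (l + 1), x.2)) hx, act_add,
    h.num_add_two, h.den_add_two]
  rcases neg_one_pow_eq_or ℂ l with e | e
  · rw [← act_neg, pow_succ, e]
    congr 1
    ext i j
    fin_cases i <;> fin_cases j <;> simp <;> ring
  · rw [pow_succ, e]
    congr 1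
    ext i j
    fin_cases i <;> fin_cases j <;> simp <;> ring

/-- The same recursion for the inverse matrices acting on vectors. Here the sign is visible;
`smul_neg_one_pow` removes it from the forms. -/
lemma IsConvergents.cfVec_succ {β μ ν : ℕ → ℂ} (h : IsConvergents β μ ν) (l : ℕ)
    (w : Fin 2 → ℂ) : cfVec μ ν (l + 1) w = (-1 : ℂ) ^ (l + 1) •
      ![cfVec μ ν l w 1 + (-1) ^ (l + 1) * β (l + 1) * cfVec μ ν l w 0, -cfVec μ ν l w 0] := by
  have e : (-1 : ℂ) ^ l * (-1) ^ l = 1 := by rw [← mul_pow]; simp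
  ext i
  fin_cases i
  · simp [cfVec, h.num_add_two, h.den_add_two, pow_succ]
    linear_combination (-(ν l * w 0 - μ l * w 1) - β (l + 1) *
      (ν (l + 1) * w 0 - μ (l + 1) * w 1)) * e
  · simp [cfVec, pow_succ]

lemma shear_neg (b : ℂ) (v : Fin 2 → ℂ) : shear b ![v 1 - b * -v 0, -v 0] = ![v 1, -v 0] := by
  ext i; fin_cases i <;> simp [shear]

lemma rot_rotInv (v : Fin 2 → ℂ) : rot ![v 1, -v 0] = v := by
  ext i; fin_cases i <;> simp [rot]

lemma IsPeriodPrimitive.smul_neg_one_pow {v u : Fin 2 → ℂ} {G : ℂ × ℝ → ℂ}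
    (h : IsPeriodPrimitive k F v u G) (l : ℕ) :
    IsPeriodPrimitive k F ((-1 : ℂ) ^ l • v) ((-1 : ℂ) ^ l • u) G := by
  rcases neg_one_pow_eq_or ℂ l with e | e
  · rwa [e, one_smul, one_smul]
  · rw [e, neg_one_smul, neg_one_smul]
    exact ⟨fun x hx => by rw [periodForm_neg]; exact h.1 x hx, h.2⟩

/-- The constant of `exists_const_inv3` is a boundary value at the cusp `0`, which is minus the
integral of the form over the geodesic from `0` to `∞`. -/
lemma IsCuspForm.exists_primitive_inv3 (hF : IsCuspForm D k F) {b : OK D}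
    (hb : toC b = omega D) (hw : (omega D).im ≠ 0) {v u : Fin 2 → ℂ} {G : ℂ × ℝ → ℂ}
    (hG : IsPeriodPrimitive k F v u G) : ∃ G', IsPeriodPrimitive k F ![v 1, -v 0] ![u 1, -u 0] G' ∧
      ∀ x ∈ H3, G (inv3 x) = G' x - linePeriod k F v u 0 := by
  obtain ⟨G', hG'⟩ := hF.exists_isPeriodPrimitive hb hw ![v 1, -v 0] ![u 1, -u 0]
  obtain ⟨c, hc, hlim⟩ := hG'.exists_const_inv3 hF (by rwa [rot_rotInv, rot_rotInv])
  refine ⟨G', hG', fun x hx => ?_⟩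
  rw [hc x hx, hF.linePeriod_eq_neg hb hw (isFiniteCusp_zero D) hG hlim, sub_neg_eq_add]

variable {β : ℕ → OK D} {μ ν : ℕ → ℂ}

/-- Writing the matrix as a word in translations and inversions, each translation carries a
normalized primitive to a normalized primitive, and each of the `l` inversions costs one integral
over `(0, ∞)`, with parameters moved by the inverse of the matrix reached so far. -/
lemma IsCuspForm.primitive_cfMatrix (hF : IsCuspForm D k F) {b : OK D}
    (hb : toC b = omega D) (hw : (omega D).im ≠ 0)
    (h : IsConvergents (fun l => toC (β l)) μ ν) {w y : Fin 2 → ℂ} {G : ℂ × ℝ → ℂ}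
    (hG : IsPeriodPrimitive k F w y G) (l : ℕ) :
    ∀ G', IsPeriodPrimitive k F (cfVec μ ν l w)
      (cfVec (fun l => conj (μ l)) (fun l => conj (ν l)) l y) G' → ∀ x ∈ H3,
      G (act (cfMatrix μ ν l) x) = G' x - ∑ i ∈ Finset.range l, linePeriod k F (cfVec μ ν i w)
        (cfVec (fun l => conj (μ l)) (fun l => conj (ν l)) i y) 0 := by
  induction l with
  | zero =>
    intro G' hG' x hx
    have e : act (cfMatrix μ ν 0) x = (x.1 + toC (β 0), x.2) := by
      simp [cfMatrix, h.num_zero, h.num_one, h.den_zero, h.den_one, act_translation]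
    have h1 : IsPeriodPrimitive k F (cfVec μ ν 0 w)
        (cfVec (fun l => conj (μ l)) (fun l => conj (ν l)) 0 y)
        (fun x => G (x.1 + toC (β 0), x.2)) := by
      refine IsPeriodPrimitive.translate hF (β 0) ?_
      convert hG using 1 <;> ext i <;> fin_cases i <;>
        simp [shear, cfVec, h.num_zero, h.num_one, h.den_zero, h.den_one]
    rw [e, Finset.sum_range_zero, sub_zero]
    exact hG'.unique h1 hx
  | succ l ih =>
    intro G' hG' x hx
    obtain ⟨G₁, hG₁⟩ := hF.exists_isPeriodPrimitive hb hw (cfVec μ ν l w)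
      (cfVec (fun l => conj (μ l)) (fun l => conj (ν l)) l y)
    obtain ⟨G₂, hG₂, h2⟩ := hF.exists_primitive_inv3 hb hw hG₁
    have hsgn : toC ((-1) ^ (l + 1) * β (l + 1)) = (-1) ^ (l + 1) * toC (β (l + 1)) := by
      simp [toC]
    have hx' : ((x.1 + (-1) ^ (l + 1) * toC (β (l + 1)), x.2) : ℂ × ℝ) ∈ H3 := hx
    rw [h.act_cfMatrix_succ l hx, ih G₁ hG₁ _ (inv3_mem hx'), h2 _ hx', Finset.sum_range_succ]
    have h3 : ∀ v u : Fin 2 → ℂ, IsPeriodPrimitive k F ![v 1, -v 0] ![u 1, -u 0] G₂ →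
        IsPeriodPrimitive k F
          ((-1 : ℂ) ^ (l + 1) • ![v 1 - toC ((-1) ^ (l + 1) * β (l + 1)) * -v 0, -v 0])
          ((-1 : ℂ) ^ (l + 1) • ![u 1 - conj (toC ((-1) ^ (l + 1) * β (l + 1))) * -u 0, -u 0])
          (fun x => G₂ (x.1 + toC ((-1) ^ (l + 1) * β (l + 1)), x.2)) := fun v u h =>
      (IsPeriodPrimitive.translate hF _ (by rwa [shear_neg, shear_neg])).smul_neg_one_pow _
    have h4 : G' x = G₂ (x.1 + (-1) ^ (l + 1) * toC (β (l + 1)), x.2) := by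
      rw [← hsgn]
      refine IsPeriodPrimitive.unique (h3 _ _ hG₂) ?_ hx
      convert hG' using 1
      · rw [h.cfVec_succ, hsgn]; simp [sub_eq_add_neg]
      · rw [h.conj.cfVec_succ, hsgn]; simp [sub_eq_add_neg]
    rw [h4]
    ring

/-- The boundary value of `G` at `κ` is computed on the other side of one more inversion. There the
geodesic ending at `κ` is a vertical line running to infinity, where the primitive vanishes, so only
the `m + 1` collected constants remain. -/
lemma IsCuspForm.linePeriod_eq_sum_convergents (hF : IsCuspForm D k F) {b : OK D}
    (hb : toC b = omega D) (hw : (omega D).im ≠ 0)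
    (h : IsConvergents (fun l => toC (β l)) μ ν) {κ : ℂ} (hκ : IsFiniteCusp D κ) {m : ℕ}
    (hm : ν (m + 1) ≠ 0) (hκm : κ = μ (m + 1) / ν (m + 1)) (w y : Fin 2 → ℂ) :
    linePeriod k F w y κ = ∑ l ∈ Finset.range (m + 1), linePeriod k F (cfVec μ ν l w)
        (cfVec (fun l => conj (μ l)) (fun l => conj (ν l)) l y) 0 := by
  obtain ⟨G, hG⟩ := hF.exists_isPeriodPrimitive hb hw w y
  obtain ⟨G₁, hG₁⟩ := hF.exists_isPeriodPrimitive hb hw (cfVec μ ν m w)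
    (cfVec (fun l => conj (μ l)) (fun l => conj (ν l)) m y)
  obtain ⟨G₂, hG₂, h2⟩ := hF.exists_primitive_inv3 hb hw hG₁
  -- The point sent to infinity by the `m`-th matrix times the inversion, namely the root of
  -- `ν_{m+1} z - (-1)^m ν_m` in the shifted indexing. Above it the height `1/(|ν_{m+1}|² t)` is
  -- mapped to `t`.
  set z : ℂ := (-1) ^ m * ν m / ν (m + 1)
  have hν : 0 < ‖ν (m + 1)‖ := norm_pos_iff.2 hm
  have hact : ∀ t > 0, act (cfMatrix μ ν m) (inv3 (z, (‖ν (m + 1)‖ ^ 2 * t)⁻¹)) = (κ, t) := by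
    intro t ht
    have hdet : μ (m + 1) * -((-1) ^ m * ν m) - -((-1) ^ m * μ m) * ν (m + 1) = 1 := by
      linear_combination h.det m
    have hz : ν (m + 1) * z + -((-1) ^ m * ν m) = 0 := by
      simp only [z]; field_simp; ring
    rw [cfMatrix, act_inv3 _ _ _ _ (show (0 : ℝ) < (‖ν (m + 1)‖ ^ 2 * t)⁻¹ by positivity)]
    simp only [act, Matrix.of_apply, Matrix.cons_val', Matrix.cons_val_zero, Matrix.cons_val_one,
      Matrix.cons_val_fin_one, Matrix.det_fin_two_of, hdet, hz, map_zero, mul_zero, norm_zero,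
      norm_one]
    have hνC : (‖ν (m + 1)‖ : ℂ) ≠ 0 := by exact_mod_cast hν.ne'
    have htC : (t : ℂ) ≠ 0 := by exact_mod_cast ht.ne'
    ext1
    · rw [hκm]
      push_cast
      rw [div_eq_div_iff _ hm]
      · linear_combination ((‖ν (m + 1)‖ : ℂ) ^ 2 * t)⁻¹ ^ 2 * (-μ (m + 1)) *
          (ofReal_norm_sq (ν (m + 1)))
      · simp [hνC, htC]
    · field_simp
      ring
  have hlim : Tendsto (fun t => G (κ, t)) (𝓝[>] 0) (𝓝 (-∑ l ∈ Finset.range (m + 1),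
      linePeriod k F (cfVec μ ν l w)
        (cfVec (fun l => conj (μ l)) (fun l => conj (ν l)) l y) 0)) := by
    have h1 : Tendsto (fun t : ℝ => (‖ν (m + 1)‖ ^ 2 * t)⁻¹) (𝓝[>] 0) atTop := by
      simp only [mul_inv]
      exact tendsto_inv_nhdsGT_zero.const_mul_atTop (by positivity)
    have h3 := ((hG₂.2 z).comp h1).sub_const (∑ l ∈ Finset.range (m + 1),
      linePeriod k F (cfVec μ ν l w) (cfVec (fun l => conj (μ l)) (fun l => conj (ν l)) l y) 0)
    rw [zero_sub] at h3
    refine h3.congr' ?_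
    filter_upwards [self_mem_nhdsWithin] with t ht
    have ht' : (0 : ℝ) < t := ht
    have hz : ((z, (‖ν (m + 1)‖ ^ 2 * t)⁻¹) : ℂ × ℝ) ∈ H3 :=
      show (0 : ℝ) < (‖ν (m + 1)‖ ^ 2 * t)⁻¹ by positivity
    rw [← hact t ht, hF.primitive_cfMatrix hb hw h hG m G₁ hG₁ _ (inv3_mem hz), h2 _ hz,
      Finset.sum_range_succ, Function.comp_apply]
    ring
  rw [hF.linePeriod_eq_neg hb hw hκ hG hlim, neg_neg]

end

section

/-! ### Extraction of the periods -/

variable {D k : ℕ} {F : ℂ × ℝ → MvPolynomial (Fin 2) ℂ}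

lemma eq_of_sum_pow_pow_eq {N : ℕ} {c d : ℕ → ℕ → ℂ}
    (h : ∀ x y : ℂ, ∑ p ∈ Finset.range N, ∑ q ∈ Finset.range N, c p q * (x ^ p * y ^ q) =
      ∑ p ∈ Finset.range N, ∑ q ∈ Finset.range N, d p q * (x ^ p * y ^ q))
    {p q : ℕ} (hp : p < N) (hq : q < N) : c p q = d p q := by
  refine eq_of_sum_pow_eq (c := c p) (d := d p) (fun y => ?_) hq
  refine eq_of_sum_pow_eq (c := fun p => ∑ q ∈ Finset.range N, c p q * y ^ q)
    (d := fun p => ∑ q ∈ Finset.range N, d p q * y ^ q) (fun x => ?_) hp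
  have := h x y
  simp only [Finset.sum_mul]
  refine Eq.trans ?_ (this.trans ?_) <;>
    exact Finset.sum_congr rfl fun p _ => Finset.sum_congr rfl fun q _ => by ring

lemma choose_mul_shift_pow {i : ℕ} (hi : i ≤ k) (κ x y : ℂ) :
    (k.choose i : ℂ) * ((x - κ * y) ^ (k - i) * y ^ i) = ∑ p ∈ Finset.range (k + 1),
      (k.choose p : ℂ) * (p.choose i * (-κ) ^ (p - i)) * (x ^ (k - p) * y ^ p) := by
  rw [show k + 1 = i + (k - i + 1) by omega, Finset.sum_range_add,
    Finset.sum_eq_zero fun p hp => by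
      rw [Nat.choose_eq_zero_of_lt (Finset.mem_range.1 hp)]; simp, zero_add,
    show x - κ * y = -κ * y + x by ring, add_pow, Finset.sum_mul, Finset.mul_sum]
  refine Finset.sum_congr rfl fun m hm => ?_
  have h := Nat.choose_mul (n := k) (k := i + m) (s := i) (by omega)
  rw [Nat.add_sub_cancel_left] at h
  have h' : (k.choose (i + m) : ℂ) * (i + m).choose i = k.choose i * (k - i).choose m := by
    exact_mod_cast h
  rw [Nat.add_sub_cancel_left, Nat.sub_sub, mul_pow, pow_add]
  linear_combination (-((-κ) ^ m * y ^ m * x ^ (k - (i + m)) * y ^ i)) * h'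

lemma coeff_linear_pow (α β : ℂ) (n u : ℕ) :
    ((Polynomial.C α * Polynomial.X + Polynomial.C β) ^ n).coeff u =
      n.choose u * α ^ u * β ^ (n - u) := by
  have h : (Polynomial.C α * Polynomial.X + Polynomial.C β) ^ n =
      ((Polynomial.X + Polynomial.C β) ^ n).comp (Polynomial.C α * Polynomial.X) := by simp
  rw [h, Polynomial.comp_C_mul_X_coeff, Polynomial.coeff_X_add_C_pow]
  ring

lemma coeff_linear_pow_mul_linear_pow {p i : ℕ} (a b c d : ℂ) :
    ((Polynomial.C a * Polynomial.X + Polynomial.C (-b)) ^ p *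
      (Polynomial.C (-c) * Polynomial.X + Polynomial.C d) ^ (k - p)).coeff i =
      (-1) ^ (p + i) * halfCoeff k p i a b c d := by
  rw [Polynomial.coeff_mul, Finset.Nat.sum_antidiagonal_eq_sum_range_succ_mk, halfCoeff,
    Finset.mul_sum]
  symm
  -- The full convolution runs to `i`, while `halfCoeff` stops at `min p i`; the additional terms
  -- contain `binom(p,u)` with `u > p`.
  refine Finset.sum_subset_zero_on_sdiff (Finset.range_subset_range.2 (by omega)) ?_ ?_
  · intro u hu
    simp only [Finset.mem_sdiff, Finset.mem_range] at hu
    rw [coeff_linear_pow, Nat.choose_eq_zero_of_lt (by omega)]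
    simp
  · intro u hu
    rw [Finset.mem_range] at hu
    have e : (-1 : ℂ) ^ (p + i) = (-1) ^ (p - u) * (-1) ^ (i - u) := by
      rw [← pow_add, show p + i = (p - u + (i - u)) + 2 * u by omega, pow_add, pow_mul]
      simp
    rw [coeff_linear_pow, coeff_linear_pow, neg_pow b, neg_pow c, e]
    ring

/-- Both sides are the coefficient of `T^i` in `((ay - cx) T + (dx - by))^k`, which is also `(y (aT
- b) + x (d - cT))^k` and can be expanded in powers of `x` and `y`. -/
lemma choose_mul_linear_pow (i : ℕ) (a b c d x y : ℂ) :
    (k.choose i : ℂ) * ((d * x - b * y) ^ (k - i) * (a * y - c * x) ^ i) =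
      ∑ p ∈ Finset.range (k + 1), (k.choose p : ℂ) * ((-1) ^ (p + i) * halfCoeff k p i a b c d) *
        (x ^ (k - p) * y ^ p) := by
  have h : (Polynomial.C (a * y - c * x) * Polynomial.X + Polynomial.C (d * x - b * y)) ^ k =
      ∑ p ∈ Finset.range (k + 1), Polynomial.C ((k.choose p : ℂ) * (x ^ (k - p) * y ^ p)) *
        ((Polynomial.C a * Polynomial.X + Polynomial.C (-b)) ^ p *
          (Polynomial.C (-c) * Polynomial.X + Polynomial.C d) ^ (k - p)) := by
    rw [show Polynomial.C (a * y - c * x) * Polynomial.X + Polynomial.C (d * x - b * y) =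
      Polynomial.C y * (Polynomial.C a * Polynomial.X + Polynomial.C (-b)) +
        Polynomial.C x * (Polynomial.C (-c) * Polynomial.X + Polynomial.C d) by
      simp only [Polynomial.C_sub, Polynomial.C_mul, Polynomial.C_neg]; ring, add_pow]
    refine Finset.sum_congr rfl fun p _ => ?_
    simp only [mul_pow, Polynomial.C_mul, Polynomial.C_pow]
    rw [← map_natCast (Polynomial.C : ℂ →+* Polynomial ℂ)]
    ring
  have h' := congrArg (fun P => Polynomial.coeff P i) h
  simp only [coeff_linear_pow, Polynomial.finsetSum_coeff, Polynomial.coeff_C_mul,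
    coeff_linear_pow_mul_linear_pow] at h'
  rw [mul_comm (_ ^ (k - i)), ← mul_assoc, h']
  refine Finset.sum_congr rfl fun p _ => ?_
  ring

lemma sum_bilinear {N : ℕ} {A A' B B' : ℕ → ℂ} {m m' : ℕ → ℕ → ℂ}
    (h : ∀ i < N, A i = ∑ p ∈ Finset.range N, m p i * B p)
    (h' : ∀ j < N, A' j = ∑ q ∈ Finset.range N, m' q j * B' q) (f : ℕ → ℕ → ℂ) :
    ∑ i ∈ Finset.range N, ∑ j ∈ Finset.range N, f i j * (A i * A' j) =
      ∑ p ∈ Finset.range N, ∑ q ∈ Finset.range N,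
        (∑ i ∈ Finset.range N, ∑ j ∈ Finset.range N, m p i * m' q j * f i j) * (B p * B' q) := by
  calc _ = ∑ i ∈ Finset.range N, ∑ j ∈ Finset.range N, ∑ p ∈ Finset.range N,
        ∑ q ∈ Finset.range N, m p i * m' q j * f i j * (B p * B' q) := by
        refine Finset.sum_congr rfl fun i hi => Finset.sum_congr rfl fun j hj => ?_
        rw [h i (Finset.mem_range.1 hi), h' j (Finset.mem_range.1 hj), Finset.sum_mul_sum,
          Finset.mul_sum]
        refine Finset.sum_congr rfl fun p _ => ?_
        rw [Finset.mul_sum]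
        refine Finset.sum_congr rfl fun q _ => ?_
        ring
    _ = ∑ p ∈ Finset.range N, ∑ q ∈ Finset.range N, ∑ i ∈ Finset.range N,
        ∑ j ∈ Finset.range N, m p i * m' q j * f i j * (B p * B' q) := by
        rw [Finset.sum_congr rfl fun i _ => Finset.sum_comm, Finset.sum_comm]
        refine Finset.sum_congr rfl fun p _ => ?_
        rw [Finset.sum_congr rfl fun i _ => Finset.sum_comm, Finset.sum_comm]
    _ = _ := by simp only [Finset.sum_mul]

lemma sum_range_succ_choose {p : ℕ} (hp : p ≤ k) (f : ℕ → ℂ) (hf : ∀ i, p < i → f i = 0) :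
    ∑ i ∈ Finset.range (p + 1), f i = ∑ i ∈ Finset.range (k + 1), f i :=
  Finset.sum_subset (Finset.range_subset_range.2 (by omega)) fun i _ hi =>
    hf i (by simpa using hi)

lemma period_eq_sum {p q : ℕ} (hp : p ≤ k) (hq : q ≤ k) (κ : ℂ) :
    period k p q κ F = ∑ i ∈ Finset.range (k + 1), ∑ j ∈ Finset.range (k + 1),
      (p.choose i * (-κ) ^ (p - i)) * (q.choose j * (-conj κ) ^ (q - j)) * cPeriod k i j κ F := by
  rw [period, sum_range_succ_choose hp _ fun i hi => by rw [Nat.choose_eq_zero_of_lt hi]; simp]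
  refine Finset.sum_congr rfl fun i _ => ?_
  rw [sum_range_succ_choose hq _ fun i hi => by rw [Nat.choose_eq_zero_of_lt hi]; simp]
  refine Finset.sum_congr rfl fun j _ => ?_
  rw [neg_pow κ, neg_pow (conj κ), pow_add]
  ring

lemma period_zero {p q : ℕ} : period k p q 0 F = cPeriod k p q 0 F := by
  rw [period, Finset.sum_range_succ, Finset.sum_eq_zero, zero_add, Finset.sum_range_succ,
    Finset.sum_eq_zero]
  · simp
  · intro j hj
    rw [Finset.mem_range] at hj
    simp [zero_pow (Nat.sub_ne_zero_of_lt hj)]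
  · intro i hi
    rw [Finset.mem_range] at hi
    simp [zero_pow (Nat.sub_ne_zero_of_lt hi)]

/-- The `r_{p,q}(κ, F)` are, up to binomial coefficients, the coefficients of the line integral as a
polynomial in `v` and `u`: expanding the powers of `v₀ - κ v₁` and `u₀ - κ̄ u₁` produces the
binomial weights in their definition. -/
lemma IsCuspForm.linePeriod_eq_sum_period (hF : IsCuspForm D k F) {b : OK D}
    (hb : toC b = omega D) (hw : (omega D).im ≠ 0) {κ : ℂ} (hκ : IsFiniteCusp D κ)
    (v u : Fin 2 → ℂ) :
    2 * (-1) ^ (k + 1) * linePeriod k F v u κ =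
      ∑ p ∈ Finset.range (k + 1), ∑ q ∈ Finset.range (k + 1),
        k.choose p * k.choose q * period k p q κ F *
          ((v 0 ^ (k - p) * v 1 ^ p) * (u 0 ^ (k - q) * u 1 ^ q)) := by
  have h := sum_bilinear (N := k + 1)
    (A := fun i => (k.choose i : ℂ) * ((v 0 - κ * v 1) ^ (k - i) * v 1 ^ i))
    (A' := fun i => (k.choose i : ℂ) * ((u 0 - conj κ * u 1) ^ (k - i) * u 1 ^ i))
    (B := fun p => v 0 ^ (k - p) * v 1 ^ p) (B' := fun p => u 0 ^ (k - p) * u 1 ^ p)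
    (fun i hi => choose_mul_shift_pow (Nat.le_of_lt_succ hi) κ (v 0) (v 1))
    (fun i hi => choose_mul_shift_pow (Nat.le_of_lt_succ hi) (conj κ) (u 0) (u 1))
    (fun i j => cPeriod k i j κ F)
  rw [hF.linePeriod_eq_sum hb hw hκ]
  refine (Eq.trans ?_ h).trans ?_
  · refine Finset.sum_congr rfl fun i _ => Finset.sum_congr rfl fun j _ => ?_
    ring
  · refine Finset.sum_congr rfl fun p hp => Finset.sum_congr rfl fun q hq => ?_
    rw [Finset.mem_range] at hp hq
    rw [period_eq_sum (by omega) (by omega)]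
    simp only [Finset.mul_sum]
    congr 1
    refine Finset.sum_congr rfl fun i _ => Finset.sum_congr rfl fun j _ => ?_
    ring

lemma IsCuspForm.linePeriod_cfVec (hF : IsCuspForm D k F) {b : OK D}
    (hb : toC b = omega D) (hw : (omega D).im ≠ 0) (μ ν μ' ν' : ℕ → ℂ) (l : ℕ)
    (v u : Fin 2 → ℂ) :
    2 * (-1) ^ (k + 1) * linePeriod k F (cfVec μ ν l v) (cfVec μ' ν' l u) 0 =
      ∑ p ∈ Finset.range (k + 1), ∑ q ∈ Finset.range (k + 1),
        (∑ i ∈ Finset.range (k + 1), ∑ j ∈ Finset.range (k + 1),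
          (-1) ^ (p + q + i + j) *
          (halfCoeff k p i ((-1) ^ l * μ l) (μ (l + 1)) ((-1) ^ l * ν l) (ν (l + 1)) *
          halfCoeff k q j ((-1) ^ l * μ' l) (μ' (l + 1)) ((-1) ^ l * ν' l) (ν' (l + 1))) *
          period k i j 0 F) * k.choose p * k.choose q *
          ((v 0 ^ (k - p) * v 1 ^ p) * (u 0 ^ (k - q) * u 1 ^ q)) := by
  have h := sum_bilinear (N := k + 1)
    (B := fun p => v 0 ^ (k - p) * v 1 ^ p) (B' := fun p => u 0 ^ (k - p) * u 1 ^ p)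
    (fun i _ => choose_mul_linear_pow i ((-1) ^ l * μ l) (μ (l + 1))
      ((-1) ^ l * ν l) (ν (l + 1)) (v 0) (v 1))
    (fun i _ => choose_mul_linear_pow i ((-1) ^ l * μ' l) (μ' (l + 1))
      ((-1) ^ l * ν' l) (ν' (l + 1)) (u 0) (u 1))
    (fun i j => period k i j 0 F)
  rw [hF.linePeriod_eq_sum_period hb hw (isFiniteCusp_zero D)]
  refine (Eq.trans ?_ h).trans ?_
  · refine Finset.sum_congr rfl fun i _ => Finset.sum_congr rfl fun j _ => ?_
    simp only [cfVec, Matrix.cons_val_zero, Matrix.cons_val_one]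
    rw [mul_sub ((-1) ^ l), mul_sub ((-1) ^ l)]
    ring
  · refine Finset.sum_congr rfl fun p hp => Finset.sum_congr rfl fun q hq => ?_
    simp only [Finset.sum_mul]
    refine Finset.sum_congr rfl fun i _ => Finset.sum_congr rfl fun j _ => ?_
    ring

/-- The identity of line integrals is used at `v = (1, x)` and `u = (1, y)`. Keeping `u` independent
of `v`, instead of taking its conjugate, makes it an identity of polynomials in two variables, so
that coefficients can be compared. -/
lemma IsCuspForm.period_eq_sum_convergents (hF : IsCuspForm D k F) {b : OK D}
    (hb : toC b = omega D) (hw : (omega D).im ≠ 0) {β : ℕ → OK D} {μ ν : ℕ → ℂ}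
    (h : IsConvergents (fun l => toC (β l)) μ ν) {κ : ℂ} (hκ : IsFiniteCusp D κ) {m : ℕ}
    (hm : ν (m + 1) ≠ 0) (hκm : κ = μ (m + 1) / ν (m + 1)) {p q : ℕ} (hp : p ≤ k) (hq : q ≤ k) :
    period k p q κ F = ∑ l ∈ Finset.range (m + 1),
      ∑ i ∈ Finset.range (k + 1), ∑ j ∈ Finset.range (k + 1), (-1) ^ (p + q + i + j) *
        eCoeff k p q i j ((-1) ^ l * μ l) (μ (l + 1)) ((-1) ^ l * ν l) (ν (l + 1)) *
        period k i j 0 F := by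
  have key := eq_of_sum_pow_pow_eq (N := k + 1)
    (c := fun p q => k.choose p * k.choose q * period k p q κ F)
    (d := fun p q => k.choose p * k.choose q * ∑ l ∈ Finset.range (m + 1),
      ∑ i ∈ Finset.range (k + 1), ∑ j ∈ Finset.range (k + 1), (-1) ^ (p + q + i + j) *
        eCoeff k p q i j ((-1) ^ l * μ l) (μ (l + 1)) ((-1) ^ l * ν l) (ν (l + 1)) *
        period k i j 0 F) (fun x y => ?_) (Nat.lt_succ_of_le hp) (Nat.lt_succ_of_le hq)
  · have h1 : (k.choose p : ℂ) ≠ 0 := by exact_mod_cast (Nat.choose_pos hp).ne'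
    have h2 : (k.choose q : ℂ) ≠ 0 := by exact_mod_cast (Nat.choose_pos hq).ne'
    exact mul_left_cancel₀ (mul_ne_zero h1 h2) key
  · have h1 := hF.linePeriod_eq_sum_period hb hw hκ ![1, x] ![1, y]
    rw [hF.linePeriod_eq_sum_convergents hb hw h hκ hm hκm, Finset.mul_sum] at h1
    simp only [hF.linePeriod_cfVec hb hw] at h1
    simp only [Matrix.cons_val_zero, Matrix.cons_val_one, one_pow, one_mul] at h1
    rw [← h1, Finset.sum_comm]
    refine Finset.sum_congr rfl fun p _ => ?_
    rw [Finset.sum_comm]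
    refine Finset.sum_congr rfl fun q _ => ?_
    rw [Finset.mul_sum, Finset.sum_mul]
    refine Finset.sum_congr rfl fun l _ => ?_
    simp only [eCoeff, map_mul, map_pow, map_neg, map_one]
    ring

end

section

/-! ### Hurwitz continued fractions terminate -/

variable {D : ℕ}

lemma toC_injective : Function.Injective (toC : OK D → ℂ) := fun _ _ h =>
  NumberField.RingOfIntegers.coe_injective (Subtype.ext h)

lemma toC_add (a b : OK D) : toC (a + b) = toC a + toC b := by simp [toC]

lemma toC_sub (a b : OK D) : toC (a - b) = toC a - toC b := by simp [toC]

lemma toC_neg (a : OK D) : toC (-a) = -toC a := by simp [toC]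

lemma toC_mul (a b : OK D) : toC (a * b) = toC a * toC b := by simp [toC]

lemma toC_pow (a : OK D) (n : ℕ) : toC (a ^ n) = toC a ^ n := by simp [toC]

lemma toC_zero : toC (0 : OK D) = 0 := by simp [toC]

lemma toC_ne_zero {a : OK D} (ha : a ≠ 0) : toC a ≠ 0 := fun h =>
  ha (toC_injective (h.trans toC_zero.symm))

/-- The restriction on `D` enters the Euclidean property here: rounding both lattice coordinates
leaves a squared distance of at most `1/4 + (Im ω)²/4`, which has to be less than one. -/
lemma omega_im_sq_lt {D : ℕ} (hD : D ∈ ({1, 2, 3, 7, 11} : Finset ℕ)) : (omega D).im ^ 2 < 3 := by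
  have h : Real.sqrt D ^ 2 = D := Real.sq_sqrt (Nat.cast_nonneg D)
  simp only [Finset.mem_insert, Finset.mem_singleton] at hD
  rcases hD with rfl | rfl | rfl | rfl | rfl <;> norm_num [omega, div_pow] at h ⊢

lemma exists_norm_sub_lt_one {D : ℕ} (hD : D ∈ ({1, 2, 3, 7, 11} : Finset ℕ)) (z : ℂ) :
    ∃ a : OK D, ‖z - toC a‖ < 1 := by
  obtain ⟨b, hb⟩ := exists_toC_eq_omega D
  have hw := omega_im_ne_zero (pos_of_mem_euclidean hD)
  have h3 := omega_im_sq_lt hD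
  set y := (omega D).im
  set n : ℤ := round (z.im / y)
  set m : ℤ := round (z.re - n * (omega D).re)
  refine ⟨(m : OK D) + (n : OK D) * b, ?_⟩
  have hb' : toC ((m : OK D) + (n : OK D) * b) = m + n * omega D := by
    rw [toC_add, toC_mul, hb]; simp [toC]
  have h1 := abs_sub_round (z.im / y)
  have h2 := abs_sub_round (z.re - n * (omega D).re)
  have h1' : |z.im - n * y| ≤ 1 / 2 * |y| := by
    rw [show z.im - n * y = (z.im / y - n) * y by field_simp, abs_mul]
    exact mul_le_mul_of_nonneg_right h1 (abs_nonneg _)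
  have h1s : (z.im - n * y) ^ 2 ≤ 1 / 4 * y ^ 2 := by
    rw [← sq_abs, ← sq_abs y]
    nlinarith [abs_nonneg (z.im - n * y), abs_nonneg y]
  have h2s : (z.re - n * (omega D).re - m) ^ 2 ≤ 1 / 4 := by
    rw [← sq_abs]
    nlinarith [abs_nonneg (z.re - n * (omega D).re - m)]
  have hsq : ‖z - toC ((m : OK D) + (n : OK D) * b)‖ ^ 2 < 1 := by
    rw [hb', Complex.sq_norm, Complex.normSq_apply]
    simp only [Complex.sub_re, Complex.add_re, Complex.mul_re, Complex.sub_im, Complex.add_im,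
      Complex.mul_im, Complex.intCast_re, Complex.intCast_im, zero_mul, sub_zero, add_zero,
      zero_add]
    nlinarith
  exact (sq_lt_one_iff₀ (norm_nonneg _)).1 hsq

lemma IsNearest.norm_sub_lt_one (hD : D ∈ ({1, 2, 3, 7, 11} : Finset ℕ)) {ρ : ℂ → OK D}
    (hρ : IsNearest ρ) (z : ℂ) : ‖z - toC (ρ z)‖ < 1 := by
  obtain ⟨a, ha⟩ := exists_norm_sub_lt_one hD z
  exact (hρ z a).trans_lt ha

lemma finite_norm_lt (D : ℕ) (R : ℝ) : {a : OK D | ‖toC a‖ < R}.Finite := by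
  refine Set.Finite.subset ((NumberField.Embeddings.finite_of_norm_le (K D) ℂ R).preimage
    (NumberField.RingOfIntegers.coe_injective (K := K D)).injOn) fun a ha => ?_
  exact ⟨a.isIntegral_coe, fun φ => by rw [norm_embedding_eq]; exact le_of_lt ha⟩

lemma quotients_succ (ρ : ℂ → OK D) (κ : ℂ) (n : ℕ) :
    quotients ρ κ (n + 1) = quotients ρ (κ - toC (ρ κ))⁻¹ n := by
  induction n with
  | zero => rfl
  | succ n ih => rw [quotients, ih]; rfl

/-- The Euclidean algorithm: one step replaces `a/b` by `b/(a - βb)`, whose denominator has smaller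
absolute value. The induction is on the finite number of integers of absolute value less than `|b|`.
-/
lemma exists_stopsAt_of_div (hD : D ∈ ({1, 2, 3, 7, 11} : Finset ℕ)) {ρ : ℂ → OK D}
    (hρ : IsNearest ρ) (a b : OK D) (hb : b ≠ 0) : ∃ m, StopsAt ρ (toC a / toC b) m := by
  induction h : {x : OK D | ‖toC x‖ < ‖toC b‖}.ncard using Nat.strong_induction_on generalizing a b
    with
  | _ n ih =>
    set κ := toC a / toC b with hκ
    have hb' := toC_ne_zero hb
    by_cases h0 : κ = toC (ρ κ)
    · exact ⟨0, h0, by simp⟩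
    · have hsub : toC (a - ρ κ * b) = toC b * (κ - toC (ρ κ)) := by
        rw [toC_sub, toC_mul, hκ]; field_simp
      have hlt : ‖toC (a - ρ κ * b)‖ < ‖toC b‖ := by
        rw [hsub, norm_mul]
        exact mul_lt_of_lt_one_right (norm_pos_iff.2 hb') (hρ.norm_sub_lt_one hD κ)
      have hne : a - ρ κ * b ≠ 0 := fun h => by
        rw [h, toC_zero] at hsub
        exact h0 (sub_eq_zero.1 ((mul_eq_zero.1 hsub.symm).resolve_left hb'))
      have hcard : {x : OK D | ‖toC x‖ < ‖toC (a - ρ κ * b)‖}.ncard < n := by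
        rw [← h]
        refine Set.ncard_lt_ncard ⟨fun x hx => ?_, fun hss => ?_⟩ (finite_norm_lt D _)
        · exact lt_trans (show ‖toC x‖ < ‖toC (a - ρ κ * b)‖ from hx) hlt
        · exact lt_irrefl ‖toC (a - ρ κ * b)‖ (hss hlt)
      obtain ⟨m, hm, hm'⟩ := ih _ hcard b (a - ρ κ * b) hne rfl
      have e : toC b / toC (a - ρ κ * b) = (κ - toC (ρ κ))⁻¹ := by
        rw [hsub]; field_simp
      rw [e] at hm hm'
      refine ⟨m + 1, by rw [digit, quotients_succ]; exact hm, fun n hn => ?_⟩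
      rcases n with _ | n
      · exact h0
      · rw [digit, quotients_succ]; exact hm' n (by omega)

lemma exists_eq_div_of_mem_K {κ : ℂ} (hκ : κ ∈ K D) :
    ∃ a b : OK D, b ≠ 0 ∧ κ = toC a / toC b := by
  obtain ⟨a, b, hb, h⟩ := IsFractionRing.div_surjective (A := OK D) (⟨κ, hκ⟩ : K D)
  refine ⟨a, b, nonZeroDivisors.ne_zero hb, ?_⟩
  have := congrArg (fun x : K D => (x : ℂ)) h
  simpa [toC] using this.symm

lemma StopsAt.mul_den {ρ : ℂ → OK D} {κ : ℂ} {m : ℕ} (h : StopsAt ρ κ m) :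
    κ * toC (den ρ κ (m + 1)) = toC (num ρ κ (m + 1)) := by
  -- This is the identity expressing `κ` through the complete quotient `κ_l` and the convergents,
  -- with denominators cleared and `κ_l - β_l` as parameter. At the last step the parameter is zero.
  have key : ∀ l ≤ m, κ * (toC (den ρ κ (l + 1)) +
      (quotients ρ κ l - toC (digit ρ κ l)) * toC (den ρ κ l)) = toC (num ρ κ (l + 1)) +
      (quotients ρ κ l - toC (digit ρ κ l)) * toC (num ρ κ l) := by
    intro l
    induction l with
    | zero => intro _; simp [num, den, quotients, toC_one, toC_zero]
    | succ l ih =>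
      intro hl
      have hne : quotients ρ κ l - toC (digit ρ κ l) ≠ 0 := sub_ne_zero.2 (h.2 l (by omega))
      have hq : quotients ρ κ (l + 1) = (quotients ρ κ l - toC (digit ρ κ l))⁻¹ := rfl
      have h1 := ih (by omega)
      have h2 : (quotients ρ κ l - toC (digit ρ κ l)) * quotients ρ κ (l + 1) = 1 := by
        rw [hq]; exact mul_inv_cancel₀ hne
      simp only [num, den, toC_add, toC_mul]
      linear_combination (quotients ρ κ (l + 1)) * h1 +
        (toC (num ρ κ l) - κ * toC (den ρ κ l)) * h2
  have := key m le_rfl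
  rwa [h.1, sub_self, zero_mul, zero_mul, add_zero, add_zero] at this

lemma det_num_den (ρ : ℂ → OK D) (κ : ℂ) (l : ℕ) :
    (-1) ^ l * (num ρ κ l * den ρ κ (l + 1) - num ρ κ (l + 1) * den ρ κ l) = 1 := by
  apply toC_injective
  have := (isConvergents_num_den ρ κ).det l
  simp only [toC_mul, toC_sub, toC_pow, toC_neg, toC_one]
  exact this

/-- A vanishing denominator would force the numerator to vanish as well, against the determinant. -/
lemma StopsAt.den_ne_zero {ρ : ℂ → OK D} {κ : ℂ} {m : ℕ} (h : StopsAt ρ κ m) :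
    den ρ κ (m + 1) ≠ 0 := fun h0 => by
  have h1 := h.mul_den
  have h2 := det_num_den ρ κ m
  rw [h0, toC_zero, mul_zero] at h1
  have h3 : num ρ κ (m + 1) = 0 := toC_injective (h1.symm.trans toC_zero.symm)
  rw [h0, h3] at h2
  simp at h2

/-- The last two convergents are the entries of a matrix that sends `κ` to `∞`. Together with
termination this shows that every `κ ∈ K` is equivalent to `∞`. -/
lemma StopsAt.isFiniteCusp {ρ : ℂ → OK D} {κ : ℂ} {m : ℕ} (h : StopsAt ρ κ m) :
    IsFiniteCusp D κ := by
  refine ⟨(-1) ^ m * den ρ κ m, -((-1) ^ m * num ρ κ m), den ρ κ (m + 1), -num ρ κ (m + 1), ?_,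
    h.den_ne_zero, ?_⟩
  · linear_combination det_num_den ρ κ m
  · rw [toC_neg, ← h.mul_den]; ring

lemma exists_stopsAt (hD : D ∈ ({1, 2, 3, 7, 11} : Finset ℕ)) {ρ : ℂ → OK D}
    (hρ : IsNearest ρ) {κ : ℂ} (hκ : κ ∈ K D) : ∃ m, StopsAt ρ κ m := by
  obtain ⟨a, b, hb, rfl⟩ := exists_eq_div_of_mem_K hκ
  exact exists_stopsAt_of_div hD hρ a b hb

lemma isFiniteCusp_of_mem_K (hD : D ∈ ({1, 2, 3, 7, 11} : Finset ℕ)) {κ : ℂ} (hκ : κ ∈ K D) :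
    IsFiniteCusp D κ := by
  obtain ⟨ρ, hρ⟩ := exists_isNearest D
  obtain ⟨m, hm⟩ := exists_stopsAt hD hρ hκ
  exact hm.isFiniteCusp

variable {k : ℕ} {F : ℂ × ℝ → MvPolynomial (Fin 2) ℂ}

lemma IsCuspForm.period_eq_sum_stopsAt (hD : D ∈ ({1, 2, 3, 7, 11} : Finset ℕ))
    (hF : IsCuspForm D k F) {ρ : ℂ → OK D} {κ : ℂ} {m : ℕ} (hm : StopsAt ρ κ m) {p q : ℕ}
    (hp : p ≤ k) (hq : q ≤ k) :
    period k p q κ F = ∑ l ∈ Finset.range (m + 1), ∑ i ∈ Finset.range (k + 1),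
      ∑ j ∈ Finset.range (k + 1), (-1) ^ (p + q + i + j) *
        eCoeff k p q i j ((-1) ^ l * toC (num ρ κ l)) (toC (num ρ κ (l + 1)))
          ((-1) ^ l * toC (den ρ κ l)) (toC (den ρ κ (l + 1))) * period k i j 0 F := by
  obtain ⟨b, hb⟩ := exists_toC_eq_omega D
  have hν := toC_ne_zero hm.den_ne_zero
  exact hF.period_eq_sum_convergents hb (omega_im_ne_zero (pos_of_mem_euclidean hD))
    (isConvergents_num_den ρ κ) hm.isFiniteCusp hν (eq_div_of_mul_eq hν hm.mul_den) hp hq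

lemma conj_mem_K {x : ℂ} (hx : x ∈ K D) : conj x ∈ K D := by
  have h : K D ≤ (K D).comap ((Complex.conjAe.toAlgHom.restrictScalars ℚ)) := by
    rw [IntermediateField.adjoin_le_iff]
    rintro y rfl
    show conj _ ∈ K D
    rw [map_mul, Complex.conj_I, Complex.conj_ofReal, neg_mul]
    exact neg_mem (IntermediateField.mem_adjoin_simple_self ℚ _)
  exact h hx

lemma exists_toC_eq_conj (a : OK D) : ∃ b : OK D, toC b = conj (toC a) := by
  have hi : IsIntegral ℤ (⟨conj (toC a), conj_mem_K (a : K D).2⟩ : K D) := by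
    have h1 : IsIntegral ℤ (toC a) := (a.isIntegral_coe).map (K D).val
    have h2 : IsIntegral ℤ (conj (toC a)) := h1.map (Complex.conjAe.toAlgHom.restrictScalars ℤ)
    exact (isIntegral_algHom_iff ((K D).val.restrictScalars ℤ) (K D).val.injective).1 h2
  exact ⟨⟨_, hi⟩, rfl⟩

/-- The image of `𝓞_K` in `ℂ`. -/
def integersC (D : ℕ) : Subring ℂ where
  carrier := Set.range (toC : OK D → ℂ)
  mul_mem' := by rintro _ _ ⟨a, rfl⟩ ⟨b, rfl⟩; exact ⟨a * b, toC_mul a b⟩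
  one_mem' := ⟨1, toC_one⟩
  add_mem' := by rintro _ _ ⟨a, rfl⟩ ⟨b, rfl⟩; exact ⟨a + b, toC_add a b⟩
  zero_mem' := ⟨0, toC_zero⟩
  neg_mem' := by rintro _ ⟨a, rfl⟩; exact ⟨-a, toC_neg a⟩

lemma toC_mem (a : OK D) : toC a ∈ integersC D := ⟨a, rfl⟩

lemma conj_mem_integersC {x : ℂ} (hx : x ∈ integersC D) : conj x ∈ integersC D := by
  obtain ⟨a, rfl⟩ := hx
  exact exists_toC_eq_conj a

lemma halfCoeff_mem {R : Subring ℂ} {a b c d : ℂ} (ha : a ∈ R) (hb : b ∈ R) (hc : c ∈ R)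
    (hd : d ∈ R) (p i : ℕ) : halfCoeff k p i a b c d ∈ R :=
  sum_mem fun _ _ => mul_mem (mul_mem (mul_mem (mul_mem (mul_mem (natCast_mem _ _)
    (natCast_mem _ _)) (pow_mem ha _)) (pow_mem hb _)) (pow_mem hc _)) (pow_mem hd _)

lemma eCoeff_mem {a b c d : ℂ} (ha : a ∈ integersC D) (hb : b ∈ integersC D)
    (hc : c ∈ integersC D) (hd : d ∈ integersC D) (p q i j : ℕ) :
    eCoeff k p q i j a b c d ∈ integersC D :=
  mul_mem (halfCoeff_mem ha hb hc hd p i) (halfCoeff_mem (conj_mem_integersC ha)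
    (conj_mem_integersC hb) (conj_mem_integersC hc) (conj_mem_integersC hd) q j)

lemma neg_one_pow_mem (R : Subring ℂ) (n : ℕ) : (-1 : ℂ) ^ n ∈ R :=
  pow_mem (neg_mem (one_mem _)) n

/-- The periods at `κ` are integral combinations of those at `0`. -/
lemma exists_period_eq_sum (hD : D ∈ ({1, 2, 3, 7, 11} : Finset ℕ)) (k : ℕ) {κ : ℂ}
    (hκ : κ ∈ K D) : ∃ a : ℕ → ℕ → ℕ → ℕ → OK D,
      ∀ F : ℂ × ℝ → MvPolynomial (Fin 2) ℂ, IsCuspForm D k F → ∀ p ≤ k, ∀ q ≤ k,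
        period k p q κ F = ∑ i ∈ Finset.range (k + 1), ∑ j ∈ Finset.range (k + 1),
          toC (a p q i j) * period k i j 0 F := by
  obtain ⟨ρ, hρ⟩ := exists_isNearest D
  obtain ⟨m, hm⟩ := exists_stopsAt hD hρ hκ
  have hmem : ∀ p q i j, ∑ l ∈ Finset.range (m + 1), (-1) ^ (p + q + i + j) *
        eCoeff k p q i j ((-1) ^ l * toC (num ρ κ l)) (toC (num ρ κ (l + 1)))
          ((-1) ^ l * toC (den ρ κ l)) (toC (den ρ κ (l + 1))) ∈ integersC D := fun p q i j =>
    sum_mem fun l _ => mul_mem (neg_one_pow_mem _ _) (eCoeff_mem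
      (mul_mem (neg_one_pow_mem _ _) (toC_mem _)) (toC_mem _)
      (mul_mem (neg_one_pow_mem _ _) (toC_mem _)) (toC_mem _) p q i j)
  choose a ha using hmem
  refine ⟨a, fun F hF p hp q hq => ?_⟩
  rw [hF.period_eq_sum_stopsAt hD hm hp hq, Finset.sum_comm]
  refine Finset.sum_congr rfl fun i _ => ?_
  rw [Finset.sum_comm]
  refine Finset.sum_congr rfl fun j _ => ?_
  rw [ha, Finset.sum_mul]

end

section

open MeasureTheory

/-! ### Periods and upper triangular matrices -/

variable {D k : ℕ} {F : ℂ × ℝ → MvPolynomial (Fin 2) ℂ}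

lemma act_upper {e d : ℂ} (hd : d ≠ 0) (b z : ℂ) (t : ℝ) :
    act !![e, b; 0, d] (z, t) = ((e * z + b) / d, ‖e‖ / ‖d‖ * t) := by
  have hd' : ‖d‖ ≠ 0 := norm_ne_zero_iff.2 hd
  have hcd : conj d ≠ 0 := by simpa using hd
  simp only [act, Matrix.of_apply, Matrix.cons_val', Matrix.cons_val_zero, Matrix.cons_val_one,
    Matrix.cons_val_fin_one, Matrix.det_fin_two_of]
  ext1
  · simp only [zero_mul, zero_add, map_zero, mul_zero, add_zero, norm_zero]
    push_cast
    rw [ofReal_norm_sq]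
    field_simp
    ring
  · simp
    field_simp

lemma inv_multiplier_upper {e d : ℂ} (hd : d ≠ 0) {s : ℂ} (hs : s ≠ 0) (b : ℂ)
    (x : ℂ × ℝ) : (multiplier (s⁻¹ • !![e, b; 0, d]) x)⁻¹ = !![s / d, 0; 0, conj (s / d)] := by
  have hcd : conj d ≠ 0 := by simpa using hd
  have hcs : conj s ≠ 0 := by simpa using hs
  refine Matrix.inv_eq_right_inv ?_
  ext i j
  fin_cases i <;> fin_cases j <;> simp [multiplier, Matrix.mul_apply, Fin.sum_univ_two]
  · field_simp
  · field_simp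

/-- The inverse multiplier is `diag(a, ā)` with `a² = e/d`, and the height is scaled by `|e/d| = a
ā`. The powers of `a` and `ā` recombine into powers of `e`, `d` and their conjugates. One factor
`|e|/|d|` is kept beside the integrand for the change of variable in `t`. -/
lemma periodIntegrand_slash {e d : ℂ} (he : e ≠ 0) (hd : d ≠ 0) (b z : ℂ) {i j : ℕ} (hi : i ≤ k)
    (hj : j ≤ k) (t : ℝ) :
    ((‖d * e‖ ^ (2 * k) : ℝ) : ℂ) * periodIntegrand k i j z (slash k !![e, b; 0, d] F) t =
      e ^ (k - i) * conj e ^ (k - j) * d ^ i * conj d ^ j * (((‖e‖ / ‖d‖ : ℝ) : ℂ) *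
        periodIntegrand k i j ((e * z + b) / d) F (‖e‖ / ‖d‖ * t)) := by
  have hdet : (!![e, b; 0, d] : Matrix (Fin 2) (Fin 2) ℂ).det = d * e := by
    rw [Matrix.det_fin_two_of]; ring
  have hde : d * e ≠ 0 := mul_ne_zero hd he
  set s : ℂ := (d * e) ^ (1 / 2 : ℂ) with hs
  have hs2 : s ^ 2 = d * e := by
    rw [hs, ← Complex.cpow_nat_mul]; simp
  have hs0 : s ≠ 0 := fun h => hde (by rw [← hs2, h]; simp)
  set a : ℂ := s / d with ha
  have ha2 : e = a ^ 2 * d := by rw [ha, div_pow, hs2]; field_simp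
  have haa : ((‖e‖ / ‖d‖ : ℝ) : ℂ) = a * conj a := by
    rw [Complex.mul_conj', ha2, norm_mul, norm_pow,
      mul_div_cancel_right₀ _ (norm_ne_zero_iff.2 hd)]
    push_cast; rfl
  have hnorm : ((‖d * e‖ ^ (2 * k) : ℝ) : ℂ) * (((‖d * e‖ ^ k)⁻¹ : ℝ) : ℂ) =
      (a * conj a) ^ k * (d * conj d) ^ k := by
    rw [← Complex.ofReal_mul, two_mul, pow_add, mul_assoc,
      mul_inv_cancel₀ (pow_ne_zero _ (norm_ne_zero_iff.2 hde)), mul_one, ← mul_pow,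
      Complex.mul_conj' d, ← haa, norm_mul]
    have hd' : (‖d‖ : ℂ) ≠ 0 := by exact_mod_cast norm_ne_zero_iff.2 hd
    push_cast
    congr 1
    field_simp
  obtain ⟨i', rfl⟩ := Nat.exists_eq_add_of_le hi
  obtain ⟨j', hj'⟩ := Nat.exists_eq_add_of_le hj
  rw [periodIntegrand, periodIntegrand, slash, hdet, inv_multiplier_upper hd hs0,
    act_upper hd, coef, MvPolynomial.coeff_C_mul, ← coef, coef_subst_diag, haa, Complex.ofReal_mul,
    haa, mul_pow (a * conj a)]
  rw [show 2 * (i + i') + 2 - (i + i' + 1 + i - j) = i' + 1 + j by omega,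
    show i + i' + 1 + i - j = i + 1 + j' by omega, show i + i' - i = i' by omega,
    show i + i' - j = j' by omega]
  have hce : conj e = conj a ^ 2 * conj d := by rw [ha2]; simp
  have e1 : conj e ^ j' * conj d ^ j = conj a ^ (2 * j') * conj d ^ (i + i') := by
    rw [hce, mul_pow, ← pow_mul, mul_assoc, ← pow_add, hj', add_comm j j']
  have e2 : e ^ i' * d ^ i = a ^ (2 * i') * d ^ (i + i') := by
    nth_rewrite 1 [ha2]
    rw [mul_pow, ← pow_mul, mul_assoc, ← pow_add, add_comm i i']
  have e3 : (conj a) ^ (i + i') = conj a ^ (j + j') := by rw [hj']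
  set X := coef (i + i') (i + 1 + j') (F ((e * z + b) / d, ‖e‖ / ‖d‖ * t))
  calc _ = ((‖d * e‖ ^ (2 * (i + i')) : ℝ) * (((‖d * e‖ ^ (i + i'))⁻¹ : ℝ) : ℂ)) *
        ((a ^ (i' + 1 + j) * conj a ^ (i + 1 + j')) * ((t : ℂ) ^ (i + j) * X)) := by ring
    _ = (a ^ (2 * i') * d ^ (i + i')) * (conj a ^ (2 * j') * conj d ^ (i + i')) *
        (a * conj a * ((a * conj a) ^ (i + j) * t ^ (i + j) * X)) := by
        rw [hnorm, mul_pow a, mul_pow d, e3]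
        ring
    _ = _ := by rw [← e1, ← e2]; ring

lemma IsCuspForm.integrableOn_periodIntegrand (hF : IsCuspForm D k F) {b : OK D}
    (hb : toC b = omega D) (hw : (omega D).im ≠ 0) {κ : ℂ} (hκ : IsFiniteCusp D κ) {i j : ℕ}
    (hi : i ≤ k) (hj : j ≤ k) : IntegrableOn (periodIntegrand k i j κ F) (Set.Ioi 0) :=
  hF.integrableOn_pow_mul_coef hb hw hκ (by omega) (by omega)

lemma integrableOn_periodIntegrand_scale {i j : ℕ} {κ : ℂ}
    (h : IntegrableOn (periodIntegrand k i j κ F) (Set.Ioi 0)) {a : ℝ} (ha : 0 < a) (c : ℂ) :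
    IntegrableOn (fun t => c * (a * periodIntegrand k i j κ F (a * t))) (Set.Ioi 0) := by
  refine (Integrable.const_mul ?_ _).const_mul _
  have := (integrableOn_Ioi_comp_mul_left_iff (periodIntegrand k i j κ F) 0 ha).2
    (by rwa [mul_zero])
  exact this

lemma integral_periodIntegrand_scale {i j : ℕ} {κ : ℂ} {a : ℝ} (ha : 0 < a) (c : ℂ) :
    ∫ t in Set.Ioi (0 : ℝ), c * (a * periodIntegrand k i j κ F (a * t)) =
      c * ∫ t in Set.Ioi (0 : ℝ), periodIntegrand k i j κ F t := by
  rw [integral_const_mul, integral_const_mul,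
    integral_comp_mul_left_Ioi (periodIntegrand k i j κ F) 0 ha, mul_zero, Complex.real_smul,
    ← mul_assoc (a : ℂ), ← Complex.ofReal_mul, mul_inv_cancel₀ ha.ne', Complex.ofReal_one, one_mul]

lemma factorizations_spec {n : OK D} (hn : n ≠ 0) :
    IsFactorizationSystem n (factorizations n) := by
  rw [factorizations, dif_pos hn]; exact (exists_factorizationSystem n hn).choose_spec

lemma residues_spec {d : OK D} (hd : d ≠ 0) : IsResidueSystem d (residues d) := by
  rw [residues, dif_pos hd]; exact (exists_residueSystem d hd).choose_spec

lemma periodIntegrand_hecke {n : OK D} (hn : n ≠ 0) {i j : ℕ} (hi : i ≤ k) (hj : j ≤ k) (t : ℝ) :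
    periodIntegrand k i j 0 (hecke k n F) t = ∑ y ∈ factorizations n, ∑ b ∈ residues y.1,
      toC y.2 ^ (k - i) * conj (toC y.2) ^ (k - j) * toC y.1 ^ i * conj (toC y.1) ^ j *
        (((‖toC y.2‖ / ‖toC y.1‖ : ℝ) : ℂ) * periodIntegrand k i j (toC b / toC y.1) F
          (‖toC y.2‖ / ‖toC y.1‖ * t)) := by
  rw [periodIntegrand, hecke, coef, MvPolynomial.coeff_C_mul, ← coef, coef_sum, Finset.mul_sum,
    Finset.mul_sum]
  refine Finset.sum_congr rfl fun y hy => ?_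
  have hyn : y.1 * y.2 = n := (factorizations_spec hn).1 y hy
  have h1 : y.1 ≠ 0 := fun h => hn (by rw [← hyn, h, zero_mul])
  have h2 : y.2 ≠ 0 := fun h => hn (by rw [← hyn, h, mul_zero])
  rw [coef_sum, Finset.mul_sum, Finset.mul_sum]
  refine Finset.sum_congr rfl fun b _ => ?_
  have h3 := periodIntegrand_slash (F := F) (toC_ne_zero h2) (toC_ne_zero h1) (toC b) 0 hi hj t
  rw [mul_zero, zero_add] at h3
  rw [← h3, ← toC_mul, hyn, periodIntegrand]
  ring

lemma div_mem_K (a b : OK D) : toC a / toC b ∈ K D :=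
  div_mem (a : K D).2 (b : K D).2

lemma IsCuspForm.integrableOn_hecke (hD : D ∈ ({1, 2, 3, 7, 11} : Finset ℕ))
    (hF : IsCuspForm D k F) {n : OK D} (hn : n ≠ 0) {i j : ℕ} (hi : i ≤ k) (hj : j ≤ k) :
    IntegrableOn (periodIntegrand k i j 0 (hecke k n F)) (Set.Ioi 0) := by
  obtain ⟨b, hb⟩ := exists_toC_eq_omega D
  rw [funext (periodIntegrand_hecke (F := F) hn hi hj)]
  refine integrable_finsetSum _ fun y hy => integrable_finsetSum _ fun c _ => ?_
  have hyn : y.1 * y.2 = n := (factorizations_spec hn).1 y hy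
  have h1 : y.1 ≠ 0 := fun h => hn (by rw [← hyn, h, zero_mul])
  have h2 : y.2 ≠ 0 := fun h => hn (by rw [← hyn, h, mul_zero])
  refine integrableOn_periodIntegrand_scale (hF.integrableOn_periodIntegrand hb
    (omega_im_ne_zero (pos_of_mem_euclidean hD)) (isFiniteCusp_of_mem_K hD (div_mem_K _ _)) hi hj)
    (div_pos (norm_pos_iff.2 (toC_ne_zero h2)) (norm_pos_iff.2 (toC_ne_zero h1))) _

lemma IsCuspForm.cPeriod_hecke (hD : D ∈ ({1, 2, 3, 7, 11} : Finset ℕ))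
    (hF : IsCuspForm D k F) {n : OK D} (hn : n ≠ 0) {i j : ℕ} (hi : i ≤ k) (hj : j ≤ k) :
    cPeriod k i j 0 (hecke k n F) = ∑ y ∈ factorizations n, ∑ b ∈ residues y.1,
      toC y.2 ^ (k - i) * conj (toC y.2) ^ (k - j) * (toC y.1 ^ i * conj (toC y.1) ^ j) *
        cPeriod k i j (toC b / toC y.1) F := by
  obtain ⟨b, hb⟩ := exists_toC_eq_omega D
  have hpos : ∀ y ∈ factorizations n, 0 < ‖toC y.2‖ / ‖toC y.1‖ := fun y hy => by
    have hyn : y.1 * y.2 = n := (factorizations_spec hn).1 y hy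
    have h1 : y.1 ≠ 0 := fun h => hn (by rw [← hyn, h, zero_mul])
    have h2 : y.2 ≠ 0 := fun h => hn (by rw [← hyn, h, mul_zero])
    exact div_pos (norm_pos_iff.2 (toC_ne_zero h2)) (norm_pos_iff.2 (toC_ne_zero h1))
  have hint : ∀ y ∈ factorizations n, ∀ (c : ℂ) (b' : OK D), IntegrableOn (fun t : ℝ =>
      c * (((‖toC y.2‖ / ‖toC y.1‖ : ℝ) : ℂ) * periodIntegrand k i j (toC b' / toC y.1) F
        (‖toC y.2‖ / ‖toC y.1‖ * t))) (Set.Ioi 0) := fun y hy c b' =>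
    integrableOn_periodIntegrand_scale (hF.integrableOn_periodIntegrand hb
      (omega_im_ne_zero (pos_of_mem_euclidean hD)) (isFiniteCusp_of_mem_K hD (div_mem_K _ _)) hi hj)
      (hpos y hy) _
  rw [cPeriod, funext (periodIntegrand_hecke (F := F) hn hi hj),
    integral_finsetSum _ fun y hy => integrable_finsetSum _ fun c _ => hint y hy _ c,
    Finset.mul_sum]
  refine Finset.sum_congr rfl fun y hy => ?_
  rw [integral_finsetSum _ fun c _ => hint y hy _ c, Finset.mul_sum]
  refine Finset.sum_congr rfl fun c _ => ?_
  rw [integral_periodIntegrand_scale (hpos y hy), cPeriod]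
  ring

lemma IsCuspForm.cPeriod_add (hF : IsCuspForm D k F) (b : OK D) (i j : ℕ) (κ : ℂ) :
    cPeriod k i j (κ + toC b) F = cPeriod k i j κ F := by
  rw [cPeriod, cPeriod]
  congr 1
  refine setIntegral_congr_fun measurableSet_Ioi fun t ht => ?_
  rw [periodIntegrand, periodIntegrand, hF.apply_add b κ ht]

lemma toC_unit_mul_inv (u : (OK D)ˣ) :
    toC (u : OK D) * toC ((u⁻¹ : (OK D)ˣ) : OK D) = 1 := by
  rw [← toC_mul, Units.mul_inv, toC_one]

/-- The effect of a unit on the periods. -/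
lemma IsCuspForm.cPeriod_unit (hF : IsCuspForm D k F) (u : (OK D)ˣ) {i j : ℕ} (hi : i ≤ k)
    (hj : j ≤ k) (κ : ℂ) :
    cPeriod k i j κ F = toC ((u⁻¹ : (OK D)ˣ) : OK D) ^ (k - i) *
      conj (toC ((u⁻¹ : (OK D)ˣ) : OK D)) ^ (k - j) * (toC (u : OK D) ^ i *
      conj (toC (u : OK D)) ^ j) *
      cPeriod k i j (toC ((u⁻¹ : (OK D)ˣ) : OK D) * κ / toC (u : OK D)) F := by
  have hprod := toC_unit_mul_inv u
  have hu : toC (u : OK D) ≠ 0 := left_ne_zero_of_mul_eq_one hprod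
  have hu' : toC ((u⁻¹ : (OK D)ˣ) : OK D) ≠ 0 := right_ne_zero_of_mul_eq_one hprod
  have hinv : ∀ x ∈ H3, slash k !![toC ((u⁻¹ : (OK D)ˣ) : OK D), 0; 0, toC (u : OK D)] F x = F x :=
    fun x hx => by
    have h := hF.invariant ⟨!![((u⁻¹ : (OK D)ˣ) : OK D), 0; 0, (u : OK D)], by
      rw [Matrix.det_fin_two_of]; simp⟩ x hx
    rw [← h]
    congr 1
    ext a b
    fin_cases a <;> fin_cases b <;> simp [toC]
  have h1 : ∀ t ∈ Set.Ioi (0 : ℝ), periodIntegrand k i j κ F t =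
      toC ((u⁻¹ : (OK D)ˣ) : OK D) ^ (k - i) *
      conj (toC ((u⁻¹ : (OK D)ˣ) : OK D)) ^ (k - j) * toC (u : OK D) ^ i *
      conj (toC (u : OK D)) ^ j * (((‖toC ((u⁻¹ : (OK D)ˣ) : OK D)‖ / ‖toC (u : OK D)‖ : ℝ) : ℂ) *
        periodIntegrand k i j ((toC ((u⁻¹ : (OK D)ˣ) : OK D) * κ + 0) / toC (u : OK D)) F
        (‖toC ((u⁻¹ : (OK D)ˣ) : OK D)‖ / ‖toC (u : OK D)‖ * t)) := fun t ht => by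
    rw [← periodIntegrand_slash hu' hu 0 κ hi hj t, hprod, periodIntegrand, periodIntegrand,
      hinv (κ, t) ht]
    simp
  rw [cPeriod, setIntegral_congr_fun measurableSet_Ioi h1, integral_periodIntegrand_scale
    (div_pos (norm_pos_iff.2 hu') (norm_pos_iff.2 hu)), cPeriod, add_zero]
  ring

end

section

/-! ### Divisors, factorizations and residues -/

variable {D : ℕ}

/-- The powers of a nonzero integer of absolute value less than one would be infinitely many
integers in a bounded region. The finiteness of the units and of the sets of divisors rests on this.
-/
lemma one_le_norm_toC {a : OK D} (ha : a ≠ 0) : 1 ≤ ‖toC a‖ := by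
  by_contra! h
  have hpos : 0 < ‖toC a‖ := norm_pos_iff.2 (toC_ne_zero ha)
  have hinj : Function.Injective fun n : ℕ => a ^ n := fun m n hmn => by
    have h1 := congrArg (fun x => ‖toC x‖) hmn
    simp only [toC_pow, norm_pow] at h1
    exact pow_right_injective₀ hpos h.ne h1
  refine Set.infinite_of_injective_forall_mem hinj (fun n => ?_) (finite_norm_lt D 2)
  change ‖toC (a ^ n)‖ < 2
  rw [toC_pow, norm_pow]
  exact (pow_le_one₀ hpos.le h.le).trans_lt one_lt_two

lemma norm_toC_le_of_dvd {d n : OK D} (hn : n ≠ 0) (h : d ∣ n) : ‖toC d‖ ≤ ‖toC n‖ := by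
  obtain ⟨e, rfl⟩ := h
  rw [toC_mul, norm_mul]
  exact le_mul_of_one_le_right (norm_nonneg _) (one_le_norm_toC (right_ne_zero_of_mul hn))

instance finite_units_OK (D : ℕ) : Finite (OK D)ˣ := by
  have hfin := finite_norm_lt D 2
  have : Finite {a : OK D | ‖toC a‖ < 2} := hfin
  refine Finite.of_injective (β := {a : OK D | ‖toC a‖ < 2}) (fun u => ⟨(u : OK D), ?_⟩) ?_
  · have h := norm_toC_le_of_dvd one_ne_zero (u.isUnit.dvd (a := (1 : OK D)))
    rw [toC_one, norm_one] at h
    exact h.trans_lt one_lt_two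
  · intro u v huv
    exact Units.ext (congrArg Subtype.val huv)

instance fintype_units_OK (D : ℕ) : Fintype (OK D)ˣ := Fintype.ofFinite _

lemma finite_pairs {n : OK D} (hn : n ≠ 0) : {x : OK D × OK D | x.1 * x.2 = n}.Finite := by
  have hfin := finite_norm_lt D (‖toC n‖ + 1)
  refine (hfin.prod hfin).subset ?_
  rintro ⟨d, e⟩ rfl
  exact ⟨(norm_toC_le_of_dvd hn (dvd_mul_right _ _)).trans_lt (lt_add_one _),
    (norm_toC_le_of_dvd hn (dvd_mul_left _ _)).trans_lt (lt_add_one _)⟩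

open Classical in
/-- All factorizations of `n ≠ 0` into two factors. -/
def pairs (n : OK D) : Finset (OK D × OK D) :=
  if hn : n ≠ 0 then (finite_pairs hn).toFinset else ∅

lemma mem_pairs {n : OK D} (hn : n ≠ 0) {x : OK D × OK D} : x ∈ pairs n ↔ x.1 * x.2 = n := by
  rw [pairs, dif_pos hn]; simp

/-- The units act freely on the factorizations of `n ≠ 0`, and `S` contains one element of each
orbit. Multiplying by the number of units replaces sums over chosen representatives by sums over all
factorizations, which are easy to rearrange. -/
lemma IsFactorizationSystem.card_mul_sum {n : OK D} (hn : n ≠ 0) {S : Finset (OK D × OK D)}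
    (hS : IsFactorizationSystem n S) (h : OK D → OK D → ℂ)
    (hh : ∀ (u : (OK D)ˣ) (d e : OK D), h (u * d) ((u⁻¹ : (OK D)ˣ) * e) = h d e) :
    (Fintype.card (OK D)ˣ : ℂ) * ∑ x ∈ S, h x.1 x.2 = ∑ x ∈ pairs n, h x.1 x.2 := by
  have h1 : (Fintype.card (OK D)ˣ : ℂ) * ∑ x ∈ S, h x.1 x.2 =
      ∑ p ∈ (Finset.univ : Finset (OK D)ˣ) ×ˢ S, h p.2.1 p.2.2 := by
    rw [Finset.sum_product]; simp
  rw [h1]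
  refine Finset.sum_bij (fun p _ => ((p.1 : OK D) * p.2.1, ((p.1⁻¹ : (OK D)ˣ) : OK D) * p.2.2))
    ?_ ?_ ?_ ?_
  · rintro ⟨u, x⟩ hx
    rw [mem_pairs hn]
    have := hS.1 x (Finset.mem_product.1 hx).2
    calc (u : OK D) * x.1 * (((u⁻¹ : (OK D)ˣ) : OK D) * x.2)
        = ((u : OK D) * ((u⁻¹ : (OK D)ˣ) : OK D)) * (x.1 * x.2) := by ring
      _ = n := by rw [Units.mul_inv, one_mul, this]
  · rintro ⟨u, x⟩ hx ⟨v, y⟩ hy huv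
    have hx' := (Finset.mem_product.1 hx).2
    have hy' := (Finset.mem_product.1 hy).2
    have h1 : (u : OK D) * x.1 = v * y.1 := congrArg Prod.fst huv
    have hxd : x.1 ∣ n := ⟨x.2, (hS.1 x hx').symm⟩
    have hass : Associated x.1 y.1 :=
      (associated_unit_mul_left x.1 u u.isUnit).symm.trans
        (h1 ▸ associated_unit_mul_left y.1 v v.isUnit)
    have hxy : x = y := (hS.2 x.1 hxd).unique ⟨hx', Associated.refl _⟩ ⟨hy', hass⟩
    subst hxy
    have hx0 : x.1 ≠ 0 := fun h => hn (zero_dvd_iff.1 (h ▸ hxd))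
    rw [Units.ext (mul_right_cancel₀ hx0 h1)]
  · rintro ⟨d, e⟩ hde
    rw [mem_pairs hn] at hde
    obtain ⟨x, ⟨hx, u, hu⟩, -⟩ := hS.2 d ⟨e, hde.symm⟩
    refine ⟨(u⁻¹, x), by simpa using hx, ?_⟩
    have hd0 : d ≠ 0 := fun h => hn (by rw [← hde, h]; simp)
    have h2 := hS.1 x hx
    rw [← hu, ← hde, mul_assoc] at h2
    have h3 := mul_left_cancel₀ hd0 h2
    simp only [inv_inv]
    rw [h3, ← hu, mul_comm d, ← mul_assoc, Units.inv_mul, one_mul]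
  · rintro ⟨u, x⟩ hx
    exact (hh u x.1 x.2).symm

/-- A nonzero element of least absolute value in the ideal `(b, d)` divides every element, by
division with remainder. -/
lemma exists_gcd (hD : D ∈ ({1, 2, 3, 7, 11} : Finset ℕ)) (b : OK D) {d : OK D} (hd : d ≠ 0) :
    ∃ g b' d' : OK D, b = g * b' ∧ d = g * d' ∧ IsCoprime b' d' := by
  have hfin : {a : OK D | a ∈ Ideal.span {b, d} ∧ a ≠ 0 ∧ ‖toC a‖ < ‖toC d‖ + 1}.Finite :=
    (finite_norm_lt D _).subset fun a ha => ha.2.2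
  obtain ⟨g, ⟨hg, hg0, hgd⟩, hmin⟩ := Set.exists_min_image _ (fun a => ‖toC a‖) hfin
    ⟨d, Ideal.subset_span (by simp), hd, lt_add_one _⟩
  have hdvd : ∀ a ∈ Ideal.span {b, d}, g ∣ a := fun a ha => by
    obtain ⟨q, hq⟩ := exists_norm_sub_lt_one hD (toC a / toC g)
    by_cases h0 : a - q * g = 0
    · exact ⟨q, by rw [mul_comm]; exact sub_eq_zero.1 h0⟩
    · have hlt : ‖toC (a - q * g)‖ < ‖toC g‖ := by
        have hg' := toC_ne_zero hg0
        rw [toC_sub, toC_mul, show toC a - toC q * toC g = toC g * (toC a / toC g - toC q) by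
          field_simp, norm_mul]
        exact mul_lt_of_lt_one_right (norm_pos_iff.2 hg') hq
      exact absurd (hmin (a - q * g) ⟨sub_mem ha (Ideal.mul_mem_left _ _ hg), h0,
        hlt.trans hgd⟩) (not_le.2 hlt)
  obtain ⟨b', hb'⟩ := hdvd b (Ideal.subset_span (by simp))
  obtain ⟨d', hd'⟩ := hdvd d (Ideal.subset_span (by simp))
  obtain ⟨x, y, hxy⟩ := Ideal.mem_span_pair.1 hg
  refine ⟨g, b', d', hb', hd', x, y, mul_left_cancel₀ hg0 ?_⟩
  linear_combination hxy - x * hb' - y * hd'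

/-- A family that represents each class of `B'` exactly once modulo `d` gives the same sum, as `H`
depends only on the class. -/
lemma sum_eq_sum_residues {ι : Type*} {d : OK D} {B B' : Finset (OK D)} (hB : IsResidueSystem d B)
    (hsub : B' ⊆ B) {A : Finset ι} (r : ι → OK D) {H : OK D → ℂ}
    (hH : ∀ x y, d ∣ x - y → H x = H y) (hmem : ∀ a ∈ A, ∀ b ∈ B, d ∣ r a - b → b ∈ B')
    (hinj : ∀ a ∈ A, ∀ a' ∈ A, d ∣ r a - r a' → a = a')
    (hsurj : ∀ b ∈ B', ∃ a ∈ A, d ∣ r a - b) : ∑ a ∈ A, H (r a) = ∑ b ∈ B', H b := by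
  choose s hs huniq using hB
  refine Finset.sum_bij (fun a _ => s (r a)) (fun a ha => hmem a ha _ (hs _).1 (hs _).2) ?_ ?_
    fun a _ => hH _ _ (hs _).2
  · intro a ha a' ha' h
    refine hinj a ha a' ha' ?_
    have h1 := (hs (r a)).2
    have h2 := (hs (r a')).2
    rw [h] at h1
    simpa using dvd_sub h1 h2
  · intro b hb
    obtain ⟨a, ha, hab⟩ := hsurj b hb
    exact ⟨a, ha, (huniq (r a) b ⟨hsub hb, hab⟩).symm⟩

lemma mem_coprimePart {d b : OK D} {B : Finset (OK D)} :
    b ∈ coprimePart d B ↔ b ∈ B ∧ IsCoprime b d := by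
  simp only [coprimePart, Finset.mem_filter]

lemma IsCoprime.of_dvd_sub {b b' d : OK D} (h : IsCoprime b d) (hd : d ∣ b - b') :
    IsCoprime b' d := by
  obtain ⟨c, hc⟩ := hd
  rw [show b' = b + d * (-c) by linear_combination -hc]
  exact h.add_mul_left_left _

lemma sum_coprimePart_unit {d : OK D} (u v : (OK D)ˣ) {B B' : Finset (OK D)}
    (hB : IsResidueSystem d B) (hB' : IsResidueSystem ((u : OK D) * d) B') {H : OK D → ℂ}
    (hH : ∀ x y, d ∣ x - y → H x = H y) :
    ∑ b ∈ coprimePart ((u : OK D) * d) B', H ((v : OK D) * b) = ∑ b ∈ coprimePart d B, H b := by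
  have hud : ∀ x, (u : OK D) * d ∣ x ↔ d ∣ x := fun x => (Units.mul_left_dvd)
  have hcop : ∀ b, IsCoprime b ((u : OK D) * d) ↔ IsCoprime b d := fun b =>
    isCoprime_mul_unit_left_right u.isUnit b d
  refine sum_eq_sum_residues hB (fun b hb => (mem_coprimePart.1 hb).1) (fun b => (v : OK D) * b) hH ?_ ?_ ?_
  · intro a ha b hb hab
    rw [mem_coprimePart, hcop] at ha
    exact mem_coprimePart.2 ⟨hb, IsCoprime.of_dvd_sub
      ((isCoprime_mul_unit_left_left v.isUnit a d).2 ha.2) hab⟩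
  · intro a ha a' ha' h
    rw [← mul_sub, Units.dvd_mul_left] at h
    obtain ⟨s, hs, huniq⟩ := hB' a'
    rw [huniq a ⟨(mem_coprimePart.1 ha).1, (hud _).2 (by rw [dvd_sub_comm]; exact h)⟩,
      huniq a' ⟨(mem_coprimePart.1 ha').1, by simp⟩]
  · intro b hb
    obtain ⟨s, ⟨hs, hsb⟩, -⟩ := hB' (((v⁻¹ : (OK D)ˣ) : OK D) * b)
    rw [hud] at hsb
    have hvs : d ∣ (v : OK D) * s - b := by
      have h1 := hsb.mul_left (v : OK D)
      rw [mul_sub, ← mul_assoc, Units.mul_inv, one_mul, dvd_sub_comm] at h1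
      exact h1
    refine ⟨s, mem_coprimePart.2 ⟨hs, (hcop s).2 ?_⟩, hvs⟩
    have h2 := IsCoprime.of_dvd_sub (mem_coprimePart.1 hb).2 (by rw [dvd_sub_comm]; exact hvs)
    exact (isCoprime_mul_unit_left_left v.isUnit s d).1 h2

/-- Grouping the residues by the greatest common divisor with the modulus. -/
lemma sum_residues_eq_sum_coprimePart (hD : D ∈ ({1, 2, 3, 7, 11} : Finset ℕ)) {d : OK D}
    (hd : d ≠ 0) {B : Finset (OK D)} (hB : IsResidueSystem d B) {S : Finset (OK D × OK D)}
    (hS : IsFactorizationSystem d S) {H : OK D → ℂ} (hH : ∀ x y, d ∣ x - y → H x = H y) :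
    ∑ x ∈ S, ∑ b ∈ coprimePart x.2 (residues x.2), H (x.1 * b) = ∑ b ∈ B, H b := by
  rw [Finset.sum_sigma']
  have hne : ∀ x ∈ S, x.1 ≠ 0 ∧ x.2 ≠ 0 := fun x hx =>
    ⟨fun h => hd (by rw [← hS.1 x hx, h, zero_mul]), fun h => hd (by rw [← hS.1 x hx, h, mul_zero])⟩
  refine sum_eq_sum_residues hB subset_rfl
    (fun a : (_ : OK D × OK D) × OK D => a.1.1 * a.2) hH (fun _ _ b hb _ => hb) ?_ ?_
  · rintro ⟨x, b⟩ hx ⟨y, c⟩ hy h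
    rw [Finset.mem_sigma, mem_coprimePart] at hx hy
    -- If `y.1 * c` is congruent to `x.1 * b` modulo `d`, then `x.1` divides `y.1 * c` and `d = y.1
    -- * y.2`, hence `y.1`, as `c` and `y.2` are coprime. By symmetry the class modulo `d`
    -- determines the common divisor up to units.
    have key : ∀ {x y : OK D × OK D} {b c : OK D}, x ∈ S → y ∈ S → IsCoprime c y.2 →
        d ∣ x.1 * b - y.1 * c → x.1 ∣ y.1 := by
      intro x y b c hx hy hc h
      have h1 : x.1 ∣ d := ⟨_, (hS.1 x hx).symm⟩
      have h2 : x.1 ∣ y.1 * c := by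
        have := dvd_sub (Dvd.intro b rfl) (h1.trans h)
        simpa using this
      obtain ⟨r, s, hrs⟩ := hc
      have h3 : y.1 = r * (y.1 * c) + s * d := by
        rw [← hS.1 y hy]; linear_combination -y.1 * hrs
      rw [h3]
      exact dvd_add (h2.mul_left _) (h1.mul_left _)
    have hass : Associated x.1 y.1 := associated_of_dvd_dvd (key hx.1 hy.1 hy.2.2 h)
      (key hy.1 hx.1 hx.2.2 (by rw [dvd_sub_comm]; exact h))
    have hxy : x = y := (hS.2 x.1 ⟨_, (hS.1 x hx.1).symm⟩).unique ⟨hx.1, Associated.refl _⟩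
      ⟨hy.1, hass⟩
    subst hxy
    have h4 : x.2 ∣ b - c := by
      refine (mul_dvd_mul_iff_left (hne x hx.1).1).1 ?_
      rw [hS.1 x hx.1, mul_sub]
      exact h
    have hbc := (residues_spec (hne x hx.1).2 b).unique (y₁ := b) (y₂ := c)
      ⟨hx.2.1, by simp⟩ ⟨hy.2.1, h4⟩
    rw [hbc]
  · intro b _
    obtain ⟨g, b', d', hb, hdg, hcop⟩ := exists_gcd hD b hd
    obtain ⟨x, ⟨hx, u, hu⟩, -⟩ := hS.2 g ⟨d', hdg⟩
    have hg0 : g ≠ 0 := fun h => hd (by rw [hdg, h, zero_mul])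
    have h2 : d' = u * x.2 := by
      have := hS.1 x hx
      rw [← hu, hdg, mul_assoc] at this
      exact (mul_left_cancel₀ hg0 this).symm
    obtain ⟨s, ⟨hs, hsb⟩, -⟩ := residues_spec (hne x hx).2 (((u⁻¹ : (OK D)ˣ) : OK D) * b')
    refine ⟨⟨x, s⟩, Finset.mem_sigma.2 ⟨hx, mem_coprimePart.2 ⟨hs, ?_⟩⟩, ?_⟩
    · refine IsCoprime.of_dvd_sub ?_ hsb
      rw [h2] at hcop
      exact (isCoprime_mul_unit_left_left (u⁻¹).isUnit _ _).2
        ((isCoprime_mul_unit_left_right u.isUnit _ _).1 hcop)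
    · have h3 : b = x.1 * (((u⁻¹ : (OK D)ˣ) : OK D) * b') := by
        rw [hb, ← hu, mul_assoc, ← mul_assoc (u : OK D), Units.mul_inv, one_mul]
      rw [h3, ← mul_sub, ← hS.1 x hx]
      exact mul_dvd_mul_left _ (by rw [dvd_sub_comm]; exact hsb)

lemma sum_pairs_unit {n : OK D} (hn : n ≠ 0) (u : (OK D)ˣ) (h : OK D → OK D → ℂ) :
    ∑ x ∈ pairs ((u : OK D) * n), h x.1 x.2 = ∑ x ∈ pairs n, h ((u : OK D) * x.1) x.2 := by
  have hn' : (u : OK D) * n ≠ 0 := mul_ne_zero u.ne_zero hn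
  symm
  refine Finset.sum_bij (fun x _ => ((u : OK D) * x.1, x.2)) ?_ ?_ ?_ (fun _ _ => rfl)
  · intro x hx
    rw [mem_pairs hn] at hx
    rw [mem_pairs hn', mul_assoc, hx]
  · rintro ⟨a, b⟩ _ ⟨c, e⟩ _ h
    obtain ⟨h1, h2⟩ := Prod.mk.inj h
    exact Prod.ext (mul_left_cancel₀ u.ne_zero h1) h2
  · rintro ⟨a, b⟩ hx
    rw [mem_pairs hn'] at hx
    refine ⟨(((u⁻¹ : (OK D)ˣ) : OK D) * a, b), ?_, ?_⟩
    · rw [mem_pairs hn]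
      change ((u⁻¹ : (OK D)ˣ) : OK D) * a * b = n
      rw [mul_assoc, hx, ← mul_assoc, Units.inv_mul, one_mul]
    · change ((u : OK D) * (((u⁻¹ : (OK D)ˣ) : OK D) * a), b) = (a, b)
      rw [← mul_assoc, Units.mul_inv, one_mul]

/-- Both sides run over the ordered triples with product `n`, bracketed in two ways. -/
lemma sum_pairs_assoc {n : OK D} (hn : n ≠ 0) (T : OK D → OK D → OK D → ℂ) :
    ∑ y ∈ pairs n, ∑ x ∈ pairs y.1, T x.1 x.2 y.2 =
      ∑ x ∈ pairs n, ∑ e ∈ pairs x.2, T e.1 x.1 e.2 := by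
  have hne : ∀ x ∈ pairs n, x.1 ≠ 0 ∧ x.2 ≠ 0 := fun x hx => by
    rw [mem_pairs hn] at hx
    exact ⟨fun h => hn (by rw [← hx, h, zero_mul]), fun h => hn (by rw [← hx, h, mul_zero])⟩
  rw [Finset.sum_sigma', Finset.sum_sigma']
  refine Finset.sum_bij' (fun a _ => ⟨(a.2.2, a.2.1 * a.1.2), (a.2.1, a.1.2)⟩)
    (fun a _ => ⟨(a.2.1 * a.1.1, a.2.2), (a.2.1, a.1.1)⟩) ?_ ?_ ?_ ?_ (fun _ _ => rfl)
  · rintro ⟨⟨a, b⟩, ⟨c, e⟩⟩ h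
    rw [Finset.mem_sigma] at h
    have h1 := (mem_pairs (hne _ h.1).1).1 h.2
    have h2 := (mem_pairs hn).1 h.1
    simp only at h1 h2
    have h3 : ((e, c * b) : OK D × OK D) ∈ pairs n :=
      (mem_pairs hn).2 (by rw [← h2, ← h1]; ring)
    exact Finset.mem_sigma.2 ⟨h3, (mem_pairs (hne _ h3).2).2 rfl⟩
  · rintro ⟨⟨a, b⟩, ⟨c, e⟩⟩ h
    rw [Finset.mem_sigma] at h
    have h1 := (mem_pairs (hne _ h.1).2).1 h.2
    have h2 := (mem_pairs hn).1 h.1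
    simp only at h1 h2
    have h3 : ((c * a, e) : OK D × OK D) ∈ pairs n :=
      (mem_pairs hn).2 (by rw [← h2, ← h1]; ring)
    exact Finset.mem_sigma.2 ⟨h3, (mem_pairs (hne _ h3).1).2 rfl⟩
  · rintro ⟨⟨a, b⟩, ⟨c, e⟩⟩ h
    rw [Finset.mem_sigma] at h
    have h1 := (mem_pairs (hne _ h.1).1).1 h.2
    simp only at h1
    simp [h1]
  · rintro ⟨⟨a, b⟩, ⟨c, e⟩⟩ h
    rw [Finset.mem_sigma] at h
    have h1 := (mem_pairs (hne _ h.1).2).1 h.2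
    simp only at h1
    simp [h1]

end

section

/-! ### The sum over the Hecke representatives -/

variable {D : ℕ}

/-- The sum over the residues coprime to the modulus. -/
def coprimeSum (φ : OK D → ℂ) (f : ℂ → ℂ) (d : OK D) : ℂ :=
  ∑ b ∈ coprimePart d (residues d), φ d * f (toC b / toC d)

lemma periodic_div {f : ℂ → ℂ} (hf : ∀ κ (b : OK D), f (κ + toC b) = f κ) {d : OK D}
    (hd : d ≠ 0) (x y : OK D) (h : d ∣ x - y) : f (toC x / toC d) = f (toC y / toC d) := by
  obtain ⟨c, hc⟩ := h
  have hd' := toC_ne_zero hd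
  rw [← hf (toC y / toC d) c, show x = y + d * c by linear_combination hc, toC_add, toC_mul]
  congr 1
  field_simp

lemma coprimeSum_eq {φ : OK D → ℂ} {f : ℂ → ℂ} (hf : ∀ κ (b : OK D), f (κ + toC b) = f κ)
    {d : OK D} (hd : d ≠ 0) {B : Finset (OK D)} (hB : IsResidueSystem d B) :
    ∑ b ∈ coprimePart d B, φ d * f (toC b / toC d) = coprimeSum φ f d := by
  have := sum_coprimePart_unit (d := d) 1 1 hB (B' := residues d)
    (by simpa using residues_spec hd) (periodic_div hf hd)
  simp only [Units.val_one, one_mul] at this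
  rw [coprimeSum, ← Finset.mul_sum, ← Finset.mul_sum, this]

lemma coprimeSum_unit {φ : OK D →* ℂ} {f : ℂ → ℂ} (hf : ∀ κ (b : OK D), f (κ + toC b) = f κ)
    {d : OK D} (hd : d ≠ 0) (u : (OK D)ˣ) :
    coprimeSum φ f ((u : OK D) * d) = φ u * coprimeSum φ f d := by
  have h := sum_coprimePart_unit (d := d) u u⁻¹ (residues_spec hd)
    (residues_spec (mul_ne_zero u.ne_zero hd)) (periodic_div hf hd)
  rw [coprimeSum, coprimeSum, ← Finset.mul_sum, ← Finset.mul_sum, ← h, map_mul, mul_assoc]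
  congr 2
  refine Finset.sum_congr rfl fun b _ => ?_
  congr 1
  have hu : toC (u : OK D) * toC ((u⁻¹ : (OK D)ˣ) : OK D) = 1 := toC_unit_mul_inv u
  have hu0 : toC (u : OK D) ≠ 0 := left_ne_zero_of_mul_eq_one hu
  have hd' := toC_ne_zero hd
  rw [toC_mul, toC_mul, eq_div_of_mul_eq hu0 ((mul_comm _ _).trans hu)]
  field_simp

/-- By the hypothesis `hu`, which for cusp forms is invariance under `diag(u⁻¹, u)`, the factor
amounts to multiplying the residues by `u⁻²`, and this permutes the classes coprime to `d`. So the
factor is `1` unless the sum vanishes, and the choice of representatives does not matter. -/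
lemma coprimeSum_mul_unit {φ ψ : OK D →* ℂ} {f : ℂ → ℂ}
    (hf : ∀ κ (b : OK D), f (κ + toC b) = f κ)
    (hu : ∀ (u : (OK D)ˣ) κ, f κ = ψ ((u⁻¹ : (OK D)ˣ) : OK D) * φ u *
      f (toC ((u⁻¹ : (OK D)ˣ) : OK D) * κ / toC (u : OK D)))
    {d : OK D} (hd : d ≠ 0) (u : (OK D)ˣ) :
    ψ ((u⁻¹ : (OK D)ˣ) : OK D) * φ u * coprimeSum φ f d = coprimeSum φ f d := by
  have h := sum_coprimePart_unit (d := d) 1 (u⁻¹ * u⁻¹) (residues_spec hd) (B' := residues d)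
    (by simpa using residues_spec hd) (periodic_div hf hd)
  simp only [Units.val_one, one_mul] at h
  rw [coprimeSum, ← Finset.mul_sum]
  nth_rewrite 1 [← h]
  rw [mul_left_comm, Finset.mul_sum]
  congr 1
  refine Finset.sum_congr rfl fun b _ => ?_
  rw [hu u (toC b / toC d)]
  have hu1 : toC (u : OK D) * toC ((u⁻¹ : (OK D)ˣ) : OK D) = 1 := toC_unit_mul_inv u
  have hu0 : toC (u : OK D) ≠ 0 := left_ne_zero_of_mul_eq_one hu1
  have hd' := toC_ne_zero hd
  congr 2
  rw [Units.val_mul, toC_mul, toC_mul, eq_div_of_mul_eq hu0 ((mul_comm _ _).trans hu1)]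
  field_simp

lemma map_unit_mul_map_inv (φ : OK D →* ℂ) (u : (OK D)ˣ) :
    φ u * φ ((u⁻¹ : (OK D)ˣ) : OK D) = 1 := by
  rw [← map_mul, Units.mul_inv, map_one]

/-- Reorganization of the sum over all upper triangular representatives. -/
theorem sum_hecke_representatives (hD : D ∈ ({1, 2, 3, 7, 11} : Finset ℕ)) (φ ψ : OK D →* ℂ)
    (f : ℂ → ℂ) (hf : ∀ κ (b : OK D), f (κ + toC b) = f κ)
    (hu : ∀ (u : (OK D)ˣ) κ, f κ = ψ ((u⁻¹ : (OK D)ˣ) : OK D) * φ u *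
      f (toC ((u⁻¹ : (OK D)ˣ) : OK D) * κ / toC (u : OK D)))
    {n : OK D} (hn : n ≠ 0) {S : Finset (OK D × OK D)} (hS : IsFactorizationSystem n S)
    {B : OK D → Finset (OK D)} (hB : ∀ x ∈ S, IsResidueSystem x.1 (B x.1))
    {E : OK D → Finset (OK D × OK D)} (hE : ∀ x ∈ S, IsFactorizationSystem x.2 (E x.2)) :
    ∑ y ∈ factorizations n, ∑ b ∈ residues y.1, ψ y.2 * φ y.1 * f (toC b / toC y.1) =
      ∑ x ∈ S, (∑ b ∈ coprimePart x.1 (B x.1), φ x.1 * f (toC b / toC x.1)) *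
        ∑ e ∈ E x.2, φ e.1 * ψ e.2 := by
  have hne : ∀ x : OK D × OK D, x.1 * x.2 = n → x.1 ≠ 0 ∧ x.2 ≠ 0 := fun x hx =>
    ⟨fun h => hn (by rw [← hx, h, zero_mul]), fun h => hn (by rw [← hx, h, mul_zero])⟩
  have hinv := map_unit_mul_map_inv φ
  have hcard : (Fintype.card (OK D)ˣ : ℂ) ≠ 0 := by exact_mod_cast Fintype.card_ne_zero
  -- On the left the residues modulo `y.1` are grouped by their common divisor `x.1` with the
  -- modulus; `b/d` is reduced to lowest terms and `φ` splits off `φ x.1`.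
  have hL : ∀ y : OK D × OK D, y.1 * y.2 = n → (Fintype.card (OK D)ˣ : ℂ) *
      ∑ b ∈ residues y.1, ψ y.2 * φ y.1 * f (toC b / toC y.1) =
      ∑ x ∈ pairs y.1, φ x.1 * coprimeSum φ f x.2 * ψ y.2 := fun y hy => by
    have h1 := (hne y hy).1
    have h2 := sum_residues_eq_sum_coprimePart hD h1 (residues_spec h1)
      (factorizations_spec h1) (periodic_div hf h1)
    have hfac : ∀ x ∈ factorizations y.1, x.1 ≠ 0 ∧ x.2 ≠ 0 ∧ x.1 * x.2 = y.1 := fun x hx => by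
      have := (factorizations_spec h1).1 x hx
      exact ⟨fun h => h1 (by rw [← this, h, zero_mul]), fun h => h1 (by rw [← this, h, mul_zero]),
        this⟩
    have h3 : ∑ b ∈ residues y.1, ψ y.2 * φ y.1 * f (toC b / toC y.1) =
        ∑ x ∈ factorizations y.1, φ x.1 * coprimeSum φ f x.2 * ψ y.2 := by
      rw [← Finset.mul_sum, ← h2, Finset.mul_sum]
      refine Finset.sum_congr rfl fun x hx => ?_
      obtain ⟨hx1, hx2, hx3⟩ := hfac x hx
      rw [coprimeSum, ← Finset.mul_sum, ← hx3, map_mul]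
      have e : ∀ b, toC (x.1 * b) / toC (x.1 * x.2) = toC b / toC x.2 := fun b => by
        have := toC_ne_zero hx1
        rw [toC_mul, toC_mul, mul_div_mul_left _ _ this]
      simp only [e]
      ring
    rw [h3]
    rw [(factorizations_spec h1).card_mul_sum h1
      (fun d e => φ d * coprimeSum φ f e * ψ y.2) fun u d e => ?_]
    -- Unit invariance is required for all arguments, including zero. There the chosen residue
    -- system is empty and both sides vanish.
    by_cases he : e = 0
    · subst he
      simp [coprimeSum, coprimePart, residues]
    · rw [coprimeSum_unit hf he, map_mul]
      linear_combination (φ d * coprimeSum φ f e * ψ y.2) * hinv u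
  have hR : ∀ x ∈ S, (Fintype.card (OK D)ˣ : ℂ) *
      ((∑ b ∈ coprimePart x.1 (B x.1), φ x.1 * f (toC b / toC x.1)) *
        ∑ e ∈ E x.2, φ e.1 * ψ e.2) =
      ∑ e ∈ pairs x.2, φ e.1 * coprimeSum φ f x.1 * ψ e.2 := fun x hx => by
    obtain ⟨h1, h2⟩ := hne x (hS.1 x hx)
    rw [coprimeSum_eq hf h1 (hB x hx), Finset.mul_sum]
    rw [← (hE x hx).card_mul_sum h2 (fun d e => φ d * coprimeSum φ f x.1 * ψ e) fun u d e => ?_]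
    · congr 1
      refine Finset.sum_congr rfl fun e _ => ?_
      ring
    · rw [map_mul, map_mul]
      linear_combination φ d * ψ e * coprimeSum_mul_unit hf hu h1 u
  -- The number of units enters twice, once for the factorizations of `n` and once for those of a
  -- factor. Both sides then become sums over all ordered triples.
  refine mul_left_cancel₀ hcard (mul_left_cancel₀ hcard ?_)
  have hLsum : (Fintype.card (OK D)ˣ : ℂ) * ((Fintype.card (OK D)ˣ : ℂ) *
      ∑ y ∈ factorizations n, ∑ b ∈ residues y.1, ψ y.2 * φ y.1 * f (toC b / toC y.1)) =
      ∑ y ∈ pairs n, ∑ x ∈ pairs y.1, φ x.1 * coprimeSum φ f x.2 * ψ y.2 := by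
    rw [Finset.mul_sum, Finset.sum_congr rfl fun y hy => hL y ((factorizations_spec hn).1 y hy)]
    refine (factorizations_spec hn).card_mul_sum hn
      (fun d e => ∑ x ∈ pairs d, φ x.1 * coprimeSum φ f x.2 * ψ e) fun u d e => ?_
    by_cases hd : d = 0
    · subst hd; simp [pairs]
    · rw [sum_pairs_unit hd u (fun a b => φ a * coprimeSum φ f b * ψ _)]
      refine Finset.sum_congr rfl fun x hx => ?_
      rw [mem_pairs hd] at hx
      have hx2 : x.2 ≠ 0 := fun h => hd (by rw [← hx, h, mul_zero])
      rw [map_mul, map_mul]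
      linear_combination φ x.1 * ψ e * coprimeSum_mul_unit hf hu hx2 u
  have hRsum : (Fintype.card (OK D)ˣ : ℂ) * ((Fintype.card (OK D)ˣ : ℂ) *
      ∑ x ∈ S, (∑ b ∈ coprimePart x.1 (B x.1), φ x.1 * f (toC b / toC x.1)) *
        ∑ e ∈ E x.2, φ e.1 * ψ e.2) =
      ∑ x ∈ pairs n, ∑ e ∈ pairs x.2, φ e.1 * coprimeSum φ f x.1 * ψ e.2 := by
    rw [Finset.mul_sum, Finset.sum_congr rfl hR]
    refine hS.card_mul_sum hn
      (fun d m => ∑ e ∈ pairs m, φ e.1 * coprimeSum φ f d * ψ e.2) fun u d m => ?_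
    by_cases hm : m = 0
    · subst hm; simp [pairs]
    · rw [sum_pairs_unit hm u⁻¹ (fun a b => φ a * coprimeSum φ f _ * ψ b)]
      refine Finset.sum_congr rfl fun e _ => ?_
      by_cases hd : d = 0
      · subst hd; simp [coprimeSum, coprimePart, residues]
      · rw [map_mul, coprimeSum_unit hf hd]
        linear_combination φ e.1 * coprimeSum φ f d * ψ e.2 * hinv u
  rw [hLsum, hRsum, sum_pairs_assoc hn fun a b c => φ a * coprimeSum φ f b * ψ c]

end

section

/-! ### The periods of the image under a Hecke operator -/

variable {D k : ℕ} {F : ℂ × ℝ → MvPolynomial (Fin 2) ℂ}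

/-- The coefficients `m p i` and `m' i l` are, up to `k`, inverse triangular matrices. -/
def IsInverseTriangular (k : ℕ) (m m' : ℕ → ℕ → ℂ) : Prop :=
  ∀ p ≤ k, ∀ l ≤ p, ∑ s ∈ Finset.range (p + 1 - l), m p (l + s) * m' (l + s) l =
    if l = p then 1 else 0

lemma IsInverseTriangular.sum_sum {m m' : ℕ → ℕ → ℂ} (h : IsInverseTriangular k m m') {p : ℕ}
    (hp : p ≤ k) (c : ℕ → ℂ) :
    ∑ i ∈ Finset.range (p + 1), m p i * ∑ l ∈ Finset.range (i + 1), m' i l * c l = c p := by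
  have h1 : ∑ i ∈ Finset.range (p + 1), m p i * ∑ l ∈ Finset.range (i + 1), m' i l * c l =
      ∑ l ∈ Finset.range (p + 1), ∑ i ∈ Finset.Ico l (p + 1), m p i * (m' i l * c l) := by
    simp only [Finset.mul_sum]
    refine Finset.sum_comm' fun i l => ?_
    simp only [Finset.mem_range, Finset.mem_Ico]
    omega
  rw [h1, Finset.sum_eq_single p]
  · have := h p hp p le_rfl
    rw [if_pos rfl] at this
    rw [Finset.sum_Ico_eq_sum_range]
    simp only [← mul_assoc]
    rw [← Finset.sum_mul, this, one_mul]
  · intro l hl hlp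
    rw [Finset.mem_range] at hl
    have := h p hp l (by omega)
    rw [if_neg hlp] at this
    rw [Finset.sum_Ico_eq_sum_range]
    simp only [← mul_assoc]
    rw [← Finset.sum_mul, this, zero_mul]
  · simp

lemma IsInverseTriangular.sum_sum_sum_sum {m m' n n' : ℕ → ℕ → ℂ}
    (h : IsInverseTriangular k m m') (h' : IsInverseTriangular k n n') {p q : ℕ} (hp : p ≤ k)
    (hq : q ≤ k) (c : ℕ → ℕ → ℂ) :
    ∑ i ∈ Finset.range (p + 1), ∑ j ∈ Finset.range (q + 1), m p i * n q j *
      ∑ a ∈ Finset.range (i + 1), ∑ b ∈ Finset.range (j + 1), m' i a * n' j b * c a b = c p q := by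
  rw [← h.sum_sum hp fun a => c a q]
  refine Finset.sum_congr rfl fun i _ => ?_
  simp only [← h'.sum_sum hq, Finset.mul_sum]
  rw [Finset.sum_comm' (s := Finset.range (i + 1)) (t' := Finset.range (q + 1))
    (s' := fun _ => Finset.range (i + 1)) (fun _ _ => Iff.rfl)]
  refine Finset.sum_congr rfl fun j _ => Finset.sum_congr rfl fun a _ =>
    Finset.sum_congr rfl fun b _ => ?_
  ring

/-- The product of the two matrices is a binomial coefficient times the binomial expansion of `(-κ +
κ)^{p-l}`. -/
lemma isInverseTriangular_choose (k : ℕ) (κ : ℂ) :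
    IsInverseTriangular k (fun p i => p.choose i * κ ^ (p - i))
      (fun p i => p.choose i * (-κ) ^ (p - i)) := by
  intro p _ l hl
  obtain ⟨s, rfl⟩ := Nat.exists_eq_add_of_le hl
  have h : ∀ r ∈ Finset.range (l + s + 1 - l), ((l + s).choose (l + r) : ℂ) *
      κ ^ (l + s - (l + r)) * ((l + r).choose l * (-κ) ^ (l + r - l)) =
      (l + s).choose l * ((-κ) ^ r * κ ^ (s - r) * s.choose r) := fun r _ => by
    have h1 := Nat.choose_mul (n := l + s) (k := l + r) (s := l) (by omega)
    rw [Nat.add_sub_cancel_left, Nat.add_sub_cancel_left] at h1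
    have h2 : ((l + s).choose (l + r) : ℂ) * (l + r).choose l = (l + s).choose l * s.choose r := by
      exact_mod_cast h1
    rw [Nat.add_sub_add_left, Nat.add_sub_cancel_left]
    linear_combination (κ ^ (s - r) * (-κ) ^ r) * h2
  rw [Finset.sum_congr rfl h, show l + s + 1 - l = s + 1 by omega, ← Finset.mul_sum, ← add_pow,
    neg_add_cancel]
  rcases Nat.eq_zero_or_pos s with rfl | hs
  · simp
  · rw [zero_pow hs.ne', mul_zero, if_neg (by omega)]

/-- The same cancellation: the product of the two weights is `binom(k-l, s) binom(s, r)`, with the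
first factor independent of the summation index. -/
lemma isInverseTriangular_choose_sub (k : ℕ) (κ : ℂ) :
    IsInverseTriangular k (fun p i => (k - i).choose (p - i) * κ ^ (p - i))
      (fun p i => (k - i).choose (p - i) * (-κ) ^ (p - i)) := by
  intro p hp l hl
  obtain ⟨s, rfl⟩ := Nat.exists_eq_add_of_le hl
  have h : ∀ r ∈ Finset.range (l + s + 1 - l), ((k - (l + r)).choose (l + s - (l + r)) : ℂ) *
      κ ^ (l + s - (l + r)) * ((k - l).choose (l + r - l) * (-κ) ^ (l + r - l)) =
      (k - l).choose s * ((-κ) ^ r * κ ^ (s - r) * s.choose r) := fun r hr => by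
    rw [Finset.mem_range] at hr
    have h1 := Nat.choose_mul (n := k - l) (k := s) (s := r) (by omega)
    rw [Nat.sub_sub] at h1
    have h2 : ((k - l).choose s : ℂ) * s.choose r =
      (k - l).choose r * (k - (l + r)).choose (s - r) := by exact_mod_cast h1
    rw [Nat.add_sub_add_left, Nat.add_sub_cancel_left]
    linear_combination (-(κ ^ (s - r) * (-κ) ^ r)) * h2
  rw [Finset.sum_congr rfl h, show l + s + 1 - l = s + 1 by omega, ← Finset.mul_sum, ← add_pow,
    neg_add_cancel]
  rcases Nat.eq_zero_or_pos s with rfl | hs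
  · simp
  · rw [zero_pow hs.ne', mul_zero, if_neg (by omega)]

lemma pow_mul_pow_eq_div {b d : ℂ} (hd : d ≠ 0) {p i : ℕ} (hi : i ≤ p) :
    b ^ (p - i) * d ^ i = d ^ p * (b / d) ^ (p - i) := by
  obtain ⟨s, rfl⟩ := Nat.exists_eq_add_of_le hi
  rw [Nat.add_sub_cancel_left, div_pow, pow_add]
  field_simp

/-- The periods invert to the integrals. -/
lemma sum_period_eq_cPeriod {p q : ℕ} (hp : p ≤ k) (hq : q ≤ k) {b d : ℂ} (hd : d ≠ 0) :
    ∑ i ∈ Finset.range (p + 1), ∑ j ∈ Finset.range (q + 1), (p.choose i : ℂ) * (q.choose j : ℂ) *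
      b ^ (p - i) * d ^ i * (conj b) ^ (q - j) * (conj d) ^ j * period k i j (b / d) F =
      d ^ p * conj d ^ q * cPeriod k p q (b / d) F := by
  have hcd : conj d ≠ 0 := by simpa using hd
  rw [← (isInverseTriangular_choose k (b / d)).sum_sum_sum_sum
    (isInverseTriangular_choose k (conj (b / d))) hp hq (fun i j => cPeriod k i j (b / d) F),
    Finset.mul_sum]
  refine Finset.sum_congr rfl fun i hi => ?_
  rw [Finset.mul_sum]
  refine Finset.sum_congr rfl fun j hj => ?_
  rw [Finset.mem_range] at hi hj
  have h1 := pow_mul_pow_eq_div (b := b) hd (Nat.le_of_lt_succ hi)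
  have h2 := pow_mul_pow_eq_div (b := conj b) hcd (Nat.le_of_lt_succ hj)
  rw [← map_div₀] at h2
  have h3 : period k i j (b / d) F = ∑ a ∈ Finset.range (i + 1), ∑ c ∈ Finset.range (j + 1),
      (i.choose a * (-(b / d)) ^ (i - a)) * (j.choose c * (-conj (b / d)) ^ (j - c)) *
        cPeriod k a c (b / d) F := by
    rw [period]
    refine Finset.sum_congr rfl fun a _ => Finset.sum_congr rfl fun c _ => ?_
    rw [neg_pow (b / d), neg_pow (conj (b / d)), pow_add]
    ring
  rw [← h3]
  calc _ = (p.choose i : ℂ) * (q.choose j : ℂ) * (b ^ (p - i) * d ^ i) *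
        ((conj b) ^ (q - j) * (conj d) ^ j) * period k i j (b / d) F := by ring
    _ = _ := by rw [h1, h2]; ring

lemma sum_period'_eq_cPeriod {p q : ℕ} (hp : p ≤ k) (hq : q ≤ k) {b d : ℂ} (hd : d ≠ 0) :
    ∑ i ∈ Finset.range (p + 1), ∑ j ∈ Finset.range (q + 1), ((k - i).choose (p - i) : ℂ) *
      ((k - j).choose (q - j) : ℂ) * b ^ (p - i) * d ^ i * (conj b) ^ (q - j) * (conj d) ^ j *
        period' k i j (b / d) F = d ^ p * conj d ^ q * cPeriod k p q (b / d) F := by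
  have hcd : conj d ≠ 0 := by simpa using hd
  rw [← (isInverseTriangular_choose_sub k (b / d)).sum_sum_sum_sum
    (isInverseTriangular_choose_sub k (conj (b / d))) hp hq (fun i j => cPeriod k i j (b / d) F),
    Finset.mul_sum]
  refine Finset.sum_congr rfl fun i hi => ?_
  rw [Finset.mul_sum]
  refine Finset.sum_congr rfl fun j hj => ?_
  rw [Finset.mem_range] at hi hj
  have h1 := pow_mul_pow_eq_div (b := b) hd (Nat.le_of_lt_succ hi)
  have h2 := pow_mul_pow_eq_div (b := conj b) hcd (Nat.le_of_lt_succ hj)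
  rw [← map_div₀] at h2
  have h3 : period' k i j (b / d) F = ∑ a ∈ Finset.range (i + 1), ∑ c ∈ Finset.range (j + 1),
      ((k - a).choose (i - a) * (-(b / d)) ^ (i - a)) *
        ((k - c).choose (j - c) * (-conj (b / d)) ^ (j - c)) * cPeriod k a c (b / d) F := by
    rw [period']
    refine Finset.sum_congr rfl fun a _ => Finset.sum_congr rfl fun c _ => ?_
    rw [neg_pow (b / d), neg_pow (conj (b / d)), pow_add]
    ring
  rw [← h3]
  calc _ = ((k - i).choose (p - i) : ℂ) * ((k - j).choose (q - j) : ℂ) * (b ^ (p - i) * d ^ i) *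
        ((conj b) ^ (q - j) * (conj d) ^ j) * period' k i j (b / d) F := by ring
    _ = _ := by rw [h1, h2]; ring

lemma period'_zero {p q : ℕ} : period' k p q 0 F = cPeriod k p q 0 F := by
  rw [period', Finset.sum_range_succ, Finset.sum_eq_zero, zero_add, Finset.sum_range_succ,
    Finset.sum_eq_zero]
  · simp
  · intro j hj
    rw [Finset.mem_range] at hj
    simp [zero_pow (Nat.sub_ne_zero_of_lt hj)]
  · intro i hi
    rw [Finset.mem_range] at hi
    simp [zero_pow (Nat.sub_ne_zero_of_lt hi)]

/-- The map `a ↦ a^p ā^q`. -/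
def powConjPow (D p q : ℕ) : OK D →* ℂ where
  toFun a := toC a ^ p * conj (toC a) ^ q
  map_one' := by simp [toC_one]
  map_mul' a b := by rw [toC_mul, map_mul]; ring

lemma IsCuspForm.cPeriod_hecke_eq (hD : D ∈ ({1, 2, 3, 7, 11} : Finset ℕ))
    (hF : IsCuspForm D k F) {n : OK D} (hn : n ≠ 0) {S : Finset (OK D × OK D)}
    (hS : IsFactorizationSystem n S) {B : OK D → Finset (OK D)}
    (hB : ∀ x ∈ S, IsResidueSystem x.1 (B x.1)) {E : OK D → Finset (OK D × OK D)}
    (hE : ∀ x ∈ S, IsFactorizationSystem x.2 (E x.2)) {p q : ℕ} (hp : p ≤ k) (hq : q ≤ k) :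
    cPeriod k p q 0 (hecke k n F) = ∑ x ∈ S, (∑ b ∈ coprimePart x.1 (B x.1),
      toC x.1 ^ p * conj (toC x.1) ^ q * cPeriod k p q (toC b / toC x.1) F) *
        ∑ e ∈ E x.2, toC e.1 ^ p * conj (toC e.1) ^ q * toC e.2 ^ (k - p) *
          conj (toC e.2) ^ (k - q) := by
  rw [hF.cPeriod_hecke hD hn hp hq]
  refine (sum_hecke_representatives hD (powConjPow D p q) (powConjPow D (k - p) (k - q))
    (fun κ => cPeriod k p q κ F) (fun κ b => hF.cPeriod_add b p q κ)
    (fun u κ => hF.cPeriod_unit u hp hq κ) hn hS hB hE).trans ?_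
  refine Finset.sum_congr rfl fun x _ => congrArg₂ _ rfl (Finset.sum_congr rfl fun e _ => ?_)
  exact (mul_assoc _ _ _).symm

/-- The linear functional `L` on cusp forms is an `𝓞_K`-linear combination of the periods at `0`. -/
def IsIntegralCombination (D k : ℕ) (L : (ℂ × ℝ → MvPolynomial (Fin 2) ℂ) → ℂ) : Prop :=
  ∃ a : ℕ → ℕ → OK D, ∀ F, IsCuspForm D k F → L F = ∑ i ∈ Finset.range (k + 1),
    ∑ j ∈ Finset.range (k + 1), toC (a i j) * period k i j 0 F

lemma IsIntegralCombination.sum {ι : Type*} {s : Finset ι}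
    {L : ι → (ℂ × ℝ → MvPolynomial (Fin 2) ℂ) → ℂ}
    (h : ∀ i ∈ s, IsIntegralCombination D k (L i)) :
    IsIntegralCombination D k (fun F => ∑ i ∈ s, L i F) := by
  choose! a ha using h
  refine ⟨fun i j => ∑ x ∈ s, a x i j, fun F hF => ?_⟩
  have hsum : ∀ i j, toC (∑ x ∈ s, a x i j) = ∑ x ∈ s, toC (a x i j) := fun i j => by simp [toC]
  beta_reduce
  rw [Finset.sum_congr rfl fun x hx => ha x hx F hF, Finset.sum_comm]
  refine Finset.sum_congr rfl fun i _ => ?_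
  rw [Finset.sum_comm]
  refine Finset.sum_congr rfl fun j _ => ?_
  rw [hsum, Finset.sum_mul]

lemma IsIntegralCombination.const_mul {L : (ℂ × ℝ → MvPolynomial (Fin 2) ℂ) → ℂ}
    (h : IsIntegralCombination D k L) {c : ℂ} (hc : c ∈ integersC D) :
    IsIntegralCombination D k (fun F => c * L F) := by
  obtain ⟨a, ha⟩ := h
  obtain ⟨c, rfl⟩ := hc
  refine ⟨fun i j => c * a i j, fun F hF => ?_⟩
  beta_reduce
  rw [ha F hF]
  simp only [Finset.mul_sum, toC_mul, mul_assoc]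

lemma isIntegralCombination_period (hD : D ∈ ({1, 2, 3, 7, 11} : Finset ℕ)) {κ : ℂ} (hκ : κ ∈ K D)
    {p q : ℕ} (hp : p ≤ k) (hq : q ≤ k) :
    IsIntegralCombination D k (fun F => period k p q κ F) := by
  obtain ⟨a, ha⟩ := exists_period_eq_sum hD k hκ
  exact ⟨a p q, fun F hF => ha F hF p hp q hq⟩

/-- The individual `c_{p,q}(b/d, F)` may have denominators as combinations of the periods. The Hecke
formula contains them only multiplied by `d^p d̄^q`, and by `sum_period_eq_cPeriod` this product is
an integral combination of the `r_{i,j}(b/d, F)`. -/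
lemma isIntegralCombination_hecke (hD : D ∈ ({1, 2, 3, 7, 11} : Finset ℕ)) {n : OK D} (hn : n ≠ 0)
    {p q : ℕ} (hp : p ≤ k) (hq : q ≤ k) :
    IsIntegralCombination D k (fun F => period k p q 0 (hecke k n F)) := by
  have key : IsIntegralCombination D k (fun F => ∑ y ∈ factorizations n, ∑ b ∈ residues y.1,
      (toC y.2 ^ (k - p) * conj (toC y.2) ^ (k - q)) *
        ∑ i ∈ Finset.range (p + 1), ∑ j ∈ Finset.range (q + 1),
          ((p.choose i : ℂ) * (q.choose j : ℂ) * toC b ^ (p - i) * toC y.1 ^ i *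
            (conj (toC b)) ^ (q - j) * (conj (toC y.1)) ^ j) *
            period k i j (toC b / toC y.1) F) := by
    refine IsIntegralCombination.sum fun y _ => IsIntegralCombination.sum fun b _ =>
      IsIntegralCombination.const_mul (IsIntegralCombination.sum fun i hi =>
        IsIntegralCombination.sum fun j hj => IsIntegralCombination.const_mul ?_ ?_) ?_
    · rw [Finset.mem_range] at hi hj
      exact isIntegralCombination_period hD (div_mem_K _ _) (by omega) (by omega)
    · have h1 := toC_mem b
      have h2 := toC_mem y.1
      exact mul_mem (mul_mem (mul_mem (mul_mem (mul_mem (natCast_mem _ _) (natCast_mem _ _))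
        (pow_mem h1 _)) (pow_mem h2 _)) (pow_mem (conj_mem_integersC h1) _))
        (pow_mem (conj_mem_integersC h2) _)
    · exact mul_mem (pow_mem (toC_mem _) _) (pow_mem (conj_mem_integersC (toC_mem _)) _)
  obtain ⟨a, ha⟩ := key
  refine ⟨a, fun F hF => ?_⟩
  rw [← ha F hF]
  beta_reduce
  rw [period_zero, hF.cPeriod_hecke hD hn hp hq]
  refine Finset.sum_congr rfl fun y hy => Finset.sum_congr rfl fun b _ => ?_
  have hy0 : y.1 ≠ 0 := fun h => hn (by rw [← (factorizations_spec hn).1 y hy, h, zero_mul])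
  rw [sum_period_eq_cPeriod hp hq (toC_ne_zero hy0)]
  ring

end

end

end Bianchi

theorem mainTheorem3 (D : ℕ) (hD : D ∈ ({1, 2, 3, 7, 11} : Finset ℕ)) (k : ℕ) :
    -- the period integrals converge
    (∀ F : ℂ × ℝ → MvPolynomial (Fin 2) ℂ, Bianchi.IsCuspForm D k F →
      ∀ κ ∈ Bianchi.K D, ∀ i ≤ k, ∀ j ≤ k,
        MeasureTheory.IntegrableOn (Bianchi.periodIntegrand k i j κ F) (Set.Ioi 0)) ∧
    (∀ F : ℂ × ℝ → MvPolynomial (Fin 2) ℂ, Bianchi.IsCuspForm D k F →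
      ∀ n : Bianchi.OK D, n ≠ 0 → ∀ i ≤ k, ∀ j ≤ k,
        MeasureTheory.IntegrableOn
          (Bianchi.periodIntegrand k i j 0 (Bianchi.hecke k n F)) (Set.Ioi 0)) ∧
    -- the explicit formula for the periods of `T_n F`
    (∀ F : ℂ × ℝ → MvPolynomial (Fin 2) ℂ, Bianchi.IsCuspForm D k F →
      ∀ n : Bianchi.OK D, n ≠ 0 →
      ∀ S : Finset (Bianchi.OK D × Bianchi.OK D), Bianchi.IsFactorizationSystem n S →
      ∀ B : Bianchi.OK D → Finset (Bianchi.OK D),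
        (∀ x ∈ S, Bianchi.IsResidueSystem x.1 (B x.1)) →
      ∀ E : Bianchi.OK D → Finset (Bianchi.OK D × Bianchi.OK D),
        (∀ x ∈ S, Bianchi.IsFactorizationSystem x.2 (E x.2)) →
      ∀ p ≤ k, ∀ q ≤ k,
        (Bianchi.period k p q 0 (Bianchi.hecke k n F) =
          ∑ x ∈ S,
            (∑ i ∈ Finset.range (p + 1), ∑ j ∈ Finset.range (q + 1),
              ∑ b ∈ Bianchi.coprimePart x.1 (B x.1),
                (p.choose i : ℂ) * (q.choose j : ℂ) *
                Bianchi.toC b ^ (p - i) * Bianchi.toC x.1 ^ i *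
                (starRingEnd ℂ (Bianchi.toC b)) ^ (q - j) *
                (starRingEnd ℂ (Bianchi.toC x.1)) ^ j *
                Bianchi.period k i j (Bianchi.toC b / Bianchi.toC x.1) F) *
            (∑ e ∈ E x.2,
              Bianchi.toC e.1 ^ p * (starRingEnd ℂ (Bianchi.toC e.1)) ^ q *
              Bianchi.toC e.2 ^ (k - p) * (starRingEnd ℂ (Bianchi.toC e.2)) ^ (k - q))) ∧
        (Bianchi.period' k p q 0 (Bianchi.hecke k n F) =
          ∑ x ∈ S,
            (∑ i ∈ Finset.range (p + 1), ∑ j ∈ Finset.range (q + 1),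
              ∑ b ∈ Bianchi.coprimePart x.1 (B x.1),
                ((k - i).choose (p - i) : ℂ) * ((k - j).choose (q - j) : ℂ) *
                Bianchi.toC b ^ (p - i) * Bianchi.toC x.1 ^ i *
                (starRingEnd ℂ (Bianchi.toC b)) ^ (q - j) *
                (starRingEnd ℂ (Bianchi.toC x.1)) ^ j *
                Bianchi.period' k i j (Bianchi.toC b / Bianchi.toC x.1) F) *
            (∑ e ∈ E x.2,
              Bianchi.toC e.1 ^ p * (starRingEnd ℂ (Bianchi.toC e.1)) ^ q *
              Bianchi.toC e.2 ^ (k - p) * (starRingEnd ℂ (Bianchi.toC e.2)) ^ (k - q)))) ∧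
    -- the periods at `κ ∈ K` through the Hurwitz continued fraction of `κ`
    (∀ ρ : ℂ → Bianchi.OK D, Bianchi.IsNearest ρ → ∀ κ ∈ Bianchi.K D,
      ∃ m : ℕ, Bianchi.StopsAt ρ κ m ∧
        ∀ F : ℂ × ℝ → MvPolynomial (Fin 2) ℂ, Bianchi.IsCuspForm D k F →
        ∀ p ≤ k, ∀ q ≤ k,
          Bianchi.period k p q κ F =
            ∑ l ∈ Finset.range (m + 1),
              ∑ i ∈ Finset.range (k + 1), ∑ j ∈ Finset.range (k + 1),
                (-1) ^ (p + q + i + j) *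
                Bianchi.eCoeff k p q i j
                  ((-1) ^ l * Bianchi.toC (Bianchi.num ρ κ l))
                  (Bianchi.toC (Bianchi.num ρ κ (l + 1)))
                  ((-1) ^ l * Bianchi.toC (Bianchi.den ρ κ l))
                  (Bianchi.toC (Bianchi.den ρ κ (l + 1))) *
                Bianchi.period k i j 0 F) ∧
    -- the periods at `κ ∈ K` are `𝓞_K`-linear combinations of those at `0`
    (∀ κ ∈ Bianchi.K D, ∃ a : ℕ → ℕ → ℕ → ℕ → Bianchi.OK D,
      ∀ F : ℂ × ℝ → MvPolynomial (Fin 2) ℂ, Bianchi.IsCuspForm D k F →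
      ∀ p ≤ k, ∀ q ≤ k,
        Bianchi.period k p q κ F =
          ∑ i ∈ Finset.range (k + 1), ∑ j ∈ Finset.range (k + 1),
            Bianchi.toC (a p q i j) * Bianchi.period k i j 0 F) ∧
    -- the periods of `T_n F` are `𝓞_K`-linear combinations of those of `F`
    (∀ n : Bianchi.OK D, n ≠ 0 → ∃ A : ℕ → ℕ → ℕ → ℕ → Bianchi.OK D,
      ∀ F : ℂ × ℝ → MvPolynomial (Fin 2) ℂ, Bianchi.IsCuspForm D k F →
      ∀ p ≤ k, ∀ q ≤ k,
        Bianchi.period k p q 0 (Bianchi.hecke k n F) =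
          ∑ i ∈ Finset.range (k + 1), ∑ j ∈ Finset.range (k + 1),
            Bianchi.toC (A p q i j) * Bianchi.period k i j 0 F) := by
  refine ⟨fun F hF κ hκ i hi j hj => ?_, fun F hF n hn i hi j hj => hF.integrableOn_hecke hD hn hi hj,
    fun F hF n hn S hS B hB E hE p hp q hq => ?_, fun ρ hρ κ hκ => ?_, fun κ hκ =>
    Bianchi.exists_period_eq_sum hD k hκ, fun n hn => ?_⟩
  · obtain ⟨b, hb⟩ := Bianchi.exists_toC_eq_omega D
    exact hF.integrableOn_periodIntegrand hb
      (Bianchi.omega_im_ne_zero (Bianchi.pos_of_mem_euclidean hD))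
      (Bianchi.isFiniteCusp_of_mem_K hD hκ) hi hj
  · have hS0 : ∀ x ∈ S, Bianchi.toC x.1 ≠ 0 := fun x hx =>
      Bianchi.toC_ne_zero fun h => hn (by rw [← hS.1 x hx, h, zero_mul])
    have hswap : ∀ (x : Bianchi.OK D × Bianchi.OK D) (f : ℕ → ℕ → Bianchi.OK D → ℂ),
        ∑ i ∈ Finset.range (p + 1), ∑ j ∈ Finset.range (q + 1),
          ∑ b ∈ Bianchi.coprimePart x.1 (B x.1), f i j b =
        ∑ b ∈ Bianchi.coprimePart x.1 (B x.1), ∑ i ∈ Finset.range (p + 1),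
          ∑ j ∈ Finset.range (q + 1), f i j b := fun x f => by
      rw [Finset.sum_congr rfl fun i _ => Finset.sum_comm, Finset.sum_comm]
    rw [Bianchi.period_zero, Bianchi.period'_zero, hF.cPeriod_hecke_eq hD hn hS hB hE hp hq]
    constructor <;> refine Finset.sum_congr rfl fun x hx => congrArg (· * _) ?_ <;>
      rw [hswap] <;> refine Finset.sum_congr rfl fun b _ => ?_
    · exact (Bianchi.sum_period_eq_cPeriod hp hq (hS0 x hx)).symm
    · exact (Bianchi.sum_period'_eq_cPeriod hp hq (hS0 x hx)).symm
  · obtain ⟨m, hm⟩ := Bianchi.exists_stopsAt hD hρ hκ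
    exact ⟨m, hm, fun F hF p hp q hq => hF.period_eq_sum_stopsAt hD hm hp hq⟩
  -- The coefficients are chosen before `F`, so they serve all forms at once; outside the range `p,
  -- q ≤ k` they are set to zero to obtain one family.
  · have h : ∀ p q, ∃ a : ℕ → ℕ → Bianchi.OK D, p ≤ k → q ≤ k →
        ∀ F, Bianchi.IsCuspForm D k F → Bianchi.period k p q 0 (Bianchi.hecke k n F) =
          ∑ i ∈ Finset.range (k + 1), ∑ j ∈ Finset.range (k + 1),
            Bianchi.toC (a i j) * Bianchi.period k i j 0 F := fun p q => by
      by_cases hpq : p ≤ k ∧ q ≤ k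
      · obtain ⟨a, ha⟩ := Bianchi.isIntegralCombination_hecke hD hn hpq.1 hpq.2
        exact ⟨a, fun _ _ => ha⟩
      · exact ⟨fun _ _ => 0, fun hp hq => absurd ⟨hp, hq⟩ hpq⟩
    choose a ha using h
    exact ⟨a, fun F hF p hp q hq => ha p q hp hq F hF⟩
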